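/- **Conventions.** For $t\in\mathcal S'(\mathbb R^K)$ let $\tilde t(q)=\int \mathrm d^Kx\,e^{\mathrm i q\cdot x}t(x)$ (in the sense of distributions), where $q\cdot x$ is the Euclidean product, or, for four-vector variables, the sum of the Minkowski products of signature $(+,-,-,-)$. For $t\in\mathcal S'(\mathbb R^N\times\mathbb R^M)$, $N\ge 1$, and $\delta\in\mathbb R$ we write $t(q,q')=O^{\mathrm{dist}}(|q|^\delta)$ iff there are a neighbourhood $\mathcal O$ of $0$ in $\mathbb R^N\times\mathbb R^M$ and functions $t_\alpha\in C(\mathcal O)$, indexed by the multi-indices $\alpha\in\mathbb N_0^N$, such that all but finitely many $t_\alpha$ vanish, $t_\alpha\equiv0$ if $\delta+|\alpha|<0$, $|t_\alpha(q,q')|\le \mathrm{const}_\alpha\,|q|^{\delta+|\alpha|}$ on $\mathcal O$, and $t=\sum_\alpha\partial_q^\alpha t_\alpha$ on $\mathcal O$ in the sense of distributions. If $N=0$, then $t=O^{\mathrm{dist}}(|\cdot|^\delta)$ means by convention that $t$ is a continuous function if $\delta\le 0$, and that $t=0$ if $\delta>0$. An equation $t=O^{\mathrm{dist}}(|q|^\delta)+P$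 means $t=u+P$ for some tempered $u=O^{\mathrm{dist}}(|q|^\delta)$. A *UV regular splitting function* in $\mathbb R^N$ is a smooth $\Theta:\mathbb R^N\to[0,1]$ that vanishes in a neighbourhood of $0$ and for which there is $\ell>0$ with $\Theta(\lambda y)=\Theta(y)$ for all $|y|>\ell$, $\lambda>1$. For $t\in\mathcal S'(\mathbb R^N\times\mathbb R^M)$ put $t_\Theta(y,x)=\Theta(y)t(y,x)$. A distribution $t\in\mathcal S'(\mathbb R^{4n}\times\mathbb R^{4m})$ has *IR-index* $d\in\mathbb Z$ with respect to its first $n$ (four-vector) variables iff for every $\varepsilon>0$ and every $f\in\mathcal S(\mathbb R^{4m})$ the Fourier transform of $f(x)\,t(y,x)$ in all variables is $O^{\mathrm{dist}}(|q|^{d-\varepsilon})$, where $q\in\mathbb R^{4n}$ is the variable conjugate to $y$. Let $\mathcal F$ be the algebra of symbolic fields, i.e. the free unital graded-commutative complex algebra on the generators $\partial^\alpha A_i$ ($1\le i\le \mathrm p$, $\alpha\in\mathbb N_0^4$) with fermion numbers $\mathbf f(A_i)\in\mathbb Z/2$. Let $\mathcal D$ be a complex vector space with a sesquilinear inner product $(\cdot|\cdot)$,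 let $\Omega\in\mathcal D$, and let $\mathrm T(B_1(x_1),\dots,B_k(x_k))$, $k\in\mathbb N_0$, be time-ordered products: operator-valued Schwartz distributions on $\mathcal D$ (linear maps from $\mathcal S(\mathbb R^{4k})$ to the linear maps $\mathcal D\to\mathcal D$ with continuous matrix elements), multilinear in $B_1,\dots,B_k\in\mathcal F$, such that $\mathrm T(\emptyset)=1$, $\mathrm T$ is graded symmetric, and $\mathrm T$ is causal: $\mathrm T(B_1(x_1),\dots,B_{k+l}(x_{k+l}))=\mathrm T(B_1(x_1),\dots,B_k(x_k))\,\mathrm T(B_{k+1}(x_{k+1}),\dots,B_{k+l}(x_{k+l}))$ where none of $x_1,\dots,x_k$ is in the (closed) causal past of any of $x_{k+1},\dots,x_{k+l}$ (as an identity on products of compactly supported test functions with such supports). No further axiom is needed. Let $S(\mathbf g)=\sum_k\frac{\mathrm i^k}{k!}\sum_{j_1,\dots,j_k}\int g_{j_1}(x_1)\cdots g_{j_k}(x_k)\,\mathrm T(B_{j_1}(x_1),\dots,B_{j_k}(x_k))$ for $\mathbf g=\sum_j g_j\otimes B_j$ be the generating functional, a formal power series in the $g_j$, which are (anti)commuting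 according to $\mathbf f(B_j)$ and commute with operators. For fields $I=(B_1(y_1),\dots,B_n(y_n))$, $J=(C_1(x_1),\dots,C_m(x_m))$ of definite fermion number and a partition $P$ of $J$ into contiguous nonempty blocks $J_1,\dots,J_k$ let $$\mathrm{Adv}(I;J;P)=(-\mathrm i)^{n+m}\frac{\delta}{\delta \mathbf h_k(J_k)}\cdots\frac{\delta}{\delta \mathbf h_1(J_1)}\frac{\delta}{\delta\mathbf g(I)}\,S(\mathbf g+\mathbf h_1)S(\mathbf g)^{-1}\cdots S(\mathbf g+\mathbf h_k)S(\mathbf g)^{-1}\Big|_{\mathbf g=\mathbf h=0},$$ let $\mathrm{Ret}(I;J;P)$ be defined in the same way with $S(\mathbf g)^{-1}S(\mathbf g+\mathbf h_1)\cdots S(\mathbf g)^{-1}S(\mathbf g+\mathbf h_k)$, and let $\mathrm{Dif}=\mathrm{Adv}-\mathrm{Ret}$. Their vacuum expectation values $(\Omega|\mathrm{Adv}(I;J;P)\Omega)$, $(\Omega|\mathrm{Ret}(I;J;P)\Omega)$ are understood as tempered distributions on $\mathbb R^{4n}\times\mathbb R^{4m}$. **Theorem.** (1) Let $N\ge2$,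 $M\ge 0$, $d\in\mathbb Z$, $\varepsilon\in(0,1)$, and let $t(y,x)=s(y,x)f(x)$ with $s\in\mathcal S'(\mathbb R^N\times\mathbb R^M)$, $f\in\mathcal S(\mathbb R^M)$, be such that $\tilde t(q,q')=O^{\mathrm{dist}}(|q|^{d-\varepsilon})$. Then for every UV regular splitting function $\Theta$ in $\mathbb R^N$ there are $c_\gamma\in C(\mathbb R^M)$, for the multi-indices $\gamma$ with $|\gamma|<d$, such that $$\widetilde{t_\Theta}(q,q')=O^{\mathrm{dist}}(|q|^{d-\varepsilon})+\sum_{|\gamma|<d}c_\gamma(q')\,q^\gamma .$$ (2) Suppose that $(\Omega|\mathrm{Dif}(I;J;P)\Omega)$ has IR-index $d\in\mathbb Z$ with respect to $y_1,\dots,y_n$. Then: (A) $(\Omega|\mathrm{Adv}(I;J;P)\Omega)$ has IR-index $\min\{d,0\}$ with respect to $y_1,\dots,y_n$. (B) If $d=1$, then for every $f\in\mathcal S(\mathbb R^{4m})$ and $\varepsilon>0$ there is $c\in\mathbb C$ such that the Fourier transforms with respect to $y_1,\dots,y_n$ of both $$\int\mathrm d^4x_1\cdots\mathrm d^4x_m\,f(x_1,\dots,x_m)\,(\Omega|\mathrm{Adv}(I;J;P)\Omega)\quad\text{and}\quad\int\mathrm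 d^4x_1\cdots\mathrm d^4x_m\,f(x_1,\dots,x_m)\,(\Omega|\mathrm{Ret}(I;J;P)\Omega)$$ are of the form $c+O^{\mathrm{dist}}(|q_1,\dots,q_n|^{1-\varepsilon})$, with the same constant $c$. -/

import Mathlib

open MeasureTheory Filter Topology SchwartzMap FourierTransform LineDeriv
open scoped ContDiff

noncomputable section

/-- `ℝ^κ` with its Euclidean norm. Points of `ℝ^N × ℝ^M` are elements of `Vec (ι ⊕ κ)` with
`N = card ι`, `M = card κ`. -/
abbrev Vec (κ : Type*) : Type _ := EuclideanSpace ℝ κ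

namespace Split

/-! ### Coordinates and products of Schwartz functions -/

/-- The linear map `z ↦ (z (e i))_i` that selects (and relabels) some of the coordinates. -/
def coords {κ κ' : Type*} [Fintype κ] [Fintype κ'] (e : κ' → κ) : Vec κ →L[ℝ] Vec κ' :=
  ((EuclideanSpace.equiv κ' ℝ).symm : (κ' → ℝ) →L[ℝ] Vec κ').comp
    ((ContinuousLinearMap.pi fun i => ContinuousLinearMap.proj (e i)).comp
      ((EuclideanSpace.equiv κ ℝ) : Vec κ →L[ℝ] (κ → ℝ)))

@[simp] theorem coords_apply {κ κ' : Type*} [Fintype κ] [Fintype κ'] (e : κ' → κ) (z : Vec κ)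
    (i : κ') : coords e z i = z (e i) := rfl

theorem norm_le_sum_coords {κ : Type*} [Fintype κ] {J : Type*} [Fintype J] {κ' : J → Type*}
    [∀ j, Fintype (κ' j)] (e : ∀ j, κ' j → κ) (he : ∀ k, ∃ j i, e j i = k) (z : Vec κ) :
    ‖z‖ ≤ (Fintype.card κ : ℝ) * ∑ j, ‖coords (e j) z‖ := by
  classical
  have h1 : ‖z‖ ≤ ∑ k, ‖z k‖ := by
    conv_lhs => rw [← (EuclideanSpace.basisFun κ ℝ).sum_repr z]
    refine (norm_sum_le _ _).trans (le_of_eq ?_)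
    refine Finset.sum_congr rfl fun k _ => ?_
    rw [norm_smul]; simp
  refine h1.trans ?_
  have : ∀ k ∈ Finset.univ, ‖z k‖ ≤ ∑ j, ‖coords (e j) z‖ := by
    intro k _
    obtain ⟨j, i, rfl⟩ := he k
    calc ‖z (e j i)‖ = ‖coords (e j) z i‖ := rfl
      _ ≤ ‖coords (e j) z‖ := PiLp.norm_apply_le _ _
      _ ≤ _ := Finset.single_le_sum (f := fun j => ‖coords (e j) z‖)
        (fun _ _ => norm_nonneg _) (Finset.mem_univ j)
  refine (Finset.sum_le_sum this).trans ?_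
  simp

theorem norm_le_add_coords {κ κ₁ κ₂ : Type*} [Fintype κ] [Fintype κ₁] [Fintype κ₂]
    (e₁ : κ₁ → κ) (e₂ : κ₂ → κ) (he : ∀ k, (∃ i, e₁ i = k) ∨ ∃ i, e₂ i = k) (z : Vec κ) :
    ‖z‖ ≤ (Fintype.card κ : ℝ) * (‖coords e₁ z‖ + ‖coords e₂ z‖) := by
  classical
  have h1 : ‖z‖ ≤ ∑ k, ‖z k‖ := by
    conv_lhs => rw [← (EuclideanSpace.basisFun κ ℝ).sum_repr z]
    refine (norm_sum_le _ _).trans (le_of_eq ?_)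
    refine Finset.sum_congr rfl fun k _ => ?_
    rw [norm_smul]; simp
  refine h1.trans ?_
  have : ∀ k ∈ Finset.univ, ‖z k‖ ≤ ‖coords e₁ z‖ + ‖coords e₂ z‖ := by
    intro k _
    rcases he k with ⟨i, rfl⟩ | ⟨i, rfl⟩
    · have := PiLp.norm_apply_le (coords e₁ z) i
      simp only [coords_apply] at this
      linarith [norm_nonneg (coords e₂ z)]
    · have := PiLp.norm_apply_le (coords e₂ z) i
      simp only [coords_apply] at this
      linarith [norm_nonneg (coords e₁ z)]
  refine (Finset.sum_le_sum this).trans ?_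
  simp [mul_add]

theorem norm_iteratedFDeriv_comp_coords_le {κ κ' : Type*} [Fintype κ] [Fintype κ'] (e : κ' → κ)
    (g : 𝓢(Vec κ', ℂ)) (n : ℕ) (z : Vec κ) :
    ‖iteratedFDeriv ℝ n (fun z => g (coords e z)) z‖ ≤
      ‖iteratedFDeriv ℝ n g (coords e z)‖ * ‖coords e‖ ^ n := by
  have h := (coords e).iteratedFDeriv_comp_right (g.smooth ⊤) z (i := n) (by exact_mod_cast le_top)
  have h' : (fun z => g (coords e z)) = (g ∘ coords e) := rfl
  rw [h', h]
  refine (ContinuousMultilinearMap.norm_compContinuousLinearMap_le _ _).trans ?_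
  simp

theorem contDiff_comp_coords {κ κ' : Type*} [Fintype κ] [Fintype κ'] (e : κ' → κ)
    (g : 𝓢(Vec κ', ℂ)) : ContDiff ℝ ∞ (fun z : Vec κ => g (coords e z)) :=
  (g.smooth ⊤).comp (coords e).contDiff

/-- `g ↦ g ⊗ f`, i.e. `(g ⊗ f) z = g (z₁) f (z₂)` where `z₁`, `z₂` are the two groups of coordinates
of `z` selected by `e₁`, `e₂`, as a continuous linear map of Schwartz spaces in `g`. -/
def tensorCLM {κ κ₁ κ₂ : Type*} [Fintype κ] [Fintype κ₁] [Fintype κ₂]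
    (e₁ : κ₁ → κ) (e₂ : κ₂ → κ) (he : ∀ k, (∃ i, e₁ i = k) ∨ ∃ i, e₂ i = k)
    (f : 𝓢(Vec κ₂, ℂ)) : 𝓢(Vec κ₁, ℂ) →L[ℂ] 𝓢(Vec κ, ℂ) :=
  SchwartzMap.mkCLM (fun g z => g (coords e₁ z) * f (coords e₂ z))
    (fun g g' z => by simp [add_mul])
    (fun a g z => by simp [mul_assoc])
    (fun g => (contDiff_comp_coords e₁ g).mul (contDiff_comp_coords e₂ f))
    (by
      rintro ⟨k, n⟩
      set K : ℝ := (Fintype.card κ : ℝ)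
      set P₁ := ‖coords (κ := κ) e₁‖
      set P₂ := ‖coords (κ := κ) e₂‖
      set S : Seminorm ℂ 𝓢(Vec κ₂, ℂ) :=
        (Finset.Iic (k, n)).sup (fun m => SchwartzMap.seminorm ℂ m.1 m.2)
      refine ⟨Finset.Iic (k, n), K ^ k * ∑ i ∈ Finset.range (n + 1),
        (n.choose i : ℝ) * P₁ ^ i * P₂ ^ (n - i) * 2 ^ k * (2 ^ k * S f), by positivity, ?_⟩
      intro g z
      have hz := norm_le_add_coords e₁ e₂ he z
      set a := ‖coords e₁ z‖
      set b := ‖coords e₂ z‖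
      have ha : 0 ≤ a := norm_nonneg _
      have hb : 0 ≤ b := norm_nonneg _
      have hzk : ‖z‖ ^ k ≤ K ^ k * ((1 + a) ^ k * (1 + b) ^ k) := by
        rw [← mul_pow, ← mul_pow]
        gcongr
        refine hz.trans ?_
        have hK : 0 ≤ K := by positivity
        exact mul_le_mul_of_nonneg_left (by nlinarith) hK
      have hD := norm_iteratedFDeriv_mul_le (contDiff_comp_coords e₁ g)
        (contDiff_comp_coords e₂ f) z (n := n) (by exact_mod_cast le_top)
      change ‖z‖ ^ k * _ ≤ _
      calc ‖z‖ ^ k * ‖iteratedFDeriv ℝ n (fun z => g (coords e₁ z) * f (coords e₂ z)) z‖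
          ≤ (K ^ k * ((1 + a) ^ k * (1 + b) ^ k)) * ∑ i ∈ Finset.range (n + 1),
            (n.choose i : ℝ) * (‖iteratedFDeriv ℝ i g (coords e₁ z)‖ * P₁ ^ i) *
              (‖iteratedFDeriv ℝ (n - i) f (coords e₂ z)‖ * P₂ ^ (n - i)) := by
            gcongr
            refine hD.trans ?_
            gcongr
            · exact norm_iteratedFDeriv_comp_coords_le e₁ g _ z
            · exact norm_iteratedFDeriv_comp_coords_le e₂ f _ z
        _ = K ^ k * ∑ i ∈ Finset.range (n + 1), (n.choose i : ℝ) * P₁ ^ i * P₂ ^ (n - i) *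
              ((1 + a) ^ k * ‖iteratedFDeriv ℝ i g (coords e₁ z)‖) *
              ((1 + b) ^ k * ‖iteratedFDeriv ℝ (n - i) f (coords e₂ z)‖) := by
            rw [mul_assoc, Finset.mul_sum]
            congr 1
            refine Finset.sum_congr rfl fun i _ => by ring
        _ ≤ K ^ k * ∑ i ∈ Finset.range (n + 1), (n.choose i : ℝ) * P₁ ^ i * P₂ ^ (n - i) *
              (2 ^ k * (Finset.Iic (k, n)).sup (schwartzSeminormFamily ℂ (Vec κ₁) ℂ) g) *
              (2 ^ k * S f) := by
            refine mul_le_mul_of_nonneg_left (Finset.sum_le_sum fun i hi => ?_) (by positivity)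
            refine mul_le_mul (mul_le_mul_of_nonneg_left ?_ (by positivity)) ?_
              (by positivity) (by positivity)
            · exact one_add_le_sup_seminorm_apply (𝕜 := ℂ) (m := (k, n)) le_rfl
                (Nat.lt_succ_iff.1 (Finset.mem_range.1 hi)) g _
            · exact one_add_le_sup_seminorm_apply (𝕜 := ℂ) (m := (k, n)) le_rfl
                (Nat.sub_le _ _) f _
        _ = _ := by
            rw [mul_assoc, Finset.sum_mul]
            congr 1
            refine Finset.sum_congr rfl fun i _ => by ring)

@[simp] theorem tensorCLM_apply {κ κ₁ κ₂ : Type*} [Fintype κ] [Fintype κ₁] [Fintype κ₂]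
    (e₁ : κ₁ → κ) (e₂ : κ₂ → κ) (he : ∀ k, (∃ i, e₁ i = k) ∨ ∃ i, e₂ i = k)
    (f : 𝓢(Vec κ₂, ℂ)) (g : 𝓢(Vec κ₁, ℂ)) (z : Vec κ) :
    tensorCLM e₁ e₂ he f g z = g (coords e₁ z) * f (coords e₂ z) := rfl

/-- The Schwartz function `z ↦ ∏ j, g j (z_j)`, where `z_j` is the `j`-th group of coordinates. -/
def tensorProd {κ : Type*} [Fintype κ] {J : Type*} [Fintype J] {κ' : Type*}
    [Fintype κ'] (e : J → κ' → κ) (he : ∀ k, ∃ j i, e j i = k)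
    (g : J → 𝓢(Vec κ', ℂ)) : 𝓢(Vec κ, ℂ) where
  toFun z := ∏ j, g j (coords (e j) z)
  smooth' := contDiff_prod fun j _ => contDiff_comp_coords (e j) (g j)
  decay' := by
    classical
    intro k n
    set K : ℝ := (Fintype.card κ : ℝ)
    set S : Seminorm ℂ 𝓢(Vec κ', ℂ) :=
        (Finset.Iic (k, n)).sup (fun m => SchwartzMap.seminorm ℂ m.1 m.2)
    refine ⟨K ^ k * ∑ p ∈ (Finset.univ : Finset J).sym n, (p.1.countPerms : ℝ) *
      ∏ j, (2 ^ k * S (g j) * ‖coords (κ := κ) (e j)‖ ^ (p.1.count j)), ?_⟩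
    intro z
    have hz := norm_le_sum_coords e he z
    have hsum : ∑ j, ‖coords (e j) z‖ ≤ ∏ j, (1 + ‖coords (e j) z‖) := by
      have h0 : ∀ s : Finset J, 1 + ∑ j ∈ s, ‖coords (e j) z‖ ≤ ∏ j ∈ s, (1 + ‖coords (e j) z‖) := by
        intro s
        induction s using Finset.induction_on with
        | empty => simp
        | insert a s ha ih =>
          rw [Finset.sum_insert ha, Finset.prod_insert ha]
          have h1 : 0 ≤ ‖coords (e a) z‖ := norm_nonneg _
          have h2 : 0 ≤ ∑ j ∈ s, ‖coords (e j) z‖ := Finset.sum_nonneg fun _ _ => norm_nonneg _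
          nlinarith
      linarith [h0 Finset.univ]
    have hzk : ‖z‖ ^ k ≤ K ^ k * ∏ j, (1 + ‖coords (e j) z‖) ^ k := by
      rw [Finset.prod_pow, ← mul_pow]
      gcongr
      exact hz.trans (mul_le_mul_of_nonneg_left hsum (by positivity))
    have hD := norm_iteratedFDeriv_prod_le (𝕜 := ℝ) (u := Finset.univ)
      (f := fun j z => g j (coords (κ := κ) (e j) z)) (N := ∞)
      (fun j _ => contDiff_comp_coords (e j) (g j)) (x := z) (n := n) (by exact_mod_cast le_top)
    calc ‖z‖ ^ k * ‖iteratedFDeriv ℝ n (fun z => ∏ j, g j (coords (e j) z)) z‖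
        ≤ (K ^ k * ∏ j, (1 + ‖coords (e j) z‖) ^ k) * ∑ p ∈ (Finset.univ : Finset J).sym n,
          (p.1.countPerms : ℝ) *
            ∏ j, (‖iteratedFDeriv ℝ (p.1.count j) (g j) (coords (e j) z)‖ *
              ‖coords (κ := κ) (e j)‖ ^ (p.1.count j)) := by
          gcongr
          refine hD.trans ?_
          exact Finset.sum_le_sum fun p _ => mul_le_mul_of_nonneg_left
            (Finset.prod_le_prod (fun j _ => norm_nonneg _) fun j _ =>
              norm_iteratedFDeriv_comp_coords_le (e j) (g j) _ z) (by positivity)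
      _ = K ^ k * ∑ p ∈ (Finset.univ : Finset J).sym n, (p.1.countPerms : ℝ) *
            ∏ j, ((1 + ‖coords (e j) z‖) ^ k *
              ‖iteratedFDeriv ℝ (p.1.count j) (g j) (coords (e j) z)‖ *
              ‖coords (κ := κ) (e j)‖ ^ (p.1.count j)) := by
          rw [mul_assoc, Finset.mul_sum]
          congr 1
          refine Finset.sum_congr rfl fun p _ => ?_
          rw [mul_left_comm, ← Finset.prod_mul_distrib]
          congr 1
          exact Finset.prod_congr rfl fun j _ => by ring
      _ ≤ _ := by
          refine mul_le_mul_of_nonneg_left (Finset.sum_le_sum fun p _ =>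
            mul_le_mul_of_nonneg_left (Finset.prod_le_prod (fun j _ => by positivity)
              fun j _ => mul_le_mul_of_nonneg_right ?_ (by positivity)) (by positivity))
            (by positivity)
          have hc : p.1.count j ≤ n := (Multiset.count_le_card j p.1).trans p.2.le
          exact one_add_le_sup_seminorm_apply (𝕜 := ℂ) (m := (k, n)) le_rfl hc (g j) _

/-! ### Fourier transform -/

/-- The linear map `x ↦ (σ i x i / 2π)_i`. -/
def scaleEquiv {κ : Type*} [Fintype κ] (σ : κ → ℤˣ) : Vec κ ≃L[ℝ] Vec κ :=
  (EuclideanSpace.equiv κ ℝ).trans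
    ((ContinuousLinearEquiv.piCongrRight fun i => ContinuousLinearEquiv.unitsEquivAut ℝ
      (Units.mk0 (((σ i : ℤ) : ℝ) / (2 * Real.pi)) (div_ne_zero (by
        exact_mod_cast (σ i).ne_zero) Real.two_pi_pos.ne'))).trans
      (EuclideanSpace.equiv κ ℝ).symm)

theorem scaleEquiv_apply {κ : Type*} [Fintype κ] (σ : κ → ℤˣ) (x : Vec κ) (i : κ) :
    scaleEquiv σ x i = x i * (((σ i : ℤ) : ℝ) / (2 * Real.pi)) := rfl

/-- The transform `φ ↦ (x ↦ ∫ exp(i q·x) φ(q) dq)` of test functions, where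
`q·x = ∑ i, σ i * q i * x i`; see `fourierTest_apply`. The signs `σ` allow both the Euclidean and
the Minkowski pairing. -/
def fourierTest {κ : Type*} [Fintype κ] (σ : κ → ℤˣ) : 𝓢(Vec κ, ℂ) →L[ℂ] 𝓢(Vec κ, ℂ) :=
  (SchwartzMap.compCLMOfContinuousLinearEquiv ℂ (scaleEquiv σ)).comp
    (fourierInvCLM ℂ 𝓢(Vec κ, ℂ))

theorem fourierTest_apply {κ : Type*} [Fintype κ] (σ : κ → ℤˣ) (φ : 𝓢(Vec κ, ℂ)) (x : Vec κ) :
    fourierTest σ φ x =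
      ∫ q : Vec κ, Complex.exp (Complex.I * (∑ i, ((σ i : ℤ) : ℝ) * q i * x i : ℝ)) * φ q := by
  have h : fourierTest σ φ x = 𝓕⁻ (φ : Vec κ → ℂ) (scaleEquiv σ x) := by
    rw [← SchwartzMap.fourierInv_coe]; rfl
  rw [h, Real.fourierInv_eq']
  refine integral_congr_ae (Eventually.of_forall fun q => ?_)
  simp only [smul_eq_mul]
  congr 2
  have : 2 * Real.pi * inner ℝ q (scaleEquiv σ x) = ∑ i, ((σ i : ℤ) : ℝ) * q i * x i := by
    rw [PiLp.inner_apply, Finset.mul_sum]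
    refine Finset.sum_congr rfl fun i _ => ?_
    rw [scaleEquiv_apply]
    simp only [RCLike.inner_apply, conj_trivial]
    field_simp
  rw [← this]
  push_cast
  ring

/-- Fourier transform of tempered distributions, `t̃(q) = ∫ exp(i q·x) t(x) dx`, that is
`⟨t̃, φ⟩ = ⟨t, x ↦ ∫ exp(i q·x) φ(q) dq⟩`. -/
def fourierDist {κ : Type*} [Fintype κ] (σ : κ → ℤˣ) (t : 𝓢'(Vec κ, ℂ)) : 𝓢'(Vec κ, ℂ) :=
  PointwiseConvergenceCLM.precomp ℂ (fourierTest σ) t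

/-! ### Partial derivatives in the first group of variables -/

/-- Standard basis vector. -/
def unitVec {κ : Type*} (k : κ) : Vec κ :=
  open Classical in EuclideanSpace.single k (1 : ℝ)

/-- `∂/∂q_i` on Schwartz functions of `(q, q')`. -/
def partialCLM {ι κ : Type*} [Fintype ι] [Fintype κ] (i : ι) :
    𝓢(Vec (ι ⊕ κ), ℂ) →L[ℂ] 𝓢(Vec (ι ⊕ κ), ℂ) :=
  lineDerivOpCLM ℂ 𝓢(Vec (ι ⊕ κ), ℂ) (unitVec (Sum.inl i : ι ⊕ κ))

theorem partialCLM_commute {ι κ : Type*} [Fintype ι] [Fintype κ] (i j : ι) :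
    Commute (partialCLM (κ := κ) i) (partialCLM (κ := κ) j) := by
  classical
  refine ContinuousLinearMap.ext fun φ => SchwartzMap.ext fun z => ?_
  have key : ∀ v w : Vec (ι ⊕ κ), (∂_{v} (∂_{w} φ : 𝓢(Vec (ι ⊕ κ), ℂ)) : 𝓢(Vec (ι ⊕ κ), ℂ)) z = fderiv ℝ (fderiv ℝ φ) z v w := by
    intro v w
    rw [SchwartzMap.lineDerivOp_apply_eq_fderiv]
    have : (⇑(∂_{w} φ : 𝓢(Vec (ι ⊕ κ), ℂ)) : Vec (ι ⊕ κ) → ℂ) = fun y => fderiv ℝ φ y w := by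
      ext y; rw [SchwartzMap.lineDerivOp_apply_eq_fderiv]
    rw [this]
    have hd : DifferentiableAt ℝ (fderiv ℝ φ) z :=
      ((φ.smooth 2).fderiv_right (m := 1) (by norm_num)).differentiable one_ne_zero z
    rw [fderiv_clm_apply hd (differentiableAt_const w)]
    simp
  have h1 := key (unitVec (Sum.inl i : ι ⊕ κ)) (unitVec (Sum.inl j : ι ⊕ κ))
  have h2 := key (unitVec (Sum.inl j : ι ⊕ κ)) (unitVec (Sum.inl i : ι ⊕ κ))
  change (∂_{unitVec (Sum.inl i : ι ⊕ κ)} (∂_{unitVec (Sum.inl j : ι ⊕ κ)} φ : 𝓢(Vec (ι ⊕ κ), ℂ)) :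
      𝓢(Vec (ι ⊕ κ), ℂ)) z =
    (∂_{unitVec (Sum.inl j : ι ⊕ κ)} (∂_{unitVec (Sum.inl i : ι ⊕ κ)} φ : 𝓢(Vec (ι ⊕ κ), ℂ)) :
      𝓢(Vec (ι ⊕ κ), ℂ)) z
  rw [h1, h2]
  have hs : IsSymmSndFDerivAt ℝ φ z :=
    (φ.contDiffAt 2).isSymmSndFDerivAt (by simp)
  exact hs _ _

/-- `∂_q^α` on Schwartz functions of `(q, q')`, for a multi-index `α`. -/
def multiPartial {ι κ : Type*} [Fintype ι] [Fintype κ] (α : ι → ℕ) :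
    𝓢(Vec (ι ⊕ κ), ℂ) →L[ℂ] 𝓢(Vec (ι ⊕ κ), ℂ) :=
  Finset.univ.noncommProd (fun i => partialCLM i ^ α i)
    fun i _ j _ _ => (partialCLM_commute i j).pow_pow _ _

/-! ### The condition `t(q, q') = O^dist(|q|^δ)` -/

/-- The variable `q` of `(q, q')`. -/
abbrev fstPart {ι κ : Type*} [Fintype ι] [Fintype κ] (z : Vec (ι ⊕ κ)) : Vec ι := coords Sum.inl z

/-- The variable `q'` of `(q, q')`. -/
abbrev sndPart {ι κ : Type*} [Fintype ι] [Fintype κ] (z : Vec (ι ⊕ κ)) : Vec κ := coords Sum.inr z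

/-- `t(q, q') = O^dist(|q|^δ)`: near the origin `t = ∑_α ∂_q^α τ_α` (a finite sum, in the sense of
distributions) with continuous functions `τ_α` such that `τ_α = 0` if `δ + |α| < 0` and
`|τ_α(q, q')| ≤ const |q|^(δ + |α|)`.
If there are no variables `q`, the condition means by convention that `t` is a continuous function
when `δ ≤ 0`, and that `t = 0` when `δ > 0`. -/
def IsODist {ι κ : Type*} [Fintype ι] [Fintype κ] (t : 𝓢'(Vec (ι ⊕ κ), ℂ)) (δ : ℝ) : Prop :=
  (Nonempty ι →
    ∃ (U : Set (Vec (ι ⊕ κ))) (A : Finset (ι → ℕ)) (τ : (ι → ℕ) → Vec (ι ⊕ κ) → ℂ),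
      IsOpen U ∧ 0 ∈ U ∧
      (∀ α, ContinuousOn (τ α) U) ∧
      (∀ α, α ∉ A → ∀ z ∈ U, τ α z = 0) ∧
      (∀ α, δ + ((∑ i, α i : ℕ) : ℝ) < 0 → ∀ z ∈ U, τ α z = 0) ∧
      (∀ α, ∃ c : ℝ, ∀ z ∈ U, ‖τ α z‖ ≤ c * ‖fstPart z‖ ^ (δ + ((∑ i, α i : ℕ) : ℝ))) ∧
      (∀ φ : 𝓢(Vec (ι ⊕ κ), ℂ), HasCompactSupport φ → tsupport φ ⊆ U →
        t φ = ∑ α ∈ A, (-1 : ℂ) ^ (∑ i, α i) * ∫ z, τ α z * multiPartial α φ z)) ∧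
  (IsEmpty ι →
    (δ ≤ 0 → ∃ τ : Vec (ι ⊕ κ) → ℂ, Continuous τ ∧
      ∀ φ : 𝓢(Vec (ι ⊕ κ), ℂ), HasCompactSupport φ → t φ = ∫ z, τ z * φ z) ∧
    (0 < δ → t = 0))

/-- `t = O^dist(|q|^δ) + P` for a continuous function `P` of `(q, q')`. -/
def EqODistAdd {ι κ : Type*} [Fintype ι] [Fintype κ] (t : 𝓢'(Vec (ι ⊕ κ), ℂ)) (δ : ℝ)
    (P : Vec (ι ⊕ κ) → ℂ) : Prop :=
  ∃ u : 𝓢'(Vec (ι ⊕ κ), ℂ), IsODist u δ ∧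
    ∀ φ : 𝓢(Vec (ι ⊕ κ), ℂ), HasCompactSupport φ → t φ = u φ + ∫ z, P z * φ z

/-- `∑_{|γ| < d} c_γ(q') q^γ`. -/
def polySum {ι κ : Type*} [Fintype ι] [Fintype κ] [DecidableEq ι] (d : ℤ)
    (c : (ι → ℕ) → Vec κ → ℂ) (z : Vec (ι ⊕ κ)) : ℂ :=
  ∑ k ∈ Finset.range d.toNat, ∑ γ ∈ Finset.piAntidiag (Finset.univ : Finset ι) k,
    c γ (sndPart z) * ((∏ i, fstPart z i ^ γ i : ℝ) : ℂ)

/-! ### UV regular splitting -/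

/-- UV regular splitting functions in `ℝ^N`. -/
structure IsUVRegularSplitting {ι : Type*} [Fintype ι] (Θ : Vec ι → ℝ) : Prop where
  smooth : ContDiff ℝ ∞ Θ
  nonneg : ∀ y, 0 ≤ Θ y
  le_one : ∀ y, Θ y ≤ 1
  zero_near_origin : ∀ᶠ y in 𝓝 (0 : Vec ι), Θ y = 0
  homogeneous : ∃ ℓ : ℝ, 0 < ℓ ∧ ∀ y, ℓ < ‖y‖ → ∀ r : ℝ, 1 < r → Θ (r • y) = Θ y

/-- `t_Θ(y, x) = Θ(y) t(y, x)`. -/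
def splitDist {ι κ : Type*} [Fintype ι] [Fintype κ] (Θ : Vec ι → ℝ) (t : 𝓢'(Vec (ι ⊕ κ), ℂ)) :
    𝓢'(Vec (ι ⊕ κ), ℂ) :=
  TemperedDistribution.smulLeftCLM ℂ (fun z => (Θ (fstPart z) : ℂ)) t

/-- The distribution `f(x) t(y, x)` for a Schwartz function `f`. -/
def mulSnd {ι κ : Type*} [Fintype ι] [Fintype κ] (f : 𝓢(Vec κ, ℂ)) (t : 𝓢'(Vec (ι ⊕ κ), ℂ)) :
    𝓢'(Vec (ι ⊕ κ), ℂ) :=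
  TemperedDistribution.smulLeftCLM ℂ (fun z => f (sndPart z)) t

/-- The distribution `∫ dx f(x) t(y, x)` of the remaining variable `y`. -/
def integrateSnd {ι κ : Type*} [Fintype ι] [Fintype κ] (f : 𝓢(Vec κ, ℂ))
    (t : 𝓢'(Vec (ι ⊕ κ), ℂ)) : 𝓢'(Vec (ι ⊕ Fin 0), ℂ) :=
  PointwiseConvergenceCLM.precomp ℂ
    (tensorCLM (Sum.elim Sum.inl Fin.elim0) Sum.inr (by
      rintro (i | k)
      · exact Or.inl ⟨Sum.inl i, rfl⟩
      · exact Or.inr ⟨k, rfl⟩) f) t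

/-! ### Minkowski space and the IR-index -/

/-- Signs of the Minkowski metric `(+,-,-,-)` in every four-vector variable. -/
def lorentzSign {J : Type*} (i : J × Fin 4) : ℤˣ := if i.2 = 0 then 1 else -1

/-- Distributions `t(x_1, …, x_n; x'_1, …, x'_m)` in `𝓢'(ℝ^{4n} × ℝ^{4m})`. -/
abbrev Dist (n m : ℕ) : Type := 𝓢'(Vec ((Fin n × Fin 4) ⊕ (Fin m × Fin 4)), ℂ)

/-- `t` has IR-index `d` with respect to the first `n` variables. -/
def HasIRIndex {n m : ℕ} (t : Dist n m) (d : ℤ) : Prop :=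
  ∀ ε : ℝ, 0 < ε → ∀ f : 𝓢(Vec (Fin m × Fin 4), ℂ),
    IsODist (fourierDist (Sum.elim lorentzSign lorentzSign) (mulSnd f t)) ((d : ℝ) - ε)

/-- The closed forward light cone. -/
def forwardCone : Set (Vec (Fin 4)) :=
  {v | 0 ≤ v 0 ∧ v 1 ^ 2 + v 2 ^ 2 + v 3 ^ 2 ≤ v 0 ^ 2}

/-- `g_1(x_1) ⋯ g_k(x_k)`. -/
def testProd {k : ℕ} (g : Fin k → 𝓢(Vec (Fin 4), ℂ)) : 𝓢(Vec (Fin k × Fin 4), ℂ) :=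
  tensorProd (fun j μ => (j, μ)) (fun i => ⟨i.1, i.2, rfl⟩) g

/-- `g_1(y_1) ⋯ g_n(y_n) h_1(x_1) ⋯ h_m(x_m)`. -/
def testProd₂ {n m : ℕ} (g : Fin n → 𝓢(Vec (Fin 4), ℂ)) (h : Fin m → 𝓢(Vec (Fin 4), ℂ)) :
    𝓢(Vec ((Fin n × Fin 4) ⊕ (Fin m × Fin 4)), ℂ) :=
  tensorProd (J := Fin n ⊕ Fin m)
    (Sum.elim (fun j μ => Sum.inl (j, μ)) (fun j μ => Sum.inr (j, μ)))
    (by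
      rintro (⟨j, μ⟩ | ⟨j, μ⟩)
      · exact ⟨Sum.inl j, μ, rfl⟩
      · exact ⟨Sum.inr j, μ, rfl⟩)
    (Sum.elim g h)

/-! ### Symbolic fields -/

/-- The sign `(-1)^{ab}` for fermion numbers `a, b`. -/
def koszul (a b : ZMod 2) : ℤ := if a = 1 ∧ b = 1 then -1 else 1

/-- Generators `∂^α A_i`. -/
abbrev Generator (p : ℕ) : Type := Fin p × (Fin 4 → ℕ)

/-- Graded commutativity of the generators; `par i` is the fermion number of `A_i`. -/
inductive SymRel {p : ℕ} (par : Fin p → ZMod 2) :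
    FreeAlgebra ℂ (Generator p) → FreeAlgebra ℂ (Generator p) → Prop
  | swap (a b : Generator p) : SymRel par (FreeAlgebra.ι ℂ a * FreeAlgebra.ι ℂ b)
      (koszul (par a.1) (par b.1) • (FreeAlgebra.ι ℂ b * FreeAlgebra.ι ℂ a))

/-- The algebra of symbolic fields: the free unital graded-commutative algebra on the
generators. -/
abbrev SymField {p : ℕ} (par : Fin p → ZMod 2) : Type := RingQuot (SymRel par)

/-- The monomial with the given list of generators. -/
def monomial {p : ℕ} (par : Fin p → ZMod 2) (l : List (Generator p)) : SymField par :=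
  (l.map fun a => RingQuot.mkAlgHom ℂ (SymRel par) (FreeAlgebra.ι ℂ a)).prod

/-- Symbolic fields of definite fermion number `r`. -/
def homogeneous {p : ℕ} (par : Fin p → ZMod 2) (r : ZMod 2) : Submodule ℂ (SymField par) :=
  Submodule.span ℂ
    {B | ∃ l : List (Generator p), (l.map fun a => par a.1).sum = r ∧ B = monomial par l}

/-! ### Time-ordered products -/

/-- The sign `(-1)^{f(π)}` of the permutation `π` of fields of fermion numbers `f`. -/
def permSign {k : ℕ} (f : Fin k → ZMod 2) (π : Equiv.Perm (Fin k)) : ℤ :=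
  ∏ i, ∏ j, if i < j ∧ π j < π i then koszul (f (π i)) (f (π j)) else 1

/-- Time-ordered products `T(B_1(x_1), …, B_k(x_k))`: multilinear families of operator-valued
Schwartz distributions on a domain `D` with inner product `form`, with `T(∅) = 1`, graded
symmetric and causal. Of the axioms usually imposed, only these are required here (translational
covariance, the Wick expansion, the normalisation of `T(B(x))` and bounds on the scaling degree
are not), and `D` need not be a Fock space, so that the class considered is larger. -/
structure TimeOrdered {p : ℕ} (par : Fin p → ZMod 2) {D : Type*} [AddCommGroup D] [Module ℂ D]
    (form : D →ₗ⋆[ℂ] D →ₗ[ℂ] ℂ) where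
  T : ∀ k : ℕ, MultilinearMap ℂ (fun _ : Fin k => SymField par)
    (𝓢(Vec (Fin k × Fin 4), ℂ) →ₗ[ℂ] Module.End ℂ D)
  continuous_matrix_element : ∀ (k : ℕ) (B : Fin k → SymField par) (Ψ Ψ' : D),
    Continuous fun g : 𝓢(Vec (Fin k × Fin 4), ℂ) => form Ψ (T k B g Ψ')
  empty : ∀ (B : Fin 0 → SymField par) (g : 𝓢(Vec (Fin 0 × Fin 4), ℂ)),
    T 0 B g = g 0 • (1 : Module.End ℂ D)
  graded_symm : ∀ (k : ℕ) (f : Fin k → ZMod 2) (B : Fin k → SymField par),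
    (∀ j, B j ∈ homogeneous par (f j)) →
    ∀ (π : Equiv.Perm (Fin k)) (g : Fin k → 𝓢(Vec (Fin 4), ℂ)),
      T k B (testProd g) =
        permSign f π • T k (fun j => B (π j)) (testProd fun j => g (π j))
  causal : ∀ (k l : ℕ) (B : Fin k → SymField par) (B' : Fin l → SymField par)
    (g : Fin k → 𝓢(Vec (Fin 4), ℂ)) (g' : Fin l → 𝓢(Vec (Fin 4), ℂ)),
    (∀ i, HasCompactSupport (g i)) → (∀ j, HasCompactSupport (g' j)) →
    (∀ i j, ∀ x ∈ tsupport (g i), ∀ y ∈ tsupport (g' j), y - x ∉ forwardCone) →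
    T (k + l) (Fin.append B B') (testProd (Fin.append g g')) =
      T k B (testProd g) * T l B' (testProd g')

/-! ### Generating functionals and the products `Adv`, `Ret`

A formal power series in `g_1, …, g_N` (with `g_j` of the Grassmann parity `f j`) is represented by
its part that is at most linear in every `g_j`, i.e. by the coefficients
`K ↦` (coefficient of `∏_{j ∈ K} g_j`, factors in increasing order), smeared with test functions.
Only this part contributes to the derivative with respect to all the `g_j` at `0`. -/

section Series

variable {N : ℕ} {R : Type*} [Ring R]

/-- Sign that arises when `∏_{j ∈ K} g_j ∏_{j ∈ L} g_j` is brought to increasing order. -/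
def shuffleSign (f : Fin N → ZMod 2) (K L : Finset (Fin N)) : ℤ :=
  ∏ a ∈ K, ∏ b ∈ L, if b < a then koszul (f a) (f b) else 1

/-- Product of formal series. -/
def serMul (f : Fin N → ZMod 2) (F G : Finset (Fin N) → R) : Finset (Fin N) → R :=
  fun K => ∑ L ∈ K.powerset, shuffleSign f L (K \ L) • (F L * G (K \ L))

/-- The unit series. -/
def serOne : Finset (Fin N) → R := fun K => if K = ∅ then 1 else 0

/-- Powers of a formal series. -/
def serPow (f : Fin N → ZMod 2) (F : Finset (Fin N) → R) : ℕ → Finset (Fin N) → R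
  | 0 => serOne
  | r + 1 => serMul f F (serPow f F r)

/-- Inverse of a formal series `F` with constant term `1`, `F⁻¹ = ∑_r (1 - F)^r`; the powers with
`r > N` vanish. -/
def serInv (f : Fin N → ZMod 2) (F : Finset (Fin N) → R) : Finset (Fin N) → R :=
  fun K => ∑ r ∈ Finset.range (N + 1), serPow f (fun L => serOne L - F L) r K

/-- Ordered product of a list of series. -/
def serProd (f : Fin N → ZMod 2) (l : List (Finset (Fin N) → R)) : Finset (Fin N) → R :=
  l.foldr (serMul f) serOne

end Series

section Products

variable {p : ℕ} {par : Fin p → ZMod 2} {D : Type*} [AddCommGroup D] [Module ℂ D]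
  {form : D →ₗ⋆[ℂ] D →ₗ[ℂ] ℂ}

/-- The generating functional `S(∑_{j ∈ X} g_j ⊗ B_j)` of the time-ordered products. -/
def genS (𝒯 : TimeOrdered par form) {N : ℕ} (B : Fin N → SymField par)
    (g : Fin N → 𝓢(Vec (Fin 4), ℂ)) (X : Finset (Fin N)) : Finset (Fin N) → Module.End ℂ D :=
  fun K => if K ⊆ X then
    Complex.I ^ K.card • 𝒯.T K.card (fun j => B (K.orderEmbOfFin rfl j))
      (testProd fun j => g (K.orderEmbOfFin rfl j))
  else 0

/-- The positions of the arguments `I = (B_1(y_1), …, B_n(y_n))` in the list `(I, J)`. -/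
def posI (n m : ℕ) : Finset (Fin (n + m)) := Finset.univ.image (Fin.castAdd m)

/-- The positions in `(I, J)` of the `i`-th block `J_i` of the partition `P` of
`J = (C_1(x_1), …, C_m(x_m))` into contiguous nonempty blocks. -/
def posJ (n : ℕ) {m : ℕ} (P : Composition m) (i : Fin P.length) : Finset (Fin (n + m)) :=
  (Finset.univ.filter fun j => P.index j = i).image (Fin.natAdd n)

/-- The generalised advanced product `Adv(I; J; P)` smeared with `g_1(y_1) ⋯ g_n(y_n) h_1(x_1) ⋯
h_m(x_m)`: `(-i)^{n+m}` times the coefficient of `g_1 ⋯ g_n h_1 ⋯ h_m` in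
`S(g + h_1) S(g)⁻¹ ⋯ S(g + h_k) S(g)⁻¹`. -/
def advOp (𝒯 : TimeOrdered par form) {n m : ℕ} (P : Composition m)
    (fB : Fin n → ZMod 2) (B : Fin n → SymField par)
    (fC : Fin m → ZMod 2) (C : Fin m → SymField par)
    (g : Fin n → 𝓢(Vec (Fin 4), ℂ)) (h : Fin m → 𝓢(Vec (Fin 4), ℂ)) : Module.End ℂ D :=
  let f := Fin.append fB fC
  let S := genS 𝒯 (Fin.append B C) (Fin.append g h)
  (-Complex.I) ^ (n + m) • serProd f
    ((List.finRange P.length).map fun i =>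
      serMul f (S (posI n m ∪ posJ n P i)) (serInv f (S (posI n m)))) Finset.univ

/-- The generalised retarded product `Ret(I; J; P)`, smeared with test functions:
`(-i)^{n+m}` times the coefficient of `g_1 ⋯ g_n h_1 ⋯ h_m` in
`S(g)⁻¹ S(g + h_1) ⋯ S(g)⁻¹ S(g + h_k)`. -/
def retOp (𝒯 : TimeOrdered par form) {n m : ℕ} (P : Composition m)
    (fB : Fin n → ZMod 2) (B : Fin n → SymField par)
    (fC : Fin m → ZMod 2) (C : Fin m → SymField par)
    (g : Fin n → 𝓢(Vec (Fin 4), ℂ)) (h : Fin m → 𝓢(Vec (Fin 4), ℂ)) : Module.End ℂ D :=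
  let f := Fin.append fB fC
  let S := genS 𝒯 (Fin.append B C) (Fin.append g h)
  (-Complex.I) ^ (n + m) • serProd f
    ((List.finRange P.length).map fun i =>
      serMul f (serInv f (S (posI n m))) (S (posI n m ∪ posJ n P i))) Finset.univ

/-- `a` is the distribution `(Ω|Adv(B_1(y_1), …, B_n(y_n); C_1(x_1), …, C_m(x_m); P)Ω)`, i.e. the
tempered distribution with the values prescribed by `Adv` on products of test functions (which
determine it). -/
def IsAdvVEV (𝒯 : TimeOrdered par form) (Ω : D) {n m : ℕ} (P : Composition m)
    (fB : Fin n → ZMod 2) (B : Fin n → SymField par)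
    (fC : Fin m → ZMod 2) (C : Fin m → SymField par) (a : Dist n m) : Prop :=
  ∀ g h, a (testProd₂ g h) = form Ω (advOp 𝒯 P fB B fC C g h Ω)

/-- `r` is the distribution `(Ω|Ret(B_1(y_1), …, B_n(y_n); C_1(x_1), …, C_m(x_m); P)Ω)`. -/
def IsRetVEV (𝒯 : TimeOrdered par form) (Ω : D) {n m : ℕ} (P : Composition m)
    (fB : Fin n → ZMod 2) (B : Fin n → SymField par)
    (fC : Fin m → ZMod 2) (C : Fin m → SymField par) (r : Dist n m) : Prop :=
  ∀ g h, r (testProd₂ g h) = form Ω (retOp 𝒯 P fB B fC C g h Ω)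

end Products

end Split

end

open MeasureTheory Filter Topology SchwartzMap FourierTransform LineDeriv
open scoped ContDiff

set_option linter.unusedSectionVars false

noncomputable section

namespace Split

/-! ### Characters and modulations of Schwartz functions. -/

section Char

variable {V : Type*} [NormedAddCommGroup V] [NormedSpace ℝ V]

/-! Splitting is a summation over dyadic scales. The function ψ(y) = Θ(y) - Θ(y/2) has compact
support away from 0, because Θ vanishes near 0 and is homogeneous of degree 0 far out, and Θ(y) =
∑_k ψ(2^{-k} y). Hence the transform of Θt is the weak limit of sums of the continuous functions
⟨s_{q'}, exp(iq·y) ψ(2^{-k} y)⟩, where s_{q'} is the slice at q' of the transform of f(x) s(y, x)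
(`tendsto_sum_osc`).

For small q' the slice is a sum of derivatives ∂^β of the functions τ_β provided by the O^dist
hypothesis, plus a distribution whose transform vanishes near q = 0 (`slice_eq_sum_fibreDist`). The
k-th term of τ_β is an average of τ_β at scale 2^{-k} around q, of size (2^{-k} + |q|)^a with a = d
- ε + |β|. Writing ψ = ∑ y_i ψ_i costs one more derivative ∂_i and gains the factor 2^{-k} that
makes the series converge. Let D be the integer strictly between a + 1 and a + 2, and subtract from
each term its Taylor polynomial of degree < D. At scales 2^{-k} ≥ |q| the remainder is small, at
scales 2^{-k} ≤ |q| the term and its Taylor terms are small one by one, and both sums are geometric.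
So the series is a polynomial of degree < D plus O(|q|^{a+1}) (`DyadicBound.exists_polySum`). The
|β| + 1 derivatives turn this into a polynomial of degree < d plus O^dist(|q|^{d-ε})
(`exists_hasSum_near`). The part that vanishes near q = 0 obeys the same bounds with any exponent a,
by rapid decay (`dyadicBound_of_vanishing`).

For the products of fields, causality gives S(g + h) = S(g)S(h) for suitably ordered supports
(`serS_union`). If no argument in a set Y of y's lies in the future of any other argument, then the
factor S(g_Y) cancels in S(g + h_i) S(g)⁻¹, and Adv vanishes (`advOp_eq_zero`; `retOp_eq_zero` for
Ret). Therefore, on the support of Adv, every y_j is in the future of some x_i, and on that of Ret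
in the past of some x_i (`apply_eq_zero_of_causal`). Where y is large compared with x, the sum of
the times of the y_j is then comparable to |y|, and positive or negative, respectively. A splitting
function Θ that is a smoothed sign of this total time thus gives Adv = Θ Dif up to terms localised
in y relative to x (`exists_splitting_of_causal`). After multiplication with f these terms are
distributions times Schwartz functions, with continuous transforms.

By the splitting result, the transform of f Adv is O^dist(|q|^{d-ε}) plus a polynomial in q plus a
continuous function, which is (A). For d = 1 and after integration over x, the polynomial is a
constant and the localised terms differ from their values at q = 0 by O(|q|), which is (B) for Adv.
The integrated Dif is itself O^dist(|q|^{1-ε}), being the slice at q' = 0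
(`exists_hasRep_integrateSnd`), so Ret = Adv - Dif has the same constant. -/

theorem norm_iteratedFDeriv_cexp_le (n : ℕ) (t : ℝ) :
    ‖iteratedFDeriv ℝ n (fun t : ℝ => Complex.exp (Complex.I * t)) t‖ ≤ 1 := by
  rw [norm_iteratedFDeriv_eq_norm_iteratedDeriv]
  have h : ∀ n, iteratedDeriv n (fun t : ℝ => Complex.exp (Complex.I * t)) =
      fun t : ℝ => Complex.I ^ n * Complex.exp (Complex.I * t) := by
    intro n
    induction n with
    | zero => simp
    | succ n ih =>
      rw [iteratedDeriv_succ, ih]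
      ext t
      have h1 : HasDerivAt (fun t : ℝ => Complex.I * (t : ℂ)) Complex.I t := by
        simpa using (Complex.ofRealCLM.hasDerivAt (x := t)).const_mul Complex.I
      have := (h1.cexp.const_mul (Complex.I ^ n)).deriv
      rw [this]; ring
  rw [h]
  simp [mul_comm Complex.I, Complex.norm_exp_ofReal_mul_I]

/-- The character `y ↦ exp(i ℓ(y))`. -/
def chr (ℓ : V →L[ℝ] ℝ) (y : V) : ℂ := Complex.exp (Complex.I * (ℓ y : ℝ))

theorem contDiff_cexp_I : ContDiff ℝ ∞ (fun t : ℝ => Complex.exp (Complex.I * t)) :=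
  (contDiff_const.mul Complex.ofRealCLM.contDiff).cexp

theorem contDiff_chr (ℓ : V →L[ℝ] ℝ) : ContDiff ℝ ∞ (chr ℓ) :=
  contDiff_cexp_I.comp ℓ.contDiff

theorem norm_chr (ℓ : V →L[ℝ] ℝ) (y : V) : ‖chr ℓ y‖ = 1 := by
  rw [chr, mul_comm, Complex.norm_exp_ofReal_mul_I]

theorem norm_iteratedFDeriv_chr_le (ℓ : V →L[ℝ] ℝ) (n : ℕ) (y : V) :
    ‖iteratedFDeriv ℝ n (chr ℓ) y‖ ≤ ‖ℓ‖ ^ n := by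
  have h := ℓ.iteratedFDeriv_comp_right contDiff_cexp_I y (i := n) (by exact_mod_cast le_top)
  have h' : chr ℓ = (fun t : ℝ => Complex.exp (Complex.I * t)) ∘ ℓ := rfl
  rw [h', h]
  refine (ContinuousMultilinearMap.norm_compContinuousLinearMap_le _ _).trans ?_
  simp only [Finset.prod_const, Finset.card_univ, Fintype.card_fin]
  exact mul_le_of_le_one_left (by positivity) (norm_iteratedFDeriv_cexp_le n _)

theorem norm_chr_sub_one_le (ℓ : V →L[ℝ] ℝ) (y : V) : ‖chr ℓ y - 1‖ ≤ ‖ℓ‖ * ‖y‖ :=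
  (Real.norm_exp_I_mul_ofReal_sub_one_le).trans (ℓ.le_opNorm y)

theorem chr_hasTemperateGrowth (ℓ : V →L[ℝ] ℝ) : (chr ℓ).HasTemperateGrowth :=
  ⟨contDiff_chr ℓ, fun n => ⟨0, ‖ℓ‖ ^ n, fun y => by
    simpa using norm_iteratedFDeriv_chr_le ℓ n y⟩⟩

theorem chr_add (ℓ ℓ' : V →L[ℝ] ℝ) (y : V) : chr (ℓ + ℓ') y = chr ℓ y * chr ℓ' y := by
  simp only [chr, _root_.add_apply, Complex.ofReal_add, mul_add, Complex.exp_add]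

@[simp] theorem chr_zero (y : V) : chr (0 : V →L[ℝ] ℝ) y = 1 := by simp [chr]

/-- Multiplication of Schwartz functions by the character `exp(i ℓ)`. -/
def charMul (ℓ : V →L[ℝ] ℝ) : 𝓢(V, ℂ) →L[ℂ] 𝓢(V, ℂ) := SchwartzMap.smulLeftCLM ℂ (chr ℓ)

@[simp] theorem charMul_apply (ℓ : V →L[ℝ] ℝ) (κ : 𝓢(V, ℂ)) (y : V) :
    charMul ℓ κ y = chr ℓ y * κ y := by
  rw [charMul, SchwartzMap.smulLeftCLM_apply_apply (chr_hasTemperateGrowth ℓ), smul_eq_mul]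

theorem charMul_add (ℓ ℓ' : V →L[ℝ] ℝ) (κ : 𝓢(V, ℂ)) :
    charMul (ℓ + ℓ') κ = charMul ℓ (charMul ℓ' κ) := by
  ext y; simp [chr_add, mul_assoc]

@[simp] theorem charMul_zero (κ : 𝓢(V, ℂ)) : charMul 0 κ = κ := by
  ext y; simp

/-- By the Leibniz rule each derivative of the character costs a factor ‖ℓ‖. The growth in ℓ is thus
polynomial, and modulations can be integrated against Schwartz functions of the momentum. -/
theorem seminorm_charMul_le (k n : ℕ) (ℓ : V →L[ℝ] ℝ) (κ : 𝓢(V, ℂ)) :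
    SchwartzMap.seminorm ℂ k n (charMul ℓ κ) ≤ (1 + ‖ℓ‖) ^ n *
      ∑ i ∈ Finset.range (n + 1), (n.choose i : ℝ) * SchwartzMap.seminorm ℂ k (n - i) κ := by
  refine SchwartzMap.seminorm_le_bound ℂ k n _ (by positivity) fun y => ?_
  have h := norm_iteratedFDeriv_mul_le (contDiff_chr ℓ) (κ.smooth ⊤) y (n := n)
    (by exact_mod_cast le_top)
  have h' : (⇑(charMul ℓ κ) : V → ℂ) = fun y => chr ℓ y * κ y := funext fun y => charMul_apply _ _ _
  rw [h']
  refine (mul_le_mul_of_nonneg_left h (by positivity)).trans ?_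
  rw [Finset.mul_sum, Finset.mul_sum]
  refine Finset.sum_le_sum fun i hi => ?_
  have hi' : i ≤ n := Nat.lt_succ_iff.1 (Finset.mem_range.1 hi)
  calc ‖y‖ ^ k * ((n.choose i : ℝ) * ‖iteratedFDeriv ℝ i (chr ℓ) y‖ *
        ‖iteratedFDeriv ℝ (n - i) κ y‖)
      = ‖iteratedFDeriv ℝ i (chr ℓ) y‖ * ((n.choose i : ℝ) *
          (‖y‖ ^ k * ‖iteratedFDeriv ℝ (n - i) κ y‖)) := by ring
    _ ≤ (1 + ‖ℓ‖) ^ n * ((n.choose i : ℝ) * SchwartzMap.seminorm ℂ k (n - i) κ) := by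
        gcongr
        · refine (norm_iteratedFDeriv_chr_le ℓ i y).trans ?_
          calc ‖ℓ‖ ^ i ≤ (1 + ‖ℓ‖) ^ i := by gcongr; linarith
            _ ≤ (1 + ‖ℓ‖) ^ n := pow_le_pow_right₀ (by linarith [norm_nonneg ℓ]) hi'
        · exact SchwartzMap.le_seminorm ℂ k (n - i) κ y

/-- The undifferentiated factor `chr ℓ y - 1` is at most ‖ℓ‖‖y‖, whence the seminorms with weight k
+ 1; every derivative of the character carries a factor ‖ℓ‖ anyway. The overall factor ‖ℓ‖ yields
continuity in ℓ and, later, the O(|q|) error of localised terms. -/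
theorem seminorm_charMul_sub_le (k n : ℕ) (ℓ : V →L[ℝ] ℝ) (κ : 𝓢(V, ℂ)) :
    SchwartzMap.seminorm ℂ k n (charMul ℓ κ - κ) ≤ ‖ℓ‖ * ((1 + ‖ℓ‖) ^ n *
      ∑ i ∈ Finset.range (n + 1), (n.choose i : ℝ) *
        (SchwartzMap.seminorm ℂ k (n - i) κ + SchwartzMap.seminorm ℂ (k + 1) (n - i) κ)) := by
  refine SchwartzMap.seminorm_le_bound ℂ k n _ (by positivity) fun y => ?_
  have hc : ContDiff ℝ ∞ (fun y => chr ℓ y - 1) := (contDiff_chr ℓ).sub contDiff_const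
  have h := norm_iteratedFDeriv_mul_le hc (κ.smooth ⊤) y (n := n)
    (by exact_mod_cast le_top)
  have h' : (⇑(charMul ℓ κ - κ) : V → ℂ) = fun y => (chr ℓ y - 1) * κ y :=
    funext fun y => by simp [sub_mul]
  rw [h']
  refine (mul_le_mul_of_nonneg_left h (by positivity)).trans ?_
  rw [← mul_assoc, Finset.mul_sum, Finset.mul_sum]
  refine Finset.sum_le_sum fun i hi => ?_
  have hi' : i ≤ n := Nat.lt_succ_iff.1 (Finset.mem_range.1 hi)
  have h1 : (1 : ℝ) ≤ 1 + ‖ℓ‖ := by linarith [norm_nonneg ℓ]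
  have key : ‖iteratedFDeriv ℝ i (fun y => chr ℓ y - 1) y‖ ≤
      ‖ℓ‖ * (1 + ‖ℓ‖) ^ n * (1 + ‖y‖) := by
    rcases Nat.eq_zero_or_pos i with rfl | hpos
    · rw [norm_iteratedFDeriv_zero]
      calc ‖chr ℓ y - 1‖ ≤ ‖ℓ‖ * 1 * ‖y‖ := by simpa using norm_chr_sub_one_le ℓ y
        _ ≤ _ := by
          gcongr
          · exact one_le_pow₀ h1
          · linarith
    · have : iteratedFDeriv ℝ i (fun y => chr ℓ y - 1) y = iteratedFDeriv ℝ i (chr ℓ) y := by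
        obtain ⟨j, rfl⟩ : ∃ j, i = j + 1 := ⟨i - 1, by omega⟩
        have h2 : fderiv ℝ (fun y => chr ℓ y - 1) = fderiv ℝ (chr ℓ) := by
          ext1 y; exact fderiv_sub_const _
        ext m
        rw [iteratedFDeriv_succ_apply_right, iteratedFDeriv_succ_apply_right, h2]
      rw [this]
      refine (norm_iteratedFDeriv_chr_le ℓ i y).trans ?_
      obtain ⟨j, rfl⟩ : ∃ j, i = j + 1 := ⟨i - 1, by omega⟩
      calc ‖ℓ‖ ^ (j + 1) = ‖ℓ‖ * ‖ℓ‖ ^ j * 1 := by ring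
        _ ≤ _ := by
          gcongr
          · calc ‖ℓ‖ ^ j ≤ (1 + ‖ℓ‖) ^ j := by gcongr; linarith
              _ ≤ (1 + ‖ℓ‖) ^ n := pow_le_pow_right₀ h1 (by omega)
          · linarith [norm_nonneg y]
  calc ‖y‖ ^ k * ((n.choose i : ℝ) * ‖iteratedFDeriv ℝ i (fun y => chr ℓ y - 1) y‖ *
        ‖iteratedFDeriv ℝ (n - i) κ y‖)
      ≤ ‖y‖ ^ k * ((n.choose i : ℝ) * (‖ℓ‖ * (1 + ‖ℓ‖) ^ n * (1 + ‖y‖)) *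
        ‖iteratedFDeriv ℝ (n - i) κ y‖) := by gcongr
    _ = ‖ℓ‖ * (1 + ‖ℓ‖) ^ n * ((n.choose i : ℝ) * (‖y‖ ^ k * ‖iteratedFDeriv ℝ (n - i) κ y‖ +
        ‖y‖ ^ (k + 1) * ‖iteratedFDeriv ℝ (n - i) κ y‖)) := by ring
    _ ≤ _ := by
        gcongr
        · exact SchwartzMap.le_seminorm ℂ k (n - i) κ y
        · exact SchwartzMap.le_seminorm ℂ (k + 1) (n - i) κ y

/-- The group law `charMul_add` reduces continuity at ℓ₀ to continuity at 0 for the function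
`charMul ℓ₀ κ`. -/
theorem continuous_charMul (κ : 𝓢(V, ℂ)) : Continuous fun ℓ : V →L[ℝ] ℝ => charMul ℓ κ := by
  rw [continuous_iff_continuousAt]
  intro ℓ₀
  rw [ContinuousAt, (schwartz_withSeminorms ℂ V ℂ).tendsto_nhds]
  rintro ⟨k, n⟩ ε hε
  set κ' := charMul ℓ₀ κ
  set K := fun ℓ : V →L[ℝ] ℝ => ‖ℓ - ℓ₀‖ * ((1 + ‖ℓ - ℓ₀‖) ^ n *
      ∑ i ∈ Finset.range (n + 1), (n.choose i : ℝ) *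
        (SchwartzMap.seminorm ℂ k (n - i) κ' + SchwartzMap.seminorm ℂ (k + 1) (n - i) κ'))
  have hK : Continuous K := by fun_prop
  have h0 : K ℓ₀ = 0 := by simp [K]
  have := (hK.tendsto ℓ₀).eventually_lt_const (u := ε) (by rw [h0]; exact hε)
  filter_upwards [this] with ℓ hℓ
  refine lt_of_le_of_lt ?_ hℓ
  have h1 : charMul ℓ κ = charMul (ℓ - ℓ₀) κ' := by rw [← charMul_add, sub_add_cancel]
  rw [h1]
  exact seminorm_charMul_sub_le k n _ _

end Char

/-! ### Interchange of tempered distributions and integrals -/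

section Exchange

variable {V : Type*} [NormedAddCommGroup V] [NormedSpace ℝ V]

/-- The value `‖x‖^k D^n f(x)(v)`, normalised by the norms of the vectors `v`. -/
def weightedDeriv (k n : ℕ) (x : V) (v : ℕ → V) (f : 𝓢(V, ℂ)) : ℂ :=
  ((‖x‖ ^ k / ∏ i : Fin n, ‖v i‖ : ℝ) : ℂ) * iteratedFDeriv ℝ n f x fun i => v i

theorem norm_weightedDeriv_le (k n : ℕ) (x : V) (v : ℕ → V) (f : 𝓢(V, ℂ)) :
    ‖weightedDeriv k n x v f‖ ≤ SchwartzMap.seminorm ℂ k n f := by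
  have h0 : 0 ≤ ∏ i : Fin n, ‖v i‖ := Finset.prod_nonneg fun _ _ => norm_nonneg _
  rw [weightedDeriv, norm_mul, Complex.norm_real, Real.norm_of_nonneg (by positivity)]
  rcases h0.eq_or_lt with h | h
  · rw [← h]; simp
  · refine le_trans ?_ (SchwartzMap.le_seminorm ℂ k n f x)
    rw [div_mul_eq_mul_div, div_le_iff₀ h, mul_assoc]
    gcongr
    exact (iteratedFDeriv ℝ n f x).le_opNorm _

theorem weightedDeriv_add (k n : ℕ) (x : V) (v : ℕ → V) (f g : 𝓢(V, ℂ)) :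
    weightedDeriv k n x v (f + g) = weightedDeriv k n x v f + weightedDeriv k n x v g := by
  have : (⇑(f + g) : V → ℂ) = ⇑f + ⇑g := rfl
  rw [weightedDeriv, this, iteratedFDeriv_add_apply
    ((f.smooth ⊤).contDiffAt.of_le (by exact_mod_cast le_top))
    ((g.smooth ⊤).contDiffAt.of_le (by exact_mod_cast le_top))]
  simp [weightedDeriv, mul_add]

theorem weightedDeriv_smul (k n : ℕ) (x : V) (v : ℕ → V) (c : ℂ) (f : 𝓢(V, ℂ)) :
    weightedDeriv k n x v (c • f) = c * weightedDeriv k n x v f := by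
  have : (⇑(c • f) : V → ℂ) = c • ⇑f := rfl
  rw [weightedDeriv, this, iteratedFDeriv_const_smul_apply
    ((f.smooth ⊤).contDiffAt.of_le (by exact_mod_cast le_top))]
  simp [weightedDeriv, mul_left_comm]

/-- The Banach space in which Schwartz functions are controlled by finitely many seminorms. -/
abbrev WeightedSpace (V : Type*) (m : Finset (ℕ × ℕ)) :=
  lp (fun _ : m × V × (ℕ → V) => ℂ) ⊤

theorem seminorm_le_sum (m : Finset (ℕ × ℕ)) (f : 𝓢(V, ℂ)) (i : m) :
    SchwartzMap.seminorm ℂ i.1.1 i.1.2 f ≤ ∑ j ∈ m, SchwartzMap.seminorm ℂ j.1 j.2 f :=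
  Finset.single_le_sum (f := fun i : ℕ × ℕ => SchwartzMap.seminorm ℂ i.1 i.2 f)
    (fun _ _ => apply_nonneg _ _) i.2

/-- The map from Schwartz functions to `WeightedSpace`. -/
def toWeighted (m : Finset (ℕ × ℕ)) : 𝓢(V, ℂ) →ₗ[ℂ] WeightedSpace V m where
  toFun f := ⟨fun d => weightedDeriv d.1.1.1 d.1.1.2 d.2.1 d.2.2 f, memℓp_infty
    ⟨∑ j ∈ m, SchwartzMap.seminorm ℂ j.1 j.2 f, by
      rintro _ ⟨d, rfl⟩
      exact (norm_weightedDeriv_le _ _ _ _ f).trans (seminorm_le_sum m f d.1)⟩⟩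
  map_add' f g := by
    ext d; exact weightedDeriv_add _ _ _ _ f g
  map_smul' c f := by
    ext d; exact weightedDeriv_smul _ _ _ _ c f

theorem toWeighted_apply (m : Finset (ℕ × ℕ)) (f : 𝓢(V, ℂ)) (d : m × V × (ℕ → V)) :
    toWeighted m f d = weightedDeriv d.1.1.1 d.1.1.2 d.2.1 d.2.2 f := rfl

theorem norm_toWeighted_le (m : Finset (ℕ × ℕ)) (f : 𝓢(V, ℂ)) :
    ‖toWeighted m f‖ ≤ ∑ j ∈ m, SchwartzMap.seminorm ℂ j.1 j.2 f :=
  lp.norm_le_of_forall_le (Finset.sum_nonneg fun _ _ => apply_nonneg _ _) fun d =>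
    (norm_weightedDeriv_le _ _ _ _ f).trans (seminorm_le_sum m f d.1)

/-- The supremum over all directions of the normalised values recovers the operator norm of the
derivative. -/
theorem seminorm_le_norm_toWeighted (m : Finset (ℕ × ℕ)) (f : 𝓢(V, ℂ)) (i : m) :
    SchwartzMap.seminorm ℂ i.1.1 i.1.2 f ≤ ‖toWeighted m f‖ := by
  refine SchwartzMap.seminorm_le_bound ℂ _ _ _ (norm_nonneg _) fun x => ?_
  rw [show ‖x‖ ^ i.1.1 * ‖iteratedFDeriv ℝ i.1.2 f x‖ =
    ‖(‖x‖ ^ i.1.1) • iteratedFDeriv ℝ i.1.2 f x‖ by rw [norm_smul]; simp]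
  refine ContinuousMultilinearMap.opNorm_le_bound (norm_nonneg _) fun v => ?_
  -- Directions are sequences over ℕ so that one index type serves all orders of differentiation;
  -- entries beyond the order are irrelevant.
  let w : ℕ → V := fun j => if h : j < i.1.2 then v ⟨j, h⟩ else 0
  have hw : (fun j : Fin i.1.2 => w j) = v := by
    ext j; simp [w]
  have h1 := lp.norm_apply_le_norm (ENNReal.top_ne_zero) (toWeighted m f) (i, x, w)
  rw [toWeighted_apply] at h1
  have h2 : ∀ j : Fin i.1.2, w j = v j := fun j => congrFun hw j
  simp only [weightedDeriv, hw, h2] at h1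
  have h0 : 0 ≤ ∏ j, ‖v j‖ := Finset.prod_nonneg fun _ _ => norm_nonneg _
  -- If some v j is 0, the normalisation divides by 0 and carries no information, but then the
  -- multilinear map vanishes on v.
  rcases h0.eq_or_lt with h | h
  · obtain ⟨j, -, hj⟩ := Finset.prod_eq_zero_iff.1 h.symm
    rw [ContinuousMultilinearMap.smul_apply,
      (iteratedFDeriv ℝ i.1.2 f x).map_coord_zero j (norm_eq_zero.1 hj), smul_zero, norm_zero]
    positivity
  · rw [norm_mul, Complex.norm_real, Real.norm_of_nonneg (by positivity), div_mul_eq_mul_div,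
      div_le_iff₀ h] at h1
    rw [ContinuousMultilinearMap.smul_apply, norm_smul, Real.norm_of_nonneg (by positivity)]
    exact h1

theorem continuous_toWeighted (m : Finset (ℕ × ℕ)) : Continuous (toWeighted (V := V) m) := by
  refine WithSeminorms.continuous_of_isBounded (schwartz_withSeminorms ℂ V ℂ)
    (norm_withSeminorms ℂ (WeightedSpace V m)) _ (fun _ => ⟨m, m.card, fun f => ?_⟩)
  refine (norm_toWeighted_le m f).trans ?_
  refine (Finset.sum_le_card_nsmul m _ (m.sup (schwartzSeminormFamily ℂ V ℂ) f)
    fun j hj => ?_).trans (le_of_eq ?_)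
  · exact Seminorm.le_def.1 (Finset.le_sup (f := schwartzSeminormFamily ℂ V ℂ) hj) f
  · simp [NNReal.smul_def]

/-- A continuous functional is bounded by finitely many seminorms, hence by the norm of `toWeighted
m`, and the Hahn–Banach theorem extends it to the whole Banach space. In this way Bochner integrals
become available for Schwartz-valued functions. -/
theorem exists_extension_weighted (u : 𝓢(V, ℂ) →L[ℂ] ℂ) :
    ∃ (m : Finset (ℕ × ℕ)) (Λ : WeightedSpace V m →L[ℂ] ℂ), ∀ f, u f = Λ (toWeighted m f) := by
  obtain ⟨m₀, C, -, hC⟩ := Seminorm.bound_of_continuous (schwartz_withSeminorms ℂ V ℂ)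
    ((normSeminorm ℂ ℂ).comp u.toLinearMap) (by
      exact continuous_norm.comp u.continuous)
  -- The index (0, 0) makes `toWeighted m` injective, so that u descends to its range.
  set m := insert ((0 : ℕ), (0 : ℕ)) m₀
  have hb : ∀ f, ‖u f‖ ≤ C * ‖toWeighted m f‖ := by
    intro f
    refine (hC f).trans ?_
    change (C : ℝ) * m₀.sup (schwartzSeminormFamily ℂ V ℂ) f ≤ _
    refine mul_le_mul_of_nonneg_left ?_ C.2
    refine Seminorm.finset_sup_apply_le (norm_nonneg _) fun i hi => ?_
    exact seminorm_le_norm_toWeighted m f ⟨i, Finset.mem_insert_of_mem hi⟩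
  have hinj : Function.Injective (toWeighted (V := V) m) := by
    rw [injective_iff_map_eq_zero]
    intro f hf
    ext x
    have h1 := seminorm_le_norm_toWeighted m f ⟨(0, 0), Finset.mem_insert_self _ _⟩
    rw [hf, norm_zero] at h1
    have h2 := SchwartzMap.norm_le_seminorm ℂ f x
    simpa using norm_le_zero_iff.1 (h2.trans h1)
  let e := LinearEquiv.ofInjective (toWeighted (V := V) m) hinj
  let φ : StrongDual ℂ (LinearMap.range (toWeighted (V := V) m)) :=
    LinearMap.mkContinuous (u.toLinearMap ∘ₗ e.symm.toLinearMap) C (fun x => by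
      obtain ⟨f, rfl⟩ := e.surjective x
      have := hb f
      simp only [LinearMap.comp_apply, LinearEquiv.coe_coe, LinearEquiv.symm_apply_apply]
      exact this)
  obtain ⟨g, hg, -⟩ := exists_extension_norm_eq _ φ
  refine ⟨m, g, fun f => ?_⟩
  have := hg (e f)
  have h2 : φ (e f) = u f := by simp [φ]
  rw [h2] at this
  exact this.symm

theorem norm_iteratedLineDeriv_le (n : ℕ) (v : Fin n → V) (f : 𝓢(V, ℂ)) (x : V) :
    ‖iteratedLineDerivOp v f x‖ ≤ SchwartzMap.seminorm ℂ 0 n f * ∏ i, ‖v i‖ := by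
  rw [SchwartzMap.iteratedLineDerivOp_eq_iteratedFDeriv]
  refine ((iteratedFDeriv ℝ n f x).le_opNorm _).trans ?_
  gcongr
  exact SchwartzMap.norm_iteratedFDeriv_le_seminorm ℂ f n x

variable {Q : Type*} [MeasurableSpace Q] [TopologicalSpace Q] [OpensMeasurableSpace Q]
  [SecondCountableTopology Q] {μ : Measure Q}

/-- Induction on n: differentiate under the integral sign along the line in direction `v 0`,
dominated by the seminorm of order n + 1. Since Ψ is already known to be smooth, its derivative is
the one so obtained. -/
theorem iteratedLineDeriv_integral {F : Q → 𝓢(V, ℂ)} (hF : Continuous F)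
    {φ : Q → ℂ} (hφm : AEStronglyMeasurable φ μ)
    (hφ : ∀ n : ℕ, Integrable (fun q => ‖φ q‖ * SchwartzMap.seminorm ℂ 0 n (F q)) μ)
    (Ψ : 𝓢(V, ℂ)) (hΨ : ∀ y, Ψ y = ∫ q, φ q * F q y ∂μ) (n : ℕ) :
    ∀ (v : Fin n → V) (y : V),
      iteratedLineDerivOp v Ψ y = ∫ q, φ q * iteratedLineDerivOp v (F q) y ∂μ := by
  have hmeas : ∀ (n : ℕ) (v : Fin n → V) (y : V),
      AEStronglyMeasurable (fun q => φ q * iteratedLineDerivOp v (F q) y) μ := by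
    intro n v y
    refine hφm.mul (Continuous.aestronglyMeasurable ?_)
    have h1 : Continuous fun f : 𝓢(V, ℂ) => (TemperedDistribution.delta y)
        (iteratedLineDerivOpCLM ℂ 𝓢(V, ℂ) v f) :=
      (show 𝓢(V, ℂ) →L[ℂ] ℂ from TemperedDistribution.delta y).continuous.comp
        (iteratedLineDerivOpCLM ℂ 𝓢(V, ℂ) v).continuous
    exact h1.comp hF
  have hbd : ∀ (n : ℕ) (v : Fin n → V) (q : Q) (y : V),
      ‖φ q * iteratedLineDerivOp v (F q) y‖ ≤
        ‖φ q‖ * SchwartzMap.seminorm ℂ 0 n (F q) * ∏ i, ‖v i‖ := by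
    intro n v q y
    rw [norm_mul, mul_assoc]
    exact mul_le_mul_of_nonneg_left (norm_iteratedLineDeriv_le n v _ y) (norm_nonneg _)
  induction n with
  | zero => intro v y; simpa using hΨ y
  | succ n ih =>
    intro v y
    set w := Fin.tail v with hw
    have hl : ∀ (f : 𝓢(V, ℂ)) (x : V) (t : ℝ), HasDerivAt
        (fun t : ℝ => iteratedLineDerivOp w f (x + t • v 0))
        (iteratedLineDerivOp v f (x + t • v 0)) t := by
      intro f x t
      have h1 := ((iteratedLineDerivOp w f).hasFDerivAt (x + t • v 0)).comp_hasDerivAt t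
        (((hasDerivAt_id t).smul_const (v 0)).const_add x)
      rw [one_smul] at h1
      rw [iteratedLineDerivOp_succ_left, SchwartzMap.lineDerivOp_apply_eq_fderiv]
      exact h1
    have h2 := hasDerivAt_integral_of_dominated_loc_of_deriv_le (μ := μ) (s := Set.univ)
      (F := fun t q => φ q * iteratedLineDerivOp w (F q) (y + t • v 0))
      (F' := fun t q => φ q * iteratedLineDerivOp v (F q) (y + t • v 0)) (x₀ := (0 : ℝ))
      (bound := fun q => ‖φ q‖ * SchwartzMap.seminorm ℂ 0 (n + 1) (F q) * ∏ i, ‖v i‖)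
      univ_mem (Eventually.of_forall fun t => hmeas n w _)
      (((hφ n).mul_const _).mono' (hmeas n w _) (Eventually.of_forall fun q => hbd n w q _))
      (hmeas (n + 1) v _) (Eventually.of_forall fun q t _ => hbd (n + 1) v q _)
      ((hφ (n + 1)).mul_const _)
      (Eventually.of_forall fun q t _ => (hl (F q) y t).const_mul _)
    have h3 := hl Ψ y 0
    simp only [ih w] at h3
    have := h3.unique h2.2
    simpa using this

/-- Tempered distributions commute with integrals of Schwartz functions. -/
theorem apply_integral (u : 𝓢(V, ℂ) →L[ℂ] ℂ) {F : Q → 𝓢(V, ℂ)} (hF : Continuous F)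
    {φ : Q → ℂ} (hφm : AEStronglyMeasurable φ μ)
    (hφ : ∀ k n : ℕ, Integrable (fun q => ‖φ q‖ * SchwartzMap.seminorm ℂ k n (F q)) μ)
    (Ψ : 𝓢(V, ℂ)) (hΨ : ∀ y, Ψ y = ∫ q, φ q * F q y ∂μ) :
    u Ψ = ∫ q, φ q * u (F q) ∂μ := by
  obtain ⟨m, Λ, hΛ⟩ := exists_extension_weighted u
  have hint : Integrable (fun q => φ q • toWeighted m (F q)) μ := by
    have hmeas : AEStronglyMeasurable (fun q => φ q • toWeighted m (F q)) μ :=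
      hφm.smul ((continuous_toWeighted m).comp hF).aestronglyMeasurable
    refine (integrable_finsetSum m fun i _ => hφ i.1 i.2).mono' hmeas
      (Eventually.of_forall fun q => ?_)
    rw [norm_smul, ← Finset.mul_sum]
    exact mul_le_mul_of_nonneg_left (norm_toWeighted_le m _) (norm_nonneg _)
  -- The vector-valued integral is identified by its components, which are weighted derivatives of Ψ
  -- at points.
  have hJ : toWeighted m Ψ = ∫ q, φ q • toWeighted m (F q) ∂μ := by
    ext d
    have h1 := (lp.evalCLM ℂ (fun _ : m × V × (ℕ → V) => ℂ) ⊤ d).integral_comp_comm hint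
    refine Eq.trans ?_ h1
    change weightedDeriv _ _ _ _ Ψ = ∫ q, φ q * weightedDeriv _ _ _ _ (F q) ∂μ
    simp only [weightedDeriv, ← SchwartzMap.iteratedLineDerivOp_eq_iteratedFDeriv]
    rw [iteratedLineDeriv_integral hF hφm (hφ 0) Ψ hΨ, ← integral_const_mul]
    refine integral_congr_ae (Eventually.of_forall fun q => ?_)
    simp only
    ring
  rw [hΛ, hJ, ← Λ.integral_comp_comm hint]
  refine integral_congr_ae (Eventually.of_forall fun q => ?_)
  simp only [map_smul, smul_eq_mul, hΛ]

/-- Tempered distributions commute with integrals of modulations of a Schwartz function. -/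
theorem apply_integral_charMul (u : 𝓢(V, ℂ) →L[ℂ] ℂ) {z : Q → (V →L[ℝ] ℝ)} (hz : Continuous z)
    {φ : Q → ℂ} (hφm : AEStronglyMeasurable φ μ)
    (hφ : ∀ n : ℕ, Integrable (fun q => ‖φ q‖ * (1 + ‖z q‖) ^ n) μ)
    (κ Ψ : 𝓢(V, ℂ)) (hΨ : ∀ y, Ψ y = ∫ q, φ q * (chr (z q) y * κ y) ∂μ) :
    u Ψ = ∫ q, φ q * u (charMul (z q) κ) ∂μ := by
  have hcont : Continuous fun q => charMul (z q) κ := (continuous_charMul κ).comp hz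
  refine apply_integral u hcont hφm (fun k n => ?_) Ψ (fun y => by simpa using hΨ y)
  refine ((hφ n).mul_const (∑ i ∈ Finset.range (n + 1), (n.choose i : ℝ) *
      SchwartzMap.seminorm ℂ k (n - i) κ)).mono' ?_ (Eventually.of_forall fun q => ?_)
  · refine hφm.norm.mul (Continuous.aestronglyMeasurable ?_)
    exact ((schwartz_withSeminorms ℂ V ℂ).continuous_seminorm (k, n)).comp hcont
  · rw [Real.norm_of_nonneg (by positivity), mul_assoc]
    exact mul_le_mul_of_nonneg_left (seminorm_charMul_le k n (z q) κ) (norm_nonneg _)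

end Exchange

/-! ### Differentiation with respect to the frequency of a character. -/

section Derivative

variable {V : Type*} [NormedAddCommGroup V] [NormedSpace ℝ V]

theorem ofReal_comp_hasTemperateGrowth {g : V → ℝ} (hg : g.HasTemperateGrowth) :
    (fun y => (g y : ℂ)).HasTemperateGrowth :=
  Function.HasTemperateGrowth.comp (by fun_prop : Complex.ofReal.HasTemperateGrowth) hg

/-- Multiplication of Schwartz functions by a real linear functional. -/
def linMul (ℓ : V →L[ℝ] ℝ) : 𝓢(V, ℂ) →L[ℂ] 𝓢(V, ℂ) :=
  SchwartzMap.smulLeftCLM ℂ (fun y => (ℓ y : ℂ))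

@[simp] theorem linMul_apply (ℓ : V →L[ℝ] ℝ) (κ : 𝓢(V, ℂ)) (y : V) :
    linMul ℓ κ y = ℓ y * κ y := by
  rw [linMul, SchwartzMap.smulLeftCLM_apply_apply
    (ofReal_comp_hasTemperateGrowth ℓ.hasTemperateGrowth), smul_eq_mul]

theorem linMul_charMul (ℓ ℓ' : V →L[ℝ] ℝ) (κ : 𝓢(V, ℂ)) :
    linMul ℓ (charMul ℓ' κ) = charMul ℓ' (linMul ℓ κ) := by
  ext y; simp [mul_left_comm]

/-- The increment is written as an integral over the segment, because integrals, unlike pointwise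
limits of difference quotients, pass through a distribution by `apply_integral_charMul`. -/
theorem chr_smul_sub_one (ℓ : V →L[ℝ] ℝ) (y : V) (t : ℝ) :
    chr (t • ℓ) y - 1 = t * ∫ s in (0 : ℝ)..1, chr ((s * t) • ℓ) y * (Complex.I * ℓ y) := by
  have h : ∀ s ∈ Set.uIcc (0 : ℝ) 1, HasDerivAt (fun s : ℝ => chr ((s * t) • ℓ) y)
      (chr ((s * t) • ℓ) y * (Complex.I * ℓ y) * t) s := by
    intro s _
    have h1 : HasDerivAt (fun s : ℝ => Complex.I * (((s * t * ℓ y : ℝ)) : ℂ))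
        (Complex.I * ((1 * t * ℓ y : ℝ) : ℂ)) s :=
      ((((hasDerivAt_id s).mul_const t).mul_const (ℓ y)).ofReal_comp).const_mul _
    have h2 := h1.cexp
    refine h2.congr_deriv ?_
    simp only [chr, _root_.smul_apply, smul_eq_mul]
    push_cast
    ring
  have hc : Continuous fun s : ℝ => chr ((s * t) • ℓ) y * (Complex.I * ℓ y) * t := by
    have : Continuous fun s : ℝ => chr ((s * t) • ℓ) y := by
      simp only [chr, _root_.smul_apply, smul_eq_mul]
      fun_prop
    fun_prop
  have := intervalIntegral.integral_eq_sub_of_hasDerivAt h (hc.intervalIntegrable _ _)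
  rw [intervalIntegral.integral_mul_const] at this
  simp only [one_mul, zero_mul, zero_smul, chr_zero] at this
  rw [← this, mul_comm]

/-- At s = 0 the increment is t times an average over [0, 1] of u applied to modulations of `I •
linMul ℓ κ`, and this average is continuous in t. The group law carries the result to every s. -/
theorem hasDerivAt_charMul (u : 𝓢(V, ℂ) →L[ℂ] ℂ) (ℓ : V →L[ℝ] ℝ) (κ : 𝓢(V, ℂ)) (s : ℝ) :
    HasDerivAt (fun s : ℝ => u (charMul (s • ℓ) κ))
      (u (charMul (s • ℓ) (Complex.I • linMul ℓ κ))) s := by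
  have key : ∀ κ : 𝓢(V, ℂ), HasDerivAt (fun s : ℝ => u (charMul (s • ℓ) κ))
      (u (Complex.I • linMul ℓ κ)) 0 := by
    intro κ
    set κ' := Complex.I • linMul ℓ κ with hκ'
    set G : ℝ → ℂ := fun t => ∫ s in (0 : ℝ)..1, u (charMul ((s * t) • ℓ) κ') with hG
    have hcont : Continuous fun p : ℝ × ℝ => u (charMul ((p.2 * p.1) • ℓ) κ') :=
      u.continuous.comp ((continuous_charMul κ').comp (by fun_prop))
    have hGc : Continuous G :=
      intervalIntegral.continuous_parametric_intervalIntegral_of_continuous' hcont 0 1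
    have hG0 : G 0 = u κ' := by simp [hG]
    have hGt : ∀ t : ℝ, u (charMul (t • ℓ) κ) = u κ + t * G t := by
      intro t
      have hfin : ∀ y, (charMul (t • ℓ) κ - κ) y = ∫ s in Set.Ioc (0 : ℝ) 1,
          (t : ℂ) * (chr ((s * t) • ℓ) y * κ' y) := by
        intro y
        have h1 := chr_smul_sub_one ℓ y t
        rw [intervalIntegral.integral_of_le zero_le_one] at h1
        rw [_root_.sub_apply, charMul_apply, ← sub_one_mul, h1, mul_assoc,
          ← integral_mul_const, ← integral_const_mul]
        refine integral_congr_ae (Eventually.of_forall fun s => ?_)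
        simp only [hκ', _root_.smul_apply, linMul_apply, smul_eq_mul]
        ring
      have h2 := apply_integral_charMul u (μ := volume.restrict (Set.Ioc (0 : ℝ) 1))
        (z := fun s : ℝ => (s * t) • ℓ) (by fun_prop) (φ := fun _ => (t : ℂ))
        aestronglyMeasurable_const (fun n => by
          have : Continuous fun q : ℝ => ‖(t : ℂ)‖ * (1 + ‖(q * t) • ℓ‖) ^ n := by fun_prop
          exact this.integrableOn_Ioc) κ' (charMul (t • ℓ) κ - κ) hfin
      rw [map_sub, integral_const_mul, ← intervalIntegral.integral_of_le zero_le_one] at h2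
      rw [← h2]; ring
    have hd : HasDerivAt (fun t : ℝ => u κ + t * G t) (u κ') 0 := by
      rw [hasDerivAt_iff_tendsto_slope]
      have : Tendsto G (𝓝[≠] 0) (𝓝 (u κ')) := by
        rw [← hG0]; exact (hGc.tendsto 0).mono_left nhdsWithin_le_nhds
      refine this.congr' ?_
      filter_upwards [self_mem_nhdsWithin] with t ht
      have ht' : (t : ℂ) ≠ 0 := by exact_mod_cast ht
      rw [slope_def_module]
      simp [ht']
    exact hd.congr_of_eventuallyEq (Eventually.of_forall hGt)
  have h := (key (charMul (s • ℓ) κ))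
  have h2 : HasDerivAt (fun r : ℝ => r - s) 1 s := (hasDerivAt_id s).sub_const s
  have h3 := HasDerivAt.scomp s (g₁ := fun r : ℝ => u (charMul (r • ℓ) (charMul (s • ℓ) κ)))
    (h := fun r => r - s) (by simpa using h) h2
  rw [linMul_charMul, one_smul] at h3
  have h4 : (fun r : ℝ => u (charMul (r • ℓ) κ)) =
      (fun r : ℝ => u (charMul (r • ℓ) (charMul (s • ℓ) κ))) ∘ fun r => r - s := by
    ext r
    simp only [Function.comp_apply]
    rw [← charMul_add, ← add_smul, sub_add_cancel]
  rw [h4, map_smul (charMul (s • ℓ)), map_smul, smul_eq_mul]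
  exact h3

end Derivative

/-! ### The pairing q·x, the inverse transform and rescaled kernels. -/

section Pairing

variable {κ : Type*} [Fintype κ]

/-- The pairing `q·x = ∑ i, σ i * q i * x i`. -/
def pair (σ : κ → ℤˣ) : Vec κ →L[ℝ] Vec κ →L[ℝ] ℝ :=
  (2 * Real.pi) • (innerSL ℝ).comp (scaleEquiv σ : Vec κ →L[ℝ] Vec κ)

theorem pair_eq_inner (σ : κ → ℤˣ) (q x : Vec κ) :
    pair σ q x = 2 * Real.pi * inner ℝ (scaleEquiv σ q) x := rfl

theorem pair_apply (σ : κ → ℤˣ) (q x : Vec κ) :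
    pair σ q x = ∑ i, ((σ i : ℤ) : ℝ) * q i * x i := by
  rw [pair_eq_inner, PiLp.inner_apply, Finset.mul_sum]
  refine Finset.sum_congr rfl fun i _ => ?_
  rw [scaleEquiv_apply]
  simp only [RCLike.inner_apply, conj_trivial]
  field_simp

theorem pair_comm (σ : κ → ℤˣ) (q x : Vec κ) : pair σ q x = pair σ x q := by
  simp only [pair_apply]
  exact Finset.sum_congr rfl fun i _ => by ring

theorem fourierTest_eq (σ : κ → ℤˣ) (φ : 𝓢(Vec κ, ℂ)) (y : Vec κ) :
    fourierTest σ φ y = ∫ q : Vec κ, φ q * chr (pair σ q) y := by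
  rw [fourierTest_apply]
  refine integral_congr_ae (Eventually.of_forall fun q => ?_)
  simp only [chr, pair_apply, mul_comm]

/-- The inverse of `fourierTest`. -/
def fourierTestInv (σ : κ → ℤˣ) : 𝓢(Vec κ, ℂ) →L[ℂ] 𝓢(Vec κ, ℂ) :=
  (fourierCLM ℂ 𝓢(Vec κ, ℂ)).comp
    (SchwartzMap.compCLMOfContinuousLinearEquiv ℂ (scaleEquiv σ).symm)

@[simp] theorem fourierTest_fourierTestInv (σ : κ → ℤˣ) (φ : 𝓢(Vec κ, ℂ)) :
    fourierTest σ (fourierTestInv σ φ) = φ := by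
  ext y
  simp [fourierTest, fourierTestInv]

@[simp] theorem fourierTestInv_fourierTest (σ : κ → ℤˣ) (φ : 𝓢(Vec κ, ℂ)) :
    fourierTestInv σ (fourierTest σ φ) = φ := by
  have : (SchwartzMap.compCLMOfContinuousLinearEquiv ℂ (scaleEquiv σ).symm)
      (fourierTest σ φ) = 𝓕⁻ φ := by
    ext y; simp [fourierTest]
  simp [fourierTestInv, this]

theorem fourierTest_lineDeriv (σ : κ → ℤˣ) (φ : 𝓢(Vec κ, ℂ)) (v : Vec κ) :
    fourierTest σ (∂_{v} φ) = -Complex.I • linMul (pair σ v) (fourierTest σ φ) := by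
  ext y
  have h1 : fourierTest σ (∂_{v} φ) y = (𝓕⁻ (∂_{v} φ)) (scaleEquiv σ y) := rfl
  have h2 : fourierTest σ φ y = (𝓕⁻ φ) (scaleEquiv σ y) := rfl
  have h3 : (fun x : Vec κ => inner ℝ x v).HasTemperateGrowth := by fun_prop
  rw [h1, SchwartzMap.fourierInv_lineDerivOp_eq]
  simp only [_root_.smul_apply, linMul_apply, h2]
  rw [SchwartzMap.smulLeftCLM_apply_apply h3, pair_comm, pair_eq_inner]
  simp only [smul_eq_mul, Complex.real_smul]
  push_cast
  ring

theorem integrable_schwartz_mul_growth {V : Type*} [NormedAddCommGroup V] [NormedSpace ℝ V]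
    (L : Vec κ →L[ℝ] V →L[ℝ] ℝ) (φ : 𝓢(Vec κ, ℂ)) (n : ℕ) :
    Integrable (fun q => ‖φ q‖ * (1 + ‖L q‖) ^ n) := by
  have h1 : Integrable (fun q : Vec κ => ((1 + ‖L‖) ^ n * 2 ^ n) *
      (‖φ q‖ + ‖q‖ ^ n * ‖φ q‖)) := by
    refine (Integrable.add ?_ ?_).const_mul _
    · simpa using φ.integrable_pow_mul volume 0
    · exact φ.integrable_pow_mul volume n
  refine h1.mono' (Continuous.aestronglyMeasurable (by fun_prop)) (Eventually.of_forall fun q => ?_)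
  rw [Real.norm_of_nonneg (by positivity)]
  have h2 : (1 + ‖L q‖) ^ n ≤ (1 + ‖L‖) ^ n * (2 ^ n * (1 + ‖q‖ ^ n)) := by
    calc (1 + ‖L q‖) ^ n ≤ ((1 + ‖L‖) * (1 + ‖q‖)) ^ n := by
          gcongr
          nlinarith [L.le_opNorm q, norm_nonneg L, norm_nonneg q]
      _ = (1 + ‖L‖) ^ n * (1 + ‖q‖) ^ n := mul_pow _ _ _
      _ ≤ _ := by
          gcongr
          have := add_pow_le zero_le_one (norm_nonneg q) n
          refine this.trans ?_
          rw [one_pow]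
          gcongr
          · exact one_le_two
          · omega
  calc ‖φ q‖ * (1 + ‖L q‖) ^ n ≤ ‖φ q‖ * ((1 + ‖L‖) ^ n * (2 ^ n * (1 + ‖q‖ ^ n))) := by gcongr
    _ = _ := by ring

/-- Modulations of a Schwartz function, integrated against a Schwartz function. -/
theorem apply_fourier {V : Type*} [NormedAddCommGroup V] [NormedSpace ℝ V]
    (u : 𝓢(V, ℂ) →L[ℂ] ℂ) (L : Vec κ →L[ℝ] V →L[ℝ] ℝ) (φ : 𝓢(Vec κ, ℂ)) (g Ψ : 𝓢(V, ℂ))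
    (hΨ : ∀ y, Ψ y = (∫ q, φ q * chr (L q) y) * g y) :
    u Ψ = ∫ q, φ q * u (charMul (L q) g) :=
  apply_integral_charMul u L.continuous φ.continuous.aestronglyMeasurable
    (integrable_schwartz_mul_growth L φ) g Ψ fun y => by
      rw [hΨ, ← integral_mul_const]
      simp only [mul_assoc]

theorem apply_mul_fourierTest (u : 𝓢(Vec κ, ℂ) →L[ℂ] ℂ) (σ : κ → ℤˣ) (φ g Ψ : 𝓢(Vec κ, ℂ))
    (hΨ : ∀ y, Ψ y = fourierTest σ φ y * g y) :
    u Ψ = ∫ q, φ q * u (charMul (pair σ q) g) :=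
  apply_fourier u (pair σ) φ g Ψ fun y => by rw [hΨ, fourierTest_eq]

/-- `f ↦ (y ↦ f (c • y))`. -/
def scal {V : Type*} [NormedAddCommGroup V] [NormedSpace ℝ V] (c : ℝˣ) :
    𝓢(V, ℂ) →L[ℂ] 𝓢(V, ℂ) :=
  SchwartzMap.compCLMOfContinuousLinearEquiv ℂ (ContinuousLinearEquiv.smulLeft c)

@[simp] theorem scal_apply {V : Type*} [NormedAddCommGroup V] [NormedSpace ℝ V] (c : ℝˣ)
    (f : 𝓢(V, ℂ)) (y : V) : scal c f y = f ((c : ℝ) • y) := rfl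

/-- The rescaled and translated function `p ↦ c^N f(c (p - q))`. -/
def kernelScal (c : ℝˣ) (q : Vec κ) : 𝓢(Vec κ, ℂ) →L[ℂ] 𝓢(Vec κ, ℂ) :=
  ((((c : ℝ) ^ Fintype.card κ : ℝ)) : ℂ) • (SchwartzMap.compSubConstCLM ℂ q).comp (scal c)

theorem kernelScal_apply (c : ℝˣ) (q : Vec κ) (f : 𝓢(Vec κ, ℂ)) (p : Vec κ) :
    kernelScal c q f p = (((c : ℝ) ^ Fintype.card κ : ℝ) : ℂ) * f ((c : ℝ) • (p - q)) := by
  simp [kernelScal]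

theorem integral_kernelScal_mul (c : ℝˣ) (hc : 0 < (c : ℝ)) (q : Vec κ) (f : 𝓢(Vec κ, ℂ))
    (g : Vec κ → ℂ) :
    ∫ p, g p * kernelScal c q f p = ∫ p, g (q + ((c⁻¹ : ℝˣ) : ℝ) • p) * f p := by
  have h1 : ∀ p, g p * kernelScal c q f p = (((c : ℝ) ^ Fintype.card κ : ℝ) : ℂ) *
      (fun p => g (q + ((c⁻¹ : ℝˣ) : ℝ) • p) * f p) ((c : ℝ) • (p - q)) := by
    intro p
    rw [kernelScal_apply]
    simp only [smul_smul, Units.inv_mul, one_smul, add_sub_cancel]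
    ring
  simp only [h1]
  rw [integral_const_mul,
    integral_sub_right_eq_self (fun p => g (q + ((c⁻¹ : ℝˣ) : ℝ) • ((c : ℝ) • p)) *
      f ((c : ℝ) • p)) q,
    Measure.integral_comp_smul volume (fun p => g (q + ((c⁻¹ : ℝˣ) : ℝ) • p) * f p) (c : ℝ)]
  have h0 : (0 : ℝ) < (c : ℝ) ^ Fintype.card κ := by positivity
  simp only [finrank_euclideanSpace, abs_of_pos (inv_pos.2 h0), Complex.real_smul]
  rw [← mul_assoc, ← Complex.ofReal_mul, mul_inv_cancel₀ h0.ne', Complex.ofReal_one, one_mul]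

/-- Translation becomes modulation and concentration becomes dilation. A modulated dilate of a
function is therefore the transform of a bump of width c⁻¹ around q, which is how dyadic terms probe
a distribution in momentum space. -/
theorem fourierTest_kernelScal (σ : κ → ℤˣ) (c : ℝˣ) (hc : 0 < (c : ℝ)) (q : Vec κ)
    (f : 𝓢(Vec κ, ℂ)) :
    fourierTest σ (kernelScal c q f) = charMul (pair σ q) (scal c⁻¹ (fourierTest σ f)) := by
  ext y
  rw [charMul_apply, scal_apply, fourierTest_eq, fourierTest_eq]
  have h := integral_kernelScal_mul c hc q f (fun p => chr (pair σ p) y)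
  simp only [mul_comm (kernelScal c q f _)]
  rw [h, ← integral_const_mul]
  refine integral_congr_ae (Eventually.of_forall fun p => ?_)
  simp only [map_add, chr_add, map_smul]
  have : chr (((c⁻¹ : ℝˣ) : ℝ) • pair σ p) y = chr (pair σ p) (((c⁻¹ : ℝˣ) : ℝ) • y) := by
    simp [chr]
  rw [this]; ring

end Pairing

/-! ### Multi-index derivatives -/

section MultiIndex

theorem multiIndex_induction {ι : Type*} [Fintype ι] [DecidableEq ι] {p : (ι → ℕ) → Prop}
    (h0 : p 0) (h1 : ∀ α i, p α → p (α + Pi.single i 1)) (α : ι → ℕ) : p α := by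
  induction hn : ∑ i, α i generalizing α with
  | zero =>
    have : α = 0 := by
      ext i
      exact Finset.sum_eq_zero_iff.1 hn i (Finset.mem_univ i)
    rwa [this]
  | succ n ih =>
    obtain ⟨i, -, hi⟩ : ∃ i ∈ Finset.univ, α i ≠ 0 := by
      by_contra! h
      rw [Finset.sum_eq_zero h] at hn
      omega
    have hα : α = (α - Pi.single i 1) + Pi.single i 1 := by
      ext j
      by_cases hj : j = i
      · subst hj; simp; omega
      · simp [hj]
    rw [hα]
    refine h1 _ _ (ih _ ?_)
    have h2 : ∑ j, α j = ∑ j, (α - Pi.single i 1 : ι → ℕ) j + 1 := by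
      conv_lhs => rw [hα]
      simp only [Pi.add_apply, Finset.sum_add_distrib, Finset.sum_pi_single', Finset.mem_univ,
        if_true]
    omega

variable {ι M : Type*} [Fintype ι] [Monoid M]

theorem pairwise_commute_pow (D : ι → M) (hD : ∀ i j, Commute (D i) (D j)) (α : ι → ℕ)
    (s : Finset ι) : (s : Set ι).Pairwise (Function.onFun Commute fun i => D i ^ α i) :=
  fun i _ j _ _ => (hD i j).pow_pow _ _

/-- The monomial `∏ i, D i ^ α i` of commuting elements. -/
def commPow (D : ι → M) (hD : ∀ i j, Commute (D i) (D j)) (α : ι → ℕ) : M :=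
  Finset.univ.noncommProd (fun i => D i ^ α i) (pairwise_commute_pow D hD α Finset.univ)

theorem commPow_add (D : ι → M) (hD : ∀ i j, Commute (D i) (D j)) (α β : ι → ℕ) :
    commPow D hD (α + β) = commPow D hD α * commPow D hD β := by
  refine Eq.trans ?_ (Finset.noncommProd_mul_distrib (fun i => D i ^ α i) (fun i => D i ^ β i)
    (pairwise_commute_pow D hD α Finset.univ) (pairwise_commute_pow D hD β Finset.univ)
    fun i _ j _ _ => (hD _ _).pow_pow _ _)
  exact Finset.noncommProd_congr rfl (fun i _ => by simp [pow_add]) _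

theorem commPow_zero (D : ι → M) (hD : ∀ i j, Commute (D i) (D j)) :
    commPow D hD 0 = 1 := by
  refine (Finset.noncommProd_eq_pow_card _ _ (pairwise_commute_pow D hD 0 Finset.univ) 1
    (by simp)).trans (one_pow _)

theorem commPow_single [DecidableEq ι] (D : ι → M) (hD : ∀ i j, Commute (D i) (D j)) (i : ι) :
    commPow D hD (Pi.single i 1) = D i := by
  have h : (Finset.univ : Finset ι) = insert i (Finset.univ.erase i) := by simp
  have h1 := Finset.noncommProd_congr (f := fun j => D j ^ (Pi.single i 1 : ι → ℕ) j) h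
    (fun _ _ => rfl) (pairwise_commute_pow D hD (Pi.single i 1) _)
  refine h1.trans ?_
  refine (Finset.noncommProd_insert_of_notMem _ _ _ _ (by simp)).trans ?_
  rw [Finset.noncommProd_eq_pow_card _ _ _ 1 (by
      intro j hj
      rw [Pi.single_eq_of_ne (Finset.ne_of_mem_erase hj), pow_zero])]
  simp

end MultiIndex

/-! ### Derivatives in q, antiderivatives, and representations near the origin. -/

section Partial

variable {ι κ : Type*} [Fintype ι] [Fintype κ]

theorem multiPartial_eq (α : ι → ℕ) :
    multiPartial (κ := κ) α = commPow (fun i => partialCLM i) partialCLM_commute α := rfl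

@[simp] theorem multiPartial_zero (φ : 𝓢(Vec (ι ⊕ κ), ℂ)) : multiPartial (0 : ι → ℕ) φ = φ := by
  rw [multiPartial_eq, commPow_zero]; rfl

theorem multiPartial_add (α β : ι → ℕ) (φ : 𝓢(Vec (ι ⊕ κ), ℂ)) :
    multiPartial (α + β) φ = multiPartial α (multiPartial β φ) := by
  rw [multiPartial_eq, commPow_add]; rfl

theorem multiPartial_single [DecidableEq ι] (i : ι) (φ : 𝓢(Vec (ι ⊕ κ), ℂ)) :
    multiPartial (Pi.single i 1) φ = partialCLM i φ := by
  rw [multiPartial_eq, commPow_single]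

theorem tsupport_multiPartial_subset (α : ι → ℕ) (φ : 𝓢(Vec (ι ⊕ κ), ℂ)) :
    tsupport (multiPartial α φ) ⊆ tsupport φ := by
  classical
  induction α using multiIndex_induction generalizing φ with
  | h0 => simp
  | h1 α i ih =>
    rw [multiPartial_add, multiPartial_single]
    exact (ih _).trans (SchwartzMap.tsupport_lineDerivOp_subset _ _)

theorem hasCompactSupport_multiPartial (α : ι → ℕ) {φ : 𝓢(Vec (ι ⊕ κ), ℂ)}
    (h : HasCompactSupport φ) : HasCompactSupport (multiPartial α φ) :=
  h.of_isClosed_subset (isClosed_tsupport _) (tsupport_multiPartial_subset α φ)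

theorem integrable_mul_of_hasCompactSupport {V : Type*} [NormedAddCommGroup V] [NormedSpace ℝ V]
    [MeasurableSpace V] [OpensMeasurableSpace V] {μ : Measure V} [IsFiniteMeasureOnCompacts μ]
    {τ : V → ℂ} (hτ : Continuous τ) {φ : 𝓢(V, ℂ)} (hφ : HasCompactSupport φ) :
    Integrable (fun z => τ z * φ z) μ :=
  (hτ.mul φ.continuous).integrable_of_hasCompactSupport hφ.mul_left

theorem integral_mul_lineDeriv_eq_neg {H H' : Vec (ι ⊕ κ) → ℂ} (hH : Continuous H)
    (hH' : Continuous H') (v : Vec (ι ⊕ κ)) {φ : 𝓢(Vec (ι ⊕ κ), ℂ)} (hφ : HasCompactSupport φ)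
    (hd : ∀ z ∈ tsupport φ, HasLineDerivAt ℝ H (H' z) z v) :
    ∫ z, H z * (∂_{v} φ : 𝓢(Vec (ι ⊕ κ), ℂ)) z = -∫ z, H' z * φ z := by
  have hφ' : HasCompactSupport (∂_{v} φ : 𝓢(Vec (ι ⊕ κ), ℂ)) :=
    hφ.of_isClosed_subset (isClosed_tsupport _) (SchwartzMap.tsupport_lineDerivOp_subset v φ)
  refine integral_bilinear_hasLineDerivAt_right_eq_neg_left_of_integrable
    (B := ContinuousLinearMap.mul ℝ ℂ) (v := v)
    (integrable_mul_of_hasCompactSupport hH' hφ) (integrable_mul_of_hasCompactSupport hH hφ')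
    (integrable_mul_of_hasCompactSupport hH hφ) hd fun z _ => ?_
  rw [SchwartzMap.lineDerivOp_apply]
  exact (φ.differentiableAt.lineDifferentiableAt).hasLineDerivAt

/-- The antiderivative in the direction of the `i`-th coordinate that vanishes for `z i = 0`. -/
def antiDeriv (i : κ) (H : Vec κ → ℂ) (z : Vec κ) : ℂ :=
  ∫ x in (0 : ℝ)..(z i), H (z + (x - z i) • unitVec i)

theorem continuous_antiDeriv (i : κ) {H : Vec κ → ℂ} (hH : Continuous H) :
    Continuous (antiDeriv i H) := by
  unfold antiDeriv
  refine intervalIntegral.continuous_parametric_intervalIntegral_of_continuous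
    (f := fun (z : Vec κ) (x : ℝ) => H (z + (x - z i) • unitVec i)) (μ := volume) ?_ (by fun_prop)
  simp only [Function.uncurry_def]
  exact hH.comp (by fun_prop)

theorem unitVec_same (i : κ) : (unitVec i : Vec κ) i = 1 := by
  simp [unitVec]

theorem unitVec_of_ne {i j : κ} (h : j ≠ i) : (unitVec i : Vec κ) j = 0 := by
  simp [unitVec, h]

theorem hasLineDerivAt_antiDeriv (i : κ) {H : Vec κ → ℂ} (hH : Continuous H) (z : Vec κ) :
    HasLineDerivAt ℝ (antiDeriv i H) (H z) z (unitVec i) := by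
  -- A shift of z along the i-th axis only moves the upper limit: the line of integration and its
  -- starting point on the hyperplane z i = 0 stay the same.
  have h1 : ∀ t : ℝ, antiDeriv i H (z + t • unitVec i) =
      ∫ x in (0 : ℝ)..(z i + t), H (z + (x - z i) • unitVec i) := by
    intro t
    unfold antiDeriv
    have h2 : (z + t • (unitVec i : Vec κ)) i = z i + t := by simp [unitVec_same]
    rw [h2]
    refine intervalIntegral.integral_congr fun x _ => ?_
    simp only
    congr 1
    module
  have hc : Continuous fun x : ℝ => H (z + (x - z i) • unitVec i) := hH.comp (by fun_prop)
  have h3 := (hc.integral_hasStrictDerivAt 0 (z i)).hasDerivAt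
  simp only [sub_self, zero_smul, add_zero] at h3
  have h4 : HasDerivAt (fun t : ℝ => z i + t) 1 0 := (hasDerivAt_id 0).const_add _
  have h5 := HasDerivAt.scomp (0 : ℝ) (h := fun t : ℝ => z i + t)
    (g₁ := fun y => ∫ x in (0 : ℝ)..y, H (z + (x - z i) • unitVec i)) (by simpa using h3) h4
  rw [one_smul] at h5
  rw [HasLineDerivAt]
  simp only [h1]
  exact h5

/-- Decreasing one coordinate in absolute value decreases both norms, so the path of integration in
`antiDeriv` stays in the ball and does not increase |q|. -/
theorem norm_fstPart_add_smul_le (i : ι) (z : Vec (ι ⊕ κ)) {x : ℝ}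
    (hx : |x| ≤ |z (Sum.inl i)|) :
    ‖fstPart (z + (x - z (Sum.inl i)) • (unitVec (Sum.inl i) : Vec (ι ⊕ κ)))‖ ≤ ‖fstPart z‖ ∧
    ‖z + (x - z (Sum.inl i)) • (unitVec (Sum.inl i) : Vec (ι ⊕ κ))‖ ≤ ‖z‖ := by
  set w := z + (x - z (Sum.inl i)) • (unitVec (Sum.inl i) : Vec (ι ⊕ κ))
  have h : ∀ k, ‖w k‖ ≤ ‖z k‖ := by
    intro k
    by_cases hk : k = Sum.inl i
    · subst hk
      simpa [w, unitVec_same] using hx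
    · simp [w, unitVec_of_ne hk]
  constructor
  · rw [EuclideanSpace.norm_eq, EuclideanSpace.norm_eq]
    exact Real.sqrt_le_sqrt (Finset.sum_le_sum fun k _ =>
      pow_le_pow_left₀ (norm_nonneg _) (h (Sum.inl k)) 2)
  · rw [EuclideanSpace.norm_eq, EuclideanSpace.norm_eq]
    exact Real.sqrt_le_sqrt (Finset.sum_le_sum fun k _ =>
      pow_le_pow_left₀ (norm_nonneg _) (h k) 2)

theorem abs_coord_le_norm_fstPart (i : ι) (z : Vec (ι ⊕ κ)) : |z (Sum.inl i)| ≤ ‖fstPart z‖ := by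
  have := PiLp.norm_apply_le (fstPart z) i
  simpa using this

theorem norm_fstPart_le (z : Vec (ι ⊕ κ)) : ‖fstPart z‖ ≤ ‖z‖ := by
  rw [EuclideanSpace.norm_eq, EuclideanSpace.norm_eq]
  refine Real.sqrt_le_sqrt ?_
  rw [Fintype.sum_sum_type]
  exact le_add_of_nonneg_right (Finset.sum_nonneg fun _ _ => by positivity)

theorem norm_sndPart_le (z : Vec (ι ⊕ κ)) : ‖sndPart z‖ ≤ ‖z‖ := by
  rw [EuclideanSpace.norm_eq, EuclideanSpace.norm_eq]
  refine Real.sqrt_le_sqrt ?_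
  rw [Fintype.sum_sum_type]
  exact le_add_of_nonneg_left (Finset.sum_nonneg fun _ _ => by positivity)

/-- The path has length |z_i| ≤ |q| and |q| does not grow along it, so one integration gains one
power of |q|. -/
theorem norm_antiDeriv_le (i : ι) {H : Vec (ι ⊕ κ) → ℂ} {ρ c b : ℝ} (hc : 0 ≤ c) (hb : 0 ≤ b)
    (hH : ∀ z, ‖z‖ < ρ → ‖H z‖ ≤ c * ‖fstPart z‖ ^ b) (z : Vec (ι ⊕ κ)) (hz : ‖z‖ < ρ) :
    ‖antiDeriv (Sum.inl i) H z‖ ≤ c * ‖fstPart z‖ ^ (b + 1) := by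
  have h1 : ‖antiDeriv (Sum.inl i) H z‖ ≤ c * ‖fstPart z‖ ^ b * |z (Sum.inl i) - 0| := by
    refine intervalIntegral.norm_integral_le_of_norm_le_const fun x hx => ?_
    have hx' : |x| ≤ |z (Sum.inl i)| := by
      rcases Set.mem_uIoc.1 hx with h | h
      · rw [abs_of_pos h.1]; exact h.2.trans (le_abs_self _)
      · rw [abs_of_nonpos h.2, abs_of_neg (h.1.trans_le h.2)]; linarith [h.1]
    obtain ⟨h2, h3⟩ := norm_fstPart_add_smul_le i z hx'
    refine (hH _ (h3.trans_lt hz)).trans ?_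
    gcongr
  refine h1.trans ?_
  rw [sub_zero, Real.rpow_add_of_nonneg (norm_nonneg _) hb zero_le_one, Real.rpow_one, ← mul_assoc]
  gcongr
  exact abs_coord_le_norm_fstPart i z

theorem exists_antiDeriv_iterate [DecidableEq ι] (i : ι) {H : Vec (ι ⊕ κ) → ℂ} (hH : Continuous H)
    {ρ c b : ℝ} (hc : 0 ≤ c) (hb : 0 ≤ b) (hHb : ∀ z, ‖z‖ < ρ → ‖H z‖ ≤ c * ‖fstPart z‖ ^ b)
    (L : ℕ) :
    ∃ G : Vec (ι ⊕ κ) → ℂ, Continuous G ∧ (∀ z, ‖z‖ < ρ → ‖G z‖ ≤ c * ‖fstPart z‖ ^ (b + L)) ∧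
      ∀ φ : 𝓢(Vec (ι ⊕ κ), ℂ), HasCompactSupport φ →
        ∫ z, H z * φ z = (-1 : ℂ) ^ L * ∫ z, G z * multiPartial (Pi.single i L) φ z := by
  induction L with
  | zero => exact ⟨H, hH, by simpa using hHb, fun φ _ => by simp⟩
  | succ L ih =>
    obtain ⟨G, hG, hGb, hGi⟩ := ih
    refine ⟨antiDeriv (Sum.inl i) G, continuous_antiDeriv _ hG, ?_, fun φ hφ => ?_⟩
    · intro z hz
      have := norm_antiDeriv_le i hc (by positivity) hGb z hz
      simpa [add_assoc] using this
    · have hs : (Pi.single i (L + 1) : ι → ℕ) = Pi.single i 1 + Pi.single i L := by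
        rw [← Pi.single_add, add_comm]
      rw [hGi φ hφ, hs, multiPartial_add, multiPartial_single]
      have := integral_mul_lineDeriv_eq_neg (continuous_antiDeriv (Sum.inl i) hG) hG
        (unitVec (Sum.inl i)) (hasCompactSupport_multiPartial (Pi.single i L) hφ)
        fun z _ => hasLineDerivAt_antiDeriv _ hG z
      change _ = (-1 : ℂ) ^ (L + 1) * ∫ z, antiDeriv (Sum.inl i) G z *
        (∂_{(unitVec (Sum.inl i) : Vec (ι ⊕ κ))} (multiPartial (Pi.single i L) φ) :
          𝓢(Vec (ι ⊕ κ), ℂ)) z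
      rw [this]; ring

/-- Representations `t = ∑_j ∂^{β_j} τ_j` near the origin, `τ_j = O(|q|^{δ + |β_j|})`. -/
def HasRep (t : 𝓢(Vec (ι ⊕ κ), ℂ) → ℂ) (δ ρ : ℝ) : Prop :=
  ∃ (J : Type) (_ : Fintype J) (β : J → ι → ℕ) (τ : J → Vec (ι ⊕ κ) → ℂ),
    (∀ j, Continuous (τ j)) ∧ (∀ j, 0 ≤ δ + ((∑ i, β j i : ℕ) : ℝ)) ∧
    (∃ c : ℝ, 0 ≤ c ∧ ∀ j z, ‖z‖ < ρ →
      ‖τ j z‖ ≤ c * ‖fstPart z‖ ^ (δ + ((∑ i, β j i : ℕ) : ℝ))) ∧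
    ∀ φ : 𝓢(Vec (ι ⊕ κ), ℂ), HasCompactSupport φ → tsupport φ ⊆ Metric.ball 0 ρ →
      t φ = ∑ j, (-1 : ℂ) ^ (∑ i, β j i) * ∫ z, τ j z * multiPartial (β j) φ z

theorem HasRep.congr {t t' : 𝓢(Vec (ι ⊕ κ), ℂ) → ℂ} {δ ρ : ℝ} (h : HasRep t δ ρ)
    (htt' : ∀ φ : 𝓢(Vec (ι ⊕ κ), ℂ), HasCompactSupport φ → tsupport φ ⊆ Metric.ball 0 ρ →
      t' φ = t φ) : HasRep t' δ ρ := by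
  obtain ⟨J, hJ, β, τ, h1, h2, h3, h4⟩ := h
  exact ⟨J, hJ, β, τ, h1, h2, h3, fun φ hφ hs => (htt' φ hφ hs).trans (h4 φ hφ hs)⟩

theorem HasRep.mono_radius {t : 𝓢(Vec (ι ⊕ κ), ℂ) → ℂ} {δ ρ ρ' : ℝ} (h : HasRep t δ ρ)
    (hρ : ρ' ≤ ρ) : HasRep t δ ρ' := by
  obtain ⟨J, hJ, β, τ, h1, h2, ⟨c, hc, h3⟩, h4⟩ := h
  exact ⟨J, hJ, β, τ, h1, h2, ⟨c, hc, fun j z hz => h3 j z (hz.trans_le hρ)⟩,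
    fun φ hφ hs => h4 φ hφ (hs.trans (Metric.ball_subset_ball hρ))⟩

theorem HasRep.add {t t' : 𝓢(Vec (ι ⊕ κ), ℂ) → ℂ} {δ ρ : ℝ} (h : HasRep t δ ρ)
    (h' : HasRep t' δ ρ) : HasRep (fun φ => t φ + t' φ) δ ρ := by
  obtain ⟨J, hJ, β, τ, h1, h2, ⟨c, hc, h3⟩, h4⟩ := h
  obtain ⟨J', hJ', β', τ', h1', h2', ⟨c', hc', h3'⟩, h4'⟩ := h'
  refine ⟨J ⊕ J', inferInstance, Sum.elim β β', Sum.elim τ τ', ?_, ?_, ⟨max c c', by positivity, ?_⟩,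
    fun φ hφ hs => ?_⟩
  · rintro (j | j)
    exacts [h1 j, h1' j]
  · rintro (j | j)
    exacts [h2 j, h2' j]
  · rintro (j | j) z hz
    · exact (h3 j z hz).trans (by simp only [Sum.elim_inl]; gcongr; exact le_max_left _ _)
    · exact (h3' j z hz).trans (by simp only [Sum.elim_inr]; gcongr; exact le_max_right _ _)
  · change t φ + t' φ = _
    rw [h4 φ hφ hs, h4' φ hφ hs, Fintype.sum_sum_type]
    rfl

theorem HasRep.const_mul {t : 𝓢(Vec (ι ⊕ κ), ℂ) → ℂ} {δ ρ : ℝ} (h : HasRep t δ ρ) (a : ℂ) :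
    HasRep (fun φ => a * t φ) δ ρ := by
  obtain ⟨J, hJ, β, τ, h1, h2, ⟨c, hc, h3⟩, h4⟩ := h
  refine ⟨J, hJ, β, fun j z => a * τ j z, fun j => (h1 j).const_mul a, h2,
    ⟨‖a‖ * c, by positivity, fun j z hz => ?_⟩, fun φ hφ hs => ?_⟩
  · rw [norm_mul, mul_assoc]
    exact mul_le_mul_of_nonneg_left (h3 j z hz) (norm_nonneg _)
  · simp only [h4 φ hφ hs, Finset.mul_sum, mul_assoc, integral_const_mul]
    exact Finset.sum_congr rfl fun j _ => by ring

theorem HasRep.sum {S : Type*} {t : S → 𝓢(Vec (ι ⊕ κ), ℂ) → ℂ} {δ ρ : ℝ} (s : Finset S)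
    (h : ∀ j ∈ s, HasRep (t j) δ ρ) : HasRep (fun φ => ∑ j ∈ s, t j φ) δ ρ := by
  classical
  induction s using Finset.induction_on with
  | empty => exact ⟨Empty, inferInstance, Empty.elim, Empty.elim, fun j => j.elim,
      fun j => j.elim, ⟨0, le_rfl, fun j => j.elim⟩, fun φ _ _ => by simp⟩
  | insert a s ha ih =>
    refine ((h a (Finset.mem_insert_self _ _)).add
      (ih fun j hj => h j (Finset.mem_insert_of_mem hj))).congr fun φ _ _ => ?_
    rw [Finset.sum_insert ha]

/-- A single term `∂^β τ`. -/
theorem hasRep_single {δ ρ c : ℝ} (hc : 0 ≤ c) (β : ι → ℕ) {τ : Vec (ι ⊕ κ) → ℂ}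
    (hτ : Continuous τ) (hβ : 0 ≤ δ + ((∑ i, β i : ℕ) : ℝ))
    (hb : ∀ z, ‖z‖ < ρ → ‖τ z‖ ≤ c * ‖fstPart z‖ ^ (δ + ((∑ i, β i : ℕ) : ℝ))) :
    HasRep (fun φ => (-1 : ℂ) ^ (∑ i, β i) * ∫ z, τ z * multiPartial β φ z) δ ρ :=
  ⟨Unit, inferInstance, fun _ => β, fun _ => τ, fun _ => hτ, fun _ => hβ,
    ⟨c, hc, fun _ => hb⟩, fun φ _ _ => by simp⟩

theorem rpow_le_rpow_of_le_one {x a b : ℝ} (hx : 0 ≤ x) (hx1 : x ≤ 1) (ha : 0 ≤ a)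
    (hab : a ≤ b) : x ^ b ≤ x ^ a := by
  rcases hx.eq_or_lt with h0 | h0
  · rw [← h0]
    rcases ha.eq_or_lt with h7 | h7
    · rw [← h7, Real.rpow_zero]
      exact Real.zero_rpow_le_one _
    · rw [Real.zero_rpow h7.ne', Real.zero_rpow (by linarith)]
  · exact Real.rpow_le_rpow_of_exponent_ge h0 hx1 hab

theorem sum_add_single [DecidableEq ι] (α : ι → ℕ) (i : ι) (L : ℕ) :
    ∑ k, (α + Pi.single i L : ι → ℕ) k = ∑ k, α k + L := by
  simp only [Pi.add_apply, Finset.sum_add_distrib, Finset.sum_pi_single', Finset.mem_univ, if_true]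

/-- L-fold integration in the i-th direction raises the order of the derivative and the order of
vanishing by L alike; the difference of the two, which is what δ measures, is unchanged. -/
theorem exists_raise_index [DecidableEq ι] (i : ι) {δ δ' ρ c : ℝ} (hc : 0 ≤ c) (β : ι → ℕ)
    {τ : Vec (ι ⊕ κ) → ℂ} (hτ : Continuous τ) (hβ : 0 ≤ δ + ((∑ i, β i : ℕ) : ℝ))
    (hb : ∀ z, ‖z‖ < ρ → ‖τ z‖ ≤ c * ‖fstPart z‖ ^ (δ + ((∑ i, β i : ℕ) : ℝ)))
    (hδ : δ' ≤ δ) (hρ : ρ ≤ 1) :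
    ∃ (γ : ι → ℕ) (G : Vec (ι ⊕ κ) → ℂ), Continuous G ∧ 0 ≤ δ' + ((∑ i, γ i : ℕ) : ℝ) ∧
      (∀ z, ‖z‖ < ρ → ‖G z‖ ≤ c * ‖fstPart z‖ ^ (δ' + ((∑ i, γ i : ℕ) : ℝ))) ∧
      ∀ φ : 𝓢(Vec (ι ⊕ κ), ℂ), HasCompactSupport φ →
        (-1 : ℂ) ^ (∑ i, β i) * ∫ z, τ z * multiPartial β φ z =
          (-1 : ℂ) ^ (∑ i, γ i) * ∫ z, G z * multiPartial γ φ z := by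
  -- With L ≥ -δ' the new multi-index satisfies δ' + |γ| ≥ 0 whatever β is.
  obtain ⟨L, hL⟩ := exists_nat_ge (-δ')
  obtain ⟨G, hG, hGb, hGi⟩ := exists_antiDeriv_iterate i hτ hc hβ hb L
  obtain ⟨γ, hγ⟩ : ∃ γ : ι → ℕ, γ = β + Pi.single i L := ⟨_, rfl⟩
  have hs : ∑ k, γ k = ∑ k, β k + L := by rw [hγ]; exact sum_add_single β i L
  have hnn : 0 ≤ δ' + ((∑ k, γ k : ℕ) : ℝ) := by
    rw [hs, Nat.cast_add]
    have : (0 : ℝ) ≤ ((∑ k, β k : ℕ) : ℝ) := Nat.cast_nonneg _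
    linarith
  refine ⟨γ, G, hG, hnn, fun z hz => ?_, fun φ hφ => ?_⟩
  · refine (hGb z hz).trans (mul_le_mul_of_nonneg_left ?_ hc)
    refine rpow_le_rpow_of_le_one (norm_nonneg _) ((norm_fstPart_le z).trans (hz.le.trans hρ)) hnn ?_
    rw [hs, Nat.cast_add]
    linarith
  · rw [hGi _ (hasCompactSupport_multiPartial β hφ), hs, hγ, add_comm β,
      multiPartial_add, ← mul_assoc, ← pow_add]

theorem hasRep_single_mono [Nonempty ι] {δ δ' ρ c : ℝ} (hc : 0 ≤ c) (β : ι → ℕ)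
    {τ : Vec (ι ⊕ κ) → ℂ}
    (hτ : Continuous τ) (hβ : 0 ≤ δ + ((∑ i, β i : ℕ) : ℝ))
    (hb : ∀ z, ‖z‖ < ρ → ‖τ z‖ ≤ c * ‖fstPart z‖ ^ (δ + ((∑ i, β i : ℕ) : ℝ)))
    (hδ : δ' ≤ δ) (hρ : ρ ≤ 1) :
    HasRep (fun φ => (-1 : ℂ) ^ (∑ i, β i) * ∫ z, τ z * multiPartial β φ z) δ' ρ := by
  classical
  obtain ⟨γ, G, hG, hnn, hGb, hGi⟩ :=
    exists_raise_index (Classical.arbitrary ι) hc β hτ hβ hb hδ hρ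
  exact (hasRep_single hc γ hG hnn hGb).congr fun φ hφ _ => hGi φ hφ

/-- Weakening the exponent is not immediate, because a term with δ' + |β| < 0 is not admitted. Such
terms are rewritten as higher derivatives, which requires at least one variable q. -/
theorem HasRep.mono [Nonempty ι] {t : 𝓢(Vec (ι ⊕ κ), ℂ) → ℂ} {δ δ' ρ : ℝ} (h : HasRep t δ ρ)
    (hδ : δ' ≤ δ) (hρ : ρ ≤ 1) : HasRep t δ' ρ := by
  obtain ⟨J, hJ, β, τ, h1, h2, ⟨c, hc, h3⟩, h4⟩ := h
  exact (HasRep.sum Finset.univ fun j _ =>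
    hasRep_single_mono hc (β j) (h1 j) (h2 j) (h3 j) hδ hρ).congr h4

/-- A continuous function is bounded on the ball, that is O(|q|^0); then the exponent is lowered. -/
theorem hasRep_continuous [Nonempty ι] {F : Vec (ι ⊕ κ) → ℂ} (hF : Continuous F) {δ ρ : ℝ}
    (hδ : δ ≤ 0) (hρ : ρ ≤ 1) : HasRep (fun φ => ∫ z, F z * φ z) δ ρ := by
  obtain ⟨c, hc⟩ := (isCompact_closedBall (0 : Vec (ι ⊕ κ)) ρ).exists_bound_of_continuousOn
    hF.continuousOn
  refine HasRep.mono (δ := 0) ?_ hδ hρ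
  have := hasRep_single (δ := 0) (ρ := ρ) (c := max c 0) (le_max_right _ _) (0 : ι → ℕ) hF (by simp)
    (fun z hz => by
      simpa using (hc z (by simpa using hz.le)).trans (le_max_left c 0))
  refine this.congr fun φ _ _ => by simp

theorem hasRep_of_norm_le [Nonempty ι] {F : Vec (ι ⊕ κ) → ℂ} (hF : Continuous F) {δ ρ c : ℝ}
    (hδ : 0 ≤ δ) (hc : 0 ≤ c) (hFb : ∀ z, ‖z‖ < ρ → ‖F z‖ ≤ c * ‖fstPart z‖ ^ δ) :
    HasRep (fun φ => ∫ z, F z * φ z) δ ρ := by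
  have := hasRep_single (δ := δ) (ρ := ρ) hc (0 : ι → ℕ) hF (by simpa using hδ)
    (by simpa using hFb)
  refine this.congr fun φ _ _ => by simp

/-- `IsODist` allows one function per multi-index, so the terms with equal β are collected along the
fibres of β. -/
theorem HasRep.isODist [Nonempty ι] {t : 𝓢'(Vec (ι ⊕ κ), ℂ)} {δ ρ : ℝ}
    (hρ : 0 < ρ) (h : HasRep t δ ρ) : IsODist t δ := by
  classical
  obtain ⟨J, hJ, β, τ, h1, h2, ⟨c, hc, h3⟩, h4⟩ := h
  refine ⟨fun _ => ⟨Metric.ball 0 ρ, Finset.univ.image β,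
    fun α z => ∑ j with β j = α, τ j z, Metric.isOpen_ball, Metric.mem_ball_self hρ, ?_, ?_, ?_, ?_,
      ?_⟩, fun h => (not_isEmpty_of_nonempty ι h).elim⟩
  · exact fun α => (continuous_finsetSum _ fun j _ => h1 j).continuousOn
  · intro α hα z _
    refine Finset.sum_eq_zero fun j hj => ?_
    exact (hα (Finset.mem_image.2 ⟨j, Finset.mem_univ _, (Finset.mem_filter.1 hj).2⟩)).elim
  · intro α hα z _
    refine Finset.sum_eq_zero fun j hj => ?_
    have := h2 j
    rw [(Finset.mem_filter.1 hj).2] at this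
    linarith
  · intro α
    refine ⟨(Finset.univ.filter fun j => β j = α).card * c, fun z hz => ?_⟩
    refine (norm_sum_le _ _).trans ?_
    rw [mul_assoc, ← nsmul_eq_mul]
    refine Finset.sum_le_card_nsmul _ _ _ fun j hj => ?_
    have := h3 j z (by simpa using hz)
    rwa [(Finset.mem_filter.1 hj).2] at this
  · intro φ hφ hs
    rw [h4 φ hφ hs, ← Finset.sum_fiberwise_of_maps_to (g := β) (t := Finset.univ.image β)
      (fun j _ => Finset.mem_image_of_mem _ (Finset.mem_univ j))]
    refine Finset.sum_congr rfl fun α _ => ?_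
    have hi : ∀ j, Integrable (fun z => τ j z * multiPartial α φ z) := fun j =>
      integrable_mul_of_hasCompactSupport (h1 j) (hasCompactSupport_multiPartial α hφ)
    simp only [Finset.sum_mul]
    rw [integral_finsetSum _ fun j _ => hi j, Finset.mul_sum]
    refine Finset.sum_congr rfl fun j hj => ?_
    rw [(Finset.mem_filter.1 hj).2]

/-- A smooth cutoff function, `1` on the ball of radius `ρ / 2` and supported in that of radius
`ρ`. -/
theorem exists_cutoff {V : Type*} [NormedAddCommGroup V] [InnerProductSpace ℝ V]
    [FiniteDimensional ℝ V] {ρ : ℝ} (hρ : 0 < ρ) :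
    ∃ χ : V → ℝ, ContDiff ℝ ∞ χ ∧ HasCompactSupport χ ∧ tsupport χ ⊆ Metric.ball 0 ρ ∧
      (∀ z, ‖z‖ ≤ ρ / 2 → χ z = 1) ∧ (∀ z, 0 ≤ χ z) ∧ ∀ z, χ z ≤ 1 := by
  let f : ContDiffBump (0 : V) := ⟨ρ / 2, 3 * ρ / 4, by positivity, by linarith⟩
  refine ⟨f, f.contDiff, f.hasCompactSupport, ?_, fun z hz => ?_, fun z => f.nonneg, fun z => f.le_one⟩
  · rw [f.tsupport_eq]
    exact Metric.closedBall_subset_ball (by change 3 * ρ / 4 < ρ; linarith)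
  · exact f.one_of_mem_closedBall (by simpa using hz)

/-- A cutoff that is 1 on the half ball makes the functions continuous and compactly supported on
the whole space, with the bound by the power of |q| valid globally, so that they define
distributions slice by slice. Terms of negative order vanish near 0 and are dropped. -/
theorem IsODist.exists_hasRep [Nonempty ι] {t : 𝓢'(Vec (ι ⊕ κ), ℂ)} {δ : ℝ} (h : IsODist t δ) :
    ∃ ρ : ℝ, 0 < ρ ∧ ∃ (J : Type) (_ : Fintype J) (β : J → ι → ℕ) (τ : J → Vec (ι ⊕ κ) → ℂ) (c : ℝ),
      (∀ j, Continuous (τ j)) ∧ (∀ j, HasCompactSupport (τ j)) ∧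
      (∀ j, 0 ≤ δ + ((∑ i, β j i : ℕ) : ℝ)) ∧ 0 ≤ c ∧
      (∀ j z, ‖τ j z‖ ≤ c * ‖fstPart z‖ ^ (δ + ((∑ i, β j i : ℕ) : ℝ))) ∧
      ∀ φ : 𝓢(Vec (ι ⊕ κ), ℂ), HasCompactSupport φ → tsupport φ ⊆ Metric.ball 0 ρ →
        t φ = ∑ j, (-1 : ℂ) ^ (∑ i, β j i) * ∫ z, τ j z * multiPartial (β j) φ z := by
  classical
  obtain ⟨U, A, τ, hU, h0, hc, hA, hneg, hb, ht⟩ := h.1 inferInstance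
  obtain ⟨ρ, hρ, hρU⟩ := Metric.isOpen_iff.1 hU 0 h0
  obtain ⟨χ, hχ, hχc, hχs, hχ1, hχ0, hχle⟩ := exists_cutoff (V := Vec (ι ⊕ κ)) hρ
  choose C hC using hb
  set A' := A.filter fun α => 0 ≤ δ + ((∑ i, α i : ℕ) : ℝ)
  let e := Fintype.equivFin A'
  have hsup : ∀ α, tsupport (fun z => (χ z : ℂ) * τ α z) ⊆ tsupport χ := fun α =>
    closure_mono fun z hz => by
      rw [Function.mem_support] at hz ⊢
      intro h; exact hz (by simp [h])
  refine ⟨ρ / 2, by positivity, Fin (Fintype.card A'), inferInstance, fun j => (e.symm j).1,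
    fun j z => (χ z : ℂ) * τ (e.symm j).1 z, ∑ α ∈ A', |C α|, fun j => ?_, fun j => ?_,
    fun j => (Finset.mem_filter.1 (e.symm j).2).2, Finset.sum_nonneg fun _ _ => abs_nonneg _,
    fun j z => ?_, fun φ hφ hs => ?_⟩
  · refine ContinuousOn.continuous_of_tsupport_subset ?_ hU ((hsup _).trans (hχs.trans hρU))
    exact (Complex.continuous_ofReal.comp hχ.continuous).continuousOn.mul (hc _)
  · exact hχc.of_isClosed_subset (isClosed_tsupport _) (hsup _)
  · set α := (e.symm j).1
    by_cases hz : z ∈ tsupport χ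
    · have h1 := hC α z (hρU (hχs hz))
      have h2 : C α ≤ ∑ α ∈ A', |C α| := (le_abs_self _).trans
        (Finset.single_le_sum (f := fun α => |C α|) (fun _ _ => abs_nonneg _) (e.symm j).2)
      rw [norm_mul, Complex.norm_real, Real.norm_of_nonneg (hχ0 z)]
      calc χ z * ‖τ α z‖ ≤ 1 * ‖τ α z‖ := by gcongr; exact hχle z
        _ ≤ C α * ‖fstPart z‖ ^ (δ + ((∑ i, α i : ℕ) : ℝ)) := by rw [one_mul]; exact h1
        _ ≤ _ := by gcongr
    · have h0 : χ z = 0 := image_eq_zero_of_notMem_tsupport hz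
      simp only [h0, Complex.ofReal_zero, zero_mul, norm_zero]
      exact mul_nonneg (Finset.sum_nonneg fun _ _ => abs_nonneg _) (by positivity)
  · have hball : tsupport φ ⊆ U :=
      hs.trans ((Metric.ball_subset_ball (by linarith)).trans hρU)
    rw [ht φ hφ hball]
    have h1 : ∀ α ∈ A, α ∉ A' →
        (-1 : ℂ) ^ (∑ i, α i) * ∫ z, τ α z * multiPartial α φ z = 0 := by
      intro α hα hα'
      have hn : δ + ((∑ i, α i : ℕ) : ℝ) < 0 := by
        by_contra! h
        exact hα' (Finset.mem_filter.2 ⟨hα, h⟩)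
      rw [integral_eq_zero_of_ae, mul_zero]
      refine Eventually.of_forall fun z => ?_
      by_cases hz : z ∈ tsupport (multiPartial α φ)
      · simp [hneg α hn z (hball (tsupport_multiPartial_subset α φ hz))]
      · simp [image_eq_zero_of_notMem_tsupport hz]
    rw [← Finset.sum_subset (Finset.filter_subset _ A) h1, ← Finset.sum_coe_sort,
      ← Equiv.sum_comp e.symm]
    refine Finset.sum_congr rfl fun j _ => ?_
    congr 1
    refine integral_congr_ae (Eventually.of_forall fun z => ?_)
    simp only
    by_cases hz : z ∈ tsupport (multiPartial (e.symm j).1 φ)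
    · have := hs (tsupport_multiPartial_subset _ φ hz)
      rw [hχ1 z (by simpa using (mem_ball_zero_iff.1 this).le)]
      simp
    · simp [image_eq_zero_of_notMem_tsupport hz]

end Partial

/-! ### Multiplication by functions that vanish near the origin -/

section Cutoff

variable {V : Type*} [NormedAddCommGroup V] [NormedSpace ℝ V]

/-- Smooth functions all of whose derivatives are bounded. -/
structure BddSmooth (h : V → ℂ) : Prop where
  smooth : ContDiff ℝ ∞ h
  bound : ∀ n, ∃ C : ℝ, ∀ x, ‖iteratedFDeriv ℝ n h x‖ ≤ C

theorem BddSmooth.hasTemperateGrowth {h : V → ℂ} (hh : BddSmooth h) : h.HasTemperateGrowth := by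
  refine ⟨hh.smooth, fun n => ?_⟩
  obtain ⟨C, hC⟩ := hh.bound n
  exact ⟨0, C, fun x => by simpa using hC x⟩

theorem BddSmooth.comp_clm {W : Type*} [NormedAddCommGroup W] [NormedSpace ℝ W] {h : V → ℂ}
    (hh : BddSmooth h) (L : W →L[ℝ] V) : BddSmooth fun w => h (L w) := by
  refine ⟨hh.smooth.comp L.contDiff, fun n => ?_⟩
  obtain ⟨C, hC⟩ := hh.bound n
  refine ⟨C * ‖L‖ ^ n, fun x => ?_⟩
  have h1 := L.iteratedFDeriv_comp_right hh.smooth x (i := n) (by exact_mod_cast le_top)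
  have h2 : (fun w => h (L w)) = h ∘ L := rfl
  rw [h2, h1]
  refine (ContinuousMultilinearMap.norm_compContinuousLinearMap_le _ _).trans ?_
  simp only [Finset.prod_const, Finset.card_univ, Fintype.card_fin]
  gcongr
  exact hC _

theorem BddSmooth.of_hasCompactSupport {h : V → ℂ} (hh : ContDiff ℝ ∞ h)
    (hc : HasCompactSupport h) : BddSmooth h := by
  refine ⟨hh, fun n => ?_⟩
  exact (hh.continuous_iteratedFDeriv (by exact_mod_cast le_top)).bounded_above_of_compact_support
    (hc.iteratedFDeriv n)

theorem BddSmooth.const_sub {h : V → ℂ} (hh : BddSmooth h) (c : ℂ) :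
    BddSmooth fun x => c - h x := by
  refine ⟨contDiff_const.sub hh.smooth, fun n => ?_⟩
  obtain ⟨C, hC⟩ := hh.bound n
  refine ⟨‖c‖ + C, fun x => ?_⟩
  have h1 : (fun x => c - h x) = (fun _ : V => c) - h := rfl
  rw [h1, iteratedFDeriv_sub_apply contDiff_const.contDiffAt
    (hh.smooth.of_le (by exact_mod_cast le_top)).contDiffAt]
  refine (norm_sub_le _ _).trans (add_le_add ?_ (hC x))
  rcases Nat.eq_zero_or_pos n with rfl | hn
  · simp
  · rw [iteratedFDeriv_const_of_ne hn.ne']; simp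

/-- Multiplication by functions with uniformly bounded derivatives that vanish on large balls maps a
Schwartz function to small ones. -/
theorem exists_seminorm_cutoff_le (g : 𝓢(V, ℂ)) (C : ℕ → ℝ) (k n L : ℕ) :
    ∃ M : ℝ, 0 ≤ M ∧ ∀ (h : V → ℂ) (r : ℝ) (G : 𝓢(V, ℂ)), ContDiff ℝ ∞ h →
      (∀ i x, ‖iteratedFDeriv ℝ i h x‖ ≤ C i) → 0 < r → (∀ x, ‖x‖ < r → h x = 0) →
      (∀ x, G x = h x * g x) → SchwartzMap.seminorm ℂ k n G ≤ M * (r⁻¹) ^ L := by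
  refine ⟨∑ i ∈ Finset.range (n + 1), (n.choose i : ℝ) * |C i| *
    SchwartzMap.seminorm ℂ (k + L) (n - i) g, by positivity, fun h r G hh hC hr hz hG => ?_⟩
  refine SchwartzMap.seminorm_le_bound ℂ k n _ (by positivity) fun x => ?_
  by_cases hx : ‖x‖ < r
  · have h1 : ⇑G =ᶠ[𝓝 x] fun _ => 0 := by
      filter_upwards [(isOpen_lt continuous_norm continuous_const).mem_nhds hx] with y hy
      rw [hG, hz y hy, zero_mul]
    rw [(h1.iteratedFDeriv ℝ n).eq_of_nhds]
    have : iteratedFDeriv ℝ n (fun _ : V => (0 : ℂ)) x = 0 := by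
      have := iteratedFDeriv_fun_zero (𝕜 := ℝ) (E := V) (F := ℂ) (n := n)
      exact congrFun this x
    rw [this, norm_zero, mul_zero]
    positivity
  · push Not at hx
    have h' : ⇑G = fun y => h y * g y := funext hG
    have h1 := norm_iteratedFDeriv_mul_le hh (g.smooth ⊤) x (n := n) (by exact_mod_cast le_top)
    rw [h']
    refine (mul_le_mul_of_nonneg_left h1 (by positivity)).trans ?_
    rw [Finset.mul_sum, Finset.sum_mul]
    refine Finset.sum_le_sum fun i _ => ?_
    have h2 := SchwartzMap.le_seminorm ℂ (k + L) (n - i) g x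
    -- Outside the ball of radius r the factor 1 may be replaced by (‖x‖/r)^L, at the price of L
    -- further powers of ‖x‖ in the seminorm of g.
    have h3 : 1 ≤ (r⁻¹) ^ L * ‖x‖ ^ L := by
      rw [← mul_pow]
      refine one_le_pow₀ ?_
      rw [inv_mul_eq_div, one_le_div hr]
      exact hx
    calc ‖x‖ ^ k * ((n.choose i : ℝ) * ‖iteratedFDeriv ℝ i h x‖ * ‖iteratedFDeriv ℝ (n - i) g x‖)
        ≤ (‖x‖ ^ k * ((n.choose i : ℝ) * |C i| * ‖iteratedFDeriv ℝ (n - i) g x‖)) *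
          ((r⁻¹) ^ L * ‖x‖ ^ L) := by
          refine le_trans ?_ (le_mul_of_one_le_right (by positivity) h3)
          gcongr
          exact (hC i x).trans (le_abs_self _)
      _ = (n.choose i : ℝ) * |C i| * (‖x‖ ^ (k + L) * ‖iteratedFDeriv ℝ (n - i) g x‖) *
          (r⁻¹) ^ L := by rw [pow_add]; ring
      _ ≤ _ := by gcongr

/-- Every derivative brings out a factor c ≤ 1, so the bounds are uniform over all dyadic scales. -/
theorem norm_iteratedFDeriv_comp_smul_le {h : V → ℂ} (hh : ContDiff ℝ ∞ h) {c : ℝ} (hc0 : 0 ≤ c)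
    (hc : c ≤ 1) (n : ℕ) (a x : V) :
    ‖iteratedFDeriv ℝ n (fun x => h (a + c • x)) x‖ ≤ ‖iteratedFDeriv ℝ n h (a + c • x)‖ := by
  have h1 := congrFun (iteratedFDeriv_comp_const_smul (𝕜 := ℝ) (i := n) (f := fun y => h (a + y)) c
    ((hh.of_le (by exact_mod_cast le_top)).comp (contDiff_const.add contDiff_id))) x
  rw [h1, norm_smul, iteratedFDeriv_comp_add_left]
  have : ‖c ^ n‖ ≤ 1 := by
    rw [norm_pow, Real.norm_of_nonneg hc0]
    exact pow_le_one₀ hc0 hc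
  exact mul_le_of_le_one_left (norm_nonneg _) this

/-- `h(2^{-k} ·) g → 0` in the Schwartz space if `h` vanishes near the origin. -/
theorem tendsto_smulLeft_scaled {h : V → ℂ} (hh : BddSmooth h) {r : ℝ} (hr : 0 < r)
    (hz : ∀ x, ‖x‖ < r → h x = 0) (g : 𝓢(V, ℂ)) (G : ℕ → 𝓢(V, ℂ))
    (hG : ∀ k x, G k x = h ((2⁻¹ : ℝ) ^ k • x) * g x) : Tendsto G atTop (𝓝 0) := by
  choose C hC using hh.bound
  rw [(schwartz_withSeminorms ℂ V ℂ).tendsto_nhds]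
  rintro ⟨k, n⟩ ε hε
  obtain ⟨M, hM, hMb⟩ := exists_seminorm_cutoff_le g C k n 1
  have h1 : ∀ K, SchwartzMap.seminorm ℂ k n (G K) ≤ M * r⁻¹ * (2⁻¹ : ℝ) ^ K := by
    intro K
    have hp : (0 : ℝ) < 2⁻¹ ^ K := by positivity
    refine (hMb (fun x => h ((2⁻¹ : ℝ) ^ K • x)) (r * 2 ^ K) (G K)
      (hh.smooth.comp (contDiff_const_smul _)) (fun i x => ?_) (by positivity) (fun x hx => ?_)
      (hG K)).trans (le_of_eq ?_)
    · have := norm_iteratedFDeriv_comp_smul_le hh.smooth hp.le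
        (pow_le_one₀ (by norm_num) (by norm_num)) i 0 x
      simp only [zero_add] at this
      exact this.trans (hC _ _)
    · refine hz _ ?_
      rw [norm_smul, Real.norm_of_nonneg hp.le, inv_pow, inv_mul_lt_iff₀ (by positivity), mul_comm]
      exact hx
    · rw [pow_one, mul_inv, inv_pow, mul_assoc]
  have h2 : Tendsto (fun K : ℕ => M * r⁻¹ * (2⁻¹ : ℝ) ^ K) atTop (𝓝 0) := by
    simpa using (tendsto_pow_atTop_nhds_zero_of_lt_one (r := (2⁻¹ : ℝ)) (by norm_num)
      (by norm_num)).const_mul (M * r⁻¹)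
  filter_upwards [h2.eventually (gt_mem_nhds hε)] with K hK
  rw [sub_zero]
  exact (h1 K).trans_lt hK

/-- Continuous functionals that vanish on compactly supported functions vanish. Variant where the
support is also known to be in a given closed set. -/
theorem apply_eq_zero_of_hasCompactSupport [FiniteDimensional ℝ V] [HasContDiffBump V]
    (u : 𝓢(V, ℂ) →L[ℂ] ℂ) (Z : Set V)
    (hu : ∀ φ : 𝓢(V, ℂ), HasCompactSupport φ → tsupport φ ⊆ Z → u φ = 0) (g : 𝓢(V, ℂ))
    (hg : tsupport g ⊆ Z) : u g = 0 := by
  let f : ContDiffBump (0 : V) := ⟨1, 2, one_pos, one_lt_two⟩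
  have hf : BddSmooth fun x : V => (f x : ℂ) :=
    .of_hasCompactSupport (Complex.ofRealCLM.contDiff.comp f.contDiff)
      (f.hasCompactSupport.comp_left (g := Complex.ofReal) Complex.ofReal_zero)
  have hp : ∀ k : ℕ, (fun x : V => (f ((2⁻¹ : ℝ) ^ k • x) : ℂ)).HasTemperateGrowth := fun k =>
    (hf.comp_clm (((2⁻¹ : ℝ) ^ k) • ContinuousLinearMap.id ℝ V)).hasTemperateGrowth
  let G : ℕ → 𝓢(V, ℂ) := fun k => SchwartzMap.smulLeftCLM ℂ (fun x => (f ((2⁻¹ : ℝ) ^ k • x) : ℂ)) g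
  have hG : ∀ k x, G k x = f ((2⁻¹ : ℝ) ^ k • x) * g x := fun k x => by
    simp only [G]
    rw [SchwartzMap.smulLeftCLM_apply_apply (hp k), smul_eq_mul]
  have h1 : Tendsto (fun k => g - G k) atTop (𝓝 0) := by
    refine tendsto_smulLeft_scaled (hf.const_sub 1) one_pos (fun x hx => ?_) g _ fun k x => ?_
    · rw [f.one_of_mem_closedBall (by simpa using hx.le)]; simp
    · rw [_root_.sub_apply, hG]; ring
  have h2 : Tendsto (fun k => u (g - G k)) atTop (𝓝 0) := by
    have := (u.continuous.tendsto 0).comp h1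
    rwa [map_zero] at this
  have h3 : ∀ k, u (g - G k) = u g := by
    intro k
    rw [map_sub, hu (G k), sub_zero]
    · refine HasCompactSupport.of_support_subset_isCompact
        ((f.hasCompactSupport.isCompact).image (continuous_const_smul ((2 : ℝ) ^ k))) fun x hx => ?_
      refine ⟨(2⁻¹ : ℝ) ^ k • x, subset_tsupport _ fun h0 => hx ?_, ?_⟩
      · rw [hG, h0]; simp
      · simp [smul_smul]
    · exact (closure_mono fun x hx => by
        rw [Function.mem_support, hG] at hx
        exact right_ne_zero_of_mul hx).trans hg
  simp only [h3] at h2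
  exact tendsto_nhds_unique tendsto_const_nhds h2

end Cutoff

/-! ### UV regular splitting functions -/

section UVRegular

variable {ι : Type*} [Fintype ι] {Θ : Vec ι → ℝ}

/-- Near a far point y the function Θ coincides with Θ(c·), where c < 1 takes y to the sphere of
radius ℓ + 1. So all derivatives are bounded by their maxima on a closed ball. -/
theorem IsUVRegularSplitting.bddSmooth (hΘ : IsUVRegularSplitting Θ) :
    BddSmooth fun y => (Θ y : ℂ) := by
  set h : Vec ι → ℂ := fun y => (Θ y : ℂ)
  have hh : ContDiff ℝ ∞ h := Complex.ofRealCLM.contDiff.comp hΘ.smooth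
  refine ⟨hh, fun n => ?_⟩
  obtain ⟨ℓ, hℓ, hhom⟩ := hΘ.homogeneous
  obtain ⟨C, hC⟩ := (isCompact_closedBall (0 : Vec ι) (ℓ + 1)).exists_bound_of_continuousOn
    (hh.continuous_iteratedFDeriv (m := n) (by exact_mod_cast le_top)).continuousOn
  refine ⟨C, fun y => ?_⟩
  rcases le_or_gt ‖y‖ (ℓ + 1) with hy | hy
  · exact hC y (by simpa using hy)
  · have hy0 : 0 < ‖y‖ := by linarith
    set c := (ℓ + 1) / ‖y‖
    have hc0 : 0 < c := by positivity
    have hc1 : c < 1 := by rw [div_lt_one hy0]; exact hy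
    have hcy : ‖c • y‖ = ℓ + 1 := by
      rw [norm_smul, Real.norm_of_nonneg hc0.le, div_mul_cancel₀ _ hy0.ne']
    have h1 : h =ᶠ[𝓝 y] fun x => h (c • x) := by
      have h2 : ∀ᶠ x in 𝓝 y, ℓ < ‖c • x‖ :=
        (isOpen_lt continuous_const (by fun_prop)).mem_nhds
          (show ℓ < ‖c • y‖ by rw [hcy]; linarith)
      filter_upwards [h2] with x hx
      have := hhom (c • x) hx c⁻¹ ((one_lt_inv₀ hc0).2 hc1)
      simp only [h]
      rw [← this, smul_smul, inv_mul_cancel₀ hc0.ne', one_smul]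
    rw [(h1.iteratedFDeriv ℝ n).eq_of_nhds]
    have := norm_iteratedFDeriv_comp_smul_le hh hc0.le hc1.le n 0 y
    simp only [zero_add] at this
    exact this.trans (hC _ (by simp [hcy]))

/-- Test functions supported in a compact set that does not contain the origin. -/
def Shell {V : Type*} [NormedAddCommGroup V] [NormedSpace ℝ V] (ψ : 𝓢(V, ℂ)) : Prop :=
  HasCompactSupport ψ ∧ ∀ᶠ y in 𝓝 0, ψ y = 0

/-- Both terms vanish near 0, and for ‖y‖ > 2ℓ they agree by homogeneity. The dilates of this
difference telescope to Θ. -/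
theorem IsUVRegularSplitting.exists_shell (hΘ : IsUVRegularSplitting Θ) :
    ∃ ψ : 𝓢(Vec ι, ℂ), Shell ψ ∧ ∀ y, ψ y = (Θ y : ℂ) - Θ ((2⁻¹ : ℝ) • y) := by
  obtain ⟨ℓ, hℓ, hhom⟩ := hΘ.homogeneous
  have hs : ContDiff ℝ ∞ fun y => (Θ y : ℂ) - Θ ((2⁻¹ : ℝ) • y) :=
    (Complex.ofRealCLM.contDiff.comp hΘ.smooth).sub
      (Complex.ofRealCLM.contDiff.comp (hΘ.smooth.comp (contDiff_const_smul _)))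
  have hc : HasCompactSupport fun y => (Θ y : ℂ) - Θ ((2⁻¹ : ℝ) • y) := by
    refine HasCompactSupport.of_support_subset_isCompact
      (isCompact_closedBall (0 : Vec ι) (2 * ℓ)) fun y hy => ?_
    by_contra h
    rw [mem_closedBall_zero_iff, not_le] at h
    refine hy ?_
    have h1 := hhom ((2⁻¹ : ℝ) • y) (by
      rw [norm_smul, Real.norm_of_nonneg (by norm_num)]; linarith) 2 one_lt_two
    rw [smul_smul, mul_inv_cancel₀ two_ne_zero, one_smul] at h1
    simp only [h1, sub_self]
  refine ⟨hc.toSchwartzMap hs, ⟨hc, ?_⟩, fun y => rfl⟩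
  have h0 : Tendsto (fun y : Vec ι => (2⁻¹ : ℝ) • y) (𝓝 0) (𝓝 0) := by
    simpa using (continuous_const_smul (2⁻¹ : ℝ)).tendsto (0 : Vec ι)
  filter_upwards [hΘ.zero_near_origin, h0.eventually hΘ.zero_near_origin] with y h1 h2
  change (Θ y : ℂ) - Θ ((2⁻¹ : ℝ) • y) = 0
  rw [h1, h2, sub_self]

theorem Shell.smulLeft {V : Type*} [NormedAddCommGroup V] [NormedSpace ℝ V] {ψ : 𝓢(V, ℂ)}
    (hψ : Shell ψ) {ψ' : 𝓢(V, ℂ)} {h : V → ℂ} (h' : ∀ y, ψ' y = h y * ψ y) : Shell ψ' := by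
  refine ⟨hψ.1.mono fun y hy => ?_, ?_⟩
  · rw [Function.mem_support, h'] at hy
    exact right_ne_zero_of_mul hy
  · filter_upwards [hψ.2] with y hy
    rw [h', hy, mul_zero]

/-- `ψ = ∑ i, y_i ψ_i`. -/
theorem Shell.exists_div {ψ : 𝓢(Vec ι, ℂ)} (hψ : Shell ψ) :
    ∃ ψ' : ι → 𝓢(Vec ι, ℂ), (∀ i, Shell (ψ' i)) ∧ ∀ y, ψ y = ∑ i, (y i : ℂ) * ψ' i y := by
  have h0 : ψ 0 = 0 := hψ.2.self_of_nhds
  -- The quotient is y_i ψ / ‖y‖², which is smooth because ψ vanishes near the origin.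
  have hs : ∀ i, ContDiff ℝ ∞ fun y : Vec ι => (((y i) / ‖y‖ ^ 2 : ℝ) : ℂ) * ψ y := by
    intro i
    rw [contDiff_iff_contDiffAt]
    intro y
    by_cases hy : y = 0
    · subst hy
      refine (contDiffAt_const (c := (0 : ℂ))).congr_of_eventuallyEq ?_
      filter_upwards [hψ.2] with y hy
      rw [hy, mul_zero]
    · refine ContDiffAt.mul ?_ (ψ.smooth ⊤).contDiffAt
      refine Complex.ofRealCLM.contDiff.contDiffAt.comp y ?_
      refine ContDiffAt.div ?_ (contDiff_norm_sq ℝ).contDiffAt (by simpa using hy)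
      exact (PiLp.proj (𝕜 := ℝ) 2 (fun _ : ι => ℝ) i).contDiff.contDiffAt
  have hc : ∀ i, HasCompactSupport fun y : Vec ι => (((y i) / ‖y‖ ^ 2 : ℝ) : ℂ) * ψ y :=
    fun i => hψ.1.mul_left
  refine ⟨fun i => (hc i).toSchwartzMap (hs i), fun i => hψ.smulLeft fun y => rfl, fun y => ?_⟩
  change ψ y = ∑ i, (y i : ℂ) * ((((y i) / ‖y‖ ^ 2 : ℝ) : ℂ) * ψ y)
  by_cases hy : y = 0
  · subst hy; simp [h0]
  · simp only [← mul_assoc, ← Finset.sum_mul]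
    have h1 : ∑ i, (y i : ℂ) * (((y i) / ‖y‖ ^ 2 : ℝ) : ℂ) = 1 := by
      rw [← Complex.ofReal_one]
      simp only [← Complex.ofReal_mul, ← Complex.ofReal_sum]
      congr 1
      simp only [← mul_div_assoc, ← Finset.sum_div]
      rw [EuclideanSpace.norm_sq_eq]
      simp only [Real.norm_eq_abs, sq_abs]
      simp only [← sq]
      refine div_self ?_
      have : ‖y‖ ^ 2 ≠ 0 := by simpa using hy
      rw [EuclideanSpace.norm_sq_eq] at this
      simpa using this
    rw [h1, one_mul]

end UVRegular

/-! ### Dyadic dilations and multiplication by monomials -/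

section Monomials

/-- `ψ ↦ (y ↦ ψ (2^{-k} y))`. -/
def dil {V : Type*} [NormedAddCommGroup V] [NormedSpace ℝ V] (k : ℕ) : 𝓢(V, ℂ) →L[ℂ] 𝓢(V, ℂ) :=
  scal (Units.mk0 ((2 : ℝ) ^ k) (by positivity))⁻¹

@[simp] theorem dil_apply {V : Type*} [NormedAddCommGroup V] [NormedSpace ℝ V] (k : ℕ)
    (ψ : 𝓢(V, ℂ)) (y : V) : dil k ψ y = ψ ((2⁻¹ : ℝ) ^ k • y) := by
  rw [dil, scal_apply]
  simp

variable {ι : Type*} [Fintype ι]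

theorem hasTemperateGrowth_monomial (σ : ι → ℤˣ) (β : ι → ℕ) :
    (fun y : Vec ι => ∏ i, (-Complex.I * ((σ i : ℤ) : ℝ) * (y i : ℂ)) ^ β i).HasTemperateGrowth := by
  classical
  have h1 : ∀ i, (fun y : Vec ι => -Complex.I * ((σ i : ℤ) : ℝ) * (y i : ℂ)).HasTemperateGrowth := by
    intro i
    have h2 : (fun y : Vec ι => (y i : ℂ)).HasTemperateGrowth :=
      ofReal_comp_hasTemperateGrowth (g := fun y : Vec ι => y i)
        (PiLp.proj (𝕜 := ℝ) 2 (fun _ : ι => ℝ) i).hasTemperateGrowth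
    exact (Function.HasTemperateGrowth.const _).mul h2
  have h3 : ∀ i (n : ℕ),
      (fun y : Vec ι => (-Complex.I * ((σ i : ℤ) : ℝ) * (y i : ℂ)) ^ n).HasTemperateGrowth := by
    intro i n
    induction n with
    | zero => simp
    | succ n ih => simp only [pow_succ]; exact ih.mul (h1 i)
  have h4 : ∀ s : Finset ι, (fun y : Vec ι => ∏ i ∈ s,
      (-Complex.I * ((σ i : ℤ) : ℝ) * (y i : ℂ)) ^ β i).HasTemperateGrowth := by
    intro s
    induction s using Finset.induction_on with
    | empty => simp
    | insert a s ha ih => simp only [Finset.prod_insert ha]; exact (h3 a _).mul ih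
  exact h4 _

/-- Multiplication by `∏ i, (-i σ_i y_i)^{β_i}`; it corresponds to `∂^β` under the transform. -/
def monoMul (σ : ι → ℤˣ) (β : ι → ℕ) : 𝓢(Vec ι, ℂ) →L[ℂ] 𝓢(Vec ι, ℂ) :=
  SchwartzMap.smulLeftCLM ℂ fun y : Vec ι => ∏ i, (-Complex.I * ((σ i : ℤ) : ℝ) * (y i : ℂ)) ^ β i

theorem monoMul_apply (σ : ι → ℤˣ) (β : ι → ℕ) (ψ : 𝓢(Vec ι, ℂ)) (y : Vec ι) :
    monoMul σ β ψ y = (∏ i, (-Complex.I * ((σ i : ℤ) : ℝ) * (y i : ℂ)) ^ β i) * ψ y := by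
  rw [monoMul, SchwartzMap.smulLeftCLM_apply_apply (hasTemperateGrowth_monomial σ β), smul_eq_mul]

theorem monoMul_zero (σ : ι → ℤˣ) (ψ : 𝓢(Vec ι, ℂ)) : monoMul σ 0 ψ = ψ := by
  ext y; simp [monoMul_apply]

theorem monoMul_add (σ : ι → ℤˣ) (α β : ι → ℕ) (ψ : 𝓢(Vec ι, ℂ)) :
    monoMul σ (α + β) ψ = monoMul σ α (monoMul σ β ψ) := by
  ext y; simp [monoMul_apply, pow_add, Finset.prod_mul_distrib, mul_assoc]

theorem pair_unitVec (σ : ι → ℤˣ) (i : ι) (y : Vec ι) :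
    pair σ (unitVec i) y = ((σ i : ℤ) : ℝ) * y i := by
  classical
  rw [pair_apply, Finset.sum_eq_single i]
  · simp [unitVec_same]
  · intro j _ hj; simp [unitVec_of_ne hj]
  · simp

theorem monoMul_single [DecidableEq ι] (σ : ι → ℤˣ) (i : ι) (ψ : 𝓢(Vec ι, ℂ)) :
    monoMul σ (Pi.single i 1) ψ = -Complex.I • linMul (pair σ (unitVec i)) ψ := by
  ext y
  rw [monoMul_apply, Finset.prod_eq_single i]
  · simp [pair_unitVec, mul_assoc]
  · intro j _ hj; simp [hj]
  · simp

theorem Shell.monoMul {σ : ι → ℤˣ} {ψ : 𝓢(Vec ι, ℂ)} (hψ : Shell ψ) (β : ι → ℕ) :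
    Shell (monoMul σ β ψ) :=
  hψ.smulLeft (monoMul_apply σ β ψ)

/-- Multinomial expansion of (i q·y)^m, with y_i = 2^k (2^{-k} y_i). The monomial in 2^{-k} y is
absorbed into the shell function, so q-derivatives of dyadic terms are again dyadic terms, at the
price of 2^{km}. -/
theorem iterate_linMul_dil [DecidableEq ι] (σ : ι → ℤˣ) (q : Vec ι) (k m : ℕ) (ψ : 𝓢(Vec ι, ℂ)) :
    (fun h => Complex.I • linMul (pair σ q) h)^[m] (dil k ψ) =
      ∑ γ ∈ Finset.piAntidiag (Finset.univ : Finset ι) m,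
        ((2 : ℂ) ^ (k * m) * ((Nat.multinomial Finset.univ γ : ℂ) * (-1) ^ m) *
          ((∏ i, q i ^ γ i : ℝ) : ℂ)) • dil k (monoMul σ γ ψ) := by
  ext y
  have h1 : ∀ (m : ℕ) (h : 𝓢(Vec ι, ℂ)), (fun h => Complex.I • linMul (pair σ q) h)^[m] h y =
      (Complex.I * pair σ q y) ^ m * h y := by
    intro m
    induction m with
    | zero => intro h; simp
    | succ m ih => intro h; rw [Function.iterate_succ_apply, ih]; simp [pow_succ]; ring
  rw [h1, _root_.sum_apply, pair_apply]
  have h2 : Complex.I * ((∑ i, ((σ i : ℤ) : ℝ) * q i * y i : ℝ) : ℂ) =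
      ∑ i, (2 : ℂ) ^ k * -1 * ((q i : ℂ) *
        (-Complex.I * ((σ i : ℤ) : ℝ) * ((((2⁻¹ : ℝ) ^ k • y) i : ℝ) : ℂ))) := by
    rw [Complex.ofReal_sum, Finset.mul_sum]
    refine Finset.sum_congr rfl fun i _ => ?_
    simp only [PiLp.smul_apply, smul_eq_mul]
    push_cast
    have : (2 : ℂ) ^ k * (2 : ℂ)⁻¹ ^ k = 1 := by rw [← mul_pow]; norm_num
    linear_combination (-Complex.I * (σ i : ℤ) * q i * y i) * this
  rw [h2, Finset.sum_pow_eq_sum_piAntidiag, Finset.sum_mul]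
  refine Finset.sum_congr rfl fun γ hγ => ?_
  rw [_root_.smul_apply, dil_apply, dil_apply, monoMul_apply, smul_eq_mul]
  have h3 : ∑ i, γ i = m := (Finset.mem_piAntidiag.1 hγ).1
  simp only [mul_pow, Finset.prod_mul_distrib, Finset.prod_pow_eq_pow_sum, h3]
  push_cast
  rw [pow_mul]
  ring

end Monomials

/-! ### Summation of Taylor remainders -/

section SumTaylor

/-- Induction on r: the remainder of `g 0` vanishes at 0 and its derivative is the remainder of `g
1`, so the mean value inequality on [0, 1] keeps the bound C. The factor 1/r! is given away. -/
theorem norm_sub_taylor_le {r : ℕ} {g : ℕ → ℝ → ℂ} {C : ℝ}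
    (hg : ∀ m s, HasDerivAt (g m) (g (m + 1) s) s)
    (hC : ∀ s ∈ Set.Icc (0 : ℝ) 1, ‖g r s‖ ≤ C) :
    ∀ s ∈ Set.Icc (0 : ℝ) 1,
      ‖g 0 s - ∑ m ∈ Finset.range r, ((s ^ m / m.factorial : ℝ) : ℂ) * g m 0‖ ≤ C := by
  induction r generalizing g with
  | zero => intro s hs; simpa using hC s hs
  | succ r ih =>
    intro s hs
    have h1 := ih (g := fun m => g (m + 1)) (fun m s => hg (m + 1) s) hC
    have hC0 : 0 ≤ C := (norm_nonneg _).trans (hC s hs)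
    set h : ℝ → ℂ := fun s => g 0 s - ∑ m ∈ Finset.range (r + 1), ((s ^ m / m.factorial : ℝ) : ℂ) * g m 0
    have h2 : ∀ s, HasDerivAt h
        (g 1 s - ∑ m ∈ Finset.range r, ((s ^ m / m.factorial : ℝ) : ℂ) * g (m + 1) 0) s := by
      intro s
      refine (hg 0 s).sub ?_
      simp only [Finset.sum_range_succ']
      have h3 : ∀ m ∈ Finset.range r, HasDerivAt
          (fun s : ℝ => ((s ^ (m + 1) / (m + 1).factorial : ℝ) : ℂ) * g (m + 1) 0)
          (((s ^ m / m.factorial : ℝ) : ℂ) * g (m + 1) 0) s := by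
        intro m _
        have h4 : HasDerivAt (fun s : ℝ => s ^ (m + 1) / (m + 1).factorial)
            (s ^ m / m.factorial) s := by
          have := (hasDerivAt_pow (m + 1) s).div_const ((m + 1).factorial : ℝ)
          refine this.congr_deriv ?_
          rw [Nat.factorial_succ]
          have h5 : (m.factorial : ℝ) ≠ 0 := by positivity
          push_cast
          field_simp
        exact h4.ofReal_comp.mul_const _
      have h6 := HasDerivAt.fun_sum h3
      simpa using h6.add_const (((s ^ 0 / (Nat.factorial 0) : ℝ) : ℂ) * g 0 0)
    have h0 : h 0 = 0 := by
      simp only [h, Finset.sum_range_succ']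
      simp
    have := (convex_Icc (0 : ℝ) 1).norm_image_sub_le_of_norm_hasDerivWithin_le (f := h) (C := C)
      (fun x _ => (h2 x).hasDerivWithinAt) h1 (Set.left_mem_Icc.2 zero_le_one) hs
    rw [h0, sub_zero, sub_zero, Real.norm_eq_abs, abs_of_nonneg hs.1] at this
    exact this.trans (mul_le_of_le_one_right hC0 hs.2)

/-- Choose J with 2^{-J-1} < x ≤ 2^{-J}. On either side of J the terms are dominated by geometric
series of ratio 2^{-θ}, whose sums do not depend on x. -/
theorem exists_tsum_le_of_dyadic {θ : ℝ} (hθ : 0 < θ) :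
    ∃ M : ℝ, 0 ≤ M ∧ ∀ x : ℝ, 0 < x → x ≤ 1 → ∀ b : ℕ → ℝ, (∀ k, 0 ≤ b k) →
      (∀ k, x ≤ (2⁻¹ : ℝ) ^ k → b k ≤ (x / (2⁻¹ : ℝ) ^ k) ^ θ) →
      (∀ k, (2⁻¹ : ℝ) ^ k ≤ x → b k ≤ ((2⁻¹ : ℝ) ^ k / x) ^ θ) →
      Summable b ∧ ∑' k, b k ≤ M := by
  set v : ℝ := (2⁻¹ : ℝ) ^ θ
  have hv0 : 0 < v := by positivity
  have hv1 : v < 1 := Real.rpow_lt_one (by norm_num) (by norm_num) hθ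
  have hpow : ∀ n : ℕ, ((2⁻¹ : ℝ) ^ n) ^ θ = v ^ n := fun n => by
    rw [← Real.rpow_natCast, ← Real.rpow_mul (by norm_num), mul_comm, Real.rpow_mul (by norm_num),
      Real.rpow_natCast]
  refine ⟨(1 - v)⁻¹ + (1 - v)⁻¹, by
    have : 0 < 1 - v := by linarith
    positivity, fun x hx0 hx1 b hb0 h1 h2 => ?_⟩
  obtain ⟨J, hJ1, hJ2⟩ := exists_nat_pow_near_of_lt_one hx0 hx1 (y := (2⁻¹ : ℝ)) (by norm_num)
    (by norm_num)
  have h3 : ∀ i, b (i + (J + 1)) ≤ v ^ i := by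
    intro i
    have hle : (2⁻¹ : ℝ) ^ (i + (J + 1)) ≤ (2⁻¹ : ℝ) ^ (J + 1) :=
      pow_le_pow_of_le_one (by norm_num) (by norm_num) (by omega)
    refine (h2 _ (hle.trans hJ1.le)).trans ?_
    rw [← hpow]
    refine Real.rpow_le_rpow (by positivity) ?_ hθ.le
    rw [div_le_iff₀ hx0, pow_add]
    gcongr
  have h4 : ∀ k ∈ Finset.range (J + 1), b k ≤ v ^ (J + 1 - 1 - k) := by
    intro k hk
    have hk' : k ≤ J := Nat.lt_succ_iff.1 (Finset.mem_range.1 hk)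
    have hle : (2⁻¹ : ℝ) ^ J ≤ (2⁻¹ : ℝ) ^ k :=
      pow_le_pow_of_le_one (by norm_num) (by norm_num) hk'
    refine (h1 _ (hJ2.trans hle)).trans ?_
    rw [← hpow]
    refine Real.rpow_le_rpow (by positivity) ?_ hθ.le
    rw [div_le_iff₀ (by positivity), ← pow_add]
    have : J + 1 - 1 - k + k = J := by omega
    rw [this]
    exact hJ2
  have hgeo := summable_geometric_of_lt_one hv0.le hv1
  have hs : Summable fun i => b (i + (J + 1)) := Summable.of_nonneg_of_le (fun i => hb0 _) h3 hgeo
  have hs' : Summable b := (summable_nat_add_iff (J + 1)).1 hs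
  refine ⟨hs', ?_⟩
  rw [← hs'.sum_add_tsum_nat_add (J + 1)]
  refine add_le_add ?_ ?_
  · refine (Finset.sum_le_sum h4).trans ?_
    rw [Finset.sum_range_reflect (fun k => v ^ k) (J + 1), ← tsum_geometric_of_lt_one hv0.le hv1]
    exact hgeo.sum_le_tsum _ fun i _ => by positivity
  · rw [← tsum_geometric_of_lt_one hv0.le hv1]
    exact hs.tsum_le_tsum h3 hgeo

end SumTaylor

/-! ### Points (q, q') as pairs. -/

section Join

variable {ι κ : Type*} [Fintype ι] [Fintype κ]

/-- The point `(q, q')`. -/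
def joinVec (q : Vec ι) (p : Vec κ) : Vec (ι ⊕ κ) := WithLp.toLp 2 (Sum.elim q p)

@[simp] theorem joinVec_inl (q : Vec ι) (p : Vec κ) (i : ι) : joinVec q p (Sum.inl i) = q i := rfl

@[simp] theorem joinVec_inr (q : Vec ι) (p : Vec κ) (i : κ) : joinVec q p (Sum.inr i) = p i := rfl

@[simp] theorem fstPart_joinVec (q : Vec ι) (p : Vec κ) : fstPart (joinVec q p) = q := by
  ext i; simp

@[simp] theorem sndPart_joinVec (q : Vec ι) (p : Vec κ) : sndPart (joinVec q p) = p := by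
  ext i; simp

@[simp] theorem joinVec_fst_snd (z : Vec (ι ⊕ κ)) : joinVec (fstPart z) (sndPart z) = z := by
  ext (i | i) <;> simp

theorem continuous_joinVec : Continuous fun p : Vec ι × Vec κ => joinVec p.1 p.2 := by
  refine (PiLp.continuous_toLp 2 _).comp (continuous_pi ?_)
  rintro (i | i)
  · exact (PiLp.proj (𝕜 := ℝ) 2 (fun _ : ι => ℝ) i).continuous.comp continuous_fst
  · exact (PiLp.proj (𝕜 := ℝ) 2 (fun _ : κ => ℝ) i).continuous.comp continuous_snd

end Join

/-! ### Dyadic sums of oscillating terms -/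

section Dyadic

variable {ι κ : Type*} [Fintype ι] [Fintype κ]

/-- The function `(q, q') ↦ ⟨u_{k,q'}, exp(i q·) ψ(2^{-k} ·)⟩`. -/
def osc (σ : ι → ℤˣ) (u : ℕ → Vec κ → 𝓢(Vec ι, ℂ) →L[ℂ] ℂ) (ψ : 𝓢(Vec ι, ℂ)) (k : ℕ)
    (z : Vec (ι ⊕ κ)) : ℂ :=
  u k (sndPart z) (charMul (pair σ (fstPart z)) (dil k ψ))

/-- Families of distributions whose dyadic pieces satisfy
`|⟨u_{k,q'}, exp(i q·) ψ(2^{-k} ·)⟩| ≤ const 2^{-k} (2^{-k} + |q|)^a`. -/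
structure DyadicBound (σ : ι → ℤˣ) (u : ℕ → Vec κ → 𝓢(Vec ι, ℂ) →L[ℂ] ℂ) (ρ a : ℝ) : Prop where
  bound : ∀ ψ, Shell ψ → ∃ C : ℝ, ∀ k p q, ‖q‖ ≤ ρ →
    ‖u k p (charMul (pair σ q) (dil k ψ))‖ ≤ C * ((2⁻¹ : ℝ) ^ k * ((2⁻¹ : ℝ) ^ k + ‖q‖) ^ a)
  cont : ∀ ψ, Shell ψ → ∀ k, Continuous (osc σ u ψ k)

variable {σ : ι → ℤˣ} {u : ℕ → Vec κ → 𝓢(Vec ι, ℂ) →L[ℂ] ℂ} {ρ a : ℝ}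

theorem DyadicBound.exists_norm_osc_le (h : DyadicBound σ u ρ a) (ha : 0 ≤ a) (hρ : ρ ≤ 1)
    {ψ : 𝓢(Vec ι, ℂ)} (hψ : Shell ψ) :
    ∃ C : ℝ, 0 ≤ C ∧ ∀ k z, ‖fstPart z‖ ≤ ρ → ‖osc σ u ψ k z‖ ≤ C * (2⁻¹ : ℝ) ^ k := by
  obtain ⟨C, hC⟩ := h.bound ψ hψ
  refine ⟨|C| * 2 ^ a, by positivity, fun k z hz => (hC k (sndPart z) (fstPart z) hz).trans ?_⟩
  have h1 : ((2⁻¹ : ℝ) ^ k + ‖fstPart z‖) ^ a ≤ 2 ^ a := by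
    refine Real.rpow_le_rpow (by positivity) ?_ ha
    have : (2⁻¹ : ℝ) ^ k ≤ 1 := pow_le_one₀ (by norm_num) (by norm_num)
    linarith
  calc C * ((2⁻¹ : ℝ) ^ k * ((2⁻¹ : ℝ) ^ k + ‖fstPart z‖) ^ a)
      ≤ |C| * ((2⁻¹ : ℝ) ^ k * 2 ^ a) := by
        gcongr
        exact le_abs_self C
    _ = _ := by ring

theorem DyadicBound.summable_osc (h : DyadicBound σ u ρ a) (ha : 0 ≤ a) (hρ : ρ ≤ 1)
    {ψ : 𝓢(Vec ι, ℂ)} (hψ : Shell ψ) {z : Vec (ι ⊕ κ)} (hz : ‖fstPart z‖ ≤ ρ) :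
    Summable fun k => osc σ u ψ k z := by
  obtain ⟨C, hC0, hC⟩ := h.exists_norm_osc_le ha hρ hψ
  exact Summable.of_norm_bounded ((summable_geometric_of_lt_one (by norm_num)
    (by norm_num : (2⁻¹ : ℝ) < 1)).mul_left C) fun k => hC k z hz

theorem DyadicBound.continuousOn_tsum_osc (h : DyadicBound σ u ρ a) (ha : 0 ≤ a) (hρ : ρ ≤ 1)
    {ψ : 𝓢(Vec ι, ℂ)} (hψ : Shell ψ) :
    ContinuousOn (fun z => ∑' k, osc σ u ψ k z) {z | ‖fstPart z‖ ≤ ρ} := by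
  obtain ⟨C, hC0, hC⟩ := h.exists_norm_osc_le ha hρ hψ
  exact continuousOn_tsum (fun k => (h.cont ψ hψ k).continuousOn)
    ((summable_geometric_of_lt_one (by norm_num) (by norm_num : (2⁻¹ : ℝ) < 1)).mul_left C)
    fun k z hz => hC k z hz

/-- With w = h/x ≤ 1 the left side equals x^{a+1} w^{1+a-m}. It is applied to the Taylor terms of
order m at scales h = 2^{-k} below x = |q|. -/
theorem rpow_mul_le_of_le {x h a : ℝ} (hx : 0 < x) (hh : 0 < h) (hhx : h ≤ x) {m : ℕ} {θ : ℝ}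
    (hθ : θ ≤ 1 + a - m) :
    (x / h) ^ m * (h * h ^ a) ≤ x ^ (a + 1) * (h / x) ^ θ := by
  have hw : 0 < h / x := by positivity
  have h1 : h * h ^ a = x ^ (a + 1) * (h / x) ^ (1 + a) := by
    rw [add_comm a 1, ← Real.mul_rpow hx.le hw.le, mul_div_cancel₀ _ hx.ne', Real.rpow_add hh,
      Real.rpow_one]
  have h2 : (x / h) ^ m * (h / x) ^ (1 + a) = (h / x) ^ (1 + a - m) := by
    rw [Real.rpow_sub hw, Real.rpow_natCast, ← inv_div, inv_pow]
    field_simp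
  rw [h1, mul_left_comm, h2]
  exact mul_le_mul_of_nonneg_left (Real.rpow_le_rpow_of_exponent_ge hw ((div_le_one hx).2 hhx) hθ)
    (by positivity)

/-- With w = x/h ≤ 1 the left side equals x^{a+1} w^{m-1-a}. It is applied with m = D to the Taylor
remainder at scales above |q|. -/
theorem rpow_mul_le_of_ge {x h a : ℝ} (hx : 0 < x) (hh : 0 < h) (hhx : x ≤ h) {m : ℕ} {θ : ℝ}
    (hθ : θ ≤ m - 1 - a) :
    (x / h) ^ m * (h * h ^ a) ≤ x ^ (a + 1) * (x / h) ^ θ := by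
  have hw : 0 < x / h := by positivity
  have h1 : h * h ^ a = x ^ (a + 1) * (x / h) ^ (-(1 + a)) := by
    rw [Real.rpow_neg hw.le, ← Real.inv_rpow hw.le, inv_div, add_comm a 1,
      ← Real.mul_rpow hx.le (by positivity), mul_div_cancel₀ _ hx.ne', Real.rpow_add hh,
      Real.rpow_one]
  have h2 : (x / h) ^ m * (x / h) ^ (-(1 + a)) = (x / h) ^ (m - 1 - a) := by
    rw [← Real.rpow_natCast, ← Real.rpow_add hw]
    congr 1; ring
  rw [h1, mul_left_comm, h2]
  exact mul_le_mul_of_nonneg_left (Real.rpow_le_rpow_of_exponent_ge hw ((div_le_one hh).2 hhx) hθ)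
    (by positivity)

variable [DecidableEq ι]

/-- `m`-th derivative of `s ↦ osc σ u ψ k (s q, p)`. -/
def oscDeriv (σ : ι → ℤˣ) (u : ℕ → Vec κ → 𝓢(Vec ι, ℂ) →L[ℂ] ℂ) (ψ : 𝓢(Vec ι, ℂ)) (k : ℕ)
    (p : Vec κ) (q : Vec ι) (m : ℕ) (s : ℝ) : ℂ :=
  u k p (charMul (s • pair σ q) ((fun h => Complex.I • linMul (pair σ q) h)^[m] (dil k ψ)))

theorem oscDeriv_eq (ψ : 𝓢(Vec ι, ℂ)) (k : ℕ) (p : Vec κ) (q : Vec ι) (m : ℕ) (s : ℝ) :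
    oscDeriv σ u ψ k p q m s = ∑ γ ∈ Finset.piAntidiag (Finset.univ : Finset ι) m,
      ((2 : ℂ) ^ (k * m) * ((Nat.multinomial Finset.univ γ : ℂ) * (-1) ^ m) *
        ((∏ i, q i ^ γ i : ℝ) : ℂ)) * u k p (charMul (pair σ (s • q)) (dil k (monoMul σ γ ψ))) := by
  rw [oscDeriv, iterate_linMul_dil, map_sum, map_sum]
  simp only [map_smul, smul_eq_mul]

theorem abs_prod_pow_le (q : Vec ι) (γ : ι → ℕ) : |∏ i, q i ^ γ i| ≤ ‖q‖ ^ (∑ i, γ i) := by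
  rw [Finset.abs_prod, ← Finset.prod_pow_eq_pow_sum]
  refine Finset.prod_le_prod (fun i _ => abs_nonneg _) fun i _ => ?_
  rw [abs_pow]
  exact pow_le_pow_left₀ (abs_nonneg _) (by simpa using PiLp.norm_apply_le q i) _

theorem DyadicBound.exists_uniform (h : DyadicBound σ u ρ a) {ψ : 𝓢(Vec ι, ℂ)}
    (hψ : Shell ψ) (D : ℕ) :
    ∃ C : ℝ, 0 ≤ C ∧ ∀ m ≤ D, ∀ γ ∈ Finset.piAntidiag (Finset.univ : Finset ι) m, ∀ k p q, ‖q‖ ≤ ρ →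
      ‖u k p (charMul (pair σ q) (dil k (monoMul σ γ ψ)))‖ ≤
        C * ((2⁻¹ : ℝ) ^ k * ((2⁻¹ : ℝ) ^ k + ‖q‖) ^ a) := by
  choose C hC using fun γ : ι → ℕ => h.bound (monoMul σ γ ψ) (hψ.monoMul γ)
  refine ⟨∑ m ∈ Finset.range (D + 1), ∑ γ ∈ Finset.piAntidiag (Finset.univ : Finset ι) m, |C γ|,
    Finset.sum_nonneg fun _ _ => Finset.sum_nonneg fun _ _ => abs_nonneg _, ?_⟩
  intro m hm γ hγ k p q hq
  refine (hC γ k p q hq).trans (mul_le_mul_of_nonneg_right ?_ (by positivity))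
  refine (le_abs_self _).trans ?_
  refine (Finset.single_le_sum (f := fun γ => |C γ|) (fun _ _ => abs_nonneg _) hγ).trans ?_
  exact Finset.single_le_sum
    (f := fun m => ∑ γ ∈ Finset.piAntidiag (Finset.univ : Finset ι) m, |C γ|)
    (fun _ _ => Finset.sum_nonneg fun _ _ => abs_nonneg _) (Finset.mem_range.2 (by omega))

/-- By `oscDeriv_eq` the m-th derivative consists of dyadic terms of the shell functions `monoMul σ
γ ψ`, with monomials of size at most |q|^m and a factor 2^{km}: each derivative costs |q|/2^{-k}. -/
theorem DyadicBound.exists_oscDeriv_le (h : DyadicBound σ u ρ a) {ψ : 𝓢(Vec ι, ℂ)}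
    (hψ : Shell ψ) (D : ℕ) :
    ∃ B : ℝ, 0 ≤ B ∧ ∀ m ≤ D, ∀ k p q s, ‖s • q‖ ≤ ρ → ‖oscDeriv σ u ψ k p q m s‖ ≤
      B * ((‖q‖ / (2⁻¹ : ℝ) ^ k) ^ m * ((2⁻¹ : ℝ) ^ k * ((2⁻¹ : ℝ) ^ k + ‖s • q‖) ^ a)) := by
  obtain ⟨C, hC0, hC⟩ := h.exists_uniform hψ D
  refine ⟨∑ m ∈ Finset.range (D + 1), ∑ γ ∈ Finset.piAntidiag (Finset.univ : Finset ι) m,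
    (Nat.multinomial Finset.univ γ : ℝ) * C, Finset.sum_nonneg fun _ _ =>
      Finset.sum_nonneg fun _ _ => by positivity, ?_⟩
  intro m hm k p q s hs
  rw [oscDeriv_eq]
  refine (norm_sum_le _ _).trans ?_
  have h1 : ∀ γ ∈ Finset.piAntidiag (Finset.univ : Finset ι) m,
      ‖((2 : ℂ) ^ (k * m) * ((Nat.multinomial Finset.univ γ : ℂ) * (-1) ^ m) *
        ((∏ i, q i ^ γ i : ℝ) : ℂ)) * u k p (charMul (pair σ (s • q)) (dil k (monoMul σ γ ψ)))‖ ≤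
      ((Nat.multinomial Finset.univ γ : ℝ) * C) * ((‖q‖ / (2⁻¹ : ℝ) ^ k) ^ m *
        ((2⁻¹ : ℝ) ^ k * ((2⁻¹ : ℝ) ^ k + ‖s • q‖) ^ a)) := by
    intro γ hγ
    have h2 := abs_prod_pow_le q γ
    rw [(Finset.mem_piAntidiag.1 hγ).1] at h2
    rw [norm_mul, norm_mul, norm_mul, norm_mul, norm_pow, norm_pow, norm_neg, norm_one, one_pow,
      mul_one, Complex.norm_real, Real.norm_eq_abs, Complex.norm_natCast, Complex.norm_ofNat]
    calc (2 : ℝ) ^ (k * m) * (Nat.multinomial Finset.univ γ : ℝ) * |∏ i, q i ^ γ i| *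
          ‖u k p (charMul (pair σ (s • q)) (dil k (monoMul σ γ ψ)))‖
        ≤ (2 : ℝ) ^ (k * m) * (Nat.multinomial Finset.univ γ : ℝ) * ‖q‖ ^ m *
          (C * ((2⁻¹ : ℝ) ^ k * ((2⁻¹ : ℝ) ^ k + ‖s • q‖) ^ a)) := by
          gcongr
          exact hC m hm γ hγ k p _ hs
      _ = _ := by
          rw [div_pow, ← pow_mul, inv_pow, inv_pow]
          field_simp
  refine (Finset.sum_le_sum h1).trans ?_
  rw [← Finset.sum_mul]
  refine mul_le_mul_of_nonneg_right ?_ (by positivity)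
  exact Finset.single_le_sum
    (f := fun m => ∑ γ ∈ Finset.piAntidiag (Finset.univ : Finset ι) m,
      (Nat.multinomial Finset.univ γ : ℝ) * C)
    (fun _ _ => Finset.sum_nonneg fun _ _ => by positivity) (Finset.mem_range.2 (by omega))

theorem hasDerivAt_oscDeriv (ψ : 𝓢(Vec ι, ℂ)) (k : ℕ) (p : Vec κ) (q : Vec ι) (m : ℕ) (s : ℝ) :
    HasDerivAt (oscDeriv σ u ψ k p q m) (oscDeriv σ u ψ k p q (m + 1) s) s := by
  have := hasDerivAt_charMul (u k p) (pair σ q)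
    ((fun h => Complex.I • linMul (pair σ q) h)^[m] (dil k ψ)) s
  unfold oscDeriv
  rw [Function.iterate_succ_apply']
  exact this

/-- Taylor coefficients of `∑ k, osc σ u ψ k`. -/
def oscCoeff (σ : ι → ℤˣ) (u : ℕ → Vec κ → 𝓢(Vec ι, ℂ) →L[ℂ] ℂ) (ψ : 𝓢(Vec ι, ℂ)) (γ : ι → ℕ)
    (k : ℕ) (p : Vec κ) : ℂ :=
  ((((∑ i, γ i).factorial : ℝ)⁻¹ : ℝ) : ℂ) * ((2 : ℂ) ^ (k * ∑ i, γ i) *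
    ((Nat.multinomial Finset.univ γ : ℂ) * (-1) ^ (∑ i, γ i))) * u k p (dil k (monoMul σ γ ψ))

theorem taylor_oscDeriv_eq (ψ : 𝓢(Vec ι, ℂ)) (k : ℕ) (p : Vec κ) (q : Vec ι) (m : ℕ) :
    (((1 : ℝ) ^ m / m.factorial : ℝ) : ℂ) * oscDeriv σ u ψ k p q m 0 =
      ∑ γ ∈ Finset.piAntidiag (Finset.univ : Finset ι) m,
        oscCoeff σ u ψ γ k p * ((∏ i, q i ^ γ i : ℝ) : ℂ) := by
  rw [oscDeriv_eq, Finset.mul_sum]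
  refine Finset.sum_congr rfl fun γ hγ => ?_
  rw [zero_smul, map_zero, charMul_zero, oscCoeff, (Finset.mem_piAntidiag.1 hγ).1, one_pow, one_div]
  ring

/-- The dyadic bound at q = 0 gives 2^{-k(1+a)}, and the |γ| derivatives cost 2^{k|γ|}. The
geometric series converges precisely when |γ| < a + 1. -/
theorem DyadicBound.exists_oscCoeff_le (h : DyadicBound σ u ρ a) (hρ : 0 ≤ ρ) {ψ : 𝓢(Vec ι, ℂ)}
    (hψ : Shell ψ) (γ : ι → ℕ) :
    ∃ C : ℝ, ∀ k p, ‖oscCoeff σ u ψ γ k p‖ ≤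
      C * ((2⁻¹ : ℝ) ^ (1 + a - ((∑ i, γ i : ℕ) : ℝ))) ^ k := by
  obtain ⟨C, hC⟩ := h.bound (monoMul σ γ ψ) (hψ.monoMul γ)
  refine ⟨((((∑ i, γ i).factorial : ℝ)⁻¹)) * (Nat.multinomial Finset.univ γ : ℝ) * C, fun k p => ?_⟩
  have h1 := hC k p 0 (by simpa using hρ)
  rw [map_zero, charMul_zero, norm_zero, add_zero] at h1
  rw [oscCoeff, norm_mul, norm_mul, norm_mul, norm_mul, norm_pow, norm_pow, norm_neg, norm_one,
    one_pow, mul_one, Complex.norm_real, Complex.norm_natCast, Complex.norm_ofNat,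
    Real.norm_of_nonneg (by positivity)]
  refine (mul_le_mul_of_nonneg_left h1 (by positivity)).trans (le_of_eq ?_)
  set m := ∑ i, γ i
  have h2 : ((2⁻¹ : ℝ) ^ (1 + a - (m : ℝ))) ^ k =
      (2 : ℝ) ^ (k * m) * ((2⁻¹ : ℝ) ^ k * ((2⁻¹ : ℝ) ^ k) ^ a) := by
    rw [← Real.rpow_natCast, ← Real.rpow_mul (by norm_num), mul_comm, Real.rpow_mul (by norm_num),
      Real.rpow_natCast, Real.rpow_sub (by positivity), Real.rpow_add (by positivity), Real.rpow_one,
      Real.rpow_natCast, pow_mul, inv_pow, inv_pow, div_inv_eq_mul]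
    ring
  rw [h2]
  ring

/-- Sums of oscillating dyadic terms are polynomials in `q` up to `O(|q|^{a + 1})`. -/
theorem DyadicBound.exists_polySum (h : DyadicBound σ u ρ a) (ha : 0 ≤ a) (hρ0 : 0 ≤ ρ) (hρ : ρ ≤ 1)
    {ψ : 𝓢(Vec ι, ℂ)} (hψ : Shell ψ) {D : ℕ} (hD1 : (D : ℝ) < a + 2) (hD2 : a + 1 < D) :
    ∃ c : (ι → ℕ) → Vec κ → ℂ, (∀ γ, Continuous (c γ)) ∧ ∃ C : ℝ, 0 ≤ C ∧
      ∀ z : Vec (ι ⊕ κ), ‖fstPart z‖ ≤ ρ →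
        ‖∑' k, osc σ u ψ k z - polySum D c z‖ ≤ C * ‖fstPart z‖ ^ (a + 1) := by
  have hr0 : (0 : ℝ) < 2⁻¹ := by norm_num
  have hr1 : (2⁻¹ : ℝ) < 1 := by norm_num
  -- From |γ| ≤ D - 1 < a + 1 the ratio is less than 1; this is where D < a + 2 is needed.
  have hvs : ∀ γ : ι → ℕ, ∑ i, γ i < D →
      Summable fun k : ℕ => ((2⁻¹ : ℝ) ^ (1 + a - ((∑ i, γ i : ℕ) : ℝ))) ^ k := by
    intro γ hγ
    refine summable_geometric_of_lt_one (by positivity) (Real.rpow_lt_one hr0.le hr1 ?_)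
    have : ((∑ i, γ i : ℕ) : ℝ) + 1 ≤ D := by exact_mod_cast hγ
    linarith
  have hcs : ∀ (γ : ι → ℕ), ∑ i, γ i < D → ∀ p, Summable fun k => oscCoeff σ u ψ γ k p := by
    intro γ hγ p
    obtain ⟨C, hC⟩ := h.exists_oscCoeff_le hρ0 hψ γ
    exact Summable.of_norm_bounded ((hvs γ hγ).mul_left C) fun k => hC k p
  have hcc : ∀ (γ : ι → ℕ), ∑ i, γ i < D → Continuous fun p => ∑' k, oscCoeff σ u ψ γ k p := by
    intro γ hγ
    obtain ⟨C, hC⟩ := h.exists_oscCoeff_le hρ0 hψ γ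
    refine continuous_tsum (fun k => ?_) ((hvs γ hγ).mul_left C) fun k p => hC k p
    have h1 := (h.cont _ (hψ.monoMul (σ := σ) γ) k).comp
      (continuous_joinVec.comp (Continuous.prodMk_right (0 : Vec ι)))
    have h2 : Continuous fun p => u k p (dil k (monoMul σ γ ψ)) := by
      refine h1.congr fun p => ?_
      simp [osc, charMul_zero]
    exact h2.const_mul _
  refine ⟨fun γ p => if ∑ i, γ i < D then ∑' k, oscCoeff σ u ψ γ k p else 0, fun γ => ?_, ?_⟩
  · by_cases hγ : ∑ i, γ i < D
    · simp only [if_pos hγ]; exact hcc γ hγ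
    · simp only [if_neg hγ]; exact continuous_const
  -- A common lower bound of the exponents gained: 1 for the term itself and 1 + a - m ≥ a + 2 - D
  -- for its Taylor terms at small scales, D - 1 - a for the remainder at large scales. All are
  -- positive because D lies strictly between a + 1 and a + 2.
  set θ : ℝ := min 1 (min (a + 2 - D) (D - 1 - a))
  have hθ : 0 < θ := lt_min one_pos (lt_min (by linarith) (by linarith))
  have hθ1 : θ ≤ 1 := min_le_left _ _
  have hθ2 : θ ≤ a + 2 - D := (min_le_right _ _).trans (min_le_left _ _)
  have hθ3 : θ ≤ D - 1 - a := (min_le_right _ _).trans (min_le_right _ _)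
  obtain ⟨B, hB0, hB⟩ := h.exists_oscDeriv_le hψ D
  obtain ⟨M, hM0, hM⟩ := exists_tsum_le_of_dyadic hθ
  -- The summand 1 makes B' positive, as it is divided by below.
  set B' : ℝ := B * (2 ^ a + D) + 1
  have hB' : 0 < B' := by positivity
  refine ⟨B' * M, by positivity, fun z hz => ?_⟩
  set q := fstPart z
  set p := sndPart z
  set R : ℕ → ℂ := fun k => oscDeriv σ u ψ k p q 0 1 -
    ∑ m ∈ Finset.range D, (((1 : ℝ) ^ m / m.factorial : ℝ) : ℂ) * oscDeriv σ u ψ k p q m 0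
  have hosc : ∀ k, oscDeriv σ u ψ k p q 0 1 = osc σ u ψ k z := fun k => by
    simp [oscDeriv, osc, q, p]
  have hPs : HasSum (fun k => ∑ m ∈ Finset.range D,
      (((1 : ℝ) ^ m / m.factorial : ℝ) : ℂ) * oscDeriv σ u ψ k p q m 0)
      (polySum D (fun γ p => if ∑ i, γ i < D then ∑' k, oscCoeff σ u ψ γ k p else 0) z) := by
    simp only [taylor_oscDeriv_eq]
    rw [polySum, Int.toNat_natCast]
    refine hasSum_sum fun m hm => hasSum_sum fun γ hγ => ?_
    have h1 : ∑ i, γ i < D := by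
      rw [(Finset.mem_piAntidiag.1 hγ).1]; exact Finset.mem_range.1 hm
    rw [if_pos h1]
    exact (hcs γ h1 p).hasSum.mul_right _
  have hRs : HasSum R (∑' k, osc σ u ψ k z -
      polySum D (fun γ p => if ∑ i, γ i < D then ∑' k, oscCoeff σ u ψ γ k p else 0) z) := by
    refine HasSum.sub ?_ hPs
    simp only [hosc]
    exact (h.summable_osc ha hρ hψ hz).hasSum
  rw [← hRs.tsum_eq]
  -- At q = 0 every term equals its Taylor polynomial; the comparison of scales needs |q| > 0.
  rcases (norm_nonneg q).eq_or_lt with hq | hq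
  · have hq0 : q = 0 := by simpa using hq.symm
    have hR0 : ∀ k, R k = 0 := by
      intro k
      have hDpos : 0 < D := by
        have : (0 : ℝ) < D := by linarith
        exact_mod_cast this
      simp only [R, hq0]
      rw [Finset.sum_eq_single 0]
      · simp [oscDeriv]
      · intro m _ hm
        obtain ⟨m, rfl⟩ := Nat.exists_eq_succ_of_ne_zero hm
        have : linMul (0 : Vec ι →L[ℝ] ℝ) = 0 := by ext; simp
        simp [oscDeriv, Function.iterate_succ_apply', this]
      · simp [hDpos.ne']
    simp only [hR0, tsum_zero, norm_zero]
    positivity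
  set x := ‖q‖
  have hx1 : x ≤ 1 := hz.trans hρ
  have h2a : (1 : ℝ) ≤ 2 ^ a := Real.one_le_rpow one_le_two ha
  -- Scales 2^{-k} ≥ |q|: Taylor's formula of order D along the segment from 0 to q.
  have hR1 : ∀ k, x ≤ (2⁻¹ : ℝ) ^ k → ‖R k‖ ≤ B' * x ^ (a + 1) * (x / (2⁻¹ : ℝ) ^ k) ^ θ := by
    intro k hk
    set η := (2⁻¹ : ℝ) ^ k
    have hη : 0 < η := by positivity
    have h1 := norm_sub_taylor_le (r := D) (g := oscDeriv σ u ψ k p q)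
      (C := B * ((x / η) ^ D * (η * (η + x) ^ a))) (hasDerivAt_oscDeriv ψ k p q)
      (fun s hs => by
        have hsq : ‖s • q‖ ≤ x := by
          rw [norm_smul, Real.norm_of_nonneg hs.1]
          exact mul_le_of_le_one_left (norm_nonneg _) hs.2
        refine (hB D le_rfl k p q s (hsq.trans hz)).trans ?_
        gcongr) 1 (Set.right_mem_Icc.2 zero_le_one)
    refine h1.trans ?_
    have h2 : (η + x) ^ a ≤ 2 ^ a * η ^ a := by
      rw [← Real.mul_rpow zero_le_two hη.le]
      exact Real.rpow_le_rpow (by positivity) (by linarith) ha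
    calc B * ((x / η) ^ D * (η * (η + x) ^ a))
        ≤ B * ((x / η) ^ D * (η * (2 ^ a * η ^ a))) := by gcongr
      _ = (B * 2 ^ a) * ((x / η) ^ D * (η * η ^ a)) := by ring
      _ ≤ (B * 2 ^ a) * (x ^ (a + 1) * (x / η) ^ θ) := by
        exact mul_le_mul_of_nonneg_left (rpow_mul_le_of_ge hq hη hk hθ3) (by positivity)
      _ ≤ B' * (x ^ (a + 1) * (x / η) ^ θ) := by
        gcongr
        have : 0 ≤ B * D := by positivity
        simp only [B']; linarith
      _ = _ := by ring
  -- Scales 2^{-k} ≤ |q|: no cancellation is needed, the term and its Taylor terms are bounded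
  -- separately.
  have hR2 : ∀ k, (2⁻¹ : ℝ) ^ k ≤ x → ‖R k‖ ≤ B' * x ^ (a + 1) * ((2⁻¹ : ℝ) ^ k / x) ^ θ := by
    intro k hk
    set η := (2⁻¹ : ℝ) ^ k
    have hη : 0 < η := by positivity
    have h0 : ‖oscDeriv σ u ψ k p q 0 1‖ ≤ B * 2 ^ a * (x ^ (a + 1) * (η / x) ^ θ) := by
      refine (hB 0 (Nat.zero_le _) k p q 1 (by simpa using hz)).trans ?_
      rw [pow_zero, one_mul, one_smul]
      have h2 : (η + x) ^ a ≤ 2 ^ a * x ^ a := by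
        rw [← Real.mul_rpow zero_le_two hq.le]
        exact Real.rpow_le_rpow (by positivity) (by change η + x ≤ 2 * x; linarith) ha
      have h3 : η * x ^ a = x ^ (a + 1) * (η / x) := by
        rw [Real.rpow_add hq, Real.rpow_one]
        field_simp
      have h4 : η / x ≤ (η / x) ^ θ := by
        conv_lhs => rw [← Real.rpow_one (η / x)]
        exact Real.rpow_le_rpow_of_exponent_ge (by positivity) ((div_le_one hq).2 hk) hθ1
      calc B * (η * (η + ‖q‖) ^ a) ≤ B * (η * (2 ^ a * x ^ a)) := by gcongr
        _ = B * 2 ^ a * (η * x ^ a) := by ring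
        _ ≤ _ := by rw [h3]; gcongr
    have hm : ∀ m ∈ Finset.range D,
        ‖(((1 : ℝ) ^ m / m.factorial : ℝ) : ℂ) * oscDeriv σ u ψ k p q m 0‖ ≤
          B * (x ^ (a + 1) * (η / x) ^ θ) := by
      intro m hm
      have hmD : m + 1 ≤ D := Finset.mem_range.1 hm
      have hmD' : (m : ℝ) + 1 ≤ D := by exact_mod_cast hmD
      have h1 := hB m (by omega) k p q 0 (by simpa using hρ0)
      rw [zero_smul, norm_zero, add_zero] at h1
      rw [norm_mul, Complex.norm_real, one_pow, Real.norm_of_nonneg (by positivity)]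
      have h5 : (1 : ℝ) / m.factorial ≤ 1 := by
        rw [div_le_one (by positivity)]
        exact_mod_cast m.factorial_pos
      refine (mul_le_of_le_one_left (norm_nonneg _) h5).trans (h1.trans ?_)
      have h6 : θ ≤ 1 + a - m := by linarith
      exact mul_le_mul_of_nonneg_left (rpow_mul_le_of_le hq hη hk h6) hB0
    calc ‖R k‖ ≤ B * 2 ^ a * (x ^ (a + 1) * (η / x) ^ θ) +
          ∑ m ∈ Finset.range D, B * (x ^ (a + 1) * (η / x) ^ θ) :=
          (norm_sub_le _ _).trans (add_le_add h0 ((norm_sum_le _ _).trans (Finset.sum_le_sum hm)))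
      _ = (B * (2 ^ a + D)) * (x ^ (a + 1) * (η / x) ^ θ) := by
          rw [Finset.sum_const, Finset.card_range, nsmul_eq_mul]; ring
      _ ≤ B' * (x ^ (a + 1) * (η / x) ^ θ) := by
          gcongr
          simp only [B']; linarith
      _ = _ := by ring
  have hE : 0 < B' * x ^ (a + 1) := by positivity
  obtain ⟨hs, hle⟩ := hM x hq hx1 (fun k => ‖R k‖ / (B' * x ^ (a + 1))) (fun k => by positivity)
    (fun k hk => by rw [div_le_iff₀' hE]; exact hR1 k hk)
    (fun k hk => by rw [div_le_iff₀' hE]; exact hR2 k hk)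
  have hsR : Summable fun k => ‖R k‖ := by
    have := hs.mul_left (B' * x ^ (a + 1))
    refine this.congr fun k => ?_
    field_simp
  refine (norm_tsum_le_tsum_norm hsR).trans ?_
  rw [tsum_div_const, div_le_iff₀ hE] at hle
  refine hle.trans (le_of_eq ?_)
  ring

end Dyadic

/-! ### Integration over `(q, q')` -/

section Fubini

variable {ι κ : Type*} [Fintype ι] [Fintype κ]

/-- `joinVec` as a measurable equivalence. -/
def joinEquiv : Vec ι × Vec κ ≃ᵐ Vec (ι ⊕ κ) :=
  ((MeasurableEquiv.prodCongr (MeasurableEquiv.toLp 2 (ι → ℝ)).symm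
    (MeasurableEquiv.toLp 2 (κ → ℝ)).symm).trans
    (MeasurableEquiv.sumPiEquivProdPi (fun _ : ι ⊕ κ => ℝ)).symm).trans
    (MeasurableEquiv.toLp 2 (ι ⊕ κ → ℝ))

theorem joinEquiv_apply (p : Vec ι × Vec κ) : joinEquiv p = joinVec p.1 p.2 := by
  ext (i | i) <;> rfl

theorem measurePreserving_joinEquiv :
    MeasurePreserving (joinEquiv (ι := ι) (κ := κ)) volume volume :=
  (((PiLp.volume_preserving_ofLp ι).prod (PiLp.volume_preserving_ofLp κ)).trans
    (volume_measurePreserving_sumPiEquivProdPi_symm (fun _ : ι ⊕ κ => ℝ))).trans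
    (PiLp.volume_preserving_toLp (ι ⊕ κ))

theorem integral_eq_integral_joinVec {F : Vec (ι ⊕ κ) → ℂ} (hF : Integrable F) :
    ∫ z, F z = ∫ p : Vec κ, ∫ q : Vec ι, F (joinVec q p) := by
  rw [← measurePreserving_joinEquiv.integral_comp' F]
  have h1 : Integrable (fun p : Vec ι × Vec κ => F (joinEquiv p)) (volume.prod volume) :=
    (measurePreserving_joinEquiv.integrable_comp_emb joinEquiv.measurableEmbedding).2 hF
  refine (integral_prod_symm _ h1).trans ?_
  simp only [joinEquiv_apply]

/-- Integration against a bounded continuous function. -/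
def boundedDist {V : Type*} [NormedAddCommGroup V] [InnerProductSpace ℝ V] [FiniteDimensional ℝ V]
    [MeasurableSpace V] [BorelSpace V] (b : V → ℂ) (hb : Continuous b)
    (hB : ∃ C : ℝ, ∀ x, ‖b x‖ ≤ C) : 𝓢(V, ℂ) →L[ℂ] ℂ :=
  Lp.toTemperedDistribution (p := ⊤) (μ := volume)
    ((memLp_top_of_bound hb.aestronglyMeasurable hB.choose
      (Eventually.of_forall hB.choose_spec) : MemLp b ⊤ (volume : Measure V)).toLp)

theorem boundedDist_apply {V : Type*} [NormedAddCommGroup V] [InnerProductSpace ℝ V]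
    [FiniteDimensional ℝ V] [MeasurableSpace V] [BorelSpace V] (b : V → ℂ) (hb : Continuous b)
    (hB : ∃ C : ℝ, ∀ x, ‖b x‖ ≤ C) (φ : 𝓢(V, ℂ)) : boundedDist b hb hB φ = ∫ x, b x * φ x := by
  have hm : MemLp b ⊤ (volume : Measure V) := memLp_top_of_bound hb.aestronglyMeasurable hB.choose
      (Eventually.of_forall hB.choose_spec)
  refine (Lp.toTemperedDistribution_apply (hm.toLp b) φ).trans (integral_congr_ae ?_)
  filter_upwards [hm.coeFn_toLp] with x hx
  rw [hx, smul_eq_mul, mul_comm]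

end Fubini

/-! ### Products `g(y) f(x)` and slices of the transform -/

section Slices

variable {ι κ : Type*} [Fintype ι] [Fintype κ]

theorem sum_cover (k : ι ⊕ κ) : (∃ i, Sum.inl i = k) ∨ ∃ i, Sum.inr i = k := by
  rcases k with i | i
  · exact Or.inl ⟨i, rfl⟩
  · exact Or.inr ⟨i, rfl⟩

/-- `g(y) f(x)`. -/
def tens (f : 𝓢(Vec κ, ℂ)) : 𝓢(Vec ι, ℂ) →L[ℂ] 𝓢(Vec (ι ⊕ κ), ℂ) :=
  tensorCLM Sum.inl Sum.inr sum_cover f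

@[simp] theorem tens_apply (f : 𝓢(Vec κ, ℂ)) (g : 𝓢(Vec ι, ℂ)) (z : Vec (ι ⊕ κ)) :
    tens f g z = g (fstPart z) * f (sndPart z) := rfl

/-- The functional `(y, x) ↦ p·x`. -/
def pairSnd (σ : ι ⊕ κ → ℤˣ) : Vec κ →L[ℝ] Vec (ι ⊕ κ) →L[ℝ] ℝ :=
  ((ContinuousLinearMap.compL ℝ (Vec (ι ⊕ κ)) (Vec κ) ℝ).flip (coords Sum.inr)).comp
    (pair fun i => σ (Sum.inr i))

theorem pairSnd_apply (σ : ι ⊕ κ → ℤˣ) (p : Vec κ) (z : Vec (ι ⊕ κ)) :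
    pairSnd σ p z = pair (fun i => σ (Sum.inr i)) p (sndPart z) := rfl

theorem pair_sum (σ : ι ⊕ κ → ℤˣ) (w z : Vec (ι ⊕ κ)) :
    pair σ w z = pair (fun i => σ (Sum.inl i)) (fstPart w) (fstPart z) +
      pair (fun i => σ (Sum.inr i)) (sndPart w) (sndPart z) := by
  simp [pair_apply, Fintype.sum_sum_type]

theorem charMul_tens (σ : ι ⊕ κ → ℤˣ) (w : Vec (ι ⊕ κ)) (f : 𝓢(Vec κ, ℂ)) (g : 𝓢(Vec ι, ℂ)) :
    charMul (pair σ w) (tens f g) = charMul (pairSnd σ (sndPart w))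
      (tens f (charMul (pair (fun i => σ (Sum.inl i)) (fstPart w)) g)) := by
  ext z
  simp only [charMul_apply, tens_apply, chr, pair_sum, pairSnd_apply]
  push_cast
  rw [mul_add, Complex.exp_add]
  ring

/-- The slice at `q' = p` of the transform of `f(x) s(y, x)`, as a distribution in `y`. -/
def slice (σ : ι ⊕ κ → ℤˣ) (s : 𝓢(Vec (ι ⊕ κ), ℂ) →L[ℂ] ℂ) (f : 𝓢(Vec κ, ℂ)) (p : Vec κ) :
    𝓢(Vec ι, ℂ) →L[ℂ] ℂ :=
  s.comp ((charMul (pairSnd σ p)).comp (tens f))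

theorem slice_apply (σ : ι ⊕ κ → ℤˣ) (s : 𝓢(Vec (ι ⊕ κ), ℂ) →L[ℂ] ℂ) (f : 𝓢(Vec κ, ℂ))
    (p : Vec κ) (h : 𝓢(Vec ι, ℂ)) : slice σ s f p h = s (charMul (pairSnd σ p) (tens f h)) := rfl

theorem apply_charMul_tens (σ : ι ⊕ κ → ℤˣ) (s : 𝓢(Vec (ι ⊕ κ), ℂ) →L[ℂ] ℂ) (f : 𝓢(Vec κ, ℂ))
    (w : Vec (ι ⊕ κ)) (g : 𝓢(Vec ι, ℂ)) :
    s (charMul (pair σ w) (tens f g)) =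
      slice σ s f (sndPart w) (charMul (pair (fun i => σ (Sum.inl i)) (fstPart w)) g) := by
  rw [charMul_tens, slice_apply]

theorem continuous_slice (σ : ι ⊕ κ → ℤˣ) (s : 𝓢(Vec (ι ⊕ κ), ℂ) →L[ℂ] ℂ) (f : 𝓢(Vec κ, ℂ))
    (h : 𝓢(Vec ι, ℂ)) : Continuous fun p => slice σ s f p h :=
  s.continuous.comp ((continuous_charMul (tens f h)).comp (pairSnd σ).continuous)

theorem continuous_osc_slice (σ : ι ⊕ κ → ℤˣ) (s : 𝓢(Vec (ι ⊕ κ), ℂ) →L[ℂ] ℂ) (f : 𝓢(Vec κ, ℂ))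
    (h : 𝓢(Vec ι, ℂ)) :
    Continuous fun w : Vec (ι ⊕ κ) => slice σ s f (sndPart w)
      (charMul (pair (fun i => σ (Sum.inl i)) (fstPart w)) h) := by
  simp only [← apply_charMul_tens]
  exact s.continuous.comp ((continuous_charMul (tens f h)).comp (pair σ).continuous)

theorem contDiff_snd_hasTemperateGrowth (f : 𝓢(Vec κ, ℂ)) :
    (fun z : Vec (ι ⊕ κ) => f (sndPart z)).HasTemperateGrowth :=
  f.hasTemperateGrowth.comp (coords (κ := ι ⊕ κ) (κ' := κ) Sum.inr).hasTemperateGrowth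

theorem mulSnd_apply (f : 𝓢(Vec κ, ℂ)) (t : 𝓢'(Vec (ι ⊕ κ), ℂ)) (Φ : 𝓢(Vec (ι ⊕ κ), ℂ)) :
    mulSnd f t Φ = t (SchwartzMap.smulLeftCLM ℂ (fun z => f (sndPart z)) Φ) := rfl

theorem fourierDist_apply {κ : Type*} [Fintype κ] (σ : κ → ℤˣ) (t : 𝓢'(Vec κ, ℂ))
    (φ : 𝓢(Vec κ, ℂ)) : fourierDist σ t φ = t (fourierTest σ φ) := rfl

/-- `∂^β` in terms of the transform. -/
def derivMul (σ : ι → ℤˣ) (β : ι → ℕ) (φ : 𝓢(Vec ι, ℂ)) : 𝓢(Vec ι, ℂ) :=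
  fourierTestInv σ (monoMul σ β (fourierTest σ φ))

theorem derivMul_zero (σ : ι → ℤˣ) (φ : 𝓢(Vec ι, ℂ)) : derivMul σ 0 φ = φ := by
  simp [derivMul, monoMul_zero]

theorem derivMul_single_add [DecidableEq ι] (σ : ι → ℤˣ) (β : ι → ℕ) (i : ι) (φ : 𝓢(Vec ι, ℂ)) :
    derivMul σ (β + Pi.single i 1) φ = ∂_{(unitVec i : Vec ι)} (derivMul σ β φ) := by
  have h := fourierTest_lineDeriv σ (derivMul σ β φ) (unitVec i)
  rw [← fourierTestInv_fourierTest σ (∂_{(unitVec i : Vec ι)} (derivMul σ β φ)), h, derivMul,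
    derivMul, fourierTest_fourierTestInv, add_comm β, monoMul_add, monoMul_single]

theorem lineDeriv_tens (χ : 𝓢(Vec κ, ℂ)) (φ : 𝓢(Vec ι, ℂ)) (i : ι) :
    partialCLM i (tens χ φ) = tens χ (∂_{(unitVec i : Vec ι)} φ) := by
  ext z
  change (∂_{(unitVec (Sum.inl i) : Vec (ι ⊕ κ))} (tens χ φ) : 𝓢(Vec (ι ⊕ κ), ℂ)) z = _
  rw [tens_apply, SchwartzMap.lineDerivOp_apply, SchwartzMap.lineDerivOp_apply, lineDeriv, lineDeriv]
  have h1 : ∀ t : ℝ, fstPart (z + t • (unitVec (Sum.inl i) : Vec (ι ⊕ κ))) =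
      fstPart z + t • (unitVec i : Vec ι) := by
    intro t
    ext j
    by_cases hj : j = i
    · subst hj; simp [unitVec_same]
    · have : (Sum.inl j : ι ⊕ κ) ≠ Sum.inl i := fun h => hj (Sum.inl_injective h)
      simp [unitVec_of_ne hj, unitVec_of_ne this]
  have h2 : ∀ t : ℝ, sndPart (z + t • (unitVec (Sum.inl i) : Vec (ι ⊕ κ))) = sndPart z := by
    intro t
    ext j
    have : (Sum.inr j : ι ⊕ κ) ≠ Sum.inl i := by simp
    simp [unitVec_of_ne this]
  simp only [tens_apply, h1, h2]
  exact deriv_mul_const_field _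

/-- On products the q-derivatives act on the first factor alone. They are expressed through the
transform because `fibreDist` is defined by means of the inverse transform. -/
theorem multiPartial_tens [DecidableEq ι] (σ : ι → ℤˣ) (χ : 𝓢(Vec κ, ℂ)) (φ : 𝓢(Vec ι, ℂ))
    (β : ι → ℕ) : multiPartial β (tens χ φ) = tens χ (derivMul σ β φ) := by
  induction β using multiIndex_induction with
  | h0 => rw [multiPartial_zero, derivMul_zero]
  | h1 β i ih =>
    rw [add_comm, multiPartial_add, multiPartial_single, ih, lineDeriv_tens, add_comm,
      derivMul_single_add]

theorem hasCompactSupport_tens {χ : 𝓢(Vec κ, ℂ)} {φ : 𝓢(Vec ι, ℂ)} (hχ : HasCompactSupport χ)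
    (hφ : HasCompactSupport φ) : HasCompactSupport (tens χ φ) := by
  have h : IsCompact ((fun p : Vec ι × Vec κ => joinVec p.1 p.2) '' (tsupport φ ×ˢ tsupport χ)) :=
    (hφ.isCompact.prod hχ.isCompact).image continuous_joinVec
  refine HasCompactSupport.of_support_subset_isCompact h fun z hz => ?_
  rw [Function.mem_support, tens_apply] at hz
  exact ⟨(fstPart z, sndPart z), ⟨subset_tsupport _ (left_ne_zero_of_mul hz),
    subset_tsupport _ (right_ne_zero_of_mul hz)⟩, joinVec_fst_snd z⟩

theorem norm_sq_eq_add (z : Vec (ι ⊕ κ)) : ‖z‖ ^ 2 = ‖fstPart z‖ ^ 2 + ‖sndPart z‖ ^ 2 := by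
  simp [EuclideanSpace.norm_sq_eq, Fintype.sum_sum_type]

theorem norm_le_add_parts (z : Vec (ι ⊕ κ)) : ‖z‖ ≤ ‖fstPart z‖ + ‖sndPart z‖ := by
  have h := norm_sq_eq_add z
  have h1 := norm_nonneg (fstPart z)
  have h2 := norm_nonneg (sndPart z)
  nlinarith [norm_nonneg z]

/-- Compactness leaves a gap between the support and the sphere, so that supports of products stay
inside an open ball. -/
theorem exists_support_lt {V : Type*} [NormedAddCommGroup V] [ProperSpace V] {φ : V → ℂ}
    {R : ℝ} (hφ : HasCompactSupport φ) (hs : tsupport φ ⊆ Metric.ball 0 R) :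
    ∃ r < R, ∀ x, φ x ≠ 0 → ‖x‖ ≤ r := by
  rcases (tsupport φ).eq_empty_or_nonempty with h | h
  · exact ⟨R - 1, by linarith, fun x hx => by
      have := subset_tsupport φ hx
      rw [h] at this
      exact this.elim⟩
  · obtain ⟨x, hx, hmax⟩ := hφ.isCompact.exists_isMaxOn h continuous_norm.continuousOn
    exact ⟨‖x‖, by simpa using hs hx, fun y hy => hmax (subset_tsupport φ hy)⟩

theorem tsupport_tens_subset {χ : 𝓢(Vec κ, ℂ)} {φ : 𝓢(Vec ι, ℂ)} {R : ℝ} (hχ : HasCompactSupport χ)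
    (hφ : HasCompactSupport φ) (hχs : tsupport χ ⊆ Metric.ball 0 R)
    (hφs : tsupport φ ⊆ Metric.ball 0 R) : tsupport (tens χ φ) ⊆ Metric.ball 0 (2 * R) := by
  obtain ⟨r, hr, h1⟩ := exists_support_lt hχ hχs
  obtain ⟨r', hr', h2⟩ := exists_support_lt hφ hφs
  have : tsupport (tens χ φ) ⊆ Metric.closedBall 0 (r' + r) := by
    refine closure_minimal (fun z hz => ?_) Metric.isClosed_closedBall
    rw [Function.mem_support, tens_apply] at hz
    rw [mem_closedBall_zero_iff]
    exact (norm_le_add_parts z).trans (add_le_add (h2 _ (left_ne_zero_of_mul hz))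
      (h1 _ (right_ne_zero_of_mul hz)))
  exact this.trans (Metric.closedBall_subset_ball (by linarith))

theorem fourierTest_tens (σ : ι ⊕ κ → ℤˣ) (χ : 𝓢(Vec κ, ℂ)) (φ : 𝓢(Vec ι, ℂ)) (z : Vec (ι ⊕ κ)) :
    fourierTest σ (tens χ φ) z = fourierTest (fun i => σ (Sum.inl i)) φ (fstPart z) *
      fourierTest (fun i => σ (Sum.inr i)) χ (sndPart z) := by
  rw [fourierTest_eq, fourierTest_eq, fourierTest_eq]
  have hi : Integrable fun w => tens χ φ w * chr (pair σ w) z := by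
    refine (tens χ φ).integrable.mul_of_top_left (memLp_top_of_bound (C := 1) ?_ ?_)
    · have : Continuous fun w => chr (pair σ w) z := by
        unfold chr
        fun_prop
      exact this.aestronglyMeasurable
    · exact Eventually.of_forall fun w => (norm_chr _ _).le
  rw [integral_eq_integral_joinVec hi, mul_comm, ← integral_mul_const]
  refine integral_congr_ae (Eventually.of_forall fun p => ?_)
  simp only
  rw [← integral_const_mul]
  refine integral_congr_ae (Eventually.of_forall fun q => ?_)
  simp only [tens_apply, chr, pair_sum, fstPart_joinVec, sndPart_joinVec]
  push_cast
  rw [mul_add, Complex.exp_add]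
  ring

end Slices

/-! ### Bounds by Schwartz seminorms -/

section SBdd

variable {V : Type*} [NormedAddCommGroup V] [NormedSpace ℝ V]

/-- `A` is bounded by a finite sum of Schwartz seminorms. -/
def SBdd (A : 𝓢(V, ℂ) → ℝ) : Prop :=
  ∃ (S : Finset (ℕ × ℕ)) (C : ℝ), 0 ≤ C ∧
    ∀ h, A h ≤ C * ∑ m ∈ S, SchwartzMap.seminorm ℂ m.1 m.2 h

theorem SBdd.mono {A A' : 𝓢(V, ℂ) → ℝ} (h : SBdd A) (hA : ∀ g, A' g ≤ A g) : SBdd A' := by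
  obtain ⟨S, C, hC, hb⟩ := h
  exact ⟨S, C, hC, fun g => (hA g).trans (hb g)⟩

theorem SBdd.const_mul {A : 𝓢(V, ℂ) → ℝ} (h : SBdd A) {c : ℝ} (hc : 0 ≤ c) :
    SBdd fun g => c * A g := by
  obtain ⟨S, C, hC, hb⟩ := h
  exact ⟨S, c * C, by positivity, fun g => by
    rw [mul_assoc]; exact mul_le_mul_of_nonneg_left (hb g) hc⟩

theorem SBdd.add {A A' : 𝓢(V, ℂ) → ℝ} (h : SBdd A) (h' : SBdd A') : SBdd fun g => A g + A' g := by
  classical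
  obtain ⟨S, C, hC, hb⟩ := h
  obtain ⟨S', C', hC', hb'⟩ := h'
  refine ⟨S ∪ S', C + C', by positivity, fun g => ?_⟩
  rw [add_mul]
  refine add_le_add ((hb g).trans ?_) ((hb' g).trans ?_)
  · exact mul_le_mul_of_nonneg_left (Finset.sum_le_sum_of_subset_of_nonneg
      Finset.subset_union_left fun _ _ _ => apply_nonneg _ _) hC
  · exact mul_le_mul_of_nonneg_left (Finset.sum_le_sum_of_subset_of_nonneg
      Finset.subset_union_right fun _ _ _ => apply_nonneg _ _) hC'

theorem sBdd_zero : SBdd fun _ : 𝓢(V, ℂ) => (0 : ℝ) := ⟨∅, 0, le_rfl, fun _ => by simp⟩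

theorem SBdd.sum {I : Type*} (s : Finset I) {A : I → 𝓢(V, ℂ) → ℝ} (h : ∀ i ∈ s, SBdd (A i)) :
    SBdd fun g => ∑ i ∈ s, A i g := by
  classical
  induction s using Finset.induction_on with
  | empty => simpa using sBdd_zero
  | insert a s ha ih =>
    simp only [Finset.sum_insert ha]
    exact (h a (Finset.mem_insert_self _ _)).add (ih fun i hi => h i (Finset.mem_insert_of_mem hi))

theorem sBdd_seminorm (k n : ℕ) : SBdd fun g : 𝓢(V, ℂ) => SchwartzMap.seminorm ℂ k n g :=
  ⟨{(k, n)}, 1, zero_le_one, fun g => by simp⟩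

theorem sBdd_of_continuous (q : Seminorm ℂ 𝓢(V, ℂ)) (hq : Continuous q) : SBdd q := by
  obtain ⟨S, C, -, h⟩ := Seminorm.bound_of_continuous (schwartz_withSeminorms ℂ V ℂ) q hq
  refine ⟨S, C, C.2, fun g => (h g).trans ?_⟩
  rw [_root_.smul_apply]
  have h1 := Seminorm.finset_sup_le_sum (schwartzSeminormFamily ℂ V ℂ) S g
  have h2 : (∑ i ∈ S, schwartzSeminormFamily ℂ V ℂ i) g =
      ∑ m ∈ S, SchwartzMap.seminorm ℂ m.1 m.2 g := by
    have : ∀ T : Finset (ℕ × ℕ), (∑ i ∈ T, schwartzSeminormFamily ℂ V ℂ i) g =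
        ∑ m ∈ T, SchwartzMap.seminorm ℂ m.1 m.2 g := by
      classical
      intro T
      induction T using Finset.induction_on with
      | empty => simp
      | insert a T ha ih =>
        rw [Finset.sum_insert ha, Finset.sum_insert ha, _root_.add_apply, ih]; rfl
    exact this S
  rw [h2] at h1
  exact mul_le_mul_of_nonneg_left h1 C.2

theorem SBdd.comp {W : Type*} [NormedAddCommGroup W] [NormedSpace ℝ W] {A : 𝓢(V, ℂ) → ℝ}
    (h : SBdd A) (L : 𝓢(W, ℂ) →L[ℂ] 𝓢(V, ℂ)) : SBdd fun g => A (L g) := by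
  obtain ⟨S, C, hC, hb⟩ := h
  refine SBdd.mono ((SBdd.sum S fun m _ => ?_).const_mul hC) fun g => hb (L g)
  have hq : Continuous ((SchwartzMap.seminorm ℂ m.1 m.2).comp (L : 𝓢(W, ℂ) →ₗ[ℂ] 𝓢(V, ℂ))) :=
    ((schwartz_withSeminorms ℂ V ℂ).continuous_seminorm m).comp L.continuous
  exact sBdd_of_continuous _ hq

theorem sBdd_norm_apply (u : 𝓢(V, ℂ) →L[ℂ] ℂ) : SBdd fun g => ‖u g‖ :=
  sBdd_of_continuous ((normSeminorm ℂ ℂ).comp (u : 𝓢(V, ℂ) →ₗ[ℂ] ℂ))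
    (continuous_norm.comp u.continuous)

theorem sBdd_integral_norm [FiniteDimensional ℝ V] [MeasurableSpace V] [BorelSpace V]
    (μ : Measure V) [μ.HasTemperateGrowth] : SBdd fun g : 𝓢(V, ℂ) => ∫ x, ‖g x‖ ∂μ := by
  refine SBdd.mono (((sBdd_seminorm 0 0).add (sBdd_seminorm (0 + μ.integrablePower) 0)).const_mul
    (c := 2 ^ μ.integrablePower * (∫ x, (1 + ‖x‖) ^ (- (μ.integrablePower : ℝ)) ∂μ)) ?_) fun g => ?_
  · exact mul_nonneg (by positivity) (integral_nonneg fun x => by positivity)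
  · simpa using g.integral_pow_mul_iteratedFDeriv_le (𝕜 := ℂ) (μ := μ) 0 0

theorem SBdd.exists_charMul {A : 𝓢(V, ℂ) → ℝ} (h : SBdd A) (B : ℝ) :
    ∃ A' : 𝓢(V, ℂ) → ℝ, SBdd A' ∧ ∀ ℓ : V →L[ℝ] ℝ, ‖ℓ‖ ≤ B → ∀ g, A (charMul ℓ g) ≤ A' g := by
  obtain ⟨S, C, hC, hb⟩ := h
  refine ⟨fun g => C * ∑ m ∈ S, (1 + |B|) ^ m.2 * ∑ i ∈ Finset.range (m.2 + 1),
    (m.2.choose i : ℝ) * SchwartzMap.seminorm ℂ m.1 (m.2 - i) g, ?_, fun ℓ hℓ g => ?_⟩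
  · exact (SBdd.sum _ fun m _ => (SBdd.sum _ fun i _ => (sBdd_seminorm _ _).const_mul
      (by positivity)).const_mul (by positivity)).const_mul hC
  · refine (hb _).trans (mul_le_mul_of_nonneg_left (Finset.sum_le_sum fun m _ => ?_) hC)
    refine (seminorm_charMul_le _ _ _ _).trans ?_
    gcongr
    exact hℓ.trans (le_abs_self B)

theorem seminorm_dil_le (k n j : ℕ) (g : 𝓢(V, ℂ)) :
    SchwartzMap.seminorm ℂ k n (dil j g) ≤ ((2 : ℝ) ^ j) ^ k * SchwartzMap.seminorm ℂ k n g := by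
  refine SchwartzMap.seminorm_le_bound ℂ k n _ (by positivity) fun x => ?_
  have h' : (⇑(dil j g) : V → ℂ) = fun x => g (0 + (2⁻¹ : ℝ) ^ j • x) := funext fun x => by simp
  rw [h']
  have h1 := norm_iteratedFDeriv_comp_smul_le (g.smooth ⊤) (c := (2⁻¹ : ℝ) ^ j) (by positivity)
    (pow_le_one₀ (by norm_num) (by norm_num)) n 0 x
  have h2 := SchwartzMap.le_seminorm ℂ k n g (0 + (2⁻¹ : ℝ) ^ j • x)
  have h3 : ‖x‖ = 2 ^ j * ‖0 + (2⁻¹ : ℝ) ^ j • x‖ := by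
    rw [zero_add, norm_smul, Real.norm_of_nonneg (by positivity), ← mul_assoc, ← mul_pow]
    norm_num
  rw [h3, mul_pow, mul_assoc]
  refine mul_le_mul_of_nonneg_left (le_trans ?_ h2) (by positivity)
  exact mul_le_mul_of_nonneg_left h1 (by positivity)

/-- Dilation to scale 2^j decreases derivatives and enlarges only the weights, so the loss is a
fixed power of 2^j. Rapid decay makes up for it in `dyadicBound_of_vanishing`. -/
theorem SBdd.exists_dil {A : 𝓢(V, ℂ) → ℝ} (h : SBdd A) :
    ∃ (A' : 𝓢(V, ℂ) → ℝ) (K : ℕ), SBdd A' ∧ ∀ j g, A (dil j g) ≤ ((2 : ℝ) ^ j) ^ K * A' g := by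
  obtain ⟨S, C, hC, hb⟩ := h
  refine ⟨fun g => C * ∑ m ∈ S, SchwartzMap.seminorm ℂ m.1 m.2 g, ∑ m ∈ S, m.1,
    (SBdd.sum _ fun m _ => sBdd_seminorm _ _).const_mul hC, fun j g => ?_⟩
  refine (hb _).trans ?_
  rw [mul_left_comm]
  refine mul_le_mul_of_nonneg_left ?_ hC
  rw [Finset.mul_sum]
  refine Finset.sum_le_sum fun m hm => ?_
  refine (seminorm_dil_le _ _ _ _).trans (mul_le_mul_of_nonneg_right ?_ (apply_nonneg _ _))
  refine pow_le_pow_right₀ (one_le_pow₀ one_le_two) ?_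
  exact Finset.single_le_sum (f := fun m : ℕ × ℕ => m.1) (fun _ _ => Nat.zero_le _) hm

theorem SBdd.exists_cutoff_le {A : 𝓢(V, ℂ) → ℝ} (h : SBdd A) (g : 𝓢(V, ℂ)) (C : ℕ → ℝ) (L : ℕ) :
    ∃ M : ℝ, 0 ≤ M ∧ ∀ (h : V → ℂ) (r : ℝ) (G : 𝓢(V, ℂ)), ContDiff ℝ ∞ h →
      (∀ i x, ‖iteratedFDeriv ℝ i h x‖ ≤ C i) → 0 < r → (∀ x, ‖x‖ < r → h x = 0) →
      (∀ x, G x = h x * g x) → A G ≤ M * (r⁻¹) ^ L := by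
  obtain ⟨S, C', hC', hb⟩ := h
  choose M hM0 hM using fun m : ℕ × ℕ => exists_seminorm_cutoff_le g C m.1 m.2 L
  refine ⟨C' * ∑ m ∈ S, M m, mul_nonneg hC' (Finset.sum_nonneg fun m _ => hM0 m),
    fun h r G h1 h2 h3 h4 h5 => (hb G).trans ?_⟩
  rw [mul_assoc, Finset.sum_mul]
  exact mul_le_mul_of_nonneg_left (Finset.sum_le_sum fun m _ => hM m h r G h1 h2 h3 h4 h5) hC'

end SBdd

/-! ### Distributions that vanish near the origin in momentum space -/

section Far

variable {ι κ : Type*} [Fintype ι] [Fintype κ]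

theorem charMul_dil_eq (σ : ι → ℤˣ) (k : ℕ) (q : Vec ι) (η : 𝓢(Vec ι, ℂ)) :
    charMul (pair σ q) (dil k (fourierTest σ η)) =
      fourierTest σ (kernelScal (Units.mk0 ((2 : ℝ) ^ k) (by positivity)) q η) := by
  rw [fourierTest_kernelScal σ _ (by simp) q η]
  rfl

/-- The modulated dilate of ψ is the transform of a Schwartz bump of width 2^{-k} around q. Its part
inside the ball of radius R is annihilated by `T p`. For |q| ≤ R/4 what is left is the tail of a
Schwartz function at distances at least 2^k R/4, which is smaller than any power of 2^{-k}. -/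
theorem dyadicBound_of_vanishing (σ : ι → ℤˣ) (T : Vec κ → 𝓢(Vec ι, ℂ) →L[ℂ] ℂ) {R ρ a : ℝ}
    (hR : 0 < R)
    (h0 : ∀ p, ∀ φ : 𝓢(Vec ι, ℂ), HasCompactSupport φ → tsupport φ ⊆ Metric.ball 0 R →
      T p (fourierTest σ φ) = 0)
    (hb : ∃ A : 𝓢(Vec ι, ℂ) → ℝ, SBdd A ∧ ∀ p h, ‖T p h‖ ≤ A h)
    (hc : ∀ h, Continuous fun z : Vec (ι ⊕ κ) => T (sndPart z) (charMul (pair σ (fstPart z)) h))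
    (ha : 0 ≤ a) (hρ : ρ ≤ R / 4) : DyadicBound σ (fun _ => T) ρ a := by
  refine ⟨fun ψ _ => ?_, fun ψ _ k => hc _⟩
  obtain ⟨A, hA, hTA⟩ := hb
  obtain ⟨A₁, hA₁, hA₁b⟩ := hA.exists_charMul (‖pair σ‖ * ρ)
  obtain ⟨A₂, K, hA₂, hA₂b⟩ := hA₁.exists_dil
  obtain ⟨χ, hχ, hχc, hχs, hχ1, hχ0, hχle⟩ := exists_cutoff (V := Vec ι) hR
  have hχC : BddSmooth fun x : Vec ι => (χ x : ℂ) :=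
    .of_hasCompactSupport (Complex.ofRealCLM.contDiff.comp hχ)
      (hχc.comp_left (g := Complex.ofReal) Complex.ofReal_zero)
  have h1χ := hχC.const_sub 1
  choose C hC using h1χ.bound
  obtain ⟨L, hL⟩ := exists_nat_ge a
  set η := fourierTestInv σ ψ
  -- Of the K + 1 + L powers of 2^{-k}, K compensate the dilation, one is the factor 2^{-k} of the
  -- dyadic bound, and L ≥ a give (2^{-k})^a.
  obtain ⟨M, hM0, hM⟩ := (hA₂.comp (fourierTest σ)).exists_cutoff_le η C (K + 1 + L)
  refine ⟨M * ((R / 4)⁻¹) ^ (K + 1 + L), fun k p q hq => ?_⟩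
  set c : ℝˣ := Units.mk0 ((2 : ℝ) ^ k) (by positivity)
  have hψη : ψ = fourierTest σ η := by simp [η]
  have hcinv : ((c⁻¹ : ℝˣ) : ℝ) = (2⁻¹ : ℝ) ^ k := by simp [c]
  have hp : (0 : ℝ) < (2⁻¹ : ℝ) ^ k := by positivity
  have hp1 : (2⁻¹ : ℝ) ^ k ≤ 1 := pow_le_one₀ (by norm_num) (by norm_num)
  set h : Vec ι → ℂ := fun x => 1 - (χ (q + (2⁻¹ : ℝ) ^ k • x) : ℂ)
  have hh : ContDiff ℝ ∞ h := h1χ.smooth.comp (contDiff_const.add (contDiff_const_smul _))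
  have hhC : ∀ i x, ‖iteratedFDeriv ℝ i h x‖ ≤ C i := fun i x =>
    (norm_iteratedFDeriv_comp_smul_le h1χ.smooth hp.le hp1 i q x).trans (hC i _)
  have hht : h.HasTemperateGrowth := BddSmooth.hasTemperateGrowth ⟨hh, fun i => ⟨C i, hhC i⟩⟩
  set G := SchwartzMap.smulLeftCLM ℂ h η
  have hG : ∀ x, G x = h x * η x := fun x => by
    simp only [G]
    rw [SchwartzMap.smulLeftCLM_apply_apply hht, smul_eq_mul]
  -- η - G is η times the cutoff χ pulled back to the scale 2^{-k} around q, so its rescaled copy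
  -- lives on the support of χ and is annihilated by `T p`.
  have hkey : ∀ x, kernelScal c q (η - G) x ≠ 0 → χ x ≠ 0 := by
    intro x hx hx0
    refine hx ?_
    have h1 : q + (2⁻¹ : ℝ) ^ k • (((c : ℝ)) • (x - q)) = x := by
      simp [c, smul_smul]
    have h2 : h ((c : ℝ) • (x - q)) = 1 := by
      simp only [h]
      rw [h1, hx0]; simp
    rw [kernelScal_apply, _root_.sub_apply, hG, h2]
    ring
  have hcut : T p (charMul (pair σ q) (dil k ψ)) =
      T p (charMul (pair σ q) (dil k (fourierTest σ G))) := by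
    rw [← sub_eq_zero, ← map_sub, ← map_sub, ← map_sub, hψη, ← map_sub, charMul_dil_eq]
    exact h0 p _ (hχc.mono hkey) ((closure_mono hkey).trans hχs)
  have hGA : A₂ (fourierTest σ G) ≤ M * ((R / 4 * 2 ^ k)⁻¹) ^ (K + 1 + L) := by
    refine hM h (R / 4 * 2 ^ k) G hh hhC (by positivity) (fun x hx => ?_) hG
    have : ‖q + (2⁻¹ : ℝ) ^ k • x‖ ≤ R / 2 := by
      have h2 : ‖(2⁻¹ : ℝ) ^ k • x‖ ≤ R / 4 := by
        rw [norm_smul, Real.norm_of_nonneg hp.le, inv_pow, inv_mul_le_iff₀ (by positivity), mul_comm]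
        exact hx.le
      linarith [norm_add_le q ((2⁻¹ : ℝ) ^ k • x)]
    simp only [h]
    rw [hχ1 _ this]; simp
  have hℓ : ‖pair σ q‖ ≤ ‖pair σ‖ * ρ :=
    ((pair σ).le_opNorm q).trans (mul_le_mul_of_nonneg_left hq (norm_nonneg _))
  rw [hcut]
  refine (hTA p _).trans ((hA₁b _ hℓ _).trans ((hA₂b k _).trans ?_))
  refine (mul_le_mul_of_nonneg_left hGA (by positivity)).trans ?_
  have h5 : ((2 : ℝ) ^ k) ^ K * (M * ((R / 4 * 2 ^ k)⁻¹) ^ (K + 1 + L)) =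
      M * ((R / 4)⁻¹) ^ (K + 1 + L) * ((2⁻¹ : ℝ) ^ k * ((2⁻¹ : ℝ) ^ k) ^ L) := by
    rw [mul_inv, mul_pow, inv_pow 2 k, inv_pow _ (K + 1 + L), inv_pow _ (K + 1 + L),
      inv_pow _ L, pow_add ((2 : ℝ) ^ k), pow_add ((2 : ℝ) ^ k)]
    field_simp
  rw [h5]
  refine mul_le_mul_of_nonneg_left (mul_le_mul_of_nonneg_left ?_ hp.le) (by positivity)
  calc ((2⁻¹ : ℝ) ^ k) ^ L = ((2⁻¹ : ℝ) ^ k) ^ (L : ℝ) := (Real.rpow_natCast _ _).symm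
    _ ≤ ((2⁻¹ : ℝ) ^ k) ^ a := Real.rpow_le_rpow_of_exponent_ge hp hp1 hL
    _ ≤ _ := Real.rpow_le_rpow hp.le (by linarith [norm_nonneg q]) ha

end Far

/-! ### Distributions given by continuous functions of momentum -/

section Near

variable {ι κ : Type*} [Fintype ι] [Fintype κ]

/-- The distribution in `y` whose transform is the function `q ↦ τ(q, p)`. -/
def fibreDist (σ : ι → ℤˣ) (τ : Vec (ι ⊕ κ) → ℂ) (hτ : Continuous τ)
    (hB : ∃ C : ℝ, ∀ z, ‖τ z‖ ≤ C) (p : Vec κ) : 𝓢(Vec ι, ℂ) →L[ℂ] ℂ :=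
  (boundedDist (fun q => τ (joinVec q p))
    (hτ.comp (continuous_joinVec.comp (Continuous.prodMk_left p)))
    ⟨hB.choose, fun q => hB.choose_spec _⟩).comp (fourierTestInv σ)

theorem fibreDist_apply (σ : ι → ℤˣ) (τ : Vec (ι ⊕ κ) → ℂ) (hτ : Continuous τ)
    (hB : ∃ C : ℝ, ∀ z, ‖τ z‖ ≤ C) (p : Vec κ) (h : 𝓢(Vec ι, ℂ)) :
    fibreDist σ τ hτ hB p h = ∫ q, τ (joinVec q p) * fourierTestInv σ h q :=
  boundedDist_apply (fun q => τ (joinVec q p))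
    (hτ.comp (continuous_joinVec.comp (Continuous.prodMk_left p)))
    ⟨hB.choose, fun _ => hB.choose_spec _⟩ _

/-- The pairing with a modulated dilate is an average of τ(·, p) around q at scale 2^{-k}. -/
theorem fibreDist_charMul_dil (σ : ι → ℤˣ) (τ : Vec (ι ⊕ κ) → ℂ) (hτ : Continuous τ)
    (hB : ∃ C : ℝ, ∀ z, ‖τ z‖ ≤ C) (p : Vec κ) (q : Vec ι) (k : ℕ) (ψ : 𝓢(Vec ι, ℂ)) :
    fibreDist σ τ hτ hB p (charMul (pair σ q) (dil k ψ)) =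
      ∫ x, τ (joinVec (q + (2⁻¹ : ℝ) ^ k • x) p) * fourierTestInv σ ψ x := by
  have hψ : ψ = fourierTest σ (fourierTestInv σ ψ) := by simp
  conv_lhs => rw [hψ]
  rw [charMul_dil_eq, fibreDist_apply, fourierTestInv_fourierTest,
    integral_kernelScal_mul _ (by simp) q _ (fun x => τ (joinVec x p))]
  simp

theorem continuous_integral_comp_mul {X V W : Type*} [TopologicalSpace X] [FirstCountableTopology X]
    [NormedAddCommGroup V] [NormedSpace ℝ V] [MeasurableSpace V] [BorelSpace V]
    [FiniteDimensional ℝ V] (μ : Measure V) [μ.HasTemperateGrowth]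
    [TopologicalSpace W] {τ : W → ℂ} (hτ : Continuous τ)
    (hB : ∃ C : ℝ, ∀ z, ‖τ z‖ ≤ C) {L : X → V → W} (hL : Continuous (Function.uncurry L))
    (η : 𝓢(V, ℂ)) : Continuous fun x => ∫ v, τ (L x v) * η v ∂μ := by
  obtain ⟨C, hC⟩ := hB
  refine continuous_of_dominated (bound := fun v => C * ‖η v‖) (fun x => ?_) (fun x => ?_)
    ((η.integrable (μ := μ)).norm.const_mul C) ?_
  · exact ((hτ.comp (hL.comp (Continuous.prodMk_right x))).mul η.continuous).aestronglyMeasurable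
  · refine Eventually.of_forall fun v => ?_
    rw [norm_mul]
    exact mul_le_mul_of_nonneg_right (hC _) (norm_nonneg _)
  · exact Eventually.of_forall fun v =>
      (hτ.comp (hL.comp (Continuous.prodMk_left v))).mul continuous_const

theorem continuous_fibreDist (σ : ι → ℤˣ) (τ : Vec (ι ⊕ κ) → ℂ) (hτ : Continuous τ)
    (hB : ∃ C : ℝ, ∀ z, ‖τ z‖ ≤ C) (h : 𝓢(Vec ι, ℂ)) :
    Continuous fun p => fibreDist σ τ hτ hB p h := by
  simp only [fibreDist_apply]
  exact continuous_integral_comp_mul volume hτ hB (L := fun p q => joinVec q p)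
    (continuous_joinVec.comp continuous_swap) _

theorem continuous_osc_fibreDist (σ : ι → ℤˣ) (τ : Vec (ι ⊕ κ) → ℂ) (hτ : Continuous τ)
    (hB : ∃ C : ℝ, ∀ z, ‖τ z‖ ≤ C) (h : 𝓢(Vec ι, ℂ)) :
    Continuous fun z : Vec (ι ⊕ κ) =>
      fibreDist σ τ hτ hB (sndPart z) (charMul (pair σ (fstPart z)) h) := by
  have h1 : ∀ z : Vec (ι ⊕ κ), fibreDist σ τ hτ hB (sndPart z) (charMul (pair σ (fstPart z)) h) =
      ∫ x, τ (joinVec (fstPart z + x) (sndPart z)) * fourierTestInv σ h x := by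
    intro z
    have h2 := fibreDist_charMul_dil σ τ hτ hB (sndPart z) (fstPart z) 0 h
    have h3 : dil 0 h = h := by ext y; simp
    rw [h3] at h2
    simpa using h2
  simp only [h1]
  refine continuous_integral_comp_mul volume hτ hB
    (L := fun (z : Vec (ι ⊕ κ)) x => joinVec (fstPart z + x) (sndPart z)) ?_ _
  exact continuous_joinVec.comp (((coords Sum.inl).continuous.comp continuous_fst |>.add
    continuous_snd).prodMk ((coords Sum.inr).continuous.comp continuous_fst))

/-- From |q + 2^{-k}x| ≤ (2^{-k} + |q|)(1 + |x|): the Schwartz weight of the average absorbs the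
power of 1 + |x|. The factor 2^{-k} put into the family is the one gained by dividing the shell
function by a coordinate. -/
theorem dyadicBound_fibreDist (σ : ι → ℤˣ) (τ : Vec (ι ⊕ κ) → ℂ) (hτ : Continuous τ)
    (hB : ∃ C : ℝ, ∀ z, ‖τ z‖ ≤ C) {c a : ℝ} (hc : 0 ≤ c) (ha : 0 ≤ a)
    (hb : ∀ z, ‖τ z‖ ≤ c * ‖fstPart z‖ ^ a) (ρ : ℝ) :
    DyadicBound σ (fun k p => ((2⁻¹ : ℂ) ^ k) • fibreDist σ τ hτ hB p) ρ a := by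
  refine ⟨fun ψ _ => ?_, fun ψ _ k => ?_⟩
  · obtain ⟨n, hn⟩ := exists_nat_ge a
    set η := fourierTestInv σ ψ
    set g : Vec ι → ℝ := fun x => 2 ^ n * (‖η x‖ + ‖x‖ ^ n * ‖η x‖)
    have hg : Integrable g := by
      refine (Integrable.add ?_ (η.integrable_pow_mul volume n)).const_mul _
      simpa using η.integrable_pow_mul volume 0
    refine ⟨c * ∫ x, g x, fun k p q _ => ?_⟩
    set h := (2⁻¹ : ℝ) ^ k
    have hh : 0 < h := by positivity
    rw [_root_.smul_apply, fibreDist_charMul_dil, norm_smul, norm_pow, norm_inv,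
      Complex.norm_ofNat]
    have h1 : ‖∫ x, τ (joinVec (q + h • x) p) * η x‖ ≤ ∫ x, c * (h + ‖q‖) ^ a * g x := by
      refine norm_integral_le_of_norm_le (hg.const_mul _) (Eventually.of_forall fun x => ?_)
      rw [norm_mul]
      have h2 := hb (joinVec (q + h • x) p)
      rw [fstPart_joinVec] at h2
      have h3 : ‖q + h • x‖ ≤ (h + ‖q‖) * (1 + ‖x‖) := by
        refine (norm_add_le _ _).trans ?_
        rw [norm_smul, Real.norm_of_nonneg hh.le]
        nlinarith [norm_nonneg q, norm_nonneg x]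
      have h4 : ‖q + h • x‖ ^ a ≤ (h + ‖q‖) ^ a * (1 + ‖x‖) ^ n := by
        refine (Real.rpow_le_rpow (norm_nonneg _) h3 ha).trans ?_
        rw [Real.mul_rpow (by positivity) (by positivity), ← Real.rpow_natCast]
        gcongr
        linarith [norm_nonneg x]
      have h5 : (1 + ‖x‖) ^ n ≤ 2 ^ n * (1 + ‖x‖ ^ n) := by
        have h6 : (1 + ‖x‖) ^ n ≤ (2 * max 1 ‖x‖) ^ n :=
          pow_le_pow_left₀ (by positivity)
            (by linarith [le_max_left 1 ‖x‖, le_max_right 1 ‖x‖]) n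
        refine h6.trans ?_
        rw [mul_pow]
        refine mul_le_mul_of_nonneg_left ?_ (by positivity)
        rcases max_choice 1 ‖x‖ with h | h <;> rw [h]
        · rw [one_pow]; linarith [pow_nonneg (norm_nonneg x) n]
        · linarith
      calc ‖τ (joinVec (q + h • x) p)‖ * ‖η x‖
          ≤ (c * ((h + ‖q‖) ^ a * (2 ^ n * (1 + ‖x‖ ^ n)))) * ‖η x‖ := by
            refine mul_le_mul_of_nonneg_right (h2.trans ?_) (norm_nonneg _)
            refine mul_le_mul_of_nonneg_left (h4.trans ?_) hc
            exact mul_le_mul_of_nonneg_left h5 (by positivity)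
        _ = _ := by simp only [g]; ring
    rw [integral_const_mul] at h1
    refine (mul_le_mul_of_nonneg_left h1 (by positivity)).trans (le_of_eq ?_)
    simp only [h, inv_pow]
    ring
  · exact (continuous_osc_fibreDist σ τ hτ hB (dil k ψ)).const_smul ((2⁻¹ : ℂ) ^ k)

end Near

/-! ### Polynomials in `q` with coefficients that are continuous in `q'` -/

section Poly

variable {ι κ : Type*} [Fintype ι] [Fintype κ]

/-- The monomial `c(q') q^γ`. -/
def monom (γ : ι → ℕ) (c : Vec κ → ℂ) (z : Vec (ι ⊕ κ)) : ℂ :=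
  c (sndPart z) * ((∏ i, fstPart z i ^ γ i : ℝ) : ℂ)

/-- Polynomials in `q` of degree less than `D` with coefficients that are continuous in `q'`. -/
def polySpan (ι κ : Type*) [Fintype ι] [Fintype κ] (D : ℕ) : Submodule ℂ (Vec (ι ⊕ κ) → ℂ) :=
  Submodule.span ℂ {P | ∃ (γ : ι → ℕ) (c : Vec κ → ℂ), ∑ i, γ i < D ∧ Continuous c ∧ P = monom γ c}

theorem monom_mem {D : ℕ} {γ : ι → ℕ} (hγ : ∑ i, γ i < D) {c : Vec κ → ℂ} (hc : Continuous c) :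
    monom γ c ∈ polySpan ι κ D :=
  Submodule.subset_span ⟨γ, c, hγ, hc, rfl⟩

theorem polySum_mem [DecidableEq ι] (D : ℕ) {c : (ι → ℕ) → Vec κ → ℂ} (hc : ∀ γ, Continuous (c γ)) :
    polySum D c ∈ polySpan ι κ D := by
  have h : polySum D c = ∑ k ∈ Finset.range D, ∑ γ ∈ Finset.piAntidiag (Finset.univ : Finset ι) k,
      monom γ (c γ) := by
    ext z
    simp [polySum, monom]
  rw [h]
  refine Submodule.sum_mem _ fun k hk => Submodule.sum_mem _ fun γ hγ => monom_mem ?_ (hc γ)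
  rw [(Finset.mem_piAntidiag.1 hγ).1]
  exact Finset.mem_range.1 hk

theorem continuous_monom (γ : ι → ℕ) {c : Vec κ → ℂ} (hc : Continuous c) :
    Continuous (monom (ι := ι) γ c) := by
  unfold monom
  refine (hc.comp (coords Sum.inr).continuous).mul (Complex.continuous_ofReal.comp ?_)
  exact continuous_finsetProd _ fun i _ => by
    have : Continuous fun z : Vec (ι ⊕ κ) => fstPart z i :=
      (PiLp.proj (𝕜 := ℝ) 2 (fun _ : ι => ℝ) i).continuous.comp (coords Sum.inl).continuous
    exact this.pow _

theorem continuous_of_mem_polySpan {D : ℕ} {P : Vec (ι ⊕ κ) → ℂ} (hP : P ∈ polySpan ι κ D) :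
    Continuous P := by
  induction hP using Submodule.span_induction with
  | mem P h => obtain ⟨γ, c, -, hc, rfl⟩ := h; exact continuous_monom γ hc
  | zero => exact continuous_const
  | add P Q _ _ h h' => exact h.add h'
  | smul a P _ h => exact h.const_smul a

theorem hasLineDerivAt_monom [DecidableEq ι] (γ : ι → ℕ) (c : Vec κ → ℂ) (i : ι) (z : Vec (ι ⊕ κ)) :
    HasLineDerivAt ℝ (monom γ c) (((γ i : ℂ) • monom (γ - Pi.single i 1) c) z) z
      (unitVec (Sum.inl i)) := by
  set K : ℝ := ∏ j ∈ Finset.univ.erase i, z (Sum.inl j) ^ γ j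
  have h1 : ∀ t : ℝ, monom γ c (z + t • (unitVec (Sum.inl i) : Vec (ι ⊕ κ))) =
      c (sndPart z) * (((z (Sum.inl i) + t) ^ γ i * K : ℝ) : ℂ) := by
    intro t
    have h2 : sndPart (z + t • (unitVec (Sum.inl i) : Vec (ι ⊕ κ))) = sndPart z := by
      ext j
      have : (Sum.inr j : ι ⊕ κ) ≠ Sum.inl i := by simp
      simp [unitVec_of_ne this]
    rw [monom, h2, ← Finset.mul_prod_erase _ _ (Finset.mem_univ i)]
    congr 3
    · simp [unitVec_same]
    · refine Finset.prod_congr rfl fun j hj => ?_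
      have : (Sum.inl j : ι ⊕ κ) ≠ Sum.inl i := fun h =>
        Finset.ne_of_mem_erase hj (Sum.inl_injective h)
      simp [unitVec_of_ne this]
  have h3 : ((γ i : ℂ) • monom (γ - Pi.single i 1) c) z =
      c (sndPart z) * ((γ i * z (Sum.inl i) ^ (γ i - 1) * K : ℝ) : ℂ) := by
    rw [Pi.smul_apply, smul_eq_mul, monom, ← Finset.mul_prod_erase _ _ (Finset.mem_univ i)]
    have : ∏ j ∈ Finset.univ.erase i, fstPart z j ^ (γ - Pi.single i 1 : ι → ℕ) j = K := by
      refine Finset.prod_congr rfl fun j hj => ?_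
      simp [Finset.ne_of_mem_erase hj]
    rw [this]
    simp only [coords_apply, Pi.sub_apply, Pi.single_eq_same]
    push_cast
    ring
  rw [HasLineDerivAt, h3]
  simp only [h1]
  refine HasDerivAt.const_mul _ (HasDerivAt.ofReal_comp ?_)
  refine HasDerivAt.mul_const ?_ K
  have h4 : HasDerivAt (fun t : ℝ => z (Sum.inl i) + t) 1 0 := (hasDerivAt_id 0).const_add _
  simpa using h4.fun_pow (γ i)

theorem exists_lineDeriv_of_mem_polySpan [DecidableEq ι] {D : ℕ} {P : Vec (ι ⊕ κ) → ℂ}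
    (hP : P ∈ polySpan ι κ D) (i : ι) : ∃ P' ∈ polySpan ι κ (D - 1),
      ∀ z, HasLineDerivAt ℝ P (P' z) z (unitVec (Sum.inl i)) := by
  induction hP using Submodule.span_induction with
  | mem P h =>
    obtain ⟨γ, c, hγ, hc, rfl⟩ := h
    refine ⟨_, ?_, hasLineDerivAt_monom γ c i⟩
    rcases Nat.eq_zero_or_pos (γ i) with h0 | h0
    · rw [h0, Nat.cast_zero, zero_smul]; exact Submodule.zero_mem _
    · refine Submodule.smul_mem _ _ (monom_mem ?_ hc)
      have h1 : γ = (γ - Pi.single i 1) + Pi.single i 1 := by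
        ext j
        by_cases hj : j = i
        · subst hj; simp; omega
        · simp [hj]
      have h2 := sum_add_single (γ - Pi.single i 1) i 1
      rw [← h1] at h2
      omega
  | zero =>
    refine ⟨0, Submodule.zero_mem _, fun z => ?_⟩
    exact (hasDerivAt_const (0 : ℝ) (0 : ℂ))
  | add P Q _ _ h h' =>
    obtain ⟨P', hP', h1⟩ := h
    obtain ⟨Q', hQ', h2⟩ := h'
    exact ⟨P' + Q', Submodule.add_mem _ hP' hQ', fun z => HasDerivAt.add (h1 z) (h2 z)⟩
  | smul a P _ h =>
    obtain ⟨P', hP', h1⟩ := h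
    exact ⟨a • P', Submodule.smul_mem _ _ hP', fun z => HasDerivAt.const_smul a (h1 z)⟩

/-- Every integration by parts lowers the degree by one; the signs go into P'. For |γ| ≥ D the
truncated difference is 0 and P' = 0. -/
theorem exists_multiPartial_of_mem_polySpan [DecidableEq ι] {D : ℕ} {P : Vec (ι ⊕ κ) → ℂ}
    (hP : P ∈ polySpan ι κ D) (γ : ι → ℕ) : ∃ P' ∈ polySpan ι κ (D - ∑ i, γ i),
      ∀ φ : 𝓢(Vec (ι ⊕ κ), ℂ), HasCompactSupport φ →
        ∫ z, P z * multiPartial γ φ z = ∫ z, P' z * φ z := by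
  induction γ using multiIndex_induction with
  | h0 => exact ⟨P, by simpa using hP, fun φ _ => by rw [multiPartial_zero]⟩
  | h1 γ i ih =>
    obtain ⟨P₁, hP₁, h1⟩ := ih
    obtain ⟨P₂, hP₂, h2⟩ := exists_lineDeriv_of_mem_polySpan hP₁ i
    refine ⟨-P₂, Submodule.neg_mem _ ?_, fun φ hφ => ?_⟩
    · rw [sum_add_single, Nat.sub_add_eq]; exact hP₂
    · have hφ' := hasCompactSupport_multiPartial (Pi.single i 1) hφ
      rw [multiPartial_add, h1 _ hφ', multiPartial_single]
      have := integral_mul_lineDeriv_eq_neg (continuous_of_mem_polySpan hP₁)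
        (continuous_of_mem_polySpan hP₂) (unitVec (Sum.inl i)) hφ fun z _ => h2 z
      refine this.trans ?_
      simp only [Pi.neg_apply, neg_mul, integral_neg]

theorem exists_polySum_of_mem_polySpan [DecidableEq ι] {d : ℤ} {P : Vec (ι ⊕ κ) → ℂ}
    (hP : P ∈ polySpan ι κ d.toNat) :
    ∃ c : (ι → ℕ) → Vec κ → ℂ, (∀ γ, Continuous (c γ)) ∧ P = polySum d c := by
  induction hP using Submodule.span_induction with
  | mem P h =>
    obtain ⟨γ, c, hγ, hc, rfl⟩ := h
    refine ⟨fun γ' => if γ' = γ then c else 0, fun γ' => ?_, ?_⟩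
    · by_cases h : γ' = γ
      · simp only [if_pos h]; exact hc
      · simp only [if_neg h]; exact continuous_const
    · ext z
      rw [polySum, Finset.sum_eq_single (∑ i, γ i), Finset.sum_eq_single γ]
      · simp [monom]
      · intro γ' _ h; simp [h]
      · intro h; exact (h (Finset.mem_piAntidiag.2 ⟨rfl, by simp⟩)).elim
      · intro k _ hk
        refine Finset.sum_eq_zero fun γ' hγ' => ?_
        have : γ' ≠ γ := by
          rintro rfl; exact hk (Finset.mem_piAntidiag.1 hγ').1.symm
        simp [this]
      · intro h; exact (h (Finset.mem_range.2 hγ)).elim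
  | zero => exact ⟨fun _ => 0, fun _ => continuous_const, by ext z; simp [polySum]⟩
  | add P Q _ _ h h' =>
    obtain ⟨c, hc, rfl⟩ := h
    obtain ⟨c', hc', rfl⟩ := h'
    refine ⟨fun γ => c γ + c' γ, fun γ => (hc γ).add (hc' γ), ?_⟩
    ext z
    simp [polySum, add_mul, Finset.sum_add_distrib]
  | smul a P _ h =>
    obtain ⟨c, hc, rfl⟩ := h
    refine ⟨fun γ => a • c γ, fun γ => (hc γ).const_smul a, ?_⟩
    ext z
    simp [polySum, mul_assoc, Finset.mul_sum]

theorem integral_sub_mul_eq {P Q : Vec (ι ⊕ κ) → ℂ} (hP : Continuous P) (hQ : Continuous Q)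
    {φ : 𝓢(Vec (ι ⊕ κ), ℂ)} (hφ : HasCompactSupport φ) :
    ∫ z, (P z - Q z) * φ z = (∫ z, P z * φ z) - ∫ z, Q z * φ z := by
  simp only [sub_mul]
  exact integral_sub (integrable_mul_of_hasCompactSupport (μ := volume) hP hφ)
    (integrable_mul_of_hasCompactSupport (μ := volume) hQ hφ)

/-- Terms of degree `≥ δ` are `O^dist(|q|^δ)`. -/
theorem exists_lowDegree [Nonempty ι] {D d : ℕ} {δ ρ : ℝ} (hδ : δ ≤ d) (hρ : ρ ≤ 1)
    {P : Vec (ι ⊕ κ) → ℂ} (hP : P ∈ polySpan ι κ D) :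
    ∃ P₁ ∈ polySpan ι κ d, HasRep (fun φ => ∫ z, (P z - P₁ z) * φ z) δ ρ := by
  induction hP using Submodule.span_induction with
  | mem P h =>
    obtain ⟨γ, c, hγ, hc, rfl⟩ := h
    rcases lt_or_ge (∑ i, γ i) d with h | h
    · refine ⟨monom γ c, monom_mem h hc, ?_⟩
      refine (HasRep.sum (ι := ι) (κ := κ) (δ := δ) (ρ := ρ) (S := Unit) (t := fun _ _ => 0) ∅
        (by simp)).congr fun φ _ _ => by simp
    · refine ⟨0, Submodule.zero_mem _, ?_⟩
      obtain ⟨C, hC⟩ := (isCompact_closedBall (0 : Vec κ) ρ).exists_bound_of_continuousOn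
        hc.continuousOn
      have hδ' : δ ≤ ((∑ i, γ i : ℕ) : ℝ) := hδ.trans (by exact_mod_cast h)
      refine ((hasRep_of_norm_le (ρ := ρ) (δ := ((∑ i, γ i : ℕ) : ℝ)) (c := |C|)
        (continuous_monom γ hc) (by positivity) (abs_nonneg _) fun z hz => ?_).mono hδ' hρ).congr
        fun φ _ _ => by simp
      rw [monom, norm_mul, Complex.norm_real, Real.norm_eq_abs, Real.rpow_natCast]
      refine mul_le_mul ((hC _ ?_).trans (le_abs_self _)) ?_ (abs_nonneg _) (abs_nonneg _)
      · rw [mem_closedBall_zero_iff]; exact (norm_sndPart_le z).trans hz.le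
      · classical
        exact abs_prod_pow_le (fstPart z) γ
  | zero =>
    refine ⟨0, Submodule.zero_mem _, (HasRep.sum (ι := ι) (κ := κ) (δ := δ) (ρ := ρ) (S := Unit)
      (t := fun _ _ => 0) ∅ (by simp)).congr fun φ _ _ => by simp⟩
  | add P Q hPm hQm h h' =>
    obtain ⟨P₁, hP₁, h1⟩ := h
    obtain ⟨Q₁, hQ₁, h2⟩ := h'
    refine ⟨P₁ + Q₁, Submodule.add_mem _ hP₁ hQ₁, (h1.add h2).congr fun φ hφ _ => ?_⟩
    have hc1 : Continuous fun z => P z - P₁ z :=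
      (continuous_of_mem_polySpan hPm).sub (continuous_of_mem_polySpan hP₁)
    have hc2 : Continuous fun z => Q z - Q₁ z :=
      (continuous_of_mem_polySpan hQm).sub (continuous_of_mem_polySpan hQ₁)
    rw [← integral_add (integrable_mul_of_hasCompactSupport hc1 hφ)
      (integrable_mul_of_hasCompactSupport hc2 hφ)]
    refine integral_congr_ae (Eventually.of_forall fun z => ?_)
    simp only [Pi.add_apply]; ring
  | smul a P _ h =>
    obtain ⟨P₁, hP₁, h1⟩ := h
    refine ⟨a • P₁, Submodule.smul_mem _ _ hP₁, (h1.const_mul a).congr fun φ hφ _ => ?_⟩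
    rw [← integral_const_mul]
    refine integral_congr_ae (Eventually.of_forall fun z => ?_)
    simp only [Pi.smul_apply, smul_eq_mul]; ring

end Poly

/-! ### Sums of dyadic terms -/

section DyadicRep

variable {ι κ : Type*} [Fintype ι] [Fintype κ] {σ : ι → ℤˣ}
  {u : ℕ → Vec κ → 𝓢(Vec ι, ℂ) →L[ℂ] ℂ} {ρ a : ℝ}

theorem ball_subset_fstPart_le : Metric.ball (0 : Vec (ι ⊕ κ)) ρ ⊆ {z | ‖fstPart z‖ ≤ ρ} :=
  fun z hz => (norm_fstPart_le z).trans (mem_ball_zero_iff.1 hz).le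

theorem DyadicBound.hasSum_integral (h : DyadicBound σ u ρ a) (ha : 0 ≤ a) (hρ : ρ ≤ 1)
    {ψ : 𝓢(Vec ι, ℂ)} (hψ : Shell ψ) {φ : 𝓢(Vec (ι ⊕ κ), ℂ)} (hφ : HasCompactSupport φ)
    (hs : tsupport φ ⊆ Metric.ball 0 ρ) :
    HasSum (fun k => ∫ z, osc σ u ψ k z * φ z) (∫ z, (∑' k, osc σ u ψ k z) * φ z) := by
  obtain ⟨C, hC0, hC⟩ := h.exists_norm_osc_le ha hρ hψ
  have hi : ∀ k, Integrable fun z => osc σ u ψ k z * φ z := fun k =>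
    integrable_mul_of_hasCompactSupport (h.cont ψ hψ k) hφ
  have hb : ∀ k z, ‖osc σ u ψ k z * φ z‖ ≤ C * (2⁻¹ : ℝ) ^ k * ‖φ z‖ := by
    intro k z
    rw [norm_mul]
    by_cases hz : z ∈ tsupport φ
    · exact mul_le_mul_of_nonneg_right (hC k z (ball_subset_fstPart_le (hs hz))) (norm_nonneg _)
    · rw [image_eq_zero_of_notMem_tsupport hz]; simp
  have := hasSum_integral_of_summable_integral_norm hi (by
    refine Summable.of_nonneg_of_le (fun k => integral_nonneg fun z => norm_nonneg _) (fun k =>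
      integral_mono (hi k).norm ((φ.integrable.norm).const_mul _) (hb k)) ?_
    simp only [integral_const_mul]
    exact ((summable_geometric_of_lt_one (by norm_num)
      (by norm_num : (2⁻¹ : ℝ) < 1)).mul_left C).mul_right _)
  simpa only [tsum_mul_right] using this

/-- `HasRep` asks for functions that are continuous everywhere, whence the cutoff and the passage to
half the radius. -/
theorem HasRep.of_continuousOn {F : Vec (ι ⊕ κ) → ℂ} (hρ0 : 0 < ρ)
    (hF : ContinuousOn F (Metric.ball 0 ρ)) {δ C : ℝ} (hC : 0 ≤ C) (γ : ι → ℕ)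
    (hδ : 0 ≤ δ + ((∑ i, γ i : ℕ) : ℝ))
    (hb : ∀ z ∈ Metric.ball (0 : Vec (ι ⊕ κ)) ρ,
      ‖F z‖ ≤ C * ‖fstPart z‖ ^ (δ + ((∑ i, γ i : ℕ) : ℝ))) :
    HasRep (fun φ => ∫ z, F z * multiPartial γ φ z) δ (ρ / 2) := by
  obtain ⟨χ, hχ, hχc, hχs, hχ1, hχ0, hχle⟩ := exists_cutoff (V := Vec (ι ⊕ κ)) hρ0
  set G : Vec (ι ⊕ κ) → ℂ := fun z => (χ z : ℂ) * F z
  have hG : Continuous G := by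
    refine ContinuousOn.continuous_of_tsupport_subset
      ((Complex.continuous_ofReal.comp hχ.continuous).continuousOn.mul hF) Metric.isOpen_ball
      ((closure_mono fun z hz => ?_).trans hχs)
    rw [Function.mem_support] at hz ⊢
    intro h
    refine hz ?_
    change (χ z : ℂ) * F z = 0
    rw [h]; simp
  have h1 := (hasRep_single (δ := δ) (ρ := ρ / 2) hC γ hG hδ fun z hz => by
    have hz' : z ∈ Metric.ball (0 : Vec (ι ⊕ κ)) ρ := by
      rw [mem_ball_zero_iff]; linarith
    refine le_trans ?_ (hb z hz')
    rw [norm_mul, Complex.norm_real, Real.norm_of_nonneg (hχ0 z)]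
    exact mul_le_of_le_one_left (norm_nonneg _) (hχle z)).const_mul ((-1) ^ (∑ i, γ i))
  refine h1.congr fun φ hφ hs => ?_
  rw [← mul_assoc, ← mul_pow]
  rw [show (-1 : ℂ) * -1 = 1 by norm_num, one_pow, one_mul]
  refine integral_congr_ae (Eventually.of_forall fun z => ?_)
  change F z * _ = (χ z : ℂ) * F z * _
  by_cases hz : z ∈ tsupport (multiPartial γ φ)
  · have := hs (tsupport_multiPartial_subset _ φ hz)
    rw [hχ1 z (mem_ball_zero_iff.1 this).le]; simp
  · simp [image_eq_zero_of_notMem_tsupport hz]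

/-- A derivative ∂^γ of a remainder O(|q|^{a+1}) is O^dist(|q|^{a+1-|γ|}) by definition. It is used
with γ = 0 for the part that vanishes near q = 0, and with γ = β + e_i for the others. -/
theorem DyadicBound.exists_hasRep [DecidableEq ι] (h : DyadicBound σ u ρ a) (ha : 0 ≤ a)
    (hρ0 : 0 < ρ) (hρ : ρ ≤ 1)
    {ψ : 𝓢(Vec ι, ℂ)} (hψ : Shell ψ) {D : ℕ} (hD1 : (D : ℝ) < a + 2) (hD2 : a + 1 < D)
    (γ : ι → ℕ) :
    ∃ P ∈ polySpan ι κ D, HasRep (fun φ => (∫ z, (∑' k, osc σ u ψ k z) * multiPartial γ φ z) -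
      ∫ z, P z * multiPartial γ φ z) (a + 1 - ((∑ i, γ i : ℕ) : ℝ)) (ρ / 2) := by
  obtain ⟨c, hc, C, hC0, hC⟩ := h.exists_polySum ha hρ0.le hρ hψ hD1 hD2
  refine ⟨polySum D c, polySum_mem D hc, ?_⟩
  have hP := continuous_of_mem_polySpan (polySum_mem D hc)
  have hS : ContinuousOn (fun z => ∑' k, osc σ u ψ k z) (Metric.ball 0 ρ) :=
    (h.continuousOn_tsum_osc ha hρ hψ).mono ball_subset_fstPart_le
  refine (HasRep.of_continuousOn hρ0 (hS.sub hP.continuousOn) hC0 γ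
    (δ := a + 1 - ((∑ i, γ i : ℕ) : ℝ)) (by linarith) fun z hz => ?_).congr fun φ hφ hs => ?_
  · rw [sub_add_cancel]; exact hC z (ball_subset_fstPart_le hz)
  · have hφ' := hasCompactSupport_multiPartial γ hφ
    have hi1 : Integrable fun z => (∑' k, osc σ u ψ k z) * multiPartial γ φ z := by
      have hc : Continuous fun z => (∑' k, osc σ u ψ k z) * multiPartial γ φ z := by
        refine ContinuousOn.continuous_of_tsupport_subset
          (hS.mul (multiPartial γ φ).continuous.continuousOn) Metric.isOpen_ball ?_
        refine (closure_mono fun z hz => ?_).trans ((tsupport_multiPartial_subset γ φ).trans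
          (hs.trans (Metric.ball_subset_ball (by linarith))))
        exact right_ne_zero_of_mul hz
      exact hc.integrable_of_hasCompactSupport hφ'.mul_left
    rw [← integral_sub hi1 (integrable_mul_of_hasCompactSupport hP hφ')]
    refine integral_congr_ae (Eventually.of_forall fun z => ?_)
    exact (sub_mul _ _ _).symm

end DyadicRep

/-! ### The slices near the origin -/

section SliceRep

variable {ι κ : Type*} [Fintype ι] [Fintype κ] [DecidableEq ι]

/-- The hypothesis is an identity of distributions in (q, q'). On products χ(q')φ(q) it says that
two continuous functions of q' have equal integrals against every χ supported in the ball, so they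
agree almost everywhere there and, by continuity, at every point. The radius 2R accommodates the
supports of products. -/
theorem slice_eq_sum_fibreDist (σ : ι ⊕ κ → ℤˣ) (s : 𝓢'(Vec (ι ⊕ κ), ℂ)) (f : 𝓢(Vec κ, ℂ)) {R : ℝ}
    {J : Type} [Fintype J] (β : J → ι → ℕ) (τ : J → Vec (ι ⊕ κ) → ℂ) (hτ : ∀ j, Continuous (τ j))
    (hB : ∀ j, ∃ C : ℝ, ∀ z, ‖τ j z‖ ≤ C)
    (hrep : ∀ φ : 𝓢(Vec (ι ⊕ κ), ℂ), HasCompactSupport φ → tsupport φ ⊆ Metric.ball 0 (2 * R) →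
      fourierDist σ (mulSnd f s) φ =
        ∑ j, (-1 : ℂ) ^ (∑ i, β j i) * ∫ z, τ j z * multiPartial (β j) φ z)
    {p : Vec κ} (hp : p ∈ Metric.ball 0 R) {φ : 𝓢(Vec ι, ℂ)} (hφ : HasCompactSupport φ)
    (hφs : tsupport φ ⊆ Metric.ball 0 R) :
    slice σ s f p (fourierTest (fun i => σ (Sum.inl i)) φ) =
      ∑ j, (-1 : ℂ) ^ (∑ i, β j i) * fibreDist (fun i => σ (Sum.inl i)) (τ j) (hτ j) (hB j) p
        (monoMul (fun i => σ (Sum.inl i)) (β j) (fourierTest (fun i => σ (Sum.inl i)) φ)) := by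
  set σ₁ : ι → ℤˣ := fun i => σ (Sum.inl i)
  set h := fourierTest σ₁ φ
  set F : Vec κ → ℂ := fun p => ∑ j, (-1 : ℂ) ^ (∑ i, β j i) *
    fibreDist σ₁ (τ j) (hτ j) (hB j) p (monoMul σ₁ (β j) h)
  have hF : Continuous F := continuous_finsetSum _ fun j _ =>
    (continuous_fibreDist σ₁ (τ j) (hτ j) (hB j) _).const_mul _
  have hS : Continuous fun p => slice σ s f p h := continuous_slice σ s f h
  have key : ∀ χ : 𝓢(Vec κ, ℂ), HasCompactSupport χ → tsupport χ ⊆ Metric.ball 0 R →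
      ∫ p, χ p * slice σ s f p h = ∫ p, χ p * F p := by
    intro χ hχ hχs
    have h1 := hrep (tens χ φ) (hasCompactSupport_tens hχ hφ) (tsupport_tens_subset hχ hφ hχs hφs)
    have h2 : fourierDist σ (mulSnd f s) (tens χ φ) = ∫ p, χ p * slice σ s f p h := by
      rw [fourierDist_apply, mulSnd_apply]
      refine apply_fourier (s : 𝓢(Vec (ι ⊕ κ), ℂ) →L[ℂ] ℂ) (pairSnd σ) χ (tens f h) _ fun z => ?_
      rw [SchwartzMap.smulLeftCLM_apply_apply (contDiff_snd_hasTemperateGrowth f), fourierTest_tens,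
        fourierTest_eq _ χ, tens_apply, smul_eq_mul]
      simp only [chr, pairSnd_apply]
      ring
    have h3 : ∀ j, ∫ z, τ j z * multiPartial (β j) (tens χ φ) z =
        ∫ p, χ p * fibreDist σ₁ (τ j) (hτ j) (hB j) p (monoMul σ₁ (β j) h) := by
      intro j
      rw [integral_eq_integral_joinVec (integrable_mul_of_hasCompactSupport (hτ j)
        (hasCompactSupport_multiPartial (β j) (hasCompactSupport_tens hχ hφ)))]
      refine integral_congr_ae (Eventually.of_forall fun p => ?_)
      simp only
      rw [fibreDist_apply, ← integral_const_mul]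
      refine integral_congr_ae (Eventually.of_forall fun q => ?_)
      simp only [multiPartial_tens σ₁, tens_apply, fstPart_joinVec, sndPart_joinVec, derivMul, h]
      ring
    have h4 : ∀ j ∈ Finset.univ, Integrable fun p => χ p * ((-1 : ℂ) ^ (∑ i, β j i) *
        fibreDist σ₁ (τ j) (hτ j) (hB j) p (monoMul σ₁ (β j) h)) := by
      intro j _
      refine Continuous.integrable_of_hasCompactSupport ?_ hχ.mul_right
      exact χ.continuous.mul ((continuous_fibreDist σ₁ (τ j) (hτ j) (hB j) _).const_mul _)
    rw [← h2, h1]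
    simp only [F, Finset.mul_sum]
    rw [integral_finsetSum _ h4]
    refine Finset.sum_congr rfl fun j _ => ?_
    rw [h3, ← integral_const_mul]
    refine integral_congr_ae (Eventually.of_forall fun p => ?_)
    simp only
    ring
  have hae := Metric.isOpen_ball.ae_eq_zero_of_integral_contDiff_smul_eq_zero (μ := volume)
    (U := Metric.ball (0 : Vec κ) R) (f := fun p => slice σ s f p h - F p)
    ((hS.sub hF).locallyIntegrable.locallyIntegrableOn _) (by
      intro g hg hgc hgs
      have hgC : ContDiff ℝ ∞ fun p => (g p : ℂ) := Complex.ofRealCLM.contDiff.comp hg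
      have hgc' : HasCompactSupport fun p => (g p : ℂ) :=
        hgc.comp_left (g := Complex.ofReal) Complex.ofReal_zero
      have hgs' : tsupport (fun p => (g p : ℂ)) ⊆ Metric.ball 0 R :=
        (closure_mono fun p hp => by
          rw [Function.mem_support] at hp ⊢
          exact fun h0 => hp (by rw [h0, Complex.ofReal_zero])).trans hgs
      have h5 := key (hgc'.toSchwartzMap hgC) hgc' hgs'
      have h6 : ∀ p, (hgc'.toSchwartzMap hgC) p = (g p : ℂ) := fun p => rfl
      simp only [h6] at h5
      simp only [Complex.real_smul, mul_sub]
      rw [integral_sub, h5, sub_self]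
      · exact ((Complex.continuous_ofReal.comp hg.continuous).mul
          hS).integrable_of_hasCompactSupport hgc'.mul_right
      · exact ((Complex.continuous_ofReal.comp hg.continuous).mul
          hF).integrable_of_hasCompactSupport hgc'.mul_right)
  have h7 := Measure.eqOn_open_of_ae_eq (μ := volume) (U := Metric.ball (0 : Vec κ) R)
    (f := fun p => slice σ s f p h - F p) (g := fun _ => 0)
    ((ae_restrict_iff' Metric.isOpen_ball.measurableSet).2 hae) Metric.isOpen_ball
    (hS.sub hF).continuousOn continuousOn_const hp
  exact sub_eq_zero.1 h7

end SliceRep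

/-! ### Splitting -/

section Splitting

variable {ι κ : Type*} [Fintype ι] [Fintype κ]

theorem hasTemperateGrowth_fst {Θ : Vec ι → ℝ} (hΘ : IsUVRegularSplitting Θ) :
    (fun z : Vec (ι ⊕ κ) => (Θ (fstPart z) : ℂ)).HasTemperateGrowth :=
  (hΘ.bddSmooth.comp_clm (coords (κ := ι ⊕ κ) Sum.inl)).hasTemperateGrowth

theorem splitDist_apply (Θ : Vec ι → ℝ) (t : 𝓢'(Vec (ι ⊕ κ), ℂ)) (Φ : 𝓢(Vec (ι ⊕ κ), ℂ)) :
    splitDist Θ t Φ = t (SchwartzMap.smulLeftCLM ℂ (fun z => (Θ (fstPart z) : ℂ)) Φ) := rfl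

set_option maxHeartbeats 800000 in
/-- The dyadic decomposition of the transform of `Θ(y) f(x) s(y, x)`. -/
theorem tendsto_sum_osc {Θ : Vec ι → ℝ} (hΘ : IsUVRegularSplitting Θ) {ψ : 𝓢(Vec ι, ℂ)}
    (hψ : ∀ y, ψ y = (Θ y : ℂ) - Θ ((2⁻¹ : ℝ) • y)) (σ : ι ⊕ κ → ℤˣ) (s : 𝓢'(Vec (ι ⊕ κ), ℂ))
    (f : 𝓢(Vec κ, ℂ)) (Φ : 𝓢(Vec (ι ⊕ κ), ℂ)) :
    Tendsto (fun K => ∑ k ∈ Finset.range K, ∫ z, osc (fun i => σ (Sum.inl i))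
      (fun _ => slice σ (s : 𝓢(Vec (ι ⊕ κ), ℂ) →L[ℂ] ℂ) f) ψ k z * Φ z) atTop
      (𝓝 (fourierDist σ (splitDist Θ (mulSnd f s)) Φ)) := by
  obtain ⟨s', hs'⟩ : ∃ s' : 𝓢(Vec (ι ⊕ κ), ℂ) →L[ℂ] ℂ, s' = s := ⟨s, rfl⟩
  obtain ⟨g, hg⟩ : ∃ g : 𝓢(Vec (ι ⊕ κ), ℂ), ∀ z, g z = f (sndPart z) * fourierTest σ Φ z := by
    refine ⟨SchwartzMap.smulLeftCLM ℂ (fun z : Vec (ι ⊕ κ) => f (sndPart z)) (fourierTest σ Φ),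
      fun z => ?_⟩
    rw [SchwartzMap.smulLeftCLM_apply_apply (contDiff_snd_hasTemperateGrowth f), smul_eq_mul]
  have hbdd : BddSmooth fun z : Vec (ι ⊕ κ) => (Θ (fstPart z) : ℂ) :=
    hΘ.bddSmooth.comp_clm (coords (κ := ι ⊕ κ) (κ' := ι) Sum.inl)
  have hscale : ∀ (K : ℕ), BddSmooth fun z : Vec (ι ⊕ κ) => (Θ (fstPart ((2⁻¹ : ℝ) ^ K • z)) : ℂ) :=
    fun K => hbdd.comp_clm ((2⁻¹ : ℝ) ^ K • ContinuousLinearMap.id ℝ _)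
  obtain ⟨G, hG⟩ : ∃ G : ℕ → 𝓢(Vec (ι ⊕ κ), ℂ),
      ∀ K z, G K z = Θ (fstPart ((2⁻¹ : ℝ) ^ K • z)) * g z :=
    ⟨fun K => SchwartzMap.smulLeftCLM ℂ (fun z => (Θ (fstPart ((2⁻¹ : ℝ) ^ K • z)) : ℂ)) g,
      fun K z => by
        rw [SchwartzMap.smulLeftCLM_apply_apply (hscale K).hasTemperateGrowth, smul_eq_mul]⟩
  obtain ⟨r, hr, hr0⟩ := Metric.eventually_nhds_iff.1 hΘ.zero_near_origin
  have hG0 : Tendsto G atTop (𝓝 0) :=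
    tendsto_smulLeft_scaled hbdd hr (fun z hz => by
      rw [hr0 (y := fstPart z) (by
        rw [dist_zero_right]; exact (norm_fstPart_le z).trans_lt hz), Complex.ofReal_zero]) g G hG
  have h1 : fourierDist σ (splitDist Θ (mulSnd f s)) Φ = s' (G 0) := by
    rw [fourierDist_apply, splitDist_apply, mulSnd_apply, hs']
    refine congrArg (s : 𝓢(Vec (ι ⊕ κ), ℂ) →L[ℂ] ℂ) (SchwartzMap.ext fun z => ?_)
    rw [SchwartzMap.smulLeftCLM_apply_apply (contDiff_snd_hasTemperateGrowth f),
      SchwartzMap.smulLeftCLM_apply_apply (hasTemperateGrowth_fst hΘ), hG, hg]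
    simp only [pow_zero, one_smul, smul_eq_mul]
    ring
  -- ψ(2^{-k}·) = Θ(2^{-k}·) - Θ(2^{-k-1}·), so the sum telescopes; the last term tends to 0 because
  -- Θ vanishes near the origin.
  have h2 : ∀ k, ∫ z, osc (fun i => σ (Sum.inl i)) (fun _ => slice σ s' f) ψ k z * Φ z =
      s' (G k) - s' (G (k + 1)) := by
    intro k
    rw [← map_sub, apply_mul_fourierTest s' σ Φ (tens f (dil k ψ)) (G k - G (k + 1)) fun z => ?_]
    · refine integral_congr_ae (Eventually.of_forall fun z => ?_)
      simp only [apply_charMul_tens, osc]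
      ring
    · rw [_root_.sub_apply, hG, hG, hg, tens_apply, dil_apply, hψ, smul_smul, pow_succ']
      simp only [map_smul]
      ring
  rw [h1, ← hs']
  simp only [h2]
  have h3 : ∀ K, ∑ k ∈ Finset.range K, (s' (G k) - s' (G (k + 1))) = s' (G 0) - s' (G K) :=
    fun K => Finset.sum_range_sub' (fun k => s' (G k)) K
  simp only [h3]
  have h4 := (s'.continuous.tendsto 0).comp hG0
  rw [map_zero] at h4
  simpa using (tendsto_const_nhds (x := s' (G 0))).sub h4

/-- The q_i-derivative of the pairing multiplies the test function by iσ_i y_i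
(`hasDerivAt_charMul`). The opposite sign in `monoMul` cancels the one from integration by parts. -/
theorem multiPartial_osc_integral [DecidableEq ι] (σ : ι → ℤˣ) (v : Vec κ → 𝓢(Vec ι, ℂ) →L[ℂ] ℂ)
    (hv : ∀ h, Continuous fun z : Vec (ι ⊕ κ) => v (sndPart z) (charMul (pair σ (fstPart z)) h))
    (β : ι → ℕ) (h : 𝓢(Vec ι, ℂ)) {φ : 𝓢(Vec (ι ⊕ κ), ℂ)} (hφ : HasCompactSupport φ) :
    ∫ z, v (sndPart z) (charMul (pair σ (fstPart z)) (monoMul σ β h)) * φ z =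
      ∫ z, v (sndPart z) (charMul (pair σ (fstPart z)) h) * multiPartial β φ z := by
  induction β using multiIndex_induction generalizing h φ with
  | h0 => rw [monoMul_zero, multiPartial_zero]
  | h1 β i ih =>
    rw [monoMul_add, ih _ hφ, add_comm β, multiPartial_add, multiPartial_single]
    have hφ' := hasCompactSupport_multiPartial β hφ
    have := integral_mul_lineDeriv_eq_neg (hv h) (hv (Complex.I • linMul (pair σ (unitVec i)) h))
      (unitVec (Sum.inl i)) hφ' fun z _ => by
        rw [HasLineDerivAt]
        have h1 : ∀ t : ℝ, fstPart (z + t • (unitVec (Sum.inl i) : Vec (ι ⊕ κ))) =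
            fstPart z + t • (unitVec i : Vec ι) := by
          intro t
          ext j
          by_cases hj : j = i
          · subst hj; simp [unitVec_same]
          · have : (Sum.inl j : ι ⊕ κ) ≠ Sum.inl i := fun h => hj (Sum.inl_injective h)
            simp [unitVec_of_ne hj, unitVec_of_ne this]
        have h2 : ∀ t : ℝ, sndPart (z + t • (unitVec (Sum.inl i) : Vec (ι ⊕ κ))) = sndPart z := by
          intro t
          ext j
          have : (Sum.inr j : ι ⊕ κ) ≠ Sum.inl i := by simp
          simp [unitVec_of_ne this]
        simp only [h1, h2, map_add, map_smul]
        have h3 := hasDerivAt_charMul ((v (sndPart z)).comp (charMul (pair σ (fstPart z))))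
          (pair σ (unitVec i)) h 0
        rw [zero_smul, charMul_zero] at h3
        refine (h3.congr_deriv ?_).congr_of_eventuallyEq (Eventually.of_forall fun t => ?_)
        · simp
        · simp [charMul_add]
    refine Eq.trans ?_ this.symm
    rw [← integral_neg]
    refine integral_congr_ae (Eventually.of_forall fun z => ?_)
    simp only [monoMul_single, map_smul, smul_eq_mul]
    ring

end Splitting

/-! ### The summed series for the individual parts of the slices. -/

section SplittingParts

variable {ι κ : Type*} [Fintype ι] [Fintype κ]

theorem monoMul_charMul (σ : ι → ℤˣ) (β : ι → ℕ) (ℓ : Vec ι →L[ℝ] ℝ) (g : 𝓢(Vec ι, ℂ)) :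
    monoMul σ β (charMul ℓ g) = charMul ℓ (monoMul σ β g) := by
  ext y
  simp only [monoMul_apply, charMul_apply]
  ring

/-- The coordinate 2^{-k} y_i split off from ψ(2^{-k} y) supplies both the convergence factor 2^{-k}
and a multiplication by y_i, i.e. a derivative. The coefficient iσ_i undoes -iσ_i in `monoMul`, as
σ_i² = 1. -/
theorem dil_eq_sum_monoMul [DecidableEq ι] (σ : ι → ℤˣ) {ψ : 𝓢(Vec ι, ℂ)} {ψ' : ι → 𝓢(Vec ι, ℂ)}
    (hψ : ∀ y, ψ y = ∑ i, (y i : ℂ) * ψ' i y) (k : ℕ) :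
    dil k ψ = ∑ i, (Complex.I * ((σ i : ℤ) : ℂ)) •
      ((2⁻¹ : ℂ) ^ k • monoMul σ (Pi.single i 1) (dil k (ψ' i))) := by
  ext y
  rw [dil_apply, hψ, _root_.sum_apply]
  refine Finset.sum_congr rfl fun i _ => ?_
  have h1 : (((σ i : ℤ) : ℂ)) * ((σ i : ℤ) : ℂ) = 1 := by
    rcases Int.units_eq_one_or (σ i) with h | h <;> simp [h]
  simp only [_root_.smul_apply, monoMul_single, linMul_apply, pair_unitVec, dil_apply, smul_eq_mul,
    PiLp.smul_apply]
  push_cast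
  linear_combination ((2⁻¹ : ℂ) ^ k * (y i) * ψ' i ((2⁻¹ : ℝ) ^ k • y)) *
    (Complex.I ^ 2 * h1 + Complex.I_sq)

theorem multiPartial_osc_sum [DecidableEq ι] (σ : ι → ℤˣ) (v : Vec κ → 𝓢(Vec ι, ℂ) →L[ℂ] ℂ)
    (hv : ∀ h, Continuous fun z : Vec (ι ⊕ κ) => v (sndPart z) (charMul (pair σ (fstPart z)) h))
    {ψ : 𝓢(Vec ι, ℂ)} {ψ' : ι → 𝓢(Vec ι, ℂ)} (hψ : ∀ y, ψ y = ∑ i, (y i : ℂ) * ψ' i y) (k : ℕ)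
    (β : ι → ℕ) {φ : 𝓢(Vec (ι ⊕ κ), ℂ)} (hφ : HasCompactSupport φ) :
    ∫ z, v (sndPart z) (monoMul σ β (charMul (pair σ (fstPart z)) (dil k ψ))) * φ z =
      ∑ i, (Complex.I * ((σ i : ℤ) : ℂ)) *
        ∫ z, osc σ (fun k p => (2⁻¹ : ℂ) ^ k • v p) (ψ' i) k z *
          multiPartial (β + Pi.single i 1) φ z := by
  have h1 : ∀ z : Vec (ι ⊕ κ),
      v (sndPart z) (monoMul σ β (charMul (pair σ (fstPart z)) (dil k ψ))) * φ z =
      ∑ i, (Complex.I * ((σ i : ℤ) : ℂ)) * ((2⁻¹ : ℂ) ^ k * (v (sndPart z)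
        (charMul (pair σ (fstPart z)) (monoMul σ (β + Pi.single i 1) (dil k (ψ' i)))) * φ z)) := by
    intro z
    rw [monoMul_charMul, dil_eq_sum_monoMul σ hψ, map_sum, map_sum, map_sum, Finset.sum_mul]
    refine Finset.sum_congr rfl fun i _ => ?_
    rw [monoMul_add]
    simp only [map_smul, smul_eq_mul]
    ring
  simp only [h1]
  rw [integral_finsetSum]
  · refine Finset.sum_congr rfl fun i _ => ?_
    rw [integral_const_mul, integral_const_mul, multiPartial_osc_integral σ v hv _ _ hφ,
      ← integral_const_mul]
    congr 1
    refine integral_congr_ae (Eventually.of_forall fun z => ?_)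
    simp only [osc, _root_.smul_apply, smul_eq_mul]
    ring
  · intro i _
    exact ((integrable_mul_of_hasCompactSupport (hv _) hφ).const_mul _).const_mul _

/-- With γ = β + e_i there are |β| + 1 derivatives in front of a series that equals a polynomial of
degree < D up to O(|q|^{a+1}), a = δ + |β|. They reduce the exponent to δ and the degree bound to D
- (|β| + 1). -/
theorem exists_hasSum_near [DecidableEq ι] {σ : ι → ℤˣ} {τ : Vec (ι ⊕ κ) → ℂ} (hτ : Continuous τ)
    (hB : ∃ C : ℝ, ∀ z, ‖τ z‖ ≤ C) {c δ : ℝ} (hc : 0 ≤ c) {β : ι → ℕ}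
    (ha : 0 ≤ δ + ((∑ i, β i : ℕ) : ℝ))
    (hb : ∀ z, ‖τ z‖ ≤ c * ‖fstPart z‖ ^ (δ + ((∑ i, β i : ℕ) : ℝ)))
    {ρ : ℝ} (hρ0 : 0 < ρ) (hρ : ρ ≤ 1) {ψ : 𝓢(Vec ι, ℂ)} (hψ : Shell ψ) {D : ℕ}
    (hD1 : (D : ℝ) < δ + ((∑ i, β i : ℕ) : ℝ) + 2) (hD2 : δ + ((∑ i, β i : ℕ) : ℝ) + 1 < D) :
    ∃ P ∈ polySpan ι κ (D - (∑ i, β i + 1)), ∃ F : 𝓢(Vec (ι ⊕ κ), ℂ) → ℂ, HasRep F δ (ρ / 2) ∧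
      ∀ φ : 𝓢(Vec (ι ⊕ κ), ℂ), HasCompactSupport φ → tsupport φ ⊆ Metric.ball 0 (ρ / 2) →
        HasSum (fun k => ∫ z, fibreDist σ τ hτ hB (sndPart z)
          (monoMul σ β (charMul (pair σ (fstPart z)) (dil k ψ))) * φ z)
          (F φ + ∫ z, P z * φ z) := by
  obtain ⟨ψ', hψ', hψψ'⟩ := hψ.exists_div
  have hdy := dyadicBound_fibreDist σ τ hτ hB hc ha hb ρ
  set u : ℕ → Vec κ → 𝓢(Vec ι, ℂ) →L[ℂ] ℂ := fun k p => ((2⁻¹ : ℂ) ^ k) • fibreDist σ τ hτ hB p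
  have hγ : ∀ i, ∃ γ : ι → ℕ, γ = β + Pi.single i 1 ∧ ∑ k, γ k = ∑ k, β k + 1 :=
    fun i => ⟨_, rfl, sum_add_single β i 1⟩
  choose γ hγ hγs using hγ
  choose P hP hrep using fun i => hdy.exists_hasRep ha hρ0 hρ (hψ' i) hD1 hD2 (γ i)
  choose P' hP' hPP' using fun i => exists_multiPartial_of_mem_polySpan (hP i) (γ i)
  refine ⟨∑ i, (Complex.I * ((σ i : ℤ) : ℂ)) • P' i, Submodule.sum_mem _ fun i _ =>
    Submodule.smul_mem _ _ (by rw [← hγs i]; exact hP' i), fun φ =>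
    ∑ i, (Complex.I * ((σ i : ℤ) : ℂ)) *
      ((∫ z, (∑' k, osc σ u (ψ' i) k z) * multiPartial (γ i) φ z) -
        ∫ z, P i z * multiPartial (γ i) φ z), ?_, fun φ hφ hs => ?_⟩
  · refine HasRep.sum (ι := ι) (κ := κ) (t := fun i φ => (Complex.I * ((σ i : ℤ) : ℂ)) *
      ((∫ z, (∑' k, osc σ u (ψ' i) k z) * multiPartial (γ i) φ z) -
        ∫ z, P i z * multiPartial (γ i) φ z)) Finset.univ fun i _ => ?_
    have h1 := (hrep i).const_mul (Complex.I * ((σ i : ℤ) : ℂ))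
    rw [hγs i] at h1
    have h2 : δ + ((∑ i, β i : ℕ) : ℝ) + 1 - ((∑ k, β k + 1 : ℕ) : ℝ) = δ := by push_cast; ring
    rwa [h2] at h1
  · have h1 : ∀ i, HasSum (fun k => ∫ z, osc σ u (ψ' i) k z * multiPartial (γ i) φ z)
        (∫ z, (∑' k, osc σ u (ψ' i) k z) * multiPartial (γ i) φ z) := fun i =>
      hdy.hasSum_integral ha hρ (hψ' i) (hasCompactSupport_multiPartial _ hφ)
        ((tsupport_multiPartial_subset _ φ).trans
          (hs.trans (Metric.ball_subset_ball (by linarith))))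
    have h2 := hasSum_sum (s := Finset.univ) fun i _ =>
      (h1 i).mul_left (Complex.I * ((σ i : ℤ) : ℂ))
    have h3 : ∀ k, ∫ z, fibreDist σ τ hτ hB (sndPart z)
          (monoMul σ β (charMul (pair σ (fstPart z)) (dil k ψ))) * φ z =
        ∑ i, (Complex.I * ((σ i : ℤ) : ℂ)) *
          ∫ z, osc σ u (ψ' i) k z * multiPartial (γ i) φ z := by
      intro k
      simp only [hγ]
      exact multiPartial_osc_sum σ (fibreDist σ τ hτ hB) (continuous_osc_fibreDist σ τ hτ hB)
        hψψ' k β hφ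
    simp only [h3]
    rw [show (∑ i, (Complex.I * ((σ i : ℤ) : ℂ)) *
      ∫ z, (∑' k, osc σ u (ψ' i) k z) * multiPartial (γ i) φ z) = _ from ?_] at h2
    · exact h2
    have h4 : ∫ z, (∑ i, (Complex.I * ((σ i : ℤ) : ℂ)) • P' i) z * φ z =
        ∑ i, (Complex.I * ((σ i : ℤ) : ℂ)) * ∫ z, P i z * multiPartial (γ i) φ z := by
      simp only [hPP' _ φ hφ, ← integral_const_mul]
      rw [← integral_finsetSum]
      · refine integral_congr_ae (Eventually.of_forall fun z => ?_)
        simp only [Finset.sum_apply, Pi.smul_apply, smul_eq_mul, Finset.sum_mul, mul_assoc]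
      · exact fun i _ => (integrable_mul_of_hasCompactSupport
          (continuous_of_mem_polySpan (hP' i)) hφ).const_mul _
    rw [h4, ← Finset.sum_add_distrib]
    refine Finset.sum_congr rfl fun i _ => ?_
    ring

/-- Here a + 1 ≥ δ, so no derivative is needed, but the polynomial may have too high a degree; its
terms of degree ≥ d are O^dist(|q|^δ) themselves and join F. -/
theorem DyadicBound.exists_hasSum [Nonempty ι] [DecidableEq ι] {σ : ι → ℤˣ}
    {u : ℕ → Vec κ → 𝓢(Vec ι, ℂ) →L[ℂ] ℂ} {ρ a δ : ℝ} (h : DyadicBound σ u ρ a) (ha : 0 ≤ a)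
    (hρ0 : 0 < ρ) (hρ : ρ ≤ 1) {ψ : 𝓢(Vec ι, ℂ)} (hψ : Shell ψ) {D d : ℕ}
    (hD1 : (D : ℝ) < a + 2) (hD2 : a + 1 < D) (hδ : δ ≤ a + 1) (hd : δ ≤ d) :
    ∃ P ∈ polySpan ι κ d, ∃ F : 𝓢(Vec (ι ⊕ κ), ℂ) → ℂ, HasRep F δ (ρ / 2) ∧
      ∀ φ : 𝓢(Vec (ι ⊕ κ), ℂ), HasCompactSupport φ → tsupport φ ⊆ Metric.ball 0 (ρ / 2) →
        HasSum (fun k => ∫ z, osc σ u ψ k z * φ z) (F φ + ∫ z, P z * φ z) := by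
  obtain ⟨P, hP, hrep⟩ := h.exists_hasRep ha hρ0 hρ hψ hD1 hD2 0
  obtain ⟨P₁, hP₁, hrep₁⟩ := exists_lowDegree (δ := δ) (ρ := ρ / 2) hd (by linarith) hP
  refine ⟨P₁, hP₁, _, (hrep.mono (δ' := δ) (by simpa using hδ) (by linarith)).add hrep₁,
    fun φ hφ hs => ?_⟩
  have h1 := h.hasSum_integral ha hρ hψ hφ (hs.trans (Metric.ball_subset_ball (by linarith)))
  convert h1 using 1
  rw [integral_sub_mul_eq (continuous_of_mem_polySpan hP) (continuous_of_mem_polySpan hP₁) hφ]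
  simp only [multiPartial_zero]
  ring

end SplittingParts

/-! ### The transform of the split distribution near the origin. -/

section SplittingMain

variable {ι κ : Type*} [Fintype ι] [Fintype κ]

theorem tsum_parts_continuous {σ : ι ⊕ κ → ℤˣ} (s : 𝓢(Vec (ι ⊕ κ), ℂ) →L[ℂ] ℂ) (f : 𝓢(Vec κ, ℂ))
    {J : Type} [Fintype J] (β : J → ι → ℕ) (τ : J → Vec (ι ⊕ κ) → ℂ) (hτ : ∀ j, Continuous (τ j))
    (hB : ∀ j, ∃ C : ℝ, ∀ z, ‖τ j z‖ ≤ C) {χ : Vec κ → ℝ} (hχ : Continuous χ) (h : 𝓢(Vec ι, ℂ)) :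
    Continuous fun z : Vec (ι ⊕ κ) => ((χ (sndPart z) : ℂ) • (slice σ s f (sndPart z) -
      ∑ j, (-1 : ℂ) ^ (∑ i, β j i) • (fibreDist (fun i => σ (Sum.inl i)) (τ j) (hτ j) (hB j)
        (sndPart z)).comp (monoMul (fun i => σ (Sum.inl i)) (β j))))
        (charMul (pair (fun i => σ (Sum.inl i)) (fstPart z)) h) := by
  simp only [_root_.smul_apply, _root_.sub_apply, _root_.sum_apply, smul_eq_mul,
    ContinuousLinearMap.comp_apply, monoMul_charMul]
  refine (Complex.continuous_ofReal.comp (hχ.comp (coords Sum.inr).continuous)).mul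
    ((continuous_osc_slice σ s f h).sub (continuous_finsetSum _ fun j _ => ?_))
  exact (continuous_osc_fibreDist _ (τ j) (hτ j) (hB j) _).const_mul _

theorem exists_sBdd_fibreDist (σ : ι → ℤˣ) (τ : Vec (ι ⊕ κ) → ℂ) (hτ : Continuous τ)
    (hB : ∃ C : ℝ, ∀ z, ‖τ z‖ ≤ C) :
    ∃ A : 𝓢(Vec ι, ℂ) → ℝ, SBdd A ∧ ∀ p h, ‖fibreDist σ τ hτ hB p h‖ ≤ A h := by
  obtain ⟨C, hC⟩ := hB
  refine ⟨fun h => |C| * ∫ x, ‖fourierTestInv σ h x‖,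
    ((sBdd_integral_norm volume).comp (fourierTestInv σ)).const_mul (abs_nonneg C), fun p h => ?_⟩
  simp only [fibreDist_apply, ← integral_const_mul]
  refine norm_integral_le_of_norm_le ((fourierTestInv σ h).integrable.norm.const_mul _)
    (Eventually.of_forall fun x => ?_)
  rw [norm_mul]
  exact mul_le_mul_of_nonneg_right ((hC _).trans (le_abs_self C)) (norm_nonneg _)

theorem exists_sBdd_slice (σ : ι ⊕ κ → ℤˣ) (s : 𝓢(Vec (ι ⊕ κ), ℂ) →L[ℂ] ℂ) (f : 𝓢(Vec κ, ℂ))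
    (R : ℝ) :
    ∃ A : 𝓢(Vec ι, ℂ) → ℝ, SBdd A ∧ ∀ p : Vec κ, ‖p‖ ≤ R → ∀ h, ‖slice σ s f p h‖ ≤ A h := by
  obtain ⟨A, hA, hb⟩ := (sBdd_norm_apply s).exists_charMul (‖pairSnd (ι := ι) σ‖ * R)
  refine ⟨fun h => A (tens f h), hA.comp (tens f), fun p hp h => ?_⟩
  exact hb _ (((pairSnd σ).le_opNorm p).trans (mul_le_mul_of_nonneg_left hp (norm_nonneg _))) _

/-- Near the origin, the transform of `Θ(y) f(x) s(y, x)` is the sum of a polynomial in `q` and of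
terms that are `O^dist(|q|^{d - ε})`. -/
theorem exists_hasRep_splitDist [Nonempty ι] [DecidableEq ι] {Θ : Vec ι → ℝ}
    (hΘ : IsUVRegularSplitting Θ) (σ : ι ⊕ κ → ℤˣ) (s : 𝓢'(Vec (ι ⊕ κ), ℂ)) (f : 𝓢(Vec κ, ℂ))
    {d : ℤ} {ε : ℝ} (hε0 : 0 < ε) (hε1 : ε < 1)
    (h : IsODist (fourierDist σ (mulSnd f s)) ((d : ℝ) - ε)) :
    ∃ ρ : ℝ, 0 < ρ ∧ ∃ P ∈ polySpan ι κ d.toNat,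
      HasRep (fun φ => fourierDist σ (splitDist Θ (mulSnd f s)) φ - ∫ z, P z * φ z)
        ((d : ℝ) - ε) ρ := by
  obtain ⟨ρ₀, hρ₀, J, _, β, τ, c, hτ, hτc, hβ, hc, hτb, hrep⟩ := h.exists_hasRep
  obtain ⟨ψ, hψ, hψΘ⟩ := hΘ.exists_shell
  set σ₁ : ι → ℤˣ := fun i => σ (Sum.inl i)
  obtain ⟨s', hs'⟩ : ∃ s' : 𝓢(Vec (ι ⊕ κ), ℂ) →L[ℂ] ℂ, s' = s := ⟨s, rfl⟩
  have hB : ∀ j, ∃ C : ℝ, ∀ z, ‖τ j z‖ ≤ C := fun j =>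
    (hτ j).bounded_above_of_compact_support (hτc j)
  set R : ℝ := ρ₀ / 2
  have hR : 0 < R := by positivity
  obtain ⟨χ, hχ, hχc, hχs, hχ1, hχ0, hχle⟩ := exists_cutoff (V := Vec κ) hR
  obtain ⟨v, hv⟩ : ∃ v : J → Vec κ → 𝓢(Vec ι, ℂ) →L[ℂ] ℂ,
    ∀ j, v j = fibreDist σ₁ (τ j) (hτ j) (hB j) := ⟨_, fun j => rfl⟩
  -- What remains of the slices when the contributions of the τ_j are removed. The cutoff χ confines
  -- q' to the ball in which this remainder vanishes near q = 0 and the slices are uniformly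
  -- bounded.
  set T : Vec κ → 𝓢(Vec ι, ℂ) →L[ℂ] ℂ := fun p => (χ p : ℂ) • (slice σ s' f p -
    ∑ j, (-1 : ℂ) ^ (∑ i, β j i) • (v j p).comp (monoMul σ₁ (β j))) with hT
  have hTapp : ∀ p g, T p g = χ p * (slice σ s' f p g -
      ∑ j, (-1 : ℂ) ^ (∑ i, β j i) * v j p (monoMul σ₁ (β j) g)) := by
    intro p g
    simp only [hT, _root_.smul_apply, _root_.sub_apply, _root_.sum_apply, smul_eq_mul,
      ContinuousLinearMap.comp_apply]
  have hTχ : ∀ p, p ∉ Metric.ball (0 : Vec κ) R → χ p = 0 := fun p hp => by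
    by_contra h0
    exact hp (hχs (subset_tsupport _ h0))
  have hcont : ∀ g, Continuous fun z : Vec (ι ⊕ κ) =>
      T (sndPart z) (charMul (pair σ₁ (fstPart z)) g) := by
    intro g
    simp only [hT, hv]
    exact tsum_parts_continuous s' f β τ hτ hB hχ.continuous g
  have hcv : ∀ j g, Continuous fun z : Vec (ι ⊕ κ) =>
      v j (sndPart z) (charMul (pair σ₁ (fstPart z)) g) := by
    intro j g
    rw [hv]
    exact continuous_osc_fibreDist _ (τ j) (hτ j) (hB j) _
  have hcs : ∀ g, Continuous fun z : Vec (ι ⊕ κ) =>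
      slice σ s' f (sndPart z) (charMul (pair σ₁ (fstPart z)) g) := continuous_osc_slice σ s' f
  -- The integer |d| + 2 lies strictly between a + 1 and a + 2, and d - ε ≤ a + 1.
  set a : ℝ := |(d : ℝ)| + 1 - ε
  have ha : 0 ≤ a := by have := abs_nonneg (d : ℝ); simp only [a]; linarith
  set ρ : ℝ := min (R / 4) 1
  have hρ0 : 0 < ρ := by positivity
  have hρ1 : ρ ≤ 1 := min_le_right _ _
  have hdyT : DyadicBound σ₁ (fun _ => T) ρ a := by
    refine dyadicBound_of_vanishing σ₁ T hR (fun p φ hφ hφs => ?_) ?_ hcont ha (min_le_left _ _)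
    · rw [hTapp]
      by_cases hp : p ∈ Metric.ball (0 : Vec κ) R
      · have h1 := slice_eq_sum_fibreDist σ s f β τ hτ hB (R := R) (fun φ hφ hs =>
          hrep φ hφ (by simpa [R, mul_div_cancel₀] using hs)) hp hφ hφs
        rw [hs', h1]
        simp only [hv]
        rw [sub_self, mul_zero]
      · rw [hTχ p hp]; simp
    · obtain ⟨A, hA, hAb⟩ := exists_sBdd_slice σ s' f R
      choose A' hA' hAb' using fun j => exists_sBdd_fibreDist σ₁ (τ j) (hτ j) (hB j)
      refine ⟨fun g => A g + ∑ j, A' j (monoMul σ₁ (β j) g), hA.add (SBdd.sum _ fun j _ =>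
        (hA' j).comp (monoMul σ₁ (β j))), fun p g => ?_⟩
      rw [hTapp]
      have hnn : ∀ j, 0 ≤ A' j (monoMul σ₁ (β j) g) := fun j =>
        (norm_nonneg _).trans (hAb' j 0 _)
      have hnA : 0 ≤ A g := (norm_nonneg _).trans (hAb 0 (by simpa using hR.le) g)
      by_cases hp : p ∈ Metric.ball (0 : Vec κ) R
      · rw [norm_mul, Complex.norm_real, Real.norm_of_nonneg (hχ0 p)]
        refine (mul_le_of_le_one_left (norm_nonneg _) (hχle p)).trans ?_
        refine (norm_sub_le _ _).trans (add_le_add (hAb p (mem_ball_zero_iff.1 hp).le g)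
          ((norm_sum_le _ _).trans (Finset.sum_le_sum fun j _ => ?_)))
        rw [norm_mul, norm_pow, norm_neg, norm_one, one_pow, one_mul, hv]
        exact hAb' j p _
      · rw [hTχ p hp, Complex.ofReal_zero, zero_mul, norm_zero]
        exact add_nonneg hnA (Finset.sum_nonneg fun j _ => hnn j)
  obtain ⟨P₀, hP₀, F₀, hF₀, hsum₀⟩ := hdyT.exists_hasSum (δ := (d : ℝ) - ε)
    (D := d.natAbs + 2) (d := d.toNat) ha hρ0 hρ1 hψ (by
      have : ((d.natAbs : ℕ) : ℝ) = |(d : ℝ)| := by rw [← Int.cast_abs, Int.abs_eq_natAbs]; simp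
      push_cast; simp only [a]; rw [this]; linarith) (by
      have : ((d.natAbs : ℕ) : ℝ) = |(d : ℝ)| := by rw [← Int.cast_abs, Int.abs_eq_natAbs]; simp
      push_cast; simp only [a]; rw [this]; linarith)
    (by simp only [a]; linarith [le_abs_self (d : ℝ)])
    (by
      have : (d : ℝ) ≤ (d.toNat : ℝ) := by exact_mod_cast Int.self_le_toNat d
      linarith)
  -- d - ε + |β_j| ≥ 0 with ε > 0 forces the integer d + |β_j| to be positive. So D = d + |β_j| + 1
  -- below is not truncated, and D - (|β_j| + 1) is `d.toNat` for either sign of d.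
  have hpos : ∀ j, 0 < d + (∑ i, β j i : ℕ) := by
    intro j
    have h1 := hβ j
    have : (0 : ℝ) < ((d + (∑ i, β j i : ℕ) : ℤ) : ℝ) := by push_cast at h1 ⊢; linarith
    exact_mod_cast this
  have hnear : ∀ j, ∃ P ∈ polySpan ι κ d.toNat, ∃ F : 𝓢(Vec (ι ⊕ κ), ℂ) → ℂ,
      HasRep F ((d : ℝ) - ε) (ρ / 2) ∧
      ∀ φ : 𝓢(Vec (ι ⊕ κ), ℂ), HasCompactSupport φ → tsupport φ ⊆ Metric.ball 0 (ρ / 2) →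
        HasSum (fun k => ∫ z, v j (sndPart z)
          (monoMul σ₁ (β j) (charMul (pair σ₁ (fstPart z)) (dil k ψ))) * φ z)
          (F φ + ∫ z, P z * φ z) := by
    intro j
    have hD : ((d + (∑ i, β j i : ℕ) + 1).toNat : ℝ) = (d : ℝ) + ((∑ i, β j i : ℕ) : ℝ) + 1 := by
      have h1 : (((d + (∑ i, β j i : ℕ) + 1).toNat : ℤ) : ℝ) =
          ((d + (∑ i, β j i : ℕ) + 1 : ℤ) : ℝ) := by
        rw [Int.toNat_of_nonneg (by have := hpos j; omega)]
      push_cast at h1 ⊢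
      exact h1
    have hd' : (d + (∑ i, β j i : ℕ) + 1).toNat - (∑ i, β j i + 1) = d.toNat := by
      have := hpos j; omega
    have h1 := exists_hasSum_near (σ := σ₁) (δ := (d : ℝ) - ε) (hτ j) (hB j) hc (hβ j) (hτb j)
      hρ0 hρ1 hψ (D := (d + (∑ i, β j i : ℕ) + 1).toNat) (by rw [hD]; linarith)
      (by rw [hD]; linarith)
    rw [hd'] at h1
    rw [hv]
    exact h1
  choose P hP F hF hsum using hnear
  refine ⟨ρ / 2, by positivity, P₀ + ∑ j, (-1 : ℂ) ^ (∑ i, β j i) • P j, Submodule.add_mem _ hP₀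
    (Submodule.sum_mem _ fun j _ => Submodule.smul_mem _ _ (hP j)), ?_⟩
  refine (hF₀.add (HasRep.sum (t := fun j φ => (-1 : ℂ) ^ (∑ i, β j i) * F j φ) Finset.univ
    fun j _ => (hF j).const_mul _)).congr fun φ hφ hs => ?_
  have h1 := (hsum₀ φ hφ hs).add (hasSum_sum (s := Finset.univ) fun j _ =>
    (hsum j φ hφ hs).mul_left ((-1 : ℂ) ^ (∑ i, β j i)))
  -- On the support of φ the cutoff χ is 1, so that the slice is T plus the contributions of the
  -- τ_j.
  have h2 : ∀ k, ∫ z, osc σ₁ (fun _ => slice σ s' f) ψ k z * φ z =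
      (∫ z, osc σ₁ (fun _ => T) ψ k z * φ z) + ∑ j, (-1 : ℂ) ^ (∑ i, β j i) *
        ∫ z, v j (sndPart z) (monoMul σ₁ (β j) (charMul (pair σ₁ (fstPart z)) (dil k ψ))) * φ z := by
    intro k
    have hi : ∀ j, Integrable fun z => (-1 : ℂ) ^ (∑ i, β j i) * (v j (sndPart z)
        (monoMul σ₁ (β j) (charMul (pair σ₁ (fstPart z)) (dil k ψ))) * φ z) := fun j => by
      simp only [monoMul_charMul]
      exact (integrable_mul_of_hasCompactSupport (hcv j _) hφ).const_mul _
    have hi0 : Integrable fun z => osc σ₁ (fun _ => T) ψ k z * φ z :=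
      integrable_mul_of_hasCompactSupport (hcont _) hφ
    simp only [← integral_const_mul]
    rw [← integral_finsetSum _ fun j _ => hi j, ← integral_add hi0 (integrable_finsetSum _ fun j _ => hi j)]
    refine integral_congr_ae (Eventually.of_forall fun z => ?_)
    by_cases hz : z ∈ tsupport φ
    · have h3 : χ (sndPart z) = 1 := hχ1 _ ((norm_sndPart_le z).trans
        ((mem_ball_zero_iff.1 (hs hz)).le.trans (by
          have : ρ ≤ R / 4 := min_le_left _ _
          linarith)))
      simp only [osc, hTapp, h3, Complex.ofReal_one, one_mul, sub_mul, Finset.sum_mul, mul_assoc]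
      ring
    · simp [image_eq_zero_of_notMem_tsupport hz]
  have h3 := tendsto_sum_osc hΘ hψΘ σ s f φ
  rw [← hs'] at h3
  simp only [← h2] at h1
  have h4 := tendsto_nhds_unique h3 h1.tendsto_sum_nat
  rw [← hs', h4]
  have h5 : ∫ z, (P₀ + ∑ j, (-1 : ℂ) ^ (∑ i, β j i) • P j) z * φ z =
      (∫ z, P₀ z * φ z) + ∑ j, (-1 : ℂ) ^ (∑ i, β j i) * ∫ z, P j z * φ z := by
    have hi : ∀ j, Integrable fun z => (-1 : ℂ) ^ (∑ i, β j i) * (P j z * φ z) := fun j =>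
      (integrable_mul_of_hasCompactSupport (continuous_of_mem_polySpan (hP j)) hφ).const_mul _
    simp only [← integral_const_mul]
    rw [← integral_finsetSum _ fun j _ => hi j, ← integral_add (integrable_mul_of_hasCompactSupport
      (continuous_of_mem_polySpan hP₀) hφ) (integrable_finsetSum _ fun j _ => hi j)]
    refine integral_congr_ae (Eventually.of_forall fun z => ?_)
    simp only [Pi.add_apply, Finset.sum_apply, Pi.smul_apply, smul_eq_mul, add_mul, Finset.sum_mul,
      mul_assoc]
  rw [h5]
  simp only [mul_add, Finset.sum_add_distrib]
  ring

end SplittingMain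

/-! ### From the neighbourhood of the origin to tempered distributions. -/

section SplittingTheorem

/-- Division by a power of 1 + ‖x‖² leaves a bounded function, and multiplication by this power
preserves Schwartz functions. -/
theorem exists_dist_of_growth {V : Type*} [NormedAddCommGroup V] [InnerProductSpace ℝ V]
    [FiniteDimensional ℝ V] [MeasurableSpace V] [BorelSpace V] {F : V → ℂ} (hF : Continuous F)
    {C : ℝ} {K : ℕ} (hb : ∀ x, ‖F x‖ ≤ C * (1 + ‖x‖) ^ K) :
    ∃ u : 𝓢(V, ℂ) →L[ℂ] ℂ, ∀ φ, u φ = ∫ x, F x * φ x := by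
  set w : V → ℝ := fun x => (1 + ‖x‖ ^ 2) ^ (K : ℝ)
  have hw : ∀ x, 0 < w x := fun x => by positivity
  have hwg : (fun x => (w x : ℂ)).HasTemperateGrowth :=
    ofReal_comp_hasTemperateGrowth (Function.hasTemperateGrowth_one_add_norm_sq_rpow V (K : ℝ))
  have hwc : Continuous fun x => (w x : ℂ) := hwg.1.continuous
  have hC : ∃ C' : ℝ, ∀ x, ‖F x / w x‖ ≤ C' := by
    refine ⟨|C| * 2 ^ K, fun x => ?_⟩
    rw [norm_div, Complex.norm_real, Real.norm_of_nonneg (hw x).le, div_le_iff₀ (hw x), mul_assoc]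
    refine (hb x).trans ((mul_le_mul_of_nonneg_right (le_abs_self C) (by positivity)).trans ?_)
    refine mul_le_mul_of_nonneg_left ?_ (abs_nonneg C)
    simp only [w, Real.rpow_natCast]
    rw [← mul_pow]
    exact pow_le_pow_left₀ (by positivity) (by nlinarith [sq_nonneg (‖x‖ - 1), norm_nonneg x]) K
  refine ⟨(boundedDist (fun x => F x / w x)
    (hF.div hwc fun x => by exact_mod_cast (hw x).ne') hC).comp
    (SchwartzMap.smulLeftCLM ℂ fun x => (w x : ℂ)), fun φ => ?_⟩
  rw [ContinuousLinearMap.comp_apply, boundedDist_apply]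
  refine integral_congr_ae (Eventually.of_forall fun x => ?_)
  have : (w x : ℂ) ≠ 0 := by exact_mod_cast (hw x).ne'
  simp only
  rw [SchwartzMap.smulLeftCLM_apply_apply hwg, smul_eq_mul]
  field_simp

variable {ι κ : Type*} [Fintype ι] [Fintype κ]

theorem norm_polySum_le [DecidableEq ι] (d : ℤ) {c : (ι → ℕ) → Vec κ → ℂ}
    (hc : ∀ γ, ∃ C : ℝ, ∀ p, ‖c γ p‖ ≤ C) :
    ∃ C : ℝ, ∀ z : Vec (ι ⊕ κ), ‖polySum d c z‖ ≤ C * (1 + ‖z‖) ^ d.toNat := by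
  choose C hC using hc
  refine ⟨∑ k ∈ Finset.range d.toNat, ∑ γ ∈ Finset.piAntidiag (Finset.univ : Finset ι) k, |C γ|,
    fun z => ?_⟩
  rw [polySum, Finset.sum_mul]
  refine (norm_sum_le _ _).trans (Finset.sum_le_sum fun k hk => ?_)
  rw [Finset.sum_mul]
  refine (norm_sum_le _ _).trans (Finset.sum_le_sum fun γ hγ => ?_)
  rw [norm_mul, Complex.norm_real, Real.norm_eq_abs]
  refine mul_le_mul ((hC γ _).trans (le_abs_self _)) ?_ (abs_nonneg _) (abs_nonneg _)
  refine (abs_prod_pow_le (fstPart z) γ).trans ?_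
  rw [(Finset.mem_piAntidiag.1 hγ).1]
  have h1 : ‖fstPart z‖ ≤ 1 + ‖z‖ := (norm_fstPart_le z).trans (by linarith [norm_nonneg z])
  exact (pow_le_pow_left₀ (norm_nonneg _) h1 k).trans
    (pow_le_pow_right₀ (by linarith [norm_nonneg z]) (Finset.mem_range.1 hk).le)

/-- The coefficients are merely continuous in q' and might grow too fast for the polynomial to be
tempered. Only their values near q' = 0 matter, so they are multiplied by a cutoff; then the
polynomial is a tempered distribution u, and t - u is the O^dist term. -/
theorem exists_eqODistAdd [Nonempty ι] [DecidableEq ι] {t : 𝓢'(Vec (ι ⊕ κ), ℂ)} {d : ℤ} {δ ρ : ℝ}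
    (hρ : 0 < ρ) {P : Vec (ι ⊕ κ) → ℂ} (hP : P ∈ polySpan ι κ d.toNat)
    (h : HasRep (fun φ => t φ - ∫ z, P z * φ z) δ ρ) :
    ∃ c : (ι → ℕ) → Vec κ → ℂ, (∀ γ, Continuous (c γ)) ∧ EqODistAdd t δ (polySum d c) := by
  obtain ⟨c, hc, rfl⟩ := exists_polySum_of_mem_polySpan hP
  obtain ⟨χ, hχ, hχc, hχs, hχ1, hχ0, hχle⟩ :=
    exists_cutoff (V := Vec κ) (ρ := 2 * ρ) (by positivity)
  have hχC : Continuous fun p => (χ p : ℂ) := Complex.continuous_ofReal.comp hχ.continuous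
  have hχcC : HasCompactSupport fun p => (χ p : ℂ) :=
    hχc.comp_left (g := Complex.ofReal) Complex.ofReal_zero
  have hc' : ∀ γ, Continuous fun p => (χ p : ℂ) * c γ p := fun γ => hχC.mul (hc γ)
  obtain ⟨C, hC⟩ := norm_polySum_le (κ := κ) d (c := fun γ p => (χ p : ℂ) * c γ p) fun γ =>
    (hc' γ).bounded_above_of_compact_support hχcC.mul_right
  have hcont : Continuous (polySum d fun γ p => (χ p : ℂ) * c γ p : Vec (ι ⊕ κ) → ℂ) := by
    unfold polySum
    exact continuous_finsetSum _ fun k _ => continuous_finsetSum _ fun γ _ =>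
      continuous_monom γ (hc' γ)
  obtain ⟨u, hu⟩ := exists_dist_of_growth hcont hC
  obtain ⟨t', ht'⟩ : ∃ t' : 𝓢(Vec (ι ⊕ κ), ℂ) →L[ℂ] ℂ, t' = t := ⟨t, rfl⟩
  refine ⟨_, hc', (t' - u : 𝓢(Vec (ι ⊕ κ), ℂ) →L[ℂ] ℂ), ?_, fun φ _ => ?_⟩
  · refine HasRep.isODist hρ (h.congr fun φ hφ hs => ?_)
    change t' φ - u φ = _
    rw [hu, ht']
    congr 1
    refine integral_congr_ae (Eventually.of_forall fun z => ?_)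
    simp only
    by_cases hz : z ∈ tsupport φ
    · have h1 : χ (sndPart z) = 1 := hχ1 _ ((norm_sndPart_le z).trans
        ((mem_ball_zero_iff.1 (hs hz)).le.trans (by linarith)))
      congr 1
      simp only [polySum, h1, Complex.ofReal_one, one_mul]
    · rw [image_eq_zero_of_notMem_tsupport hz, mul_zero, mul_zero]
  · change t φ = t' φ - u φ + _
    rw [hu, ht']
    exact (sub_add_cancel _ _).symm

/-- Splitting: multiplication with a UV regular splitting function changes the infrared behaviour
of the transform only by a polynomial in `q`. -/
theorem eqODistAdd_splitDist [Nonempty ι] [DecidableEq ι] {Θ : Vec ι → ℝ}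
    (hΘ : IsUVRegularSplitting Θ) (σ : ι ⊕ κ → ℤˣ) (s : 𝓢'(Vec (ι ⊕ κ), ℂ)) (f : 𝓢(Vec κ, ℂ))
    {d : ℤ} {ε : ℝ} (hε0 : 0 < ε) (hε1 : ε < 1)
    (h : IsODist (fourierDist σ (mulSnd f s)) ((d : ℝ) - ε)) :
    ∃ c : (ι → ℕ) → Vec κ → ℂ, (∀ γ, Continuous (c γ)) ∧
      EqODistAdd (fourierDist σ (splitDist Θ (mulSnd f s))) ((d : ℝ) - ε) (polySum d c) := by
  obtain ⟨ρ, hρ, P, hP, hrep⟩ := exists_hasRep_splitDist hΘ σ s f hε0 hε1 h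
  exact exists_eqODistAdd hρ hP hrep

end SplittingTheorem

/-! ### The ring of formal series -/

section SeriesRing

variable {N : ℕ}

theorem shuffleSign_union_left (f : Fin N → ZMod 2) {K L : Finset (Fin N)} (h : Disjoint K L)
    (M : Finset (Fin N)) :
    shuffleSign f (K ∪ L) M = shuffleSign f K M * shuffleSign f L M :=
  Finset.prod_union h

theorem shuffleSign_union_right (f : Fin N → ZMod 2) (K : Finset (Fin N)) {L M : Finset (Fin N)}
    (h : Disjoint L M) :
    shuffleSign f K (L ∪ M) = shuffleSign f K L * shuffleSign f K M := by
  simp only [shuffleSign, ← Finset.prod_mul_distrib]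
  exact Finset.prod_congr rfl fun a _ => Finset.prod_union h

/-- Formal series, with the product `serMul f`. -/
def Ser (_f : Fin N → ZMod 2) (R : Type*) : Type _ := Finset (Fin N) → R

variable {f : Fin N → ZMod 2} {R : Type*} [Ring R]

instance : AddCommGroup (Ser f R) := inferInstanceAs (AddCommGroup (Finset (Fin N) → R))

/-- Both sides are sums over ordered partitions of K into three sets, matched by (L, M) ↦ (M, L \
M). The signs agree because `shuffleSign` is multiplicative over disjoint unions in each argument.
-/
theorem serMul_assoc (F G H : Finset (Fin N) → R) :
    serMul f (serMul f F G) H = serMul f F (serMul f G H) := by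
  funext K
  simp only [serMul, Finset.smul_sum, Finset.sum_mul, Finset.mul_sum]
  rw [Finset.sum_sigma', Finset.sum_sigma']
  refine Finset.sum_bij' (fun x _ => ⟨x.2, x.1 \ x.2⟩) (fun x _ => ⟨x.1 ∪ x.2, x.1⟩) ?_ ?_ ?_ ?_ ?_
  · rintro ⟨L, M⟩ h
    simp only [Finset.mem_sigma, Finset.mem_powerset] at h ⊢
    exact ⟨h.2.trans h.1, Finset.sdiff_subset_sdiff h.1 le_rfl⟩
  · rintro ⟨M, L⟩ h
    simp only [Finset.mem_sigma, Finset.mem_powerset] at h ⊢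
    exact ⟨Finset.union_subset h.1 (h.2.trans Finset.sdiff_subset), Finset.subset_union_left⟩
  · rintro ⟨L, M⟩ h
    simp only [Finset.mem_sigma, Finset.mem_powerset] at h
    simp only [Finset.union_sdiff_of_subset h.2]
  · rintro ⟨M, L⟩ h
    simp only [Finset.mem_sigma, Finset.mem_powerset] at h
    have : Disjoint M L := Finset.disjoint_of_subset_right h.2 Finset.disjoint_sdiff
    simp only [Finset.union_sdiff_cancel_left this]
  · rintro ⟨L, M⟩ h
    simp only [Finset.mem_sigma, Finset.mem_powerset] at h
    have h1 : (K \ M) \ (L \ M) = K \ L := by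
      ext x
      simp only [Finset.mem_sdiff]
      have := @h.2 x
      tauto
    have h2 : K \ M = (L \ M) ∪ (K \ L) := by
      ext x
      simp only [Finset.mem_sdiff, Finset.mem_union]
      have := @h.2 x
      have := @h.1 x
      tauto
    have h3 : Disjoint (L \ M) (K \ L) :=
      Finset.disjoint_of_subset_left Finset.sdiff_subset Finset.disjoint_sdiff
    have h4 : shuffleSign f L (K \ L) = shuffleSign f M (K \ L) * shuffleSign f (L \ M) (K \ L) := by
      rw [← shuffleSign_union_left f Finset.disjoint_sdiff, Finset.union_sdiff_of_subset h.2]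
    simp only
    have h5 : shuffleSign f M (K \ M) = shuffleSign f M (L \ M) * shuffleSign f M (K \ L) := by
      rw [h2]; exact shuffleSign_union_right f M h3
    rw [h1, h4, h5]
    simp only [smul_mul_assoc, mul_smul_comm, smul_smul, mul_assoc]
    congr 1
    ring

theorem serOne_mul (F : Finset (Fin N) → R) : serMul f serOne F = F := by
  funext K
  rw [serMul, Finset.sum_eq_single ∅]
  · simp [serOne, shuffleSign]
  · intro L _ hL; simp [serOne, hL]
  · simp

theorem serMul_one (F : Finset (Fin N) → R) : serMul f F serOne = F := by
  funext K
  rw [serMul, Finset.sum_eq_single K]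
  · simp [serOne, shuffleSign]
  · intro L hL hLK
    have : K \ L ≠ ∅ := fun h =>
      hLK ((Finset.mem_powerset.1 hL).antisymm (Finset.sdiff_eq_empty_iff_subset.1 h))
    simp [serOne, this]
  · simp

instance : Ring (Ser f R) where
  __ := (inferInstance : AddCommGroup (Ser f R))
  mul F G := serMul f F G
  one := (serOne : Finset (Fin N) → R)
  mul_assoc := serMul_assoc
  one_mul := serOne_mul
  mul_one := serMul_one
  left_distrib F G H := by
    funext K
    change serMul f F (fun K => G K + H K) K = serMul f F G K + serMul f F H K
    simp only [serMul, mul_add, smul_add, Finset.sum_add_distrib]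
  right_distrib F G H := by
    funext K
    change serMul f (fun K => F K + G K) H K = serMul f F H K + serMul f G H K
    simp only [serMul, add_mul, smul_add, Finset.sum_add_distrib]
  zero_mul F := by
    funext K
    change serMul f (fun _ => 0) F K = 0
    simp [serMul]
  mul_zero F := by
    funext K
    change serMul f F (fun _ => 0) K = 0
    simp [serMul]

theorem Ser.mul_def (F G : Ser f R) : F * G = (serMul f F G : Finset (Fin N) → R) := rfl

theorem Ser.mul_apply (F G : Ser f R) (K : Finset (Fin N)) :
    (F * G) K = ∑ L ∈ K.powerset, shuffleSign f L (K \ L) • (F L * G (K \ L)) := rfl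

theorem Ser.one_apply (K : Finset (Fin N)) : (1 : Ser f R) K = if K = ∅ then 1 else 0 := rfl

theorem Ser.add_apply (F G : Ser f R) (K : Finset (Fin N)) : (F + G) K = F K + G K := rfl

theorem Ser.sub_apply (F G : Ser f R) (K : Finset (Fin N)) : (F - G) K = F K - G K := rfl

theorem Ser.sum_apply {J : Type*} (s : Finset J) (F : J → Ser f R) (K : Finset (Fin N)) :
    (∑ j ∈ s, F j) K = ∑ j ∈ s, F j K :=
  Finset.sum_apply (M := fun _ : Finset (Fin N) => R) K s F

theorem serPow_eq (F : Ser f R) (r : ℕ) : (serPow f F r : Finset (Fin N) → R) = (F ^ r : Ser f R) := by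
  induction r with
  | zero => rw [pow_zero]; rfl
  | succ r ih => rw [pow_succ', Ser.mul_def, ← ih]; rfl

theorem serInv_eq (F : Ser f R) :
    (serInv f F : Finset (Fin N) → R) = (∑ r ∈ Finset.range (N + 1), (1 - F) ^ r : Ser f R) := by
  funext K
  have h1 := Ser.sum_apply (f := f) (Finset.range (N + 1)) (fun r => (1 - F) ^ r) K
  refine Eq.trans ?_ h1.symm
  exact Finset.sum_congr rfl fun r _ => congrFun (serPow_eq (1 - F) r) K

/-- Without constant term each of the r factors uses up at least one variable. This makes the
geometric series for the inverse finite. -/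
theorem Ser.pow_apply_eq_zero {F : Ser f R} (h : F ∅ = 0) (r : ℕ) (K : Finset (Fin N))
    (hK : K.card < r) : (F ^ r) K = 0 := by
  induction r generalizing K with
  | zero => omega
  | succ r ih =>
    rw [pow_succ', Ser.mul_apply]
    refine Finset.sum_eq_zero fun L hL => ?_
    rcases L.eq_empty_or_nonempty with h0 | h0
    · rw [h0, h, zero_mul, smul_zero]
    · rw [ih, mul_zero, smul_zero]
      have h1 := Finset.card_sdiff_add_card_eq_card (Finset.mem_powerset.1 hL)
      have h2 := h0.card_pos
      omega

theorem Ser.one_sub_pow_eq_zero {F : Ser f R} (h : F ∅ = 1) : (1 - F) ^ (N + 1) = 0 := by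
  funext K
  refine Ser.pow_apply_eq_zero ?_ _ K ?_
  · rw [Ser.sub_apply, h, Ser.one_apply, if_pos rfl, sub_self]
  · have := Finset.card_le_univ K
    rw [Fintype.card_fin] at this
    omega

/-- The inverse of a series with constant term `1`. -/
def Ser.inv (F : Ser f R) : Ser f R := ∑ r ∈ Finset.range (N + 1), (1 - F) ^ r

theorem Ser.mul_inv {F : Ser f R} (h : F ∅ = 1) : F * F.inv = 1 := by
  have := mul_neg_geom_sum (1 - F) (N + 1)
  rwa [Ser.one_sub_pow_eq_zero h, sub_sub_cancel, sub_zero] at this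

theorem Ser.inv_mul {F : Ser f R} (h : F ∅ = 1) : F.inv * F = 1 := by
  have := geom_sum_mul_neg (1 - F) (N + 1)
  rwa [Ser.one_sub_pow_eq_zero h, sub_sub_cancel, sub_zero] at this

theorem Ser.mul_apply_empty (F G : Ser f R) : (F * G) ∅ = F ∅ * G ∅ := by
  rw [Ser.mul_apply]; simp [shuffleSign]

/-- (CB)⁻¹ = B⁻¹C⁻¹, and B cancels. This removes a set of variables from the advanced products;
`Ser.inv_mul_mul` does the same for the retarded ones. -/
theorem Ser.mul_mul_inv {A B C : Ser f R} (hB : B ∅ = 1) (hC : C ∅ = 1) :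
    A * B * (C * B).inv = A * C.inv := by
  have h1 : (C * B) ∅ = 1 := by rw [Ser.mul_apply_empty, hB, hC, one_mul]
  have h2 : (C * B).inv = B.inv * C.inv := by
    refine left_inv_eq_right_inv (Ser.inv_mul h1) ?_
    rw [mul_assoc, ← mul_assoc B, Ser.mul_inv hB, one_mul, Ser.mul_inv hC]
  rw [h2, mul_assoc, ← mul_assoc B, Ser.mul_inv hB, one_mul]

theorem Ser.inv_mul_mul {A B C : Ser f R} (hB : B ∅ = 1) (hC : C ∅ = 1) :
    (B * C).inv * (B * A) = C.inv * A := by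
  have h1 : (B * C) ∅ = 1 := by rw [Ser.mul_apply_empty, hB, hC, one_mul]
  have h2 : (B * C).inv = C.inv * B.inv := by
    refine left_inv_eq_right_inv (Ser.inv_mul h1) ?_
    rw [mul_assoc, ← mul_assoc C, Ser.mul_inv hC, one_mul, Ser.mul_inv hB]
  rw [h2, mul_assoc, ← mul_assoc B.inv, Ser.inv_mul hB, one_mul]

/-- The subring of the series in the variables `g_j`, `j ∈ Z`. -/
def Ser.supported (f : Fin N → ZMod 2) (R : Type*) [Ring R] (Z : Finset (Fin N)) :
    Subring (Ser f R) where
  carrier := {F | ∀ K, ¬K ⊆ Z → F K = 0}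
  mul_mem' := by
    intro F G hF hG K hK
    rw [Ser.mul_apply]
    refine Finset.sum_eq_zero fun L hL => ?_
    by_cases h1 : L ⊆ Z
    · have h2 : ¬K \ L ⊆ Z := fun h => hK fun x hx => by
        by_cases hxL : x ∈ L
        exacts [h1 hxL, h (Finset.mem_sdiff.2 ⟨hx, hxL⟩)]
      rw [hG _ h2, mul_zero, smul_zero]
    · rw [hF _ h1, zero_mul, smul_zero]
  one_mem' := by
    intro K hK
    rw [Ser.one_apply, if_neg]
    rintro rfl
    exact hK (Finset.empty_subset _)
  add_mem' := by
    intro F G hF hG K hK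
    rw [Ser.add_apply, hF K hK, hG K hK, add_zero]
  zero_mem' := fun K _ => rfl
  neg_mem' := by
    intro F hF K hK
    change -(F K) = 0
    rw [hF K hK, neg_zero]

theorem Ser.inv_mem_supported {Z : Finset (Fin N)} {F : Ser f R} (hF : F ∈ Ser.supported f R Z) :
    F.inv ∈ Ser.supported f R Z :=
  Subring.sum_mem _ fun _ _ => Subring.pow_mem _ (Subring.sub_mem _ (Subring.one_mem _) hF) _

theorem serProd_eq (l : List (Ser f R)) : (serProd f l : Finset (Fin N) → R) = (l.prod : Ser f R) := by
  induction l with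
  | nil => rfl
  | cons F l ih => rw [List.prod_cons, Ser.mul_def, ← ih]; rfl

end SeriesRing

/-! ### Causal factorisation of the generating functional -/

section Causal

variable {p : ℕ} {par : Fin p → ZMod 2} {D : Type*} [AddCommGroup D] [Module ℂ D]
  {form : D →ₗ⋆[ℂ] D →ₗ[ℂ] ℂ} {N : ℕ}

theorem genS_eq (𝒯 : TimeOrdered par form) (B : Fin N → SymField par)
    (g : Fin N → 𝓢(Vec (Fin 4), ℂ)) {X K : Finset (Fin N)} (hK : K ⊆ X) {k : ℕ} (hk : K.card = k) :
    genS 𝒯 B g X K = Complex.I ^ k • 𝒯.T k (fun j => B (K.orderEmbOfFin hk j))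
      (testProd fun j => g (K.orderEmbOfFin hk j)) := by
  subst hk
  rw [genS, if_pos hK]

theorem exists_perm_append {K L : Finset (Fin N)} (h : Disjoint K L)
    (hKL : (K ∪ L).card = K.card + L.card) :
    ∃ π : Equiv.Perm (Fin (K.card + L.card)), ∀ i, (K ∪ L).orderEmbOfFin hKL (π i) =
      Fin.append (K.orderEmbOfFin rfl) (L.orderEmbOfFin rfl) i := by
  set w := Fin.append (K.orderEmbOfFin rfl) (L.orderEmbOfFin rfl)
  have hw : ∀ i, w i ∈ K ∪ L := by
    intro i
    refine Fin.addCases (fun i => ?_) (fun i => ?_) i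
    · simp only [w, Fin.append_left]
      exact Finset.mem_union_left _ (Finset.orderEmbOfFin_mem _ _ _)
    · simp only [w, Fin.append_right]
      exact Finset.mem_union_right _ (Finset.orderEmbOfFin_mem _ _ _)
  have hinj : Function.Injective w := by
    rw [Fin.append_injective_iff]
    refine ⟨(K.orderEmbOfFin rfl).injective, (L.orderEmbOfFin rfl).injective, fun i j hij => ?_⟩
    exact Finset.disjoint_left.1 h (Finset.orderEmbOfFin_mem K rfl i)
      (hij ▸ Finset.orderEmbOfFin_mem L rfl j)
  set v : Fin (K.card + L.card) → Fin (K.card + L.card) := fun i =>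
    ((K ∪ L).orderIsoOfFin hKL).symm ⟨w i, hw i⟩
  have hv : Function.Injective v := fun i j hij => by
    have := ((K ∪ L).orderIsoOfFin hKL).symm.injective hij
    exact hinj (Subtype.ext_iff.1 this)
  refine ⟨Equiv.ofBijective v (Finite.injective_iff_bijective.1 hv), fun i => ?_⟩
  rw [Equiv.ofBijective_apply, ← Finset.coe_orderIsoOfFin_apply]
  simp [v]

/-- Inside K and inside L the elements are already increasing, so the inversions are the pairs with
one element in each, and these are what `shuffleSign` counts. -/
theorem permSign_eq_shuffleSign (f : Fin N → ZMod 2) {K L : Finset (Fin N)}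
    (hKL : (K ∪ L).card = K.card + L.card) (π : Equiv.Perm (Fin (K.card + L.card)))
    (hπ : ∀ i, (K ∪ L).orderEmbOfFin hKL (π i) =
      Fin.append (K.orderEmbOfFin rfl) (L.orderEmbOfFin rfl) i) :
    permSign (fun i => f ((K ∪ L).orderEmbOfFin hKL i)) π = shuffleSign f K L := by
  have h1 : ∀ i j, π j < π i ↔ Fin.append (K.orderEmbOfFin rfl) (L.orderEmbOfFin rfl) j <
      Fin.append (K.orderEmbOfFin rfl) (L.orderEmbOfFin rfl) i := fun i j => by
    rw [← hπ, ← hπ, OrderEmbedding.lt_iff_lt]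
  have h2 : ∀ (M : Finset (Fin N)) (F : Fin N → ℤ), ∏ i, F (M.orderEmbOfFin rfl i) = ∏ a ∈ M, F a := by
    intro M F
    conv_rhs => rw [← Finset.image_orderEmbOfFin_univ M rfl]
    rw [Finset.prod_image fun i _ j _ h => (M.orderEmbOfFin rfl).injective h]
  have h3 : ∀ i j : Fin K.card, ¬(i < j ∧ K.orderEmbOfFin rfl j < K.orderEmbOfFin rfl i) := by
    rintro i j ⟨hij, h⟩
    exact lt_asymm hij ((K.orderEmbOfFin rfl).lt_iff_lt.1 h)
  have h4 : ∀ i j : Fin L.card, ¬(i < j ∧ L.orderEmbOfFin rfl j < L.orderEmbOfFin rfl i) := by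
    rintro i j ⟨hij, h⟩
    exact lt_asymm hij ((L.orderEmbOfFin rfl).lt_iff_lt.1 h)
  have h5 : ∀ (i : Fin K.card) (j : Fin L.card), Fin.castAdd L.card i < Fin.natAdd K.card j := by
    intro i j
    rw [Fin.lt_def, Fin.val_castAdd, Fin.val_natAdd]
    omega
  have h6 : ∀ (i : Fin L.card) (j : Fin K.card), ¬Fin.natAdd K.card i < Fin.castAdd L.card j :=
    fun i j => (h5 j i).not_gt
  have h7 : ∀ i j : Fin K.card, Fin.castAdd L.card i < Fin.castAdd L.card j ↔ i < j :=
    fun i j => Iff.rfl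
  have h8 : ∀ i j : Fin L.card, Fin.natAdd K.card i < Fin.natAdd K.card j ↔ i < j := by
    intro i j; simp
  rw [permSign]
  simp only [h1, hπ, Fin.prod_univ_add, Fin.append_left, Fin.append_right, h7, h8, h3, h4, h6, h5,
    if_false, false_and, true_and, Finset.prod_const_one, one_mul, mul_one]
  rw [shuffleSign, ← h2 K]
  refine Finset.prod_congr rfl fun i _ => ?_
  rw [← h2 L]

theorem append_comp {X : Type*} {K L : Finset (Fin N)} (B : Fin N → X) (i : Fin (K.card + L.card)) :
    B (Fin.append (K.orderEmbOfFin rfl) (L.orderEmbOfFin rfl) i) =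
      Fin.append (fun j => B (K.orderEmbOfFin rfl j)) (fun j => B (L.orderEmbOfFin rfl j)) i := by
  refine Fin.addCases (fun i => ?_) (fun i => ?_) i <;> simp

/-- The generating functional as an element of the ring of formal series. -/
def serS (𝒯 : TimeOrdered par form) (f : Fin N → ZMod 2) (B : Fin N → SymField par)
    (g : Fin N → 𝓢(Vec (Fin 4), ℂ)) (X : Finset (Fin N)) : Ser f (Module.End ℂ D) :=
  genS 𝒯 B g X

/-- Causal factorisation `S(g + h) = S(g) S(h)`. -/
theorem serS_union (𝒯 : TimeOrdered par form) {f : Fin N → ZMod 2} {B : Fin N → SymField par}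
    (hB : ∀ j, B j ∈ homogeneous par (f j)) {g : Fin N → 𝓢(Vec (Fin 4), ℂ)}
    (hg : ∀ j, HasCompactSupport (g j)) {X Y : Finset (Fin N)} (hXY : Disjoint X Y)
    (hc : ∀ i ∈ X, ∀ j ∈ Y, ∀ x ∈ tsupport (g i), ∀ y ∈ tsupport (g j), y - x ∉ forwardCone) :
    serS 𝒯 f B g (X ∪ Y) = serS 𝒯 f B g X * serS 𝒯 f B g Y := by
  funext M
  rw [Ser.mul_apply]
  simp only [serS]
  by_cases hM : M ⊆ X ∪ Y
  -- Of all decompositions of M only (M ∩ X, M ∩ Y) contributes; in the others one factor vanishes.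
  · rw [Finset.sum_eq_single (M ∩ X)]
    · have h0 : M \ (M ∩ X) = M ∩ Y := by
        ext x
        have h1 := @hM x
        have h2 : x ∈ X → x ∉ Y := fun hx => Finset.disjoint_left.1 hXY hx
        simp only [Finset.mem_sdiff, Finset.mem_inter, Finset.mem_union] at h1 ⊢
        tauto
      rw [h0]
      obtain ⟨K, hK⟩ : ∃ K, K = M ∩ X := ⟨_, rfl⟩
      obtain ⟨L, hL⟩ : ∃ L, L = M ∩ Y := ⟨_, rfl⟩
      have hKX : K ⊆ X := hK ▸ Finset.inter_subset_right
      have hLY : L ⊆ Y := hL ▸ Finset.inter_subset_right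
      have hMKL : M = K ∪ L := by
        rw [hK, hL, ← Finset.inter_union_distrib_left, Finset.inter_eq_left.2 hM]
      have hd : Disjoint K L := Finset.disjoint_of_subset_left hKX
        (Finset.disjoint_of_subset_right hLY hXY)
      rw [← hK, ← hL]
      have hcard : (K ∪ L).card = K.card + L.card := Finset.card_union_of_disjoint hd
      obtain ⟨π, hπ⟩ := exists_perm_append hd hcard
      subst hMKL
      rw [genS_eq 𝒯 B g hM hcard, genS_eq 𝒯 B g hKX rfl, genS_eq 𝒯 B g hLY rfl]
      -- Graded symmetry moves the arguments in K in front of those in L, with the sign that the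
      -- product of series carries; then causality factorises.
      rw [𝒯.graded_symm _ (fun i => f ((K ∪ L).orderEmbOfFin hcard i)) _ (fun j => hB _) π,
        permSign_eq_shuffleSign f hcard π hπ]
      simp only [hπ, append_comp]
      rw [𝒯.causal]
      · rw [smul_mul_smul_comm, ← pow_add, smul_comm]
      · exact fun i => hg _
      · exact fun j => hg _
      · exact fun i j => hc _ (hKX (Finset.orderEmbOfFin_mem _ _ _)) _
          (hLY (Finset.orderEmbOfFin_mem _ _ _))
    · intro L hL hLM
      by_cases h1 : L ⊆ X
      · have h2 : ¬M \ L ⊆ Y := by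
          intro h
          refine hLM (Finset.Subset.antisymm (Finset.subset_inter (Finset.mem_powerset.1 hL) h1) ?_)
          intro x hx
          by_contra hxL
          obtain ⟨hxM, hxX⟩ := Finset.mem_inter.1 hx
          exact Finset.disjoint_left.1 hXY hxX (h (Finset.mem_sdiff.2 ⟨hxM, hxL⟩))
        rw [genS, genS, if_neg h2, mul_zero, smul_zero]
      · rw [genS, if_neg h1, zero_mul, smul_zero]
    · intro h; exact (h (Finset.mem_powerset.2 Finset.inter_subset_left)).elim
  · rw [genS, if_neg hM]
    refine (Finset.sum_eq_zero fun L hL => ?_).symm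
    by_cases h1 : L ⊆ X
    · have h2 : ¬M \ L ⊆ Y := by
        intro h
        refine hM fun x hx => ?_
        by_cases hxL : x ∈ L
        exacts [Finset.mem_union_left _ (h1 hxL),
          Finset.mem_union_right _ (h (Finset.mem_sdiff.2 ⟨hx, hxL⟩))]
      rw [genS, genS, if_neg h2, mul_zero, smul_zero]
    · rw [genS, if_neg h1, zero_mul, smul_zero]

theorem serS_empty (𝒯 : TimeOrdered par form) (f : Fin N → ZMod 2) (B : Fin N → SymField par)
    (g : Fin N → 𝓢(Vec (Fin 4), ℂ)) (X : Finset (Fin N)) : serS 𝒯 f B g X ∅ = 1 := by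
  rw [serS, genS_eq 𝒯 B g (Finset.empty_subset X) (k := 0) rfl, 𝒯.empty]
  have h : ∀ g : Fin 0 → 𝓢(Vec (Fin 4), ℂ), testProd g 0 = 1 := fun g =>
    Fintype.prod_empty fun j => g j (coords (fun μ => (j, μ)) 0)
  rw [h, pow_zero, one_smul, one_smul]

theorem serS_mem_supported (𝒯 : TimeOrdered par form) {f : Fin N → ZMod 2} (B : Fin N → SymField par)
    (g : Fin N → 𝓢(Vec (Fin 4), ℂ)) {X Z : Finset (Fin N)} (h : X ⊆ Z) :
    serS 𝒯 f B g X ∈ Ser.supported f (Module.End ℂ D) Z := by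
  intro K hK
  rw [serS, genS, if_neg fun h' => hK (h'.trans h)]

end Causal

/-! ### Support of the advanced and retarded products -/

section Support

variable {p : ℕ} {par : Fin p → ZMod 2} {D : Type*} [AddCommGroup D] [Module ℂ D]
  {form : D →ₗ⋆[ℂ] D →ₗ[ℂ] ℂ} {n m : ℕ}

theorem append_mem_homogeneous {fB : Fin n → ZMod 2} {B : Fin n → SymField par}
    {fC : Fin m → ZMod 2} {C : Fin m → SymField par} (hB : ∀ j, B j ∈ homogeneous par (fB j))
    (hC : ∀ j, C j ∈ homogeneous par (fC j)) (j : Fin (n + m)) :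
    Fin.append B C j ∈ homogeneous par (Fin.append fB fC j) := by
  refine Fin.addCases (fun i => ?_) (fun i => ?_) j
  · simpa using hB i
  · simpa using hC i

theorem append_hasCompactSupport {g : Fin n → 𝓢(Vec (Fin 4), ℂ)} {h : Fin m → 𝓢(Vec (Fin 4), ℂ)}
    (hg : ∀ j, HasCompactSupport (g j)) (hh : ∀ j, HasCompactSupport (h j)) (j : Fin (n + m)) :
    HasCompactSupport (Fin.append g h j : 𝓢(Vec (Fin 4), ℂ)) := by
  refine Fin.addCases (fun i => ?_) (fun i => ?_) j
  · simpa using hg i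
  · simpa using hh i

theorem posI_eq_union (Y : Finset (Fin n)) :
    posI n m = Yᶜ.image (Fin.castAdd m) ∪ Y.image (Fin.castAdd m) := by
  rw [← Finset.image_union, Finset.union_comm, Finset.union_compl, posI]

theorem disjoint_posJ (P : Composition m) (i : Fin P.length) (Y : Finset (Fin n)) :
    Disjoint (Yᶜ.image (Fin.castAdd m) ∪ posJ n P i) (Y.image (Fin.castAdd m)) := by
  rw [Finset.disjoint_left]
  intro a ha hb
  obtain ⟨j, hj, rfl⟩ := Finset.mem_image.1 hb
  rcases Finset.mem_union.1 ha with h | h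
  · obtain ⟨j', hj', h'⟩ := Finset.mem_image.1 h
    rw [Fin.castAdd_inj] at h'
    exact Finset.mem_compl.1 hj' (h' ▸ hj)
  · obtain ⟨j', -, h'⟩ := Finset.mem_image.1 h
    have := congrArg Fin.val h'
    rw [Fin.val_natAdd, Fin.val_castAdd] at this
    omega

theorem disjoint_compl_image (Y : Finset (Fin n)) :
    Disjoint (Yᶜ.image (Fin.castAdd m)) (Y.image (Fin.castAdd m)) := by
  rw [Finset.disjoint_image (Fin.castAdd_injective n m)]
  exact disjoint_compl_left

/-- `R` relates the arguments outside of `Y` to those in `Y`. -/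
theorem forall_append {g : Fin n → 𝓢(Vec (Fin 4), ℂ)} {h : Fin m → 𝓢(Vec (Fin 4), ℂ)}
    {R : Vec (Fin 4) → Vec (Fin 4) → Prop} {Y : Finset (Fin n)}
    (hx : ∀ j ∈ Y, ∀ i, ∀ y ∈ tsupport (g j), ∀ x ∈ tsupport (h i), R x y)
    (hy : ∀ j ∈ Y, ∀ j' ∉ Y, ∀ y ∈ tsupport (g j), ∀ y' ∈ tsupport (g j'), R y' y)
    (P : Composition m) (i : Fin P.length) :
    ∀ a ∈ Yᶜ.image (Fin.castAdd m) ∪ posJ n P i, ∀ b ∈ Y.image (Fin.castAdd m),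
      ∀ x ∈ tsupport (Fin.append g h a : 𝓢(Vec (Fin 4), ℂ)),
        ∀ y ∈ tsupport (Fin.append g h b : 𝓢(Vec (Fin 4), ℂ)), R x y := by
  intro a ha b hb x hxa y hyb
  obtain ⟨j, hj, rfl⟩ := Finset.mem_image.1 hb
  rw [Fin.append_left] at hyb
  rcases Finset.mem_union.1 ha with h' | h'
  · obtain ⟨j', hj', rfl⟩ := Finset.mem_image.1 h'
    rw [Fin.append_left] at hxa
    exact hy j hj j' (Finset.mem_compl.1 hj') y hyb x hxa
  · obtain ⟨i', -, rfl⟩ := Finset.mem_image.1 h'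
    rw [Fin.append_right] at hxa
    exact hx j hj i' y hyb x hxa

theorem not_univ_subset {Y : Finset (Fin n)} (hY : Y.Nonempty) :
    ¬(Finset.univ : Finset (Fin (n + m))) ⊆ (Y.image (Fin.castAdd m))ᶜ := by
  obtain ⟨j, hj⟩ := hY
  intro h
  exact Finset.mem_compl.1 (h (Finset.mem_univ (Fin.castAdd m j))) (Finset.mem_image_of_mem _ hj)

/-- If no factor depends on the variables in Y, neither does the product, so it has no term
containing all variables. -/
theorem serProd_univ_eq_zero {f : Fin (n + m) → ZMod 2} {R : Type*} [Ring R] {Y : Finset (Fin n)}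
    (hY : Y.Nonempty) {k : ℕ} (F : Fin k → Finset (Fin (n + m)) → R)
    (hF : ∀ i, F i ∈ Ser.supported f R (Y.image (Fin.castAdd m))ᶜ) :
    serProd f ((List.finRange k).map F) Finset.univ = 0 := by
  refine (congrFun (serProd_eq (f := f) (R := R) ((List.finRange k).map F)) Finset.univ).trans ?_
  refine Subring.list_prod_mem (Ser.supported f R (Y.image (Fin.castAdd m))ᶜ) ?_ Finset.univ
    (not_univ_subset hY)
  intro G hG
  obtain ⟨i, -, rfl⟩ := List.mem_map.1 hG
  exact hF i

/-- No argument in Y is in the future of any argument outside of Y. So S(g) = S(g')S(g_Y) and S(g +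
h_i) = S(g' + h_i)S(g_Y), where g' collects the y-variables outside of Y. In S(g + h_i)S(g)⁻¹ the
factor S(g_Y) cancels, and no dependence on the variables in Y is left. -/
theorem advOp_eq_zero (𝒯 : TimeOrdered par form) (P : Composition m)
    {fB : Fin n → ZMod 2} {B : Fin n → SymField par}
    {fC : Fin m → ZMod 2} {C : Fin m → SymField par} (hB : ∀ j, B j ∈ homogeneous par (fB j))
    (hC : ∀ j, C j ∈ homogeneous par (fC j))
    {g : Fin n → 𝓢(Vec (Fin 4), ℂ)} {h : Fin m → 𝓢(Vec (Fin 4), ℂ)}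
    (hg : ∀ j, HasCompactSupport (g j)) (hh : ∀ j, HasCompactSupport (h j))
    {Y : Finset (Fin n)} (hY : Y.Nonempty)
    (hx : ∀ j ∈ Y, ∀ i, ∀ y ∈ tsupport (g j), ∀ x ∈ tsupport (h i), y - x ∉ forwardCone)
    (hy : ∀ j ∈ Y, ∀ j' ∉ Y, ∀ y ∈ tsupport (g j), ∀ y' ∈ tsupport (g j'),
      y - y' ∉ forwardCone) :
    advOp 𝒯 P fB B fC C g h = 0 := by
  set f := Fin.append fB fC
  set S := serS 𝒯 f (Fin.append B C) (Fin.append g h)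
  set Y₁ := Y.image (Fin.castAdd m)
  set Y₂ := Yᶜ.image (Fin.castAdd m)
  have hBC := append_mem_homogeneous hB hC
  have hgh := append_hasCompactSupport hg hh
  have hsub : Y₂ ⊆ Y₁ᶜ := fun a ha => Finset.mem_compl.2 fun h =>
    Finset.disjoint_left.1 (disjoint_compl_image Y) ha h
  have key := fun i => forall_append (R := fun x y => y - x ∉ forwardCone) hx hy P i
  obtain ⟨F, hF⟩ : ∃ F : Fin P.length → Ser f (Module.End ℂ D),
    ∀ i, F i = S (posI n m ∪ posJ n P i) * (S (posI n m)).inv := ⟨_, fun i => rfl⟩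
  have hkey : serProd f ((List.finRange P.length).map F) Finset.univ = 0 := by
    refine serProd_univ_eq_zero hY F fun i => (?_ : F i ∈ Ser.supported f (Module.End ℂ D) Y₁ᶜ)
    have h1 : S (posI n m ∪ posJ n P i) = S (Y₂ ∪ posJ n P i) * S Y₁ := by
      rw [← serS_union 𝒯 hBC hgh (disjoint_posJ P i Y) (key i), posI_eq_union Y,
        Finset.union_right_comm]
    have h2 : S (posI n m) = S Y₂ * S Y₁ := by
      rw [← serS_union 𝒯 hBC hgh (disjoint_compl_image Y) fun a ha => key i a
        (Finset.mem_union_left _ ha), posI_eq_union Y]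
    rw [hF, h1, h2, Ser.mul_mul_inv (serS_empty 𝒯 f _ _ _) (serS_empty 𝒯 f _ _ _)]
    exact (Ser.supported f (Module.End ℂ D) Y₁ᶜ).mul_mem (serS_mem_supported 𝒯 _ _ (Finset.union_subset hsub fun a ha =>
      Finset.mem_compl.2 fun h => Finset.disjoint_left.1 (disjoint_posJ P i Y)
        (Finset.mem_union_right _ ha) h)) (Ser.inv_mem_supported (serS_mem_supported 𝒯 _ _ hsub))
  have h3 : (fun i => serMul f (genS 𝒯 (Fin.append B C) (Fin.append g h) (posI n m ∪ posJ n P i))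
      (serInv f (genS 𝒯 (Fin.append B C) (Fin.append g h) (posI n m)))) =
      F := funext fun i => by
    rw [hF, Ser.mul_def, ← show _ = (S (posI n m)).inv from serInv_eq (S (posI n m))]
    rfl
  refine (congrArg (fun G => (-Complex.I) ^ (n + m) • serProd f ((List.finRange P.length).map G)
    Finset.univ) h3).trans ?_
  rw [hkey, smul_zero]

/-- The mirror image of `advOp_eq_zero`: S(g_Y) now stands on the left of S(g') and S(g' + h_i), and
cancels in S(g)⁻¹S(g + h_i). -/
theorem retOp_eq_zero (𝒯 : TimeOrdered par form) (P : Composition m)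
    {fB : Fin n → ZMod 2} {B : Fin n → SymField par}
    {fC : Fin m → ZMod 2} {C : Fin m → SymField par} (hB : ∀ j, B j ∈ homogeneous par (fB j))
    (hC : ∀ j, C j ∈ homogeneous par (fC j))
    {g : Fin n → 𝓢(Vec (Fin 4), ℂ)} {h : Fin m → 𝓢(Vec (Fin 4), ℂ)}
    (hg : ∀ j, HasCompactSupport (g j)) (hh : ∀ j, HasCompactSupport (h j))
    {Y : Finset (Fin n)} (hY : Y.Nonempty)
    (hx : ∀ j ∈ Y, ∀ i, ∀ y ∈ tsupport (g j), ∀ x ∈ tsupport (h i), x - y ∉ forwardCone)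
    (hy : ∀ j ∈ Y, ∀ j' ∉ Y, ∀ y ∈ tsupport (g j), ∀ y' ∈ tsupport (g j'),
      y' - y ∉ forwardCone) :
    retOp 𝒯 P fB B fC C g h = 0 := by
  set f := Fin.append fB fC
  set S := serS 𝒯 f (Fin.append B C) (Fin.append g h)
  set Y₁ := Y.image (Fin.castAdd m)
  set Y₂ := Yᶜ.image (Fin.castAdd m)
  have hBC := append_mem_homogeneous hB hC
  have hgh := append_hasCompactSupport hg hh
  have hsub : Y₂ ⊆ Y₁ᶜ := fun a ha => Finset.mem_compl.2 fun h =>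
    Finset.disjoint_left.1 (disjoint_compl_image Y) ha h
  have key := fun i => forall_append (R := fun x y => x - y ∉ forwardCone) hx hy P i
  obtain ⟨F, hF⟩ : ∃ F : Fin P.length → Ser f (Module.End ℂ D),
    ∀ i, F i = (S (posI n m)).inv * S (posI n m ∪ posJ n P i) := ⟨_, fun i => rfl⟩
  have hkey : serProd f ((List.finRange P.length).map F) Finset.univ = 0 := by
    refine serProd_univ_eq_zero hY F fun i => (?_ : F i ∈ Ser.supported f (Module.End ℂ D) Y₁ᶜ)
    have h1 : S (posI n m ∪ posJ n P i) = S Y₁ * S (Y₂ ∪ posJ n P i) := by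
      rw [← serS_union 𝒯 hBC hgh (disjoint_posJ P i Y).symm fun a ha b hb x hx y hy =>
        key i b hb a ha y hy x hx, posI_eq_union Y, Finset.union_right_comm, Finset.union_comm]
    have h2 : S (posI n m) = S Y₁ * S Y₂ := by
      rw [← serS_union 𝒯 hBC hgh (disjoint_compl_image Y).symm fun a ha b hb x hx y hy =>
        key i b (Finset.mem_union_left _ hb) a ha y hy x hx, posI_eq_union Y, Finset.union_comm]
    rw [hF, h1, h2, Ser.inv_mul_mul (serS_empty 𝒯 f _ _ _) (serS_empty 𝒯 f _ _ _)]
    exact (Ser.supported f (Module.End ℂ D) Y₁ᶜ).mul_mem (Ser.inv_mem_supported (serS_mem_supported 𝒯 _ _ hsub))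
      (serS_mem_supported 𝒯 _ _ (Finset.union_subset hsub fun a ha =>
      Finset.mem_compl.2 fun h => Finset.disjoint_left.1 (disjoint_posJ P i Y)
        (Finset.mem_union_right _ ha) h))
  have h3 : (fun i => serMul f (serInv f (genS 𝒯 (Fin.append B C) (Fin.append g h) (posI n m)))
      (genS 𝒯 (Fin.append B C) (Fin.append g h) (posI n m ∪ posJ n P i))) =
      F := funext fun i => by
    rw [hF, Ser.mul_def, ← show _ = (S (posI n m)).inv from serInv_eq (S (posI n m))]
    rfl
  refine (congrArg (fun G => (-Complex.I) ^ (n + m) • serProd f ((List.finRange P.length).map G)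
    Finset.univ) h3).trans ?_
  rw [hkey, smul_zero]

end Support

/-! ### Distributions that vanish on products of test functions -/

section Mollifier

variable {κ : Type*} [Fintype κ]

theorem kernelScal_one_apply (z : Vec κ) (f : 𝓢(Vec κ, ℂ)) (p : Vec κ) :
    kernelScal 1 z f p = f (p - z) := by
  simp [kernelScal_apply]

/-- Both sides are u applied to the convolution of φ and ψ. Under the transform this is a pointwise
product, whose symmetry is evident. -/
theorem apply_convolution_comm (u : 𝓢(Vec κ, ℂ) →L[ℂ] ℂ) (φ ψ : 𝓢(Vec κ, ℂ)) :
    ∫ z, φ z * u (kernelScal 1 z ψ) = ∫ z, ψ z * u (kernelScal 1 z φ) := by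
  set σ : κ → ℤˣ := fun _ => 1
  have hk : ∀ (f : 𝓢(Vec κ, ℂ)) (z : Vec κ),
      kernelScal 1 z f = fourierTestInv σ (charMul (pair σ z) (fourierTest σ f)) := by
    intro f z
    have h := fourierTest_kernelScal σ 1 (by simp) z f
    have h1 : scal (1 : ℝˣ)⁻¹ (fourierTest σ f) = fourierTest σ f := by ext y; simp
    rw [h1] at h
    rw [← h, fourierTestInv_fourierTest]
  have hp := SchwartzMap.hasTemperateGrowth (fourierTest σ φ)
  set Ψ := SchwartzMap.smulLeftCLM ℂ (fourierTest σ φ) (fourierTest σ ψ)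
  have hΨ : ∀ y, Ψ y = fourierTest σ φ y * fourierTest σ ψ y := fun y =>
    SchwartzMap.smulLeftCLM_apply_apply hp _ _
  have h1 := apply_mul_fourierTest (u.comp (fourierTestInv σ)) σ φ (fourierTest σ ψ) Ψ hΨ
  have h2 := apply_mul_fourierTest (u.comp (fourierTestInv σ)) σ ψ (fourierTest σ φ) Ψ
    fun y => by rw [hΨ, mul_comm]
  simp only [hk]
  exact h1.symm.trans h2

theorem continuous_apply_kernelScal (u : 𝓢(Vec κ, ℂ) →L[ℂ] ℂ) (φ : 𝓢(Vec κ, ℂ)) :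
    Continuous fun z => u (kernelScal 1 z φ) := by
  set σ : κ → ℤˣ := fun _ => 1
  have hk : ∀ (z : Vec κ),
      kernelScal 1 z φ = fourierTestInv σ (charMul (pair σ z) (fourierTest σ φ)) := by
    intro z
    have h := fourierTest_kernelScal σ 1 (by simp) z φ
    have h1 : scal (1 : ℝˣ)⁻¹ (fourierTest σ φ) = fourierTest σ φ := by ext y; simp
    rw [h1] at h
    rw [← h, fourierTestInv_fourierTest]
  simp only [hk]
  exact u.continuous.comp ((fourierTestInv σ).continuous.comp
    ((continuous_charMul _).comp (pair σ).continuous))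

/-- A distribution vanishes on `φ` if it vanishes on the translates, by vectors in the support of
`φ`, of positive functions with arbitrarily small support. -/
theorem apply_eq_zero_of_mollifiers (u : 𝓢(Vec κ, ℂ) →L[ℂ] ℂ) (φ : 𝓢(Vec κ, ℂ))
    (h : ∀ δ > 0, ∃ (ρ : 𝓢(Vec κ, ℂ)) (b : Vec κ → ℝ), (∀ w, ρ w = b w) ∧ (∀ w, 0 ≤ b w) ∧
      b 0 ≠ 0 ∧ (∀ w, b w ≠ 0 → ‖w‖ < δ) ∧ ∀ z, φ z ≠ 0 → u (kernelScal 1 z ρ) = 0) :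
    u φ = 0 := by
  obtain ⟨G, hG⟩ : ∃ G : Vec κ → ℂ, ∀ z, G z = u (kernelScal 1 z φ) := ⟨_, fun _ => rfl⟩
  have hGc : Continuous G := by
    simpa only [← hG] using continuous_apply_kernelScal u φ
  have hG0 : G 0 = u φ := by
    rw [hG]; congr 1; ext p; rw [kernelScal_one_apply, sub_zero]
  rw [← hG0]
  by_contra hne
  have hpos : 0 < ‖G 0‖ := norm_pos_iff.2 hne
  obtain ⟨δ, hδ, hδG⟩ := Metric.continuous_iff.1 hGc 0 (‖G 0‖ / 2) (by positivity)
  obtain ⟨ρ, b, hρ, hb, hb0, hbδ, hz⟩ := h δ hδ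
  have hbρ : ∀ w, b w = ‖ρ w‖ := fun w => by
    rw [hρ, Complex.norm_real, Real.norm_of_nonneg (hb w)]
  have hbc : Continuous b := by
    rw [show b = fun w => ‖ρ w‖ from funext hbρ]; exact ρ.continuous.norm
  have hbi : Integrable b := by
    rw [show b = fun w => ‖ρ w‖ from funext hbρ]; exact ρ.integrable.norm
  have hint : 0 < ∫ w, b w := by
    rw [integral_pos_iff_support_of_nonneg hb hbi]
    exact hbc.isOpen_support.measure_pos _ ⟨0, hb0⟩
  -- The average of the values of u on translates of φ, weighted with ρ, is the average of its
  -- values on translates of ρ, weighted with φ.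
  have h0 : ∫ w, ρ w * G w = 0 := by
    simp only [hG]
    rw [← apply_convolution_comm]
    refine integral_eq_zero_of_ae (Eventually.of_forall fun z => ?_)
    by_cases hφ : φ z = 0
    · simp [hφ]
    · simp [hz z hφ]
  have hbd : ∀ w, ‖ρ w * (G w - G 0)‖ ≤ b w * (‖G 0‖ / 2) := by
    intro w
    rw [norm_mul, ← hbρ]
    by_cases hw : b w = 0
    · simp [hw]
    · refine mul_le_mul_of_nonneg_left ?_ (hb w)
      have := hδG w (by rw [dist_zero_right]; exact hbδ w hw)
      rw [dist_eq_norm] at this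
      exact this.le
  have hi1 : Integrable fun w => ρ w * (G w - G 0) :=
    (hbi.mul_const _).mono' (ρ.continuous.mul (hGc.sub continuous_const)).aestronglyMeasurable
      (Eventually.of_forall hbd)
  have hi2 : Integrable fun w => ρ w * G 0 := ρ.integrable.mul_const _
  have h1 : (∫ w, ρ w * (G w - G 0)) = -((∫ w, b w : ℝ) * G 0) := by
    have h2 : (∫ w, ρ w * (G w - G 0)) + ∫ w, ρ w * G 0 = 0 := by
      rw [← integral_add hi1 hi2, ← h0]
      congr 1; ext w; ring
    rw [eq_neg_of_add_eq_zero_left h2, integral_mul_const]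
    simp only [hρ]
    rw [integral_complex_ofReal]
  -- G differs from G 0 by at most half of |G 0| on the support of ρ, so its average with positive
  -- weight ρ cannot vanish.
  have h3 : ‖∫ w, ρ w * (G w - G 0)‖ ≤ (∫ w, b w) * (‖G 0‖ / 2) := by
    rw [← integral_mul_const]
    exact norm_integral_le_of_norm_le (hbi.mul_const _) (Eventually.of_forall hbd)
  rw [h1, norm_neg, norm_mul, Complex.norm_real, Real.norm_of_nonneg hint.le] at h3
  nlinarith [mul_pos hint hpos]

end Mollifier

/-! ### Support properties of the vacuum expectation values. -/

section Products

variable {n m : ℕ}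

/-- The four-vector `y_j` of `(y, x)`. -/
abbrev yPart (j : Fin n) (z : Vec ((Fin n × Fin 4) ⊕ (Fin m × Fin 4))) : Vec (Fin 4) :=
  coords (fun μ => Sum.inl (j, μ)) z

/-- The four-vector `x_i` of `(y, x)`. -/
abbrev xPart (i : Fin m) (z : Vec ((Fin n × Fin 4) ⊕ (Fin m × Fin 4))) : Vec (Fin 4) :=
  coords (fun μ => Sum.inr (i, μ)) z

theorem norm_coords_le {κ κ' : Type*} [Fintype κ] [Fintype κ'] (e : κ' → κ)
    (he : Function.Injective e) (z : Vec κ) : ‖coords e z‖ ≤ ‖z‖ := by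
  rw [EuclideanSpace.norm_eq, EuclideanSpace.norm_eq]
  refine Real.sqrt_le_sqrt ?_
  simp only [coords_apply]
  exact (Finset.sum_map Finset.univ ⟨e, he⟩ fun k => ‖z k‖ ^ 2).symm.le.trans
    (Finset.sum_le_sum_of_subset_of_nonneg (Finset.subset_univ _) fun _ _ _ => by positivity)

theorem norm_yPart_le (j : Fin n) (z : Vec ((Fin n × Fin 4) ⊕ (Fin m × Fin 4))) :
    ‖yPart j z‖ ≤ ‖z‖ := norm_coords_le _ (fun μ ν h => by simpa using h) z

theorem norm_xPart_le (i : Fin m) (z : Vec ((Fin n × Fin 4) ⊕ (Fin m × Fin 4))) :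
    ‖xPart i z‖ ≤ ‖z‖ := norm_coords_le _ (fun μ ν h => by simpa using h) z

theorem testProd₂_apply (g : Fin n → 𝓢(Vec (Fin 4), ℂ)) (h : Fin m → 𝓢(Vec (Fin 4), ℂ))
    (z : Vec ((Fin n × Fin 4) ⊕ (Fin m × Fin 4))) :
    testProd₂ g h z = (∏ j, g j (yPart j z)) * ∏ i, h i (xPart i z) := by
  change ∏ j : Fin n ⊕ Fin m, _ = _
  rw [Fintype.prod_sum_type]
  rfl

theorem kernelScal_testProd₂ (z : Vec ((Fin n × Fin 4) ⊕ (Fin m × Fin 4)))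
    (g : Fin n → 𝓢(Vec (Fin 4), ℂ)) (h : Fin m → 𝓢(Vec (Fin 4), ℂ)) :
    kernelScal 1 z (testProd₂ g h) =
      testProd₂ (fun j => kernelScal 1 (yPart j z) (g j))
        (fun i => kernelScal 1 (xPart i z) (h i)) := by
  ext p
  rw [kernelScal_one_apply, testProd₂_apply, testProd₂_apply]
  simp only [kernelScal_one_apply, yPart, xPart, map_sub]

theorem tsupport_kernelScal_subset {κ : Type*} [Fintype κ] {f : 𝓢(Vec κ, ℂ)} {r : ℝ}
    (hf : ∀ w, f w ≠ 0 → ‖w‖ ≤ r) (z : Vec κ) :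
    tsupport (kernelScal 1 z f) ⊆ Metric.closedBall z r := by
  refine closure_minimal (fun p hp => ?_) Metric.isClosed_closedBall
  rw [Function.mem_support, kernelScal_one_apply] at hp
  rw [Metric.mem_closedBall, dist_eq_norm]
  exact hf _ hp

theorem hasCompactSupport_of_tsupport_subset {κ : Type*} [Fintype κ] {f : Vec κ → ℂ} {z : Vec κ}
    {r : ℝ} (hf : tsupport f ⊆ Metric.closedBall z r) : HasCompactSupport f :=
  (isCompact_closedBall z r).of_isClosed_subset (isClosed_tsupport f) hf

/-- `a` vanishes on products of test functions with supports in the balls of radius `r` around the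
components of `z`. -/
def VanishesOn (a : Dist n m) (z : Vec ((Fin n × Fin 4) ⊕ (Fin m × Fin 4))) (r : ℝ) : Prop :=
  ∀ (g : Fin n → 𝓢(Vec (Fin 4), ℂ)) (h : Fin m → 𝓢(Vec (Fin 4), ℂ)),
    (∀ j, tsupport (g j) ⊆ Metric.closedBall (yPart j z) r) →
    (∀ i, tsupport (h i) ⊆ Metric.closedBall (xPart i z) r) → a (testProd₂ g h) = 0

theorem VanishesOn.mono {a : Dist n m} {z z' : Vec ((Fin n × Fin 4) ⊕ (Fin m × Fin 4))} {r r' : ℝ}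
    (h : VanishesOn a z r) (hr : r' + ‖z' - z‖ ≤ r) : VanishesOn a z' r' := by
  intro g k hg hk
  refine h g k (fun j => (hg j).trans ?_) fun i => (hk i).trans ?_
  · refine Metric.closedBall_subset_closedBall' ?_
    rw [dist_eq_norm, yPart, yPart, ← map_sub]
    linarith [norm_yPart_le j (z' - z)]
  · refine Metric.closedBall_subset_closedBall' ?_
    rw [dist_eq_norm, xPart, xPart, ← map_sub]
    linarith [norm_xPart_le i (z' - z)]

theorem exists_radius_of_isCompact {a : Dist n m} {K : Set (Vec ((Fin n × Fin 4) ⊕ (Fin m × Fin 4)))}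
    (hK : IsCompact K) (h : ∀ z ∈ K, ∃ r > 0, VanishesOn a z r) :
    ∃ r > 0, ∀ z ∈ K, VanishesOn a z r := by
  refine hK.induction_on (p := fun s => ∃ r > 0, ∀ z ∈ s, VanishesOn a z r)
    ⟨1, one_pos, fun z hz => hz.elim⟩ ?_ ?_ ?_
  · rintro s t hst ⟨r, hr, ht⟩
    exact ⟨r, hr, fun z hz => ht z (hst hz)⟩
  · rintro s t ⟨r, hr, hs⟩ ⟨r', hr', ht⟩
    refine ⟨min r r', lt_min hr hr', ?_⟩
    rintro z (hz | hz)
    · exact (hs z hz).mono (by simp)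
    · exact (ht z hz).mono (by simp)
  · intro z hz
    obtain ⟨r, hr, hv⟩ := h z hz
    refine ⟨Metric.ball z (r / 2), mem_nhdsWithin_of_mem_nhds (Metric.ball_mem_nhds z (by positivity)),
      r / 2, by positivity, fun z' hz' => hv.mono ?_⟩
    rw [Metric.mem_ball, dist_eq_norm] at hz'
    linarith

/-- By compactness one radius serves the whole support. Products of equal bumps are the mollifiers,
and their translates are again products of test functions with small supports. -/
theorem apply_eq_zero_of_vanishesOn {a : Dist n m}
    {φ : 𝓢(Vec ((Fin n × Fin 4) ⊕ (Fin m × Fin 4)), ℂ)} (hφ : HasCompactSupport φ)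
    (h : ∀ z ∈ tsupport φ, ∃ r > 0, VanishesOn a z r) : a φ = 0 := by
  obtain ⟨r, hr, hv⟩ := exists_radius_of_isCompact hφ h
  refine apply_eq_zero_of_mollifiers (show _ →L[ℂ] ℂ from a) φ fun δ hδ => ?_
  -- If all four-vectors have norm at most r', the norm of the point is at most (N - 1) r' by
  -- `norm_le_sum_coords`, hence less than δ.
  set N : ℝ := (Fintype.card ((Fin n × Fin 4) ⊕ (Fin m × Fin 4)) : ℝ) * (n + m) + 1
  have hN : 0 < N := by positivity
  set r' := min r (δ / N)
  have hr' : 0 < r' := lt_min hr (by positivity)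
  let f : ContDiffBump (0 : Vec (Fin 4)) := ⟨r' / 2, r', by positivity, by linarith⟩
  have hfc : HasCompactSupport fun x => (f x : ℂ) :=
    f.hasCompactSupport.comp_left (g := Complex.ofReal) Complex.ofReal_zero
  set F : 𝓢(Vec (Fin 4), ℂ) := hfc.toSchwartzMap (Complex.ofRealCLM.contDiff.comp f.contDiff)
  have hF : ∀ x, F x = (f x : ℂ) := fun x => rfl
  have hFs : ∀ x, F x ≠ 0 → ‖x‖ ≤ r' := fun x hx => by
    have : f x ≠ 0 := fun h => hx (by rw [hF, h, Complex.ofReal_zero])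
    have h2 : x ∈ Function.support f := this
    rw [f.support_eq, Metric.mem_ball, dist_zero_right] at h2
    exact h2.le
  refine ⟨testProd₂ (fun _ => F) fun _ => F,
    fun z => (∏ j, f (yPart j z)) * ∏ i, f (xPart i z), fun w => ?_, fun w => ?_, ?_, fun w hw => ?_,
    fun z hz => ?_⟩
  · rw [testProd₂_apply]; simp [hF]
  · exact mul_nonneg (Finset.prod_nonneg fun _ _ => f.nonneg) (Finset.prod_nonneg fun _ _ => f.nonneg)
  · have h0 : f 0 = 1 := f.one_of_mem_closedBall (by simp [f]; positivity)
    simp [h0]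
  · obtain ⟨h1, h2⟩ := mul_ne_zero_iff.1 hw
    rw [Finset.prod_ne_zero_iff] at h1 h2
    have hb : ∀ x, f x ≠ 0 → ‖x‖ ≤ r' := fun x hx => hFs x (by rw [hF]; exact_mod_cast hx)
    have h3 := norm_le_sum_coords (J := Fin n ⊕ Fin m) (κ' := fun _ => Fin 4)
      (κ := (Fin n × Fin 4) ⊕ (Fin m × Fin 4))
      (Sum.elim (fun j μ => Sum.inl (j, μ)) (fun j μ => Sum.inr (j, μ)))
      (by
        rintro (⟨j, μ⟩ | ⟨j, μ⟩)
        · exact ⟨Sum.inl j, μ, rfl⟩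
        · exact ⟨Sum.inr j, μ, rfl⟩) w
    rw [Fintype.sum_sum_type] at h3
    have h4 : ∑ j : Fin n, ‖yPart j w‖ ≤ n * r' := by
      refine (Finset.sum_le_card_nsmul _ _ r' fun j _ => hb _ (h1 j (Finset.mem_univ j))).trans ?_
      simp
    have h5 : ∑ j : Fin m, ‖xPart j w‖ ≤ m * r' := by
      refine (Finset.sum_le_card_nsmul _ _ r' fun j _ => hb _ (h2 j (Finset.mem_univ j))).trans ?_
      simp
    refine (h3.trans (mul_le_mul_of_nonneg_left (add_le_add h4 h5) (by positivity))).trans_lt ?_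
    calc _ = (N - 1) * r' := by ring
      _ < N * r' := by gcongr; linarith
      _ ≤ N * (δ / N) := by gcongr; exact min_le_right _ _
      _ = δ := by field_simp
  · have hz' := hv z (subset_tsupport φ hz)
    rw [kernelScal_testProd₂]
    have hb : ∀ y : Vec (Fin 4), tsupport (kernelScal 1 y F) ⊆ Metric.closedBall y r := fun y =>
      (tsupport_kernelScal_subset hFs y).trans
        (Metric.closedBall_subset_closedBall (min_le_left _ _))
    exact hz' _ _ (fun j => hb _) fun i => hb _

theorem eventually_closedBall_sub_notMem {E : Type*} [NormedAddCommGroup E] {V : Set E}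
    (hV : IsClosed V) {y x : E} (h : y - x ∉ V) :
    ∀ᶠ r : ℝ in 𝓝[>] 0, ∀ y' ∈ Metric.closedBall y r, ∀ x' ∈ Metric.closedBall x r,
      y' - x' ∉ V := by
  obtain ⟨δ, hδ, hb⟩ := Metric.isOpen_iff.1 hV.isOpen_compl (y - x) h
  filter_upwards [Ioo_mem_nhdsGT (show 0 < δ / 2 by positivity)] with r hr y' hy' x' hx'
  refine hb ?_
  rw [Metric.mem_closedBall, dist_eq_norm] at hy' hx'
  rw [Metric.mem_ball, dist_eq_norm]
  calc ‖y' - x' - (y - x)‖ = ‖(y' - y) - (x' - x)‖ := by congr 1; abel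
    _ ≤ ‖y' - y‖ + ‖x' - x‖ := norm_sub_le _ _
    _ < δ := by linarith [hr.2]

/-- If `a` is a distribution with the causal support property of the advanced or the retarded
products, with `V` the closed forward or backward light cone, then `y_j ∈ x_i + V`, with some `i`
for every `j`, on the support of `a`. -/
theorem apply_eq_zero_of_causal {a : Dist n m} {V : Set (Vec (Fin 4))} (hV : IsClosed V)
    (hadd : ∀ v ∈ V, ∀ w ∈ V, v + w ∈ V)
    (ha : ∀ (g : Fin n → 𝓢(Vec (Fin 4), ℂ)) (h : Fin m → 𝓢(Vec (Fin 4), ℂ)),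
      (∀ j, HasCompactSupport (g j)) → (∀ j, HasCompactSupport (h j)) →
      ∀ Y : Finset (Fin n), Y.Nonempty →
      (∀ j ∈ Y, ∀ i, ∀ y ∈ tsupport (g j), ∀ x ∈ tsupport (h i), y - x ∉ V) →
      (∀ j ∈ Y, ∀ j' ∉ Y, ∀ y ∈ tsupport (g j), ∀ y' ∈ tsupport (g j'), y - y' ∉ V) →
      a (testProd₂ g h) = 0)
    (φ : 𝓢(Vec ((Fin n × Fin 4) ⊕ (Fin m × Fin 4)), ℂ))
    (hφ : ∀ z ∈ tsupport φ, ∃ j, ∀ i, yPart j z - xPart i z ∉ V) : a φ = 0 := by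
  classical
  refine apply_eq_zero_of_hasCompactSupport (show _ →L[ℂ] ℂ from a)
    {z | ∃ j, ∀ i, yPart j z - xPart i z ∉ V} (fun ψ hψ hs => ?_) φ hφ
  refine apply_eq_zero_of_vanishesOn hψ fun z hz => ?_
  obtain ⟨j₀, hj₀⟩ := hs hz
  -- Y contains every index with this property, not only j₀. Then y_j - y_{j'} ∈ V for j ∈ Y, j' ∉ Y
  -- is impossible: with y_{j'} - x_i ∈ V for some i it would give y_j - x_i ∈ V.
  set Y : Finset (Fin n) := Finset.univ.filter fun j => ∀ i, yPart j z - xPart i z ∉ V with hY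
  have h1 : ∀ᶠ r : ℝ in 𝓝[>] 0, ∀ j ∈ Y, ∀ i, ∀ y' ∈ Metric.closedBall (yPart j z) r,
      ∀ x' ∈ Metric.closedBall (xPart i z) r, y' - x' ∉ V := by
    refine (Filter.eventually_all_finset _).2 fun j hj => eventually_all.2 fun i => ?_
    exact eventually_closedBall_sub_notMem hV ((Finset.mem_filter.1 hj).2 i)
  have h2 : ∀ᶠ r : ℝ in 𝓝[>] 0, ∀ j ∈ Y, ∀ j', j' ∉ Y → ∀ y' ∈ Metric.closedBall (yPart j z) r,
      ∀ x' ∈ Metric.closedBall (yPart j' z) r, y' - x' ∉ V := by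
    refine (Filter.eventually_all_finset _).2 fun j hj => eventually_all.2 fun j' => ?_
    by_cases hj' : j' ∈ Y
    · exact Eventually.of_forall fun _ h => absurd hj' h
    refine (eventually_closedBall_sub_notMem hV (y := yPart j z) (x := yPart j' z)
      fun hmem => ?_).mono fun r hr _ => hr
    have : ∃ i, yPart j' z - xPart i z ∈ V := by
      by_contra! hcon
      exact hj' (Finset.mem_filter.2 ⟨Finset.mem_univ _, hcon⟩)
    obtain ⟨i, hi⟩ := this
    exact (Finset.mem_filter.1 hj).2 i (by simpa using hadd _ hmem _ hi)
  obtain ⟨r, ⟨hr1, hr2⟩, hr⟩ := ((h1.and h2).and self_mem_nhdsWithin).exists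
  refine ⟨r, hr, fun g h hg hh => ha g h (fun j => hasCompactSupport_of_tsupport_subset (hg j))
    (fun i => hasCompactSupport_of_tsupport_subset (hh i)) Y
    ⟨j₀, Finset.mem_filter.2 ⟨Finset.mem_univ _, hj₀⟩⟩ ?_ ?_⟩
  · exact fun j hj i y hy x hx => hr1 j hj i y (hg j hy) x (hh i hx)
  · exact fun j hj j' hj' y hy y' hy' => hr2 j hj j' hj' y (hg j hy) y' (hg j' hy')

theorem isClosed_forwardCone : IsClosed forwardCone := by
  have h : ∀ i : Fin 4, Continuous fun v : Vec (Fin 4) => v i := fun i => by fun_prop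
  have h1 : IsClosed {v : Vec (Fin 4) | 0 ≤ v 0} := isClosed_le continuous_const (h 0)
  have h2 : IsClosed {v : Vec (Fin 4) | v 1 ^ 2 + v 2 ^ 2 + v 3 ^ 2 ≤ v 0 ^ 2} :=
    isClosed_le ((((h 1).pow 2).add ((h 2).pow 2)).add ((h 3).pow 2)) ((h 0).pow 2)
  exact h1.inter h2

theorem add_mem_forwardCone {v w : Vec (Fin 4)} (hv : v ∈ forwardCone) (hw : w ∈ forwardCone) :
    v + w ∈ forwardCone := by
  obtain ⟨hv0, hv1⟩ := hv
  obtain ⟨hw0, hw1⟩ := hw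
  refine ⟨by simpa using add_nonneg hv0 hw0, ?_⟩
  simp only [PiLp.add_apply]
  -- The Cauchy–Schwarz inequality for the spatial parts, via Lagrange's identity.
  have h : v 1 * w 1 + v 2 * w 2 + v 3 * w 3 ≤ v 0 * w 0 := by
    refine abs_le_of_sq_le_sq' ?_ (mul_nonneg hv0 hw0) |>.2
    calc _ ≤ (v 1 ^ 2 + v 2 ^ 2 + v 3 ^ 2) * (w 1 ^ 2 + w 2 ^ 2 + w 3 ^ 2) := by
          nlinarith [sq_nonneg (v 1 * w 2 - v 2 * w 1), sq_nonneg (v 1 * w 3 - v 3 * w 1),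
            sq_nonneg (v 2 * w 3 - v 3 * w 2)]
      _ ≤ v 0 ^ 2 * w 0 ^ 2 := by gcongr
      _ = _ := by ring
  nlinarith

section VEV

variable {p : ℕ} {par : Fin p → ZMod 2} {D : Type*} [AddCommGroup D] [Module ℂ D]
  {form : D →ₗ⋆[ℂ] D →ₗ[ℂ] ℂ} {𝒯 : TimeOrdered par form} {Ω : D} {P : Composition m}
  {fB : Fin n → ZMod 2} {B : Fin n → SymField par}
  {fC : Fin m → ZMod 2} {C : Fin m → SymField par}

theorem IsAdvVEV.apply_eq_zero {a : Dist n m} (ha : IsAdvVEV 𝒯 Ω P fB B fC C a)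
    (hB : ∀ j, B j ∈ homogeneous par (fB j)) (hC : ∀ j, C j ∈ homogeneous par (fC j))
    (φ : 𝓢(Vec ((Fin n × Fin 4) ⊕ (Fin m × Fin 4)), ℂ))
    (hφ : ∀ z ∈ tsupport φ, ∃ j, ∀ i, yPart j z - xPart i z ∉ forwardCone) : a φ = 0 := by
  refine apply_eq_zero_of_causal isClosed_forwardCone
    (fun v hv w hw => add_mem_forwardCone hv hw) (fun g h hg hh Y hY hx hy => ?_) φ hφ
  rw [ha g h, advOp_eq_zero 𝒯 P hB hC hg hh hY hx hy]
  simp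

theorem IsRetVEV.apply_eq_zero {a : Dist n m} (ha : IsRetVEV 𝒯 Ω P fB B fC C a)
    (hB : ∀ j, B j ∈ homogeneous par (fB j)) (hC : ∀ j, C j ∈ homogeneous par (fC j))
    (φ : 𝓢(Vec ((Fin n × Fin 4) ⊕ (Fin m × Fin 4)), ℂ))
    (hφ : ∀ z ∈ tsupport φ, ∃ j, ∀ i, xPart i z - yPart j z ∉ forwardCone) : a φ = 0 := by
  refine apply_eq_zero_of_causal (V := {v | -v ∈ forwardCone})
    (isClosed_forwardCone.preimage continuous_neg)
    (fun v hv w hw => ?_) (fun g h hg hh Y hY hx hy => ?_) φ fun z hz => ?_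
  · have := add_mem_forwardCone (Set.mem_ofPred_eq ▸ hv) (Set.mem_ofPred_eq ▸ hw)
    rw [Set.mem_ofPred_eq, neg_add]; exact this
  · simp only [Set.mem_ofPred_eq, neg_sub] at hx hy
    rw [ha g h, retOp_eq_zero 𝒯 P hB hC hg hh hY hx hy]
    simp
  · simpa only [Set.mem_ofPred_eq, neg_sub] using hφ z hz

end VEV

end Products

/-! ### Cutoff functions adapted to the light cones -/

section Cutoffs

/-- A UV regular splitting function that is constant on two cones. -/
theorem exists_splitting_of_functional {ι : Type*} [Fintype ι] (T : Vec ι →L[ℝ] ℝ) :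
    ∃ Θ : Vec ι → ℝ, IsUVRegularSplitting Θ ∧ (∀ y, 1 ≤ ‖y‖ → ‖y‖ / 8 ≤ T y → Θ y = 1) ∧
      ∀ y, 1 ≤ ‖y‖ → T y ≤ -(‖y‖ / 8) → Θ y = 0 := by
  let f : ContDiffBump (0 : Vec ι) := ⟨1 / 4, 1 / 2, by norm_num, by norm_num⟩
  have hf0 : ∀ y, 1 / 2 ≤ ‖y‖ → f y = 0 := fun y hy =>
    f.zero_of_le_dist (by rw [dist_zero_right]; exact hy)
  have hf1 : ∀ y, ‖y‖ ≤ 1 / 4 → f y = 1 := fun y hy =>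
    f.one_of_mem_closedBall (by rw [Metric.mem_closedBall, dist_zero_right]; exact hy)
  have hnear : ∀ᶠ y in 𝓝 (0 : Vec ι),
      (1 - f y) * Real.smoothTransition (1 / 2 + 4 * (T y / ‖y‖)) = 0 := by
    filter_upwards [Metric.ball_mem_nhds (0 : Vec ι) (show (0 : ℝ) < 1 / 4 by norm_num)] with y hy
    rw [hf1 y (by rw [← dist_zero_right]; exact (Metric.mem_ball.1 hy).le), sub_self, zero_mul]
  -- The second factor is 1 if T y/‖y‖ ≥ 1/8, is 0 if T y/‖y‖ ≤ -1/8, and is homogeneous of degree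
  -- 0; the first removes its singularity at 0 and is 1 for ‖y‖ ≥ 1/2.
  refine ⟨fun y => (1 - f y) * Real.smoothTransition (1 / 2 + 4 * (T y / ‖y‖)),
    ⟨?_, fun y => mul_nonneg (sub_nonneg.2 f.le_one) (Real.smoothTransition.nonneg _), fun y =>
      mul_le_one₀ (by linarith [f.nonneg (x := y)]) (Real.smoothTransition.nonneg _)
        (Real.smoothTransition.le_one _), hnear, 1, one_pos, fun y hy r hr => ?_⟩,
    fun y hy hT => ?_, fun y hy hT => ?_⟩
  · rw [contDiff_iff_contDiffAt]
    intro y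
    by_cases hy : y = 0
    · subst hy
      refine (contDiffAt_const (c := (0 : ℝ))).congr_of_eventuallyEq ?_
      exact hnear
    · refine (contDiffAt_const.sub f.contDiffAt).mul
        (Real.smoothTransition.contDiffAt.comp y ?_)
      exact contDiffAt_const.add (contDiffAt_const.mul
        (T.contDiff.contDiffAt.div (contDiffAt_norm ℝ hy) (norm_ne_zero_iff.2 hy)))
  · have h1 : ‖r • y‖ = r * ‖y‖ := by rw [norm_smul, Real.norm_of_nonneg (by linarith)]
    have h2 : 1 ≤ r * ‖y‖ := by nlinarith
    rw [hf0 _ (by rw [h1]; linarith), hf0 y (by linarith), h1, map_smul, smul_eq_mul,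
      mul_div_mul_left _ _ (by linarith)]
  · simp only
    rw [hf0 y (by linarith), Real.smoothTransition.one_of_one_le, sub_zero, one_mul]
    have : 1 / 8 ≤ T y / ‖y‖ := by rw [le_div_iff₀ (by linarith)]; linarith
    linarith
  · simp only
    rw [Real.smoothTransition.zero_of_nonpos, mul_zero]
    have : T y / ‖y‖ ≤ -(1 / 8) := by rw [div_le_iff₀ (by linarith)]; linarith
    linarith

theorem smoothTransition_hasTemperateGrowth :
    Function.HasTemperateGrowth Real.smoothTransition := by
  have hc : ContDiff ℝ ∞ Real.smoothTransition := Real.smoothTransition.contDiff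
  refine .of_fderiv (HasCompactSupport.hasTemperateGrowth ?_ ?_)
    (hc.differentiable (by simp)) (k := 0) (C := 1) fun x => ?_
  · refine HasCompactSupport.intro (isCompact_Icc (a := (0 : ℝ)) (b := 1)) fun x hx => ?_
    rw [Set.mem_Icc, not_and_or, not_le, not_le] at hx
    rcases hx with hx | hx
    · have : Real.smoothTransition =ᶠ[𝓝 x] fun _ => 0 := by
        filter_upwards [Iio_mem_nhds hx] with y hy
        exact Real.smoothTransition.zero_of_nonpos (le_of_lt hy)
      rw [this.fderiv_eq]; simp
    · have : Real.smoothTransition =ᶠ[𝓝 x] fun _ => 1 := by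
        filter_upwards [Ioi_mem_nhds hx] with y hy
        exact Real.smoothTransition.one_of_one_le (le_of_lt hy)
      rw [this.fderiv_eq]; simp
  · exact hc.fderiv_right (by simp)
  · rw [pow_zero, mul_one, Real.norm_of_nonneg (Real.smoothTransition.nonneg x)]
    exact Real.smoothTransition.le_one x

/-- A smooth function that distinguishes large from small values of `‖y‖² / (1 + ‖x‖²)`. -/
theorem exists_cone_cutoff {ι κ : Type*} [Fintype ι] [Fintype κ] {c : ℝ} (hc : 0 < c) :
    ∃ Z : Vec (ι ⊕ κ) → ℝ, Z.HasTemperateGrowth ∧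
      (∀ z, ‖fstPart z‖ ^ 2 ≤ c ^ 2 * (1 + ‖sndPart z‖ ^ 2) → Z z = 0) ∧
      ∀ z, 2 * c ^ 2 * (1 + ‖sndPart z‖ ^ 2) ≤ ‖fstPart z‖ ^ 2 → Z z = 1 := by
  -- R = ‖y‖²/(c²(1 + ‖x‖²)) - 1 is ≤ 0 in the first region and ≥ 1 in the second. The squares of
  -- the norms make it smooth.
  obtain ⟨R, hR⟩ : ∃ R : Vec (ι ⊕ κ) → ℝ, ∀ z, R z =
    (c ^ 2)⁻¹ * (‖fstPart z‖ ^ 2 * (1 + ‖sndPart z‖ ^ 2) ^ (-1 : ℝ)) + -1 := ⟨_, fun _ => rfl⟩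
  have hR' : ∀ z, R z = ‖fstPart z‖ ^ 2 / (c ^ 2 * (1 + ‖sndPart z‖ ^ 2)) - 1 := by
    intro z
    rw [hR, Real.rpow_neg_one, div_eq_mul_inv, mul_inv]
    ring
  have hRt : R.HasTemperateGrowth := by
    rw [show R = _ from funext hR]
    have h1 : (fun z : Vec (ι ⊕ κ) => ‖fstPart z‖ ^ 2).HasTemperateGrowth :=
      (Function.hasTemperateGrowth_norm_sq (H := Vec ι)).comp
        (coords (κ := ι ⊕ κ) (κ' := ι) Sum.inl).hasTemperateGrowth
    have h2 : (fun z : Vec (ι ⊕ κ) => (1 + ‖sndPart z‖ ^ 2) ^ (-1 : ℝ)).HasTemperateGrowth :=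
      (Function.hasTemperateGrowth_one_add_norm_sq_rpow (Vec κ) (-1)).comp
        (coords (κ := ι ⊕ κ) (κ' := κ) Sum.inr).hasTemperateGrowth
    exact ((Function.HasTemperateGrowth.const _).mul (h1.mul h2)).add
      (Function.HasTemperateGrowth.const _)
  refine ⟨fun z => Real.smoothTransition (R z), smoothTransition_hasTemperateGrowth.comp hRt,
    fun z hz => Real.smoothTransition.zero_of_nonpos ?_,
    fun z hz => Real.smoothTransition.one_of_one_le ?_⟩
  · rw [hR', sub_nonpos, div_le_one (by positivity)]
    exact hz
  · rw [hR', le_sub_iff_add_le, le_div_iff₀ (by positivity)]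
    linarith

/-- A function `χ(y, x) f(x)` is a Schwartz function if `f` is and `χ` is a function of temperate
growth that is supported where `‖(y, x)‖ ≤ C (1 + ‖x‖)`. -/
theorem exists_schwartz_mul_snd {ι κ : Type*} [Fintype ι] [Fintype κ] {χ : Vec (ι ⊕ κ) → ℂ}
    (hχ : χ.HasTemperateGrowth) {C : ℝ} (hs : ∀ z ∈ tsupport χ, ‖z‖ ≤ C * (1 + ‖sndPart z‖))
    (f : 𝓢(Vec κ, ℂ)) : ∃ F : 𝓢(Vec (ι ⊕ κ), ℂ), ∀ z, F z = χ z * f (sndPart z) := by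
  have hsm : ContDiff ℝ ∞ fun z : Vec (ι ⊕ κ) => χ z * f (sndPart z) :=
    hχ.1.mul (contDiff_comp_coords Sum.inr f)
  refine ⟨⟨fun z => χ z * f (sndPart z), hsm, fun k n => ?_⟩, fun z => rfl⟩
  obtain ⟨l, A, hA, hχb⟩ := hχ.norm_iteratedFDeriv_le_uniform n
  set S : ℝ := 2 ^ (k + l) * (Finset.Iic (k + l, n)).sup (schwartzSeminormFamily ℂ (Vec κ) ℂ) f
  set p : ℝ := ‖coords (κ := ι ⊕ κ) (κ' := κ) Sum.inr‖
  refine ⟨∑ i ∈ Finset.range (n + 1),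
    (n.choose i : ℝ) * A * (|C| + 1) ^ (k + l) * p ^ (n - i) * S, fun z => ?_⟩
  have hS : 0 ≤ S := by positivity
  by_cases hz : z ∈ tsupport fun z : Vec (ι ⊕ κ) => χ z * f (sndPart z)
  · have hz' : z ∈ tsupport χ := tsupport_mul_subset_left hz
    -- On the support 1 + ‖z‖ is dominated by 1 + ‖x‖, so the decay of f in x absorbs the weight and
    -- the growth of the derivatives of χ.
    have h1 : 1 + ‖z‖ ≤ (|C| + 1) * (1 + ‖sndPart z‖) := by
      have h2 := hs z hz'
      have h3 := norm_nonneg (sndPart z)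
      nlinarith [le_abs_self C]
    have hD := norm_iteratedFDeriv_mul_le (hχ.1) (contDiff_comp_coords (κ := ι ⊕ κ) Sum.inr f) z
      (n := n) (by exact_mod_cast le_top)
    refine (mul_le_mul_of_nonneg_left hD (by positivity)).trans ?_
    rw [Finset.mul_sum]
    refine Finset.sum_le_sum fun i hi => ?_
    have hi' : i ≤ n := Nat.lt_succ_iff.1 (Finset.mem_range.1 hi)
    have h4 := norm_iteratedFDeriv_comp_coords_le (κ := ι ⊕ κ) Sum.inr f (n - i) z
    have h5 : (1 + ‖sndPart z‖) ^ (k + l) * ‖iteratedFDeriv ℝ (n - i) f (sndPart z)‖ ≤ S :=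
      one_add_le_sup_seminorm_apply (𝕜 := ℂ) (m := (k + l, n)) le_rfl (Nat.sub_le _ _) f _
    have h6 : ‖z‖ ^ k * (1 + ‖z‖) ^ l ≤ (|C| + 1) ^ (k + l) * (1 + ‖sndPart z‖) ^ (k + l) := by
      rw [← mul_pow]
      calc ‖z‖ ^ k * (1 + ‖z‖) ^ l ≤ (1 + ‖z‖) ^ k * (1 + ‖z‖) ^ l := by gcongr; linarith
        _ = (1 + ‖z‖) ^ (k + l) := by rw [pow_add]
        _ ≤ _ := by gcongr
    calc _ ≤ ‖z‖ ^ k * ((n.choose i : ℝ) * (A * (1 + ‖z‖) ^ l) *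
          (‖iteratedFDeriv ℝ (n - i) f (sndPart z)‖ * p ^ (n - i))) := by
          gcongr
          exact hχb i hi' z
      _ = (n.choose i : ℝ) * A * p ^ (n - i) * (‖z‖ ^ k * (1 + ‖z‖) ^ l) *
          ‖iteratedFDeriv ℝ (n - i) f (sndPart z)‖ := by ring
      _ ≤ (n.choose i : ℝ) * A * p ^ (n - i) *
          ((|C| + 1) ^ (k + l) * (1 + ‖sndPart z‖) ^ (k + l)) *
          ‖iteratedFDeriv ℝ (n - i) f (sndPart z)‖ := by gcongr
      _ = (n.choose i : ℝ) * A * (|C| + 1) ^ (k + l) * p ^ (n - i) *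
          ((1 + ‖sndPart z‖) ^ (k + l) * ‖iteratedFDeriv ℝ (n - i) f (sndPart z)‖) := by ring
      _ ≤ _ := by gcongr
  · have h0 : iteratedFDeriv ℝ n (fun z : Vec (ι ⊕ κ) => χ z * f (sndPart z)) z = 0 :=
      image_eq_zero_of_notMem_tsupport fun h => hz (tsupport_iteratedFDeriv_subset n h)
    rw [h0, norm_zero, mul_zero]
    positivity

end Cutoffs

/-! ### Light cones and the splitting of causal distributions. -/

section Causal

variable {n m : ℕ}

/-- The sum of the times of the four-vectors. -/
def totalTime (n : ℕ) : Vec (Fin n × Fin 4) →L[ℝ] ℝ :=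
  ∑ j : Fin n, EuclideanSpace.proj (𝕜 := ℝ) (j, (0 : Fin 4))

theorem totalTime_apply (y : Vec (Fin n × Fin 4)) : totalTime n y = ∑ j, y (j, 0) := by
  simp [totalTime]

theorem abs_le_of_mem_forwardCone {v : Vec (Fin 4)} (hv : v ∈ forwardCone) (μ : Fin 4) :
    |v μ| ≤ v 0 := by
  obtain ⟨h0, h1⟩ := hv
  refine abs_le_of_sq_le_sq ?_ h0
  fin_cases μ <;> simp only [Fin.zero_eta, Fin.mk_one, Fin.reduceFinMk] <;>
    nlinarith [sq_nonneg (v 1), sq_nonneg (v 2), sq_nonneg (v 3)]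

theorem norm_le_sum_abs {κ : Type*} [Fintype κ] (y : Vec κ) : ‖y‖ ≤ ∑ k, |y k| := by
  classical
  conv_lhs => rw [← (EuclideanSpace.basisFun κ ℝ).sum_repr y]
  refine (norm_sum_le _ _).trans (le_of_eq ?_)
  refine Finset.sum_congr rfl fun k _ => ?_
  rw [norm_smul]; simp

/-- In the forward cone the time component dominates the others, whence |y_j^μ| ≤ y_j^0 + 2‖x‖; this
is summed over the 4n components. A large y forces a large positive total time. -/
theorem norm_fstPart_le_of_causal {z : Vec ((Fin n × Fin 4) ⊕ (Fin m × Fin 4))}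
    (hz : ∀ j, ∃ i, yPart j z - xPart i z ∈ forwardCone) :
    ‖fstPart z‖ ≤ 4 * totalTime n (fstPart z) + 8 * n * ‖sndPart z‖ := by
  have h1 : ∀ j μ, |fstPart z (j, μ)| ≤ fstPart z (j, 0) + 2 * ‖sndPart z‖ := by
    intro j μ
    obtain ⟨i, hi⟩ := hz j
    have h2 := abs_le_of_mem_forwardCone hi μ
    have h3 := abs_le_of_mem_forwardCone hi 0
    have hx : ∀ ν, |sndPart z (i, ν)| ≤ ‖sndPart z‖ := fun ν =>
      PiLp.norm_apply_le (sndPart z) (i, ν)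
    have e : ∀ ν, (yPart j z - xPart i z) ν = fstPart z (j, ν) - sndPart z (i, ν) := fun ν => rfl
    rw [e, e] at h2
    have h4 := abs_le.1 (hx 0)
    have h5 := abs_le.1 (hx μ)
    have h6 := abs_le.1 h2
    rw [abs_le]
    constructor <;> linarith
  refine (norm_le_sum_abs _).trans ?_
  rw [Fintype.sum_prod_type, totalTime_apply]
  refine (Finset.sum_le_sum fun j _ => Finset.sum_le_sum fun μ _ => h1 j μ).trans (le_of_eq ?_)
  simp only [Finset.sum_const, Finset.card_univ, Fintype.card_fin, nsmul_eq_mul,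
    ← Finset.mul_sum, Finset.sum_add_distrib]
  push_cast
  ring

theorem one_le_norm_fstPart {z : Vec ((Fin n × Fin 4) ⊕ (Fin m × Fin 4))}
    (hz : (16 * n + 1 : ℝ) ^ 2 * (1 + ‖sndPart z‖ ^ 2) ≤ ‖fstPart z‖ ^ 2) :
    1 ≤ ‖fstPart z‖ ∧ 16 * n * ‖sndPart z‖ < ‖fstPart z‖ := by
  have hn : (0 : ℝ) ≤ n := by positivity
  have h0 := norm_nonneg (sndPart z)
  have h1 := norm_nonneg (fstPart z)
  constructor
  · refine (sq_le_sq₀ zero_le_one h1).1 (le_trans ?_ hz)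
    have : (1 : ℝ) ≤ (16 * n + 1) ^ 2 := one_le_pow₀ (by linarith)
    nlinarith [sq_nonneg ‖sndPart z‖]
  · refine (sq_lt_sq₀ (by positivity) h1).1 (lt_of_lt_of_le ?_ hz)
    have : (0 : ℝ) < (16 * n + 1) ^ 2 := by positivity
    have h2 : (16 * n * ‖sndPart z‖) ^ 2 = (16 * n) ^ 2 * ‖sndPart z‖ ^ 2 := by ring
    have h3 : (16 * n : ℝ) ^ 2 ≤ (16 * n + 1) ^ 2 := by gcongr; linarith
    have h4 := mul_le_mul_of_nonneg_right h3 (sq_nonneg ‖sndPart z‖)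
    linarith

/-- Otherwise ‖y‖ ≤ ‖y‖/2 + 8n‖x‖, in contradiction to 16n‖x‖ < ‖y‖. This fixes the opening 1/8 of
the cones and the constant 16n + 1 in the cutoffs. -/
theorem exists_notMem_forwardCone {z : Vec ((Fin n × Fin 4) ⊕ (Fin m × Fin 4))}
    (hz : (16 * n + 1 : ℝ) ^ 2 * (1 + ‖sndPart z‖ ^ 2) ≤ ‖fstPart z‖ ^ 2)
    (hT : totalTime n (fstPart z) ≤ ‖fstPart z‖ / 8) :
    ∃ j, ∀ i, yPart j z - xPart i z ∉ forwardCone := by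
  by_contra! h
  linarith [(one_le_norm_fstPart hz).2, norm_fstPart_le_of_causal h]

theorem exists_notMem_backwardCone {z : Vec ((Fin n × Fin 4) ⊕ (Fin m × Fin 4))}
    (hz : (16 * n + 1 : ℝ) ^ 2 * (1 + ‖sndPart z‖ ^ 2) ≤ ‖fstPart z‖ ^ 2)
    (hT : -(‖fstPart z‖ / 8) ≤ totalTime n (fstPart z)) :
    ∃ j, ∀ i, xPart i z - yPart j z ∉ forwardCone := by
  have h := exists_notMem_forwardCone (z := -z) (n := n) (m := m)
    (by simpa only [map_neg, norm_neg] using hz)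
    (by simp only [map_neg, norm_neg]; linarith)
  obtain ⟨j, hj⟩ := h
  refine ⟨j, fun i hi => hj i ?_⟩
  simpa only [yPart, xPart, map_neg, neg_sub_neg] using hi

/-- Splitting of the difference of an advanced and a retarded distribution, up to corrections
which are localised in all variables. -/
theorem exists_splitting_of_causal {a r : Dist n m}
    (ha : ∀ φ : 𝓢(Vec ((Fin n × Fin 4) ⊕ (Fin m × Fin 4)), ℂ),
      (∀ z ∈ tsupport φ, ∃ j, ∀ i, yPart j z - xPart i z ∉ forwardCone) → a φ = 0)
    (hr : ∀ φ : 𝓢(Vec ((Fin n × Fin 4) ⊕ (Fin m × Fin 4)), ℂ),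
      (∀ z ∈ tsupport φ, ∃ j, ∀ i, xPart i z - yPart j z ∉ forwardCone) → r φ = 0) :
    ∃ Θ : Vec (Fin n × Fin 4) → ℝ, IsUVRegularSplitting Θ ∧
      ∀ f : 𝓢(Vec (Fin m × Fin 4), ℂ),
        ∃ χ₁ χ₂ : 𝓢(Vec ((Fin n × Fin 4) ⊕ (Fin m × Fin 4)), ℂ),
          ∀ ψ : Vec ((Fin n × Fin 4) ⊕ (Fin m × Fin 4)) → ℂ, ψ.HasTemperateGrowth →
            ∀ Φ : 𝓢(Vec ((Fin n × Fin 4) ⊕ (Fin m × Fin 4)), ℂ),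
              (∀ z, Φ z = ψ z * f (sndPart z)) →
              a Φ = (a - r) (SchwartzMap.smulLeftCLM ℂ (fun z => (Θ (fstPart z) : ℂ)) Φ) +
                a (SchwartzMap.smulLeftCLM ℂ ψ χ₁) + r (SchwartzMap.smulLeftCLM ℂ ψ χ₂) := by
  obtain ⟨Θ, hΘ, hΘ1, hΘ0⟩ := exists_splitting_of_functional (totalTime n)
  refine ⟨Θ, hΘ, fun f => ?_⟩
  set c : ℝ := 16 * n + 1
  have hc : 0 < c := by positivity
  obtain ⟨Z, hZ, hZ0, hZ1⟩ := exists_cone_cutoff (ι := Fin n × Fin 4) (κ := Fin m × Fin 4) hc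
  have hZc : (fun z => (Z z : ℂ)).HasTemperateGrowth := ofReal_comp_hasTemperateGrowth hZ
  have hΘc := hasTemperateGrowth_fst (κ := Fin m × Fin 4) hΘ
  have h1Z : (fun z => 1 - (Z z : ℂ)).HasTemperateGrowth :=
    (Function.HasTemperateGrowth.const (1 : ℂ)).sub hZc
  have h1Θ : (fun z : Vec ((Fin n × Fin 4) ⊕ (Fin m × Fin 4)) =>
      1 - (Θ (fstPart z) : ℂ)).HasTemperateGrowth :=
    (Function.HasTemperateGrowth.const (1 : ℂ)).sub hΘc
  have hsupp : ∀ z ∈ tsupport fun z => 1 - (Z z : ℂ), ‖z‖ ≤ (2 * c + 1) * (1 + ‖sndPart z‖) := by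
    intro z hz
    have hcl : IsClosed {z : Vec ((Fin n × Fin 4) ⊕ (Fin m × Fin 4)) |
        ‖fstPart z‖ ^ 2 ≤ 2 * c ^ 2 * (1 + ‖sndPart z‖ ^ 2)} :=
      isClosed_le (by fun_prop) (by fun_prop)
    have hmem := closure_minimal (t := {z : Vec ((Fin n × Fin 4) ⊕ (Fin m × Fin 4)) |
        ‖fstPart z‖ ^ 2 ≤ 2 * c ^ 2 * (1 + ‖sndPart z‖ ^ 2)}) (fun w hw => by
      by_contra hcon
      rw [Set.mem_ofPred_eq, not_le] at hcon
      refine hw ?_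
      simp only
      rw [hZ1 w hcon.le]; simp) hcl hz
    rw [Set.mem_ofPred_eq] at hmem
    have h0 := norm_nonneg (sndPart z)
    have h1 : ‖fstPart z‖ ≤ 2 * c * (1 + ‖sndPart z‖) := by
      refine (sq_le_sq₀ (norm_nonneg _) (by positivity)).1 (hmem.trans ?_)
      nlinarith [mul_nonneg (sq_nonneg c) h0, mul_nonneg (sq_nonneg c) (sq_nonneg ‖sndPart z‖),
        sq_nonneg c]
    have h2 := norm_le_add_parts z
    nlinarith
  -- χ₁ = (1 - Z)(1 - Θ) f and χ₂ = (1 - Z) Θ f are Schwartz functions because y is bounded in terms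
  -- of x on the support of 1 - Z.
  obtain ⟨χ₁, hχ₁⟩ := exists_schwartz_mul_snd (h1Z.mul h1Θ)
    (fun z hz => hsupp z (tsupport_mul_subset_left hz)) f
  obtain ⟨χ₂, hχ₂⟩ := exists_schwartz_mul_snd (h1Z.mul hΘc)
    (fun z hz => hsupp z (tsupport_mul_subset_left hz)) f
  refine ⟨χ₁, χ₂, fun ψ hψ Φ hΦ => ?_⟩
  obtain ⟨A, hA⟩ : ∃ A : 𝓢(Vec ((Fin n × Fin 4) ⊕ (Fin m × Fin 4)), ℂ),
      ∀ z, A z = Z z * (1 - Θ (fstPart z)) * Φ z :=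
    ⟨SchwartzMap.smulLeftCLM ℂ _ Φ, fun z => SchwartzMap.smulLeftCLM_apply_apply (hZc.mul h1Θ) _ z⟩
  obtain ⟨R, hR⟩ : ∃ R : 𝓢(Vec ((Fin n × Fin 4) ⊕ (Fin m × Fin 4)), ℂ),
      ∀ z, R z = Z z * Θ (fstPart z) * Φ z :=
    ⟨SchwartzMap.smulLeftCLM ℂ _ Φ, fun z => SchwartzMap.smulLeftCLM_apply_apply (hZc.mul hΘc) _ z⟩
  have hZne : ∀ z, Z z ≠ 0 → c ^ 2 * (1 + ‖sndPart z‖ ^ 2) ≤ ‖fstPart z‖ ^ 2 := fun z hz => by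
    by_contra hcon
    exact hz (hZ0 z (not_le.1 hcon).le)
  -- On the support of Z(1 - Θ) the vector y is large and its total time at most ‖y‖/8, which is
  -- outside of the support of the advanced distribution.
  have hA0 : a A = 0 := by
    refine ha A fun z hz => ?_
    have hcl : IsClosed {z : Vec ((Fin n × Fin 4) ⊕ (Fin m × Fin 4)) |
        c ^ 2 * (1 + ‖sndPart z‖ ^ 2) ≤ ‖fstPart z‖ ^ 2 ∧
          totalTime n (fstPart z) ≤ ‖fstPart z‖ / 8} :=
      IsClosed.and (isClosed_le (by fun_prop) (by fun_prop)) (isClosed_le (by fun_prop) (by fun_prop))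
    have hmem := closure_minimal (fun w hw => ?_) hcl hz
    · exact exists_notMem_forwardCone hmem.1 hmem.2
    · rw [Function.mem_support, hA] at hw
      have hw1 := hZne w fun h => hw (by rw [h]; simp)
      refine ⟨hw1, ?_⟩
      by_contra hcon
      refine hw ?_
      rw [hΘ1 _ (one_le_norm_fstPart hw1).1 (not_le.1 hcon).le]
      simp
  -- Likewise, on the support of ZΘ the total time is at least -‖y‖/8, which excludes the retarded
  -- distribution.
  have hR0 : r R = 0 := by
    refine hr R fun z hz => ?_
    have hcl : IsClosed {z : Vec ((Fin n × Fin 4) ⊕ (Fin m × Fin 4)) |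
        c ^ 2 * (1 + ‖sndPart z‖ ^ 2) ≤ ‖fstPart z‖ ^ 2 ∧
          -(‖fstPart z‖ / 8) ≤ totalTime n (fstPart z)} :=
      IsClosed.and (isClosed_le (by fun_prop) (by fun_prop)) (isClosed_le (by fun_prop) (by fun_prop))
    have hmem := closure_minimal (fun w hw => ?_) hcl hz
    · exact exists_notMem_backwardCone hmem.1 hmem.2
    · rw [Function.mem_support, hR] at hw
      have hw1 := hZne w fun h => hw (by rw [h]; simp)
      refine ⟨hw1, ?_⟩
      by_contra hcon
      refine hw ?_
      rw [hΘ0 _ (one_le_norm_fstPart hw1).1 (not_le.1 hcon).le]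
      simp
  set ΘΦ := SchwartzMap.smulLeftCLM ℂ (fun z => (Θ (fstPart z) : ℂ)) Φ
  have hΘΦ : ∀ z, ΘΦ z = Θ (fstPart z) * Φ z := fun z =>
    SchwartzMap.smulLeftCLM_apply_apply hΘc _ z
  -- 1 = Θ + Z(1 - Θ) + (1 - Z)(1 - Θ) under a, and Θ = ZΘ + (1 - Z)Θ under r. With aΘ = (a - r)Θ +
  -- rΘ only localised terms remain besides the split difference.
  have e1 : Φ = ΘΦ + A + SchwartzMap.smulLeftCLM ℂ ψ χ₁ := by
    ext z
    rw [_root_.add_apply, _root_.add_apply, hΘΦ, hA, SchwartzMap.smulLeftCLM_apply_apply hψ, hχ₁,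
      Pi.mul_apply, smul_eq_mul, hΦ]
    ring
  have e2 : ΘΦ = R + SchwartzMap.smulLeftCLM ℂ ψ χ₂ := by
    ext z
    rw [_root_.add_apply, hΘΦ, hR, SchwartzMap.smulLeftCLM_apply_apply hψ, hχ₂,
      Pi.mul_apply, smul_eq_mul, hΦ]
    ring
  have h1 : a Φ = a ΘΦ + a A + a (SchwartzMap.smulLeftCLM ℂ ψ χ₁) := by
    conv_lhs => rw [e1]
    rw [map_add, map_add]
  have h2 : r ΘΦ = r R + r (SchwartzMap.smulLeftCLM ℂ ψ χ₂) := by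
    conv_lhs => rw [e2]
    rw [map_add]
  rw [h1, hA0, _root_.sub_apply, h2, hR0]
  ring

end Causal

/-! ### The infrared behaviour of the advanced products -/

section Localized

variable {n m : ℕ}

theorem continuous_apply_charMul {κ V : Type*} [Fintype κ] [NormedAddCommGroup V] [NormedSpace ℝ V]
    (u : 𝓢(V, ℂ) →L[ℂ] ℂ) (L : Vec κ →L[ℝ] V →L[ℝ] ℝ) (χ : 𝓢(V, ℂ)) :
    Continuous fun q => u (charMul (L q) χ) :=
  u.continuous.comp ((continuous_charMul χ).comp L.continuous)

/-- The transform of `f(x) a(y, x)` is that of `Θ(y) f(x) (a - r)(y, x)` up to a continuous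
function. -/
theorem exists_splitting_fourierDist {a r : Dist n m}
    (ha : ∀ φ : 𝓢(Vec ((Fin n × Fin 4) ⊕ (Fin m × Fin 4)), ℂ),
      (∀ z ∈ tsupport φ, ∃ j, ∀ i, yPart j z - xPart i z ∉ forwardCone) → a φ = 0)
    (hr : ∀ φ : 𝓢(Vec ((Fin n × Fin 4) ⊕ (Fin m × Fin 4)), ℂ),
      (∀ z ∈ tsupport φ, ∃ j, ∀ i, xPart i z - yPart j z ∉ forwardCone) → r φ = 0)
    (σ : (Fin n × Fin 4) ⊕ (Fin m × Fin 4) → ℤˣ) (f : 𝓢(Vec (Fin m × Fin 4), ℂ)) :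
    ∃ Θ : Vec (Fin n × Fin 4) → ℝ, IsUVRegularSplitting Θ ∧
      ∃ F : Vec ((Fin n × Fin 4) ⊕ (Fin m × Fin 4)) → ℂ, Continuous F ∧
        ∀ φ : 𝓢(Vec ((Fin n × Fin 4) ⊕ (Fin m × Fin 4)), ℂ), HasCompactSupport φ →
          fourierDist σ (mulSnd f a) φ =
            fourierDist σ (splitDist Θ (mulSnd f (a - r))) φ + ∫ z, F z * φ z := by
  obtain ⟨Θ, hΘ, h⟩ := exists_splitting_of_causal ha hr
  obtain ⟨χ₁, χ₂, h⟩ := h f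
  have hF₁ : Continuous fun z => a (charMul (pair σ z) χ₁) :=
    continuous_apply_charMul (show _ →L[ℂ] ℂ from a) (pair σ) χ₁
  have hF₂ : Continuous fun z => r (charMul (pair σ z) χ₂) :=
    continuous_apply_charMul (show _ →L[ℂ] ℂ from r) (pair σ) χ₂
  refine ⟨Θ, hΘ, fun z => a (charMul (pair σ z) χ₁) + r (charMul (pair σ z) χ₂),
    hF₁.add hF₂, fun φ hφ => ?_⟩
  have hψ := (fourierTest σ φ).hasTemperateGrowth
  have hf := contDiff_snd_hasTemperateGrowth (ι := Fin n × Fin 4) f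
  have h1 := h _ hψ (SchwartzMap.smulLeftCLM ℂ (fun z => f (sndPart z)) (fourierTest σ φ)) fun z => by
    rw [SchwartzMap.smulLeftCLM_apply_apply hf, smul_eq_mul, mul_comm]
  have h2 : a (SchwartzMap.smulLeftCLM ℂ (fourierTest σ φ) χ₁) =
      ∫ z, φ z * a (charMul (pair σ z) χ₁) :=
    apply_mul_fourierTest (show _ →L[ℂ] ℂ from a) σ φ χ₁ (SchwartzMap.smulLeftCLM ℂ (fourierTest σ φ) χ₁)
    fun z => SchwartzMap.smulLeftCLM_apply_apply hψ _ z
  have h3 : r (SchwartzMap.smulLeftCLM ℂ (fourierTest σ φ) χ₂) =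
      ∫ z, φ z * r (charMul (pair σ z) χ₂) :=
    apply_mul_fourierTest (show _ →L[ℂ] ℂ from r) σ φ χ₂ (SchwartzMap.smulLeftCLM ℂ (fourierTest σ φ) χ₂)
    fun z => SchwartzMap.smulLeftCLM_apply_apply hψ _ z
  rw [fourierDist_apply, mulSnd_apply, fourierDist_apply, splitDist_apply, mulSnd_apply]
  refine h1.trans ?_
  have h4 : SchwartzMap.smulLeftCLM ℂ (fun z => (Θ (fstPart z) : ℂ))
      (SchwartzMap.smulLeftCLM ℂ (fun z => f (sndPart z)) (fourierTest σ φ)) =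
      SchwartzMap.smulLeftCLM ℂ (fun z => f (sndPart z))
        (SchwartzMap.smulLeftCLM ℂ (fun z => (Θ (fstPart z) : ℂ)) (fourierTest σ φ)) := by
    rw [SchwartzMap.smulLeftCLM_smulLeftCLM_apply (hasTemperateGrowth_fst hΘ) hf,
      SchwartzMap.smulLeftCLM_smulLeftCLM_apply hf (hasTemperateGrowth_fst hΘ), mul_comm]
  rw [h4, add_assoc]
  congr 1
  refine (congrArg₂ (· + ·) h2 h3).trans ?_
  rw [← integral_add]
  · refine integral_congr_ae (Eventually.of_forall fun z => ?_)
    simp only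
    ring
  · exact (φ.continuous.mul hF₁).integrable_of_hasCompactSupport hφ.mul_right
  · exact (φ.continuous.mul hF₂).integrable_of_hasCompactSupport hφ.mul_right

theorem eq_zero_of_isEmpty {ι : Type*} [Fintype ι] [IsEmpty ι] {Θ : Vec ι → ℝ}
    (hΘ : IsUVRegularSplitting Θ) : Θ = 0 := by
  ext y
  rw [Subsingleton.elim y 0]
  exact hΘ.zero_near_origin.self_of_nhds

/-- Three contributions: the O^dist(|q|^{d-ε}) term of the splitting, its polynomial, and the
continuous transform of the localised terms. The last two are bounded near the origin, hence the
minimum with 0. -/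
theorem hasIRIndex_min_of_causal {a r : Dist n m}
    (ha : ∀ φ : 𝓢(Vec ((Fin n × Fin 4) ⊕ (Fin m × Fin 4)), ℂ),
      (∀ z ∈ tsupport φ, ∃ j, ∀ i, yPart j z - xPart i z ∉ forwardCone) → a φ = 0)
    (hr : ∀ φ : 𝓢(Vec ((Fin n × Fin 4) ⊕ (Fin m × Fin 4)), ℂ),
      (∀ z ∈ tsupport φ, ∃ j, ∀ i, xPart i z - yPart j z ∉ forwardCone) → r φ = 0)
    {d : ℤ} (h : HasIRIndex (a - r) d) : HasIRIndex a (min d 0) := by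
  intro ε hε f
  obtain ⟨Θ, hΘ, F, hF, hsplit⟩ :=
    exists_splitting_fourierDist ha hr (Sum.elim lorentzSign lorentzSign) f
  have hδ0 : ((min d 0 : ℤ) : ℝ) - ε ≤ 0 := by
    have : ((min d 0 : ℤ) : ℝ) ≤ 0 := by exact_mod_cast min_le_right d 0
    linarith
  rcases isEmpty_or_nonempty (Fin n × Fin 4) with he | hne
  -- Without variables y the splitting function vanishes, since it does so near the origin, and the
  -- transform is the continuous function F.
  · refine ⟨fun h => (not_nonempty_iff.2 he h).elim, fun _ => ⟨fun _ => ⟨F, hF, fun φ hφ => ?_⟩,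
      fun h => absurd h (not_lt.2 hδ0)⟩⟩
    rw [hsplit φ hφ, fourierDist_apply, splitDist_apply, eq_zero_of_isEmpty hΘ]
    have : SchwartzMap.smulLeftCLM ℂ
        (fun z : Vec ((Fin n × Fin 4) ⊕ (Fin m × Fin 4)) => (((0 : Vec (Fin n × Fin 4) → ℝ) (fstPart z) : ℝ) : ℂ))
        (fourierTest (Sum.elim lorentzSign lorentzSign) φ) = 0 := by
      ext z
      simp only [Pi.zero_apply, Complex.ofReal_zero]
      rw [SchwartzMap.smulLeftCLM_apply_apply (Function.HasTemperateGrowth.const 0)]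
      simp
    rw [this, map_zero, zero_add]
  -- The splitting result needs ε < 1; a smaller ε gives a stronger bound.
  · have hε' : 0 < min ε (1 / 2) := lt_min hε (by norm_num)
    obtain ⟨ρ, hρ, P, hP, hrep⟩ := exists_hasRep_splitDist hΘ _ (a - r) f hε'
      ((min_le_right _ _).trans_lt (by norm_num)) (h _ hε' f)
    have hρ' : 0 < min ρ 1 := lt_min hρ one_pos
    have hle : ((min d 0 : ℤ) : ℝ) - ε ≤ (d : ℝ) - min ε (1 / 2) := by
      have h1 : ((min d 0 : ℤ) : ℝ) ≤ d := by exact_mod_cast min_le_left d 0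
      linarith [min_le_left ε (1 / 2)]
    have h1 := (hrep.mono_radius (min_le_left ρ 1)).mono hle (min_le_right _ _)
    have h2 := hasRep_continuous (continuous_of_mem_polySpan hP) hδ0 (min_le_right ρ 1)
    have h3 := hasRep_continuous hF hδ0 (min_le_right ρ 1)
    refine HasRep.isODist hρ' (((h1.add h2).add h3).congr fun φ hφ _ => ?_)
    rw [hsplit φ hφ]
    ring

end Localized

/-! ### Integration over the second group of variables -/

section IntegrateSnd

variable {ι κ : Type*} [Fintype ι] [Fintype κ]

theorem exists_schwartz_one (J : Type*) [Fintype J] [IsEmpty J] :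
    ∃ one : 𝓢(Vec J, ℂ), ∀ x, one x = 1 := by
  have h : HasCompactSupport fun _ : Vec J => (1 : ℂ) :=
    HasCompactSupport.of_support_subset_isCompact (K := Set.univ) (Set.subsingleton_univ.isCompact) (Set.subset_univ _)
  exact ⟨h.toSchwartzMap contDiff_const, fun _ => rfl⟩

/-- The coordinates of `ℝ^N × ℝ^0` as coordinates of `ℝ^N × ℝ^M`. -/
abbrev inclFst : ι ⊕ Fin 0 → ι ⊕ κ := Sum.elim Sum.inl Fin.elim0

theorem inclFst_cover (k : ι ⊕ κ) : (∃ i, inclFst (κ := κ) i = k) ∨ ∃ i, Sum.inr i = k := by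
  rcases k with i | i
  · exact Or.inl ⟨Sum.inl i, rfl⟩
  · exact Or.inr ⟨i, rfl⟩

theorem integrateSnd_apply (f : 𝓢(Vec κ, ℂ)) (t : 𝓢'(Vec (ι ⊕ κ), ℂ)) (φ : 𝓢(Vec (ι ⊕ Fin 0), ℂ)) :
    integrateSnd f t φ = t (tensorCLM inclFst Sum.inr inclFst_cover f φ) := rfl

theorem norm_fstPart_eq (z : Vec (ι ⊕ Fin 0)) : ‖fstPart z‖ = ‖z‖ := by
  refine le_antisymm (norm_fstPart_le z) ((norm_le_add_parts z).trans ?_)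
  rw [Subsingleton.elim (sndPart z) 0, norm_zero, add_zero]

/-- Forgetting the empty group of variables. -/
def dropSnd (ι : Type*) [Fintype ι] : Vec ι ≃ₗᵢ[ℝ] Vec (ι ⊕ Fin 0) :=
  LinearIsometryEquiv.piLpCongrLeft 2 ℝ ℝ (Equiv.sumEmpty ι (Fin 0)).symm

theorem dropSnd_apply (y : Vec ι) (p : Vec (Fin 0)) : dropSnd ι y = joinVec y p := by
  ext (i | i)
  · rfl
  · exact i.elim0

theorem exists_eq_tens (one : 𝓢(Vec (Fin 0), ℂ)) (hone : ∀ x, one x = 1)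
    (Φ : 𝓢(Vec (ι ⊕ Fin 0), ℂ)) : ∃ φ : 𝓢(Vec ι, ℂ), Φ = tens one φ ∧
      ∀ y, φ y = Φ (joinVec y 0) := by
  refine ⟨SchwartzMap.compCLMOfContinuousLinearEquiv ℂ
    (dropSnd ι).toContinuousLinearEquiv Φ, ?_, fun y => ?_⟩
  · ext z
    rw [tens_apply, hone, mul_one]
    change Φ z = Φ (dropSnd ι (fstPart z))
    rw [dropSnd_apply _ (sndPart z), joinVec_fst_snd]
  · change Φ (dropSnd ι y) = _
    rw [dropSnd_apply y 0]

theorem integral_joinVec (F : Vec (ι ⊕ Fin 0) → ℂ) : ∫ y : Vec ι, F (joinVec y 0) = ∫ z, F z := by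
  rw [← (dropSnd ι).measurePreserving.integral_comp (dropSnd ι).toHomeomorph.measurableEmbedding]
  refine integral_congr_ae (Eventually.of_forall fun y => ?_)
  simp only
  rw [dropSnd_apply y 0]

theorem fourierTest_tens_one (σ : ι → ℤˣ) (one : 𝓢(Vec (Fin 0), ℂ)) (hone : ∀ x, one x = 1)
    (φ : 𝓢(Vec ι, ℂ)) (z : Vec (ι ⊕ Fin 0)) :
    fourierTest (Sum.elim σ fun _ => 1) (tens one φ) z = fourierTest σ φ (fstPart z) := by
  rw [fourierTest_eq, fourierTest_eq, ← integral_joinVec]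
  refine integral_congr_ae (Eventually.of_forall fun y => ?_)
  simp only [tens_apply, fstPart_joinVec, hone, mul_one, chr, pair_sum, Sum.elim_inl, Sum.elim_inr]
  rw [Subsingleton.elim (sndPart z) 0, map_zero, add_zero]

/-- The transform of `∫ dx f(x) s(y, x)` is the slice at `0` of the transform of
`f(x) s(y, x)`. -/
theorem exists_hasRep_integrateSnd [Nonempty ι] [DecidableEq ι] (σ : ι ⊕ κ → ℤˣ)
    (s : 𝓢'(Vec (ι ⊕ κ), ℂ)) (f : 𝓢(Vec κ, ℂ)) {δ : ℝ}
    (h : IsODist (fourierDist σ (mulSnd f s)) δ) :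
    ∃ ρ : ℝ, 0 < ρ ∧ HasRep
      (fun φ => fourierDist (Sum.elim (fun i => σ (Sum.inl i)) fun _ => 1) (integrateSnd f s) φ)
        δ ρ := by
  obtain ⟨ρ, hρ, J, _, β, τ, c, hτ, hτc, hβ, hc, hτb, hrep⟩ := h.exists_hasRep
  obtain ⟨one, hone⟩ := exists_schwartz_one (Fin 0)
  have hB : ∀ j, ∃ C : ℝ, ∀ z, ‖τ j z‖ ≤ C := fun j =>
    (hτ j).bounded_above_of_compact_support (hτc j)
  have hcj : Continuous fun z : Vec (ι ⊕ Fin 0) => (joinVec (fstPart z) 0 : Vec (ι ⊕ κ)) :=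
    continuous_joinVec.comp ((coords (κ := ι ⊕ Fin 0) (κ' := ι) Sum.inl).continuous.prodMk continuous_const)
  refine ⟨ρ / 2, by positivity, J, inferInstance, β, fun j z => τ j (joinVec (fstPart z) 0),
    fun j => (hτ j).comp hcj, hβ, ⟨c, hc, fun j z _ => ?_⟩, fun Φ hΦ hΦs => ?_⟩
  · simpa using hτb j (joinVec (fstPart z) 0)
  obtain ⟨φ, rfl, hφ⟩ := exists_eq_tens one hone Φ
  have hjc : Continuous fun y : Vec ι => (joinVec y 0 : Vec (ι ⊕ Fin 0)) :=
    continuous_joinVec.comp (Continuous.prodMk_left _)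
  have hφs : tsupport φ ⊆ Metric.ball 0 (ρ / 2) := by
    have hcl : tsupport φ ⊆ (fun y : Vec ι => (joinVec y 0 : Vec (ι ⊕ Fin 0))) ⁻¹'
        tsupport (tens one φ) := by
      refine closure_minimal (fun y hy => ?_) ((isClosed_tsupport _).preimage hjc)
      refine subset_tsupport _ ?_
      rw [Function.mem_support, ← hφ]
      exact hy
    intro y hy
    have := hΦs (hcl hy)
    rw [mem_ball_zero_iff] at this ⊢
    rwa [← norm_fstPart_eq, fstPart_joinVec] at this
  have hφc : HasCompactSupport φ :=
    (isCompact_closedBall (0 : Vec ι) (ρ / 2)).of_isClosed_subset (isClosed_tsupport _)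
      (hφs.trans Metric.ball_subset_closedBall)
  set σ₁ : ι → ℤˣ := fun i => σ (Sum.inl i)
  -- An identity of distributions in (q, q') could not be restricted to q' = 0, but the pointwise
  -- identity for the slices can.
  have h1 := slice_eq_sum_fibreDist σ s f (R := ρ / 2) β τ hτ hB
    (fun φ hφ hs => hrep φ hφ (by rwa [mul_div_cancel₀ _ two_ne_zero] at hs))
    (p := 0) (Metric.mem_ball_self (by positivity)) hφc hφs
  have h2 : fourierDist (Sum.elim σ₁ fun _ => 1) (integrateSnd f s) (tens one φ) =
      slice σ s f 0 (fourierTest σ₁ φ) := by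
    rw [fourierDist_apply, integrateSnd_apply]
    change s _ = s (charMul (pairSnd σ 0) (tens f _))
    rw [map_zero, charMul_zero]
    congr 1
    ext z
    rw [tensorCLM_apply, fourierTest_tens_one σ₁ one hone, tens_apply]
    rfl
  refine (h2.trans h1).trans ?_
  refine Finset.sum_congr rfl fun j _ => ?_
  rw [fibreDist_apply, ← integral_joinVec]
  congr 1
  refine integral_congr_ae (Eventually.of_forall fun y => ?_)
  simp only [multiPartial_tens σ₁, tens_apply, fstPart_joinVec, hone, mul_one, derivMul]
  rfl

theorem exists_norm_apply_charMul_sub_le {V : Type*} [NormedAddCommGroup V] [NormedSpace ℝ V]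
    (u : 𝓢(V, ℂ) →L[ℂ] ℂ) (χ : 𝓢(V, ℂ)) :
    ∃ C : ℝ, 0 ≤ C ∧ ∀ ℓ : V →L[ℝ] ℝ, ‖ℓ‖ ≤ 1 → ‖u (charMul ℓ χ) - u χ‖ ≤ C * ‖ℓ‖ := by
  obtain ⟨S, C, hC, hb⟩ := sBdd_norm_apply u
  refine ⟨C * ∑ m ∈ S, 2 ^ m.2 * ∑ i ∈ Finset.range (m.2 + 1), (m.2.choose i : ℝ) *
        (SchwartzMap.seminorm ℂ m.1 (m.2 - i) χ + SchwartzMap.seminorm ℂ (m.1 + 1) (m.2 - i) χ),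
    by positivity, fun ℓ hℓ => ?_⟩
  rw [← map_sub, mul_assoc, Finset.sum_mul]
  refine (hb _).trans (mul_le_mul_of_nonneg_left (Finset.sum_le_sum fun m _ => ?_) hC)
  refine (seminorm_charMul_sub_le m.1 m.2 ℓ χ).trans ?_
  rw [mul_comm ‖ℓ‖]
  gcongr
  linarith

theorem eqODistAdd_const_of_hasRep [Nonempty ι] {t : 𝓢'(Vec (ι ⊕ κ), ℂ)} {δ ρ : ℝ} (hρ : 0 < ρ)
    {c : ℂ} (h : HasRep (fun φ => t φ - ∫ z, c * φ z) δ ρ) : EqODistAdd t δ fun _ => c := by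
  obtain ⟨u, hu⟩ := exists_dist_of_growth (V := Vec (ι ⊕ κ)) (F := fun _ => c) continuous_const
    (C := ‖c‖) (K := 0) fun _ => by simp
  obtain ⟨t', ht'⟩ : ∃ t' : 𝓢(Vec (ι ⊕ κ), ℂ) →L[ℂ] ℂ, t' = t := ⟨t, rfl⟩
  refine ⟨(t' - u : 𝓢(Vec (ι ⊕ κ), ℂ) →L[ℂ] ℂ), ?_, fun φ _ => ?_⟩
  · refine HasRep.isODist hρ (h.congr fun φ hφ hs => ?_)
    change t' φ - u φ = _
    rw [hu, ht']
    rfl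
  · change t φ = t' φ - u φ + _
    rw [hu, ht']
    exact (sub_add_cancel _ _).symm

theorem exists_const_of_mem_polySpan [DecidableEq ι] {P : Vec (ι ⊕ Fin 0) → ℂ}
    (hP : P ∈ polySpan ι (Fin 0) (1 : ℤ).toNat) : ∃ c : ℂ, P = fun _ => c := by
  obtain ⟨c, -, rfl⟩ := exists_polySum_of_mem_polySpan hP
  refine ⟨c 0 0, funext fun z => ?_⟩
  rw [polySum, Int.toNat_one, Finset.sum_range_one, Finset.piAntidiag_zero, Finset.sum_singleton,
    Subsingleton.elim (sndPart z) 0]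
  simp

end IntegrateSnd

/-! ### The constant in the infrared behaviour of integrated advanced and retarded products -/

section Integrated

variable {n m : ℕ}

/-- The functional `(y, x) ↦ q·y`. -/
def pairFst {ι κ : Type*} [Fintype ι] [Fintype κ] (σ : ι → ℤˣ) :
    Vec (ι ⊕ Fin 0) →L[ℝ] Vec (ι ⊕ κ) →L[ℝ] ℝ :=
  ((ContinuousLinearMap.compL ℝ (Vec (ι ⊕ κ)) (Vec (ι ⊕ Fin 0)) ℝ).flip (coords inclFst)).comp
    (pair (Sum.elim σ fun _ => 1))

/-- A Schwartz function times a distribution has a Lipschitz transform near q = 0, so up to O(|q|)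
only its value at 0 survives. -/
theorem hasRep_apply_charMul_sub {ι κ : Type*} [Fintype ι] [Fintype κ] [Nonempty ι] (σ : ι → ℤˣ)
    (u : 𝓢(Vec (ι ⊕ κ), ℂ) →L[ℂ] ℂ) (χ : 𝓢(Vec (ι ⊕ κ), ℂ)) :
    ∃ ρ > 0, HasRep (fun φ : 𝓢(Vec (ι ⊕ Fin 0), ℂ) =>
      ∫ q, (u (charMul (pairFst σ q) χ) - u χ) * φ q) 1 ρ := by
  obtain ⟨C, hC, hb⟩ := exists_norm_apply_charMul_sub_le u χ
  set L := pairFst (κ := κ) σ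
  refine ⟨(‖L‖ + 1)⁻¹, by positivity, hasRep_of_norm_le (c := C * ‖L‖)
    ((continuous_apply_charMul u L χ).sub continuous_const) zero_le_one (by positivity) fun z hz => ?_⟩
  have h1 : ‖L z‖ ≤ ‖L‖ * ‖z‖ := L.le_opNorm z
  have h2 : (‖L‖ + 1) * ‖z‖ < 1 := by
    rwa [← lt_div_iff₀' (by positivity), one_div]
  rw [Real.rpow_one, norm_fstPart_eq, mul_assoc]
  refine (hb (L z) (by nlinarith [norm_nonneg z])).trans (mul_le_mul_of_nonneg_left h1 hC)

/-- The transform of `∫ dx f(x) a(y, x)` for an advanced distribution `a`. -/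
theorem exists_splitting_integrateSnd {a r : Dist n m}
    (ha : ∀ φ : 𝓢(Vec ((Fin n × Fin 4) ⊕ (Fin m × Fin 4)), ℂ),
      (∀ z ∈ tsupport φ, ∃ j, ∀ i, yPart j z - xPart i z ∉ forwardCone) → a φ = 0)
    (hr : ∀ φ : 𝓢(Vec ((Fin n × Fin 4) ⊕ (Fin m × Fin 4)), ℂ),
      (∀ z ∈ tsupport φ, ∃ j, ∀ i, xPart i z - yPart j z ∉ forwardCone) → r φ = 0)
    (σ : Fin n × Fin 4 → ℤˣ) (f : 𝓢(Vec (Fin m × Fin 4), ℂ))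
    (one : 𝓢(Vec (Fin 0), ℂ)) (hone : ∀ x, one x = 1) :
    ∃ Θ : Vec (Fin n × Fin 4) → ℝ, IsUVRegularSplitting Θ ∧
      ∃ χ₁ χ₂ : 𝓢(Vec ((Fin n × Fin 4) ⊕ (Fin m × Fin 4)), ℂ),
        ∀ φ : 𝓢(Vec ((Fin n × Fin 4) ⊕ Fin 0), ℂ),
          fourierDist (Sum.elim σ fun _ => 1) (integrateSnd f a) φ =
            fourierDist (Sum.elim σ fun _ => 1)
              (splitDist Θ (mulSnd one (integrateSnd f (a - r)))) φ +
            (∫ q, φ q * a (charMul (pairFst σ q) χ₁)) +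
            ∫ q, φ q * r (charMul (pairFst σ q) χ₂) := by
  obtain ⟨Θ, hΘ, h⟩ := exists_splitting_of_causal ha hr
  obtain ⟨χ₁, χ₂, h⟩ := h f
  refine ⟨Θ, hΘ, χ₁, χ₂, fun φ => ?_⟩
  set ψ := fourierTest (Sum.elim σ fun _ => 1) φ
  have hψ : (fun z : Vec ((Fin n × Fin 4) ⊕ (Fin m × Fin 4)) =>
      ψ (coords inclFst z)).HasTemperateGrowth :=
    ψ.hasTemperateGrowth.comp (coords (κ := (Fin n × Fin 4) ⊕ (Fin m × Fin 4))
      (κ' := (Fin n × Fin 4) ⊕ Fin 0) inclFst).hasTemperateGrowth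
  have h1 := h _ hψ (tensorCLM inclFst Sum.inr inclFst_cover f ψ) fun z => by
    rw [tensorCLM_apply]
  have key : ∀ χ : 𝓢(Vec ((Fin n × Fin 4) ⊕ (Fin m × Fin 4)), ℂ), ∀ z,
      SchwartzMap.smulLeftCLM ℂ (fun z => ψ (coords inclFst z)) χ z =
        (∫ q, φ q * chr (pairFst σ q) z) * χ z := fun χ z => by
    rw [SchwartzMap.smulLeftCLM_apply_apply hψ, smul_eq_mul]
    congr 1
    exact fourierTest_eq _ _ _
  have h2 : a (SchwartzMap.smulLeftCLM ℂ (fun z => ψ (coords inclFst z)) χ₁) =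
      ∫ q, φ q * a (charMul (pairFst σ q) χ₁) :=
    apply_fourier (show _ →L[ℂ] ℂ from a) (pairFst σ) φ χ₁ _ (key χ₁)
  have h3 : r (SchwartzMap.smulLeftCLM ℂ (fun z => ψ (coords inclFst z)) χ₂) =
      ∫ q, φ q * r (charMul (pairFst σ q) χ₂) :=
    apply_fourier (show _ →L[ℂ] ℂ from r) (pairFst σ) φ χ₂ _ (key χ₂)
  rw [fourierDist_apply, integrateSnd_apply, h1, h2, h3, fourierDist_apply, splitDist_apply,
    mulSnd_apply, integrateSnd_apply]
  congr 3
  ext z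
  rw [SchwartzMap.smulLeftCLM_apply_apply (hasTemperateGrowth_fst hΘ), tensorCLM_apply,
    tensorCLM_apply, SchwartzMap.smulLeftCLM_apply_apply (contDiff_snd_hasTemperateGrowth one),
    SchwartzMap.smulLeftCLM_apply_apply (hasTemperateGrowth_fst hΘ), hone, one_smul, smul_eq_mul,
    smul_eq_mul, mul_assoc]
  rfl

theorem mulSnd_one {ι : Type*} [Fintype ι] (one : 𝓢(Vec (Fin 0), ℂ)) (hone : ∀ x, one x = 1)
    (t : 𝓢'(Vec (ι ⊕ Fin 0), ℂ)) : mulSnd one t = t := by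
  ext φ
  rw [mulSnd_apply]
  congr 1
  ext z
  rw [SchwartzMap.smulLeftCLM_apply_apply (contDiff_snd_hasTemperateGrowth one), hone, one_smul]

theorem integrateSnd_sub {ι κ : Type*} [Fintype ι] [Fintype κ] (f : 𝓢(Vec κ, ℂ))
    (a r : 𝓢'(Vec (ι ⊕ κ), ℂ)) (σ : ι ⊕ Fin 0 → ℤˣ) (φ : 𝓢(Vec (ι ⊕ Fin 0), ℂ)) :
    fourierDist σ (integrateSnd f r) φ =
      fourierDist σ (integrateSnd f a) φ + -1 * fourierDist σ (integrateSnd f (a - r)) φ := by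
  simp only [fourierDist_apply, integrateSnd_apply, _root_.sub_apply]
  ring

theorem integral_sub_const_mul {V : Type*} [NormedAddCommGroup V] [MeasurableSpace V] [BorelSpace V]
    [NormedSpace ℝ V] (μ : Measure V) [IsFiniteMeasureOnCompacts μ] {F : V → ℂ} (hF : Continuous F) (c : ℂ) {φ : 𝓢(V, ℂ)}
    (hφ : HasCompactSupport φ) :
    ∫ q, (F q - c) * φ q ∂μ = (∫ q, φ q * F q ∂μ) - ∫ q, c * φ q ∂μ := by
  rw [← integral_sub]
  · refine integral_congr_ae (Eventually.of_forall fun q => ?_)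
    simp only
    ring
  · exact (φ.continuous.mul hF).integrable_of_hasCompactSupport hφ.mul_right
  · exact (continuous_const.mul φ.continuous).integrable_of_hasCompactSupport hφ.mul_left

/-- The infrared behaviour of the integrated advanced and retarded products if there are
arguments `y`. -/
theorem exists_eqODistAdd_integrateSnd [Nonempty (Fin n × Fin 4)] {a r : Dist n m}
    (ha : ∀ φ : 𝓢(Vec ((Fin n × Fin 4) ⊕ (Fin m × Fin 4)), ℂ),
      (∀ z ∈ tsupport φ, ∃ j, ∀ i, yPart j z - xPart i z ∉ forwardCone) → a φ = 0)
    (hr : ∀ φ : 𝓢(Vec ((Fin n × Fin 4) ⊕ (Fin m × Fin 4)), ℂ),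
      (∀ z ∈ tsupport φ, ∃ j, ∀ i, xPart i z - yPart j z ∉ forwardCone) → r φ = 0)
    (h : HasIRIndex (a - r) 1) (f : 𝓢(Vec (Fin m × Fin 4), ℂ)) {ε : ℝ} (hε : 0 < ε) :
    ∃ c : ℂ,
      EqODistAdd (fourierDist (Sum.elim lorentzSign fun _ => 1) (integrateSnd f a)) (1 - ε)
        (fun _ => c) ∧
      EqODistAdd (fourierDist (Sum.elim lorentzSign fun _ => 1) (integrateSnd f r)) (1 - ε)
        (fun _ => c) := by
  obtain ⟨one, hone⟩ := exists_schwartz_one (Fin 0)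
  obtain ⟨Θ, hΘ, χ₁, χ₂, hsplit⟩ := exists_splitting_integrateSnd ha hr lorentzSign f one hone
  set ε' : ℝ := min ε (1 / 2)
  have hε' : 0 < ε' := lt_min hε (by norm_num)
  have hε1 : ε' < 1 := (min_le_right _ _).trans_lt (by norm_num)
  have hεle : 1 - ε ≤ 1 - ε' := by linarith [min_le_left ε (1 / 2)]
  obtain ⟨ρ₀, hρ₀, hrep₀⟩ := exists_hasRep_integrateSnd _ (a - r) f (h ε' hε' f)
  simp only [Sum.elim_inl, Int.cast_one] at hrep₀
  -- The splitting is applied after the integration over x, with no variables q' and with f = 1.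
  have hod : IsODist (fourierDist (Sum.elim lorentzSign fun _ => 1)
      (mulSnd one (integrateSnd f (a - r)))) (((1 : ℤ) : ℝ) - ε') := by
    rw [mulSnd_one one hone, Int.cast_one]
    exact HasRep.isODist hρ₀ hrep₀
  obtain ⟨ρ₁, hρ₁, P, hP, hrep₁⟩ := exists_hasRep_splitDist hΘ _ _ one hε' hε1 hod
  obtain ⟨c₀, rfl⟩ := exists_const_of_mem_polySpan hP
  rw [Int.cast_one] at hrep₁
  obtain ⟨ρ₂, hρ₂, hrep₂⟩ := hasRep_apply_charMul_sub lorentzSign (show _ →L[ℂ] ℂ from a) χ₁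
  obtain ⟨ρ₃, hρ₃, hrep₃⟩ := hasRep_apply_charMul_sub lorentzSign (show _ →L[ℂ] ℂ from r) χ₂
  obtain ⟨ρ, hρ, hρle, hρ1, hρ0le, hρ2le, hρ3le⟩ : ∃ ρ : ℝ, 0 < ρ ∧ ρ ≤ ρ₁ ∧ ρ ≤ 1 ∧ ρ ≤ ρ₀ ∧
      ρ ≤ ρ₂ ∧ ρ ≤ ρ₃ := by
    refine ⟨min (min ρ₁ 1) (min ρ₀ (min ρ₂ ρ₃)), by positivity, ?_, ?_, ?_, ?_, ?_⟩ <;> simp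
  -- The constant has three parts: the polynomial of the splitting, of degree < 1, and the values at
  -- q = 0 of the transforms of the two localised terms.
  have hA : HasRep (fun φ => fourierDist (Sum.elim lorentzSign fun _ => 1) (integrateSnd f a) φ -
      ∫ z, (c₀ + a χ₁ + r χ₂) * φ z) (1 - ε) ρ := by
    refine ((((hrep₁.mono_radius hρle).mono hεle hρ1).add ((hrep₂.mono_radius hρ2le).mono
      (by linarith : 1 - ε ≤ 1) hρ1)).add ((hrep₃.mono_radius hρ3le).mono
      (by linarith : 1 - ε ≤ 1) hρ1)).congr fun φ hφ _ => ?_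
    have h2 : (∫ q, (a (charMul (pairFst lorentzSign q) χ₁) - a χ₁) * φ q) =
        (∫ q, φ q * a (charMul (pairFst lorentzSign q) χ₁)) - ∫ q, a χ₁ * φ q :=
      integral_sub_const_mul volume
        (continuous_apply_charMul (show _ →L[ℂ] ℂ from a) (pairFst lorentzSign) χ₁) _ hφ
    have h3 : (∫ q, (r (charMul (pairFst lorentzSign q) χ₂) - r χ₂) * φ q) =
        (∫ q, φ q * r (charMul (pairFst lorentzSign q) χ₂)) - ∫ q, r χ₂ * φ q :=
      integral_sub_const_mul volume
        (continuous_apply_charMul (show _ →L[ℂ] ℂ from r) (pairFst lorentzSign) χ₂) _ hφ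
    refine Eq.trans ?_ (congrArg₂ (· + ·) (congrArg₂ (· + ·) rfl h2.symm) h3.symm)
    rw [hsplit φ]
    simp only [integral_const_mul]
    ring
  -- r = a - (a - r), and the integrated difference is O^dist(|q|^{1-ε}) without any polynomial, so
  -- the constant does not change.
  have hR : HasRep (fun φ => fourierDist (Sum.elim lorentzSign fun _ => 1) (integrateSnd f r) φ -
      ∫ z, (c₀ + a χ₁ + r χ₂) * φ z) (1 - ε) ρ := by
    refine (hA.add (((hrep₀.mono_radius hρ0le).mono hεle hρ1).const_mul (-1))).congr
      fun φ _ _ => ?_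
    rw [integrateSnd_sub f a r]
    ring
  exact ⟨_, eqODistAdd_const_of_hasRep hρ hA, eqODistAdd_const_of_hasRep hρ hR⟩

/-- A compactly supported test function is unchanged by multiplication with a cutoff in x, and such
functions are dense. -/
theorem eq_zero_of_mulSnd_eq_zero {ι κ : Type*} [Fintype ι] [Fintype κ] {t : 𝓢'(Vec (ι ⊕ κ), ℂ)}
    (h : ∀ f : 𝓢(Vec κ, ℂ), mulSnd f t = 0) (φ : 𝓢(Vec (ι ⊕ κ), ℂ)) : t φ = 0 := by
  refine apply_eq_zero_of_hasCompactSupport (show _ →L[ℂ] ℂ from t) Set.univ (fun φ hφ _ => ?_) φ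
    (Set.subset_univ _)
  obtain ⟨R, hR⟩ := hφ.isCompact.isBounded.subset_closedBall 0
  have hR' : 0 < 2 * (|R| + 1) := by positivity
  obtain ⟨χ, hχ, hχc, -, hχ1, -, -⟩ := exists_cutoff (V := Vec κ) hR'
  have hc : HasCompactSupport fun x => (χ x : ℂ) :=
    hχc.comp_left (g := Complex.ofReal) Complex.ofReal_zero
  have h1 := congrArg (fun t : 𝓢'(Vec (ι ⊕ κ), ℂ) => t φ)
    (h (hc.toSchwartzMap (Complex.ofRealCLM.contDiff.comp hχ)))
  simp only [mulSnd_apply] at h1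
  refine Eq.trans (congrArg t ?_) h1
  ext z
  rw [SchwartzMap.smulLeftCLM_apply_apply (contDiff_snd_hasTemperateGrowth _), smul_eq_mul]
  change φ z = (χ (sndPart z) : ℂ) * φ z
  by_cases hz : z ∈ tsupport φ
  · have h2 : ‖z‖ ≤ R := by simpa using hR hz
    rw [hχ1 _ ((norm_sndPart_le z).trans (by linarith [le_abs_self R])), Complex.ofReal_one, one_mul]
  · rw [image_eq_zero_of_notMem_tsupport hz, mul_zero]

theorem isODist_zero {ι κ : Type*} [Fintype ι] [Fintype κ] (δ : ℝ) :
    IsODist (0 : 𝓢'(Vec (ι ⊕ κ), ℂ)) δ := by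
  refine ⟨fun _ => ⟨Set.univ, ∅, 0, isOpen_univ, Set.mem_univ _, fun _ => continuousOn_const,
    fun _ _ _ _ => rfl, fun _ _ _ _ => rfl, fun α => ⟨0, fun z _ => by simp⟩,
    fun φ _ _ => by simp⟩, fun _ => ⟨fun _ => ⟨0, continuous_const, fun φ _ => by simp⟩, fun _ => rfl⟩⟩

/-- If there are no arguments `y`, the integrated products are numbers. -/
theorem eqODistAdd_integrateSnd_of_isEmpty {ι κ : Type*} [Fintype ι] [Fintype κ] [IsEmpty ι]
    (σ : ι ⊕ Fin 0 → ℤˣ) (f : 𝓢(Vec κ, ℂ)) (t : 𝓢'(Vec (ι ⊕ κ), ℂ)) (δ : ℝ)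
    {one : 𝓢(Vec (ι ⊕ Fin 0), ℂ)} (hone : ∀ x, one x = 1) :
    EqODistAdd (fourierDist σ (integrateSnd f t)) δ fun _ => integrateSnd f t one := by
  refine ⟨0, isODist_zero δ, fun φ _ => ?_⟩
  have h1 : fourierTest σ φ = (∫ z, φ z) • one := by
    ext y
    rw [_root_.smul_apply, hone, smul_eq_mul, mul_one, fourierTest_eq]
    refine integral_congr_ae (Eventually.of_forall fun q => ?_)
    have h2 : pair σ q = 0 := by rw [Subsingleton.elim q 0, map_zero]
    simp only [h2, chr_zero, mul_one]
  rw [fourierDist_apply, h1, map_smul, integral_const_mul, smul_eq_mul, mul_comm]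
  simp

theorem exists_eqODistAdd_of_hasIRIndex {a r : Dist n m}
    (ha : ∀ φ : 𝓢(Vec ((Fin n × Fin 4) ⊕ (Fin m × Fin 4)), ℂ),
      (∀ z ∈ tsupport φ, ∃ j, ∀ i, yPart j z - xPart i z ∉ forwardCone) → a φ = 0)
    (hr : ∀ φ : 𝓢(Vec ((Fin n × Fin 4) ⊕ (Fin m × Fin 4)), ℂ),
      (∀ z ∈ tsupport φ, ∃ j, ∀ i, xPart i z - yPart j z ∉ forwardCone) → r φ = 0)
    (h : HasIRIndex (a - r) 1) (f : 𝓢(Vec (Fin m × Fin 4), ℂ)) {ε : ℝ} (hε : 0 < ε) :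
    ∃ c : ℂ,
      EqODistAdd (fourierDist (Sum.elim lorentzSign fun _ => 1) (integrateSnd f a)) (1 - ε)
        (fun _ => c) ∧
      EqODistAdd (fourierDist (Sum.elim lorentzSign fun _ => 1) (integrateSnd f r)) (1 - ε)
        (fun _ => c) := by
  rcases isEmpty_or_nonempty (Fin n × Fin 4) with he | hne
  · obtain ⟨one, hone⟩ := exists_schwartz_one ((Fin n × Fin 4) ⊕ Fin 0)
    -- Without variables y an IR-index 1 means, by convention, that the transform vanishes for
    -- positive exponents such as 1 - 1/2. So a = r, and the integrated products are the same
    -- number.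
    have h0 : ∀ f : 𝓢(Vec (Fin m × Fin 4), ℂ), mulSnd f (a - r) = 0 := by
      intro f
      have h1 := ((h (1 / 2) (by norm_num) f).2 he).2 (by norm_num)
      ext φ
      have h2 := congrArg (fun t : Dist n m => t
        (fourierTestInv (Sum.elim lorentzSign lorentzSign) φ)) h1
      simp only [fourierDist_apply, fourierTest_fourierTestInv] at h2
      exact h2.trans rfl
    have har : a = r := by
      ext φ
      have := eq_zero_of_mulSnd_eq_zero h0 φ
      rw [_root_.sub_apply, sub_eq_zero] at this
      exact this
    subst har
    exact ⟨_, eqODistAdd_integrateSnd_of_isEmpty _ f a _ hone,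
      eqODistAdd_integrateSnd_of_isEmpty _ f a _ hone⟩
  · exact exists_eqODistAdd_integrateSnd ha hr h f hε

end Integrated

end Split

end

theorem theorem3p8 :
    -- Splitting of a single distribution `t(y, x) = s(y, x) f(x)`.
    (∀ (N M : ℕ), 2 ≤ N →
      ∀ (s : 𝓢'(Vec (Fin N ⊕ Fin M), ℂ)) (f : 𝓢(Vec (Fin M), ℂ)) (d : ℤ) (ε : ℝ),
        0 < ε → ε < 1 →
        Split.IsODist (Split.fourierDist (fun _ => 1) (Split.mulSnd f s)) ((d : ℝ) - ε) →
        ∀ Θ : Vec (Fin N) → ℝ, Split.IsUVRegularSplitting Θ →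
          ∃ c : (Fin N → ℕ) → Vec (Fin M) → ℂ, (∀ γ, Continuous (c γ)) ∧
            Split.EqODistAdd
              (Split.fourierDist (fun _ => 1) (Split.splitDist Θ (Split.mulSnd f s)))
              ((d : ℝ) - ε) (Split.polySum d c)) ∧
    -- Vacuum expectation values of the advanced and retarded products.
    (∀ {p : ℕ} (par : Fin p → ZMod 2) {D : Type*} [AddCommGroup D] [Module ℂ D]
      (form : D →ₗ⋆[ℂ] D →ₗ[ℂ] ℂ) (Ω : D) (𝒯 : Split.TimeOrdered par form)
      (n m : ℕ) (P : Composition m)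
      (fB : Fin n → ZMod 2) (B : Fin n → Split.SymField par)
      (fC : Fin m → ZMod 2) (C : Fin m → Split.SymField par),
      (∀ j, B j ∈ Split.homogeneous par (fB j)) → (∀ j, C j ∈ Split.homogeneous par (fC j)) →
      ∀ (a r : Split.Dist n m),
        Split.IsAdvVEV 𝒯 Ω P fB B fC C a → Split.IsRetVEV 𝒯 Ω P fB B fC C r →
        ∀ d : ℤ, Split.HasIRIndex (a - r) d →
          Split.HasIRIndex a (min d 0) ∧
          (d = 1 → ∀ (f : 𝓢(Vec (Fin m × Fin 4), ℂ)) (ε : ℝ), 0 < ε →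
            ∃ c : ℂ,
              Split.EqODistAdd
                (Split.fourierDist (Sum.elim Split.lorentzSign fun _ => 1)
                  (Split.integrateSnd f a)) (1 - ε) (fun _ => c) ∧
              Split.EqODistAdd
                (Split.fourierDist (Sum.elim Split.lorentzSign fun _ => 1)
                  (Split.integrateSnd f r)) (1 - ε) (fun _ => c))) := by
  refine ⟨fun N M hN s f d ε hε0 hε1 h Θ hΘ => ?_, fun par D _ _ form Ω 𝒯 n m P fB B fC C hB hC a r
    ha hr d h => ⟨?_, ?_⟩⟩
  · have : Nonempty (Fin N) := ⟨⟨0, by omega⟩⟩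
    exact Split.eqODistAdd_splitDist hΘ _ s f hε0 hε1 h
  · exact Split.hasIRIndex_min_of_causal (ha.apply_eq_zero hB hC) (hr.apply_eq_zero hB hC) h
  · rintro rfl f ε hε
    exact Split.exists_eqODistAdd_of_hasIRIndex (ha.apply_eq_zero hB hC) (hr.apply_eq_zero hB hC)
      h f hε
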